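/- Fix a universe of sets. A **vectoid** is a symmetric monoidal category $(\mathcal A,\otimes,\mathbf 1_{\mathcal A})$ (with small Hom-sets) such that: small colimits exist and $\otimes$ preserves them in each variable; finite limits exist; every pullback of an epimorphism is the cokernel (coequalizer) of its kernel pair, and every equivalence relation $R\subset X\times X$ has a quotient $X/R$ with $R=X\times_{X/R}X$; there is a small set of generators; and every presheaf $\mathcal A^{op}\to\mathbf{Sets}$ carrying small colimits to limits is representable. A **morphism of vectoids** $f:\mathcal A\to\mathcal B$ is a symmetric (strong) monoidal functor $f^*:\mathcal B\to\mathcal A$ with a right adjoint $f_*$; a morphism $f\to g$ in the category $\mathrm{Hom}(\mathcal A,\mathcal B)$ is a monoidal natural transformation $f^*\to g^*$. For a vectoid $\mathcal A$ let $\mathrm{CommAlg}(\mathcal A)$ be the category of commutative algebras (commutative monoids) in $\mathcal A$. A vectoid over $\mathcal A$ is a vectoid $\mathcal B$ with a morphism $p:\mathcal B\to\mathcal A$; morphisms over $\mathcal A$ come with a monoidal isomorphism making the triangle of inverse image functors commute, and 2-morphisms respect these. Let $\mathcal N$ be the category of the finite sets $\mathbf n=\{1,\dots,n\}$, $n\ge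 0$, and all maps, and $h_{\mathbf n}=\mathrm{Hom}_{\mathcal N}(-,\mathbf n)$. For a vectoid $\mathcal A$ let $q_a\mathcal A=\mathrm{Funct}(\mathcal N^{op},\mathcal A)$, with the tensor product obtained by bicocontinuous extension (Day convolution) from the disjoint union on $\mathcal N$, and put $\mathcal Q_a=q_a\mathbf{Sets}=\hat{\mathcal N}$ (for $\otimes=\times$ on $\mathbf{Sets}$). Presheaves on $\mathcal N$ are extended to all finite sets. For $M\in\mathrm{CommAlg}(\mathcal A)$ and $\varphi:\mathbf m\to\mathbf n$ let $\varphi_*:M^{\otimes m}\to M^{\otimes n}$ multiply the factors in each fibre of $\varphi$ (inserting units for empty fibres); this gives a functor $\Phi_M:\mathcal N\to\mathcal A$, $\mathbf n\mapsto M^{\otimes n}$, and $\bar\Phi_M:\mathcal Q_a\to\mathcal A$ is its cocontinuous extension. For a set $S$ and an object $X$, $S\otimes X=\bigsqcup_{S}X$. Then: 1. $\mathcal Q_a$ is a vectoid, and the canonical maps $\mathbf 1\to h_{\mathbf 0}$ and $h_{\mathbf m}\otimes h_{\mathbf n}\to h_{\mathbf m\sqcup\mathbf n}$ are isomorphisms.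 2. Let $X_a\in\mathrm{CommAlg}(\mathcal Q_a)$ be $h_{\mathbf 1}$ with the multiplication and the unit induced by $\mathbf 2\to\mathbf 1$ and $\mathbf 0\to\mathbf 1$. For every vectoid $\mathcal A$ the functor $\mathrm{Hom}(\mathcal A,\mathcal Q_a)\to\mathrm{CommAlg}(\mathcal A)$, $f\mapsto f^*X_a$, is an equivalence; i.e. $(\mathcal Q_a,X_a)$ is the classifying vectoid of commutative algebras. 3. For every vectoid $\mathcal A$ and $M\in\mathrm{CommAlg}(\mathcal A)$, the functor $\bar\Phi_M$ extends $\Phi_M$ and has a right adjoint, and it has a symmetric strong monoidal structure for which $\bar\Phi_M(X_a)\cong M$ as algebras, compatibly with $\bar\Phi_M(h_{\mathbf 1})\cong\Phi_M(\mathbf 1)\cong M$. For every $F\in\mathcal Q_a$, $$\bar\Phi_M(F)=\mathrm{Coker}\Bigl(\bigsqcup_{\varphi:\mathbf m\to\mathbf n}F(\mathbf n)\otimes M^{\otimes m}\rightrightarrows\bigsqcup_{n\ge0}F(\mathbf n)\otimes M^{\otimes n}\Bigr),$$ where the two arrows are induced by $F(\varphi)\otimes\mathrm{id}$ and $\mathrm{id}\otimes\varphi_*$,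 and the projection restricts, on the copy of $M^{\otimes n}$ with index $x\in F(\mathbf n)$, to the map induced by $x:h_{\mathbf n}\to F$. 4. For every vectoid $\mathcal A$, $q_a\mathcal A$ is a vectoid. For $F,G\in q_a\mathcal A$ and every finite set $W$ the canonical maps exhibit $$(F\otimes G)(W)=\bigsqcup_{U\sqcup V=W}F(U)\otimes G(V),$$ the coproduct being over all subsets $U\subset W$, $V=W\setminus U$. The unit object satisfies $\mathbf 1_\otimes(\mathbf 0)=\mathbf 1_{\mathcal A}$, and $\mathbf 1_\otimes(\mathbf n)$ is an initial object for $n>0$. 5. Let $q^*:\mathcal A\to q_a\mathcal A$, $a\mapsto(\mathbf n\mapsto a\otimes\mathbf 1_\otimes(\mathbf n))$, with its canonical symmetric monoidal structure. It is strong monoidal and has a right adjoint, so $q_a\mathcal A$ is a vectoid over $\mathcal A$. Let $X_{a,\mathcal A}$ be the constant presheaf $\mathbf 1_{\mathcal A}$ with its canonical algebra structure. For every vectoid $\mathcal B$ over $\mathcal A$, the functor $\mathrm{Hom}_{\mathcal A}(\mathcal B,q_a\mathcal A)\to\mathrm{CommAlg}(\mathcal B)$, $f\mapsto f^*X_{a,\mathcal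 A}$, is an equivalence. In particular $\theta:\mathrm{End}_{\mathcal A}(q_a\mathcal A)\to\mathrm{CommAlg}(q_a\mathcal A)$, $f\mapsto f^*X_{a,\mathcal A}$, is an equivalence. The composition product $X\circ Y$ is by definition the one corresponding under $\theta$ to the composition of endomorphisms; one has $\theta(f\circ g)=g^*(\theta(f))$, i.e. $X\circ Y=\bar\Phi_Y(X)$, where $\bar\Phi_Y=g^*$ for $g$ with $\theta(g)\cong Y$. 6. For $F\in q_a\mathcal A$ and $n\ge0$ there is a morphism $\mathrm{ev}_{F,n}:q^*F(\mathbf n)\otimes X_{a,\mathcal A}^{\otimes n}\to F$ which carries the generic element $F(\mathbf n)\to(q^*F(\mathbf n)\otimes X_{a,\mathcal A}^{\otimes n})(\mathbf n)$ to $\mathrm{id}_{F(\mathbf n)}$, and for which the following hold. (i) Let $p:\mathcal B\to\mathcal A$ be a vectoid over $\mathcal A$, $Y\in\mathrm{CommAlg}(\mathcal B)$, and $f:\mathcal B\to q_a\mathcal A$ a morphism over $\mathcal A$ with $f^*X_{a,\mathcal A}\cong Y$; put $\bar\Phi_Y=f^*$. For every $F\in q_a\mathcal A$ $$\bar\Phi_Y(F)=\mathrm{Coker}\Bigl(\bigsqcup_{\varphi:\mathbf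 m\to\mathbf n}p^*F(\mathbf n)\otimes Y^{\otimes m}\rightrightarrows\bigsqcup_{n\ge0}p^*F(\mathbf n)\otimes Y^{\otimes n}\Bigr),$$ with the arrows $p^*F(\varphi)\otimes\mathrm{id}$ and $\mathrm{id}\otimes\varphi_*$, and with the projection $p^*F(\mathbf n)\otimes Y^{\otimes n}\to f^*(q^*F(\mathbf n)\otimes X_{a,\mathcal A}^{\otimes n})\to f^*F$ given by $f^*(\mathrm{ev}_{F,n})$. (ii) For every $Y\in\mathrm{CommAlg}(q_a\mathcal A)$, every object $X$ of $q_a\mathcal A$ and every finite set $V$, $$(X\circ Y)(V)=\bar\Phi_Y(X)(V)=\mathrm{Coker}\Bigl(\bigsqcup_{\varphi:\mathbf m\to\mathbf n}\ \bigsqcup_{U_1\sqcup\dots\sqcup U_m=V}X(\mathbf n)\otimes Y(U_1)\otimes\dots\otimes Y(U_m)\rightrightarrows\bigsqcup_{n\ge0}\ \bigsqcup_{U_1\sqcup\dots\sqcup U_n=V}X(\mathbf n)\otimes Y(U_1)\otimes\dots\otimes Y(U_n)\Bigr),$$ where decompositions $U_1\sqcup\dots\sqcup U_n=V$ are maps $d:V\to\mathbf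 n$ ($U_i=d^{-1}(i)$). On the summand $(\varphi,d)$ the first arrow is $X(\varphi)\otimes\mathrm{id}$ into the summand $(m,d)$; the second is $\mathrm{id}\otimes\rho_{\varphi,d}$ into the summand $(n,\varphi\circ d)$, where $\rho_{\varphi,d}:\bigotimes_iY(d^{-1}(i))\to\bigotimes_jY((\varphi d)^{-1}(j))$ is compatible, via the canonical maps to $Y^{\otimes m}(V)$ and $Y^{\otimes n}(V)$, with $\varphi_*:Y^{\otimes m}\to Y^{\otimes n}$; such maps $\rho_{\varphi,d}$ exist, independently of $X$. The projection on the summand $(n,d)$ is the composite $X(\mathbf n)\otimes\bigotimes_iY(d^{-1}(i))\to(q^*X(\mathbf n)\otimes Y^{\otimes n})(V)\to\bar\Phi_Y(X)(V)$ of the canonical map and the projection of (i). -/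

import Mathlib

open CategoryTheory MonoidalCategory Limits Opposite

universe u w w' w''

set_option linter.unusedSimpArgs false
set_option linter.unusedSectionVars false

namespace AlgClassifier

/-- The category of standard finite sets and all maps between them. -/
abbrev FinN : Type u := FintypeCat.Skeleton.{u}

namespace FinN

/-- The elements of the standard finite set `X`. -/
abbrev El (X : FinN.{u}) : Type u := ULift.{u} (Fin X.len)

/-- The standard set of cardinality `m + n`, the disjoint union of `X` and `Y`; the elements of
`X` precede those of `Y`. -/
def sum (X Y : FinN.{u}) : FinN.{u} := FintypeCat.Skeleton.mk (X.len + Y.len)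

/-- The standard set with no elements. -/
def zero : FinN.{u} := FintypeCat.Skeleton.mk 0

def sumEquiv (X Y : FinN.{u}) : El (sum X Y) ≃ El X ⊕ El Y :=
  Equiv.ulift.trans (finSumFinEquiv.symm.trans (Equiv.sumCongr Equiv.ulift.symm Equiv.ulift.symm))

/-- A map between standard finite sets. -/
def ofFun {X Y : FinN.{u}} (f : El X → El Y) : X ⟶ Y := f

def isoOfEquiv {X Y : FinN.{u}} (e : El X ≃ El Y) : X ≅ Y where
  hom := ofFun e
  inv := ofFun e.symm
  hom_inv_id := by funext x; exact e.symm_apply_apply x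
  inv_hom_id := by funext x; exact e.apply_symm_apply x

def zeroSum (X : FinN.{u}) : El (sum zero X) ≃ El X :=
  haveI : IsEmpty (El zero.{u}) := ⟨fun x => x.down.elim0⟩
  (sumEquiv zero X).trans (Equiv.emptySum _ _)

def sumZero (X : FinN.{u}) : El (sum X zero) ≃ El X :=
  haveI : IsEmpty (El zero.{u}) := ⟨fun x => x.down.elim0⟩
  (sumEquiv X zero).trans (Equiv.sumEmpty _ _)

def sumAssoc (X Y Z : FinN.{u}) : El (sum (sum X Y) Z) ≃ El (sum X (sum Y Z)) :=
  (sumEquiv (sum X Y) Z).trans <| ((sumEquiv X Y).sumCongr (Equiv.refl _)).trans <|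
    (Equiv.sumAssoc _ _ _).trans <| ((Equiv.refl _).sumCongr (sumEquiv Y Z).symm).trans
      (sumEquiv X (sum Y Z)).symm

def sumMap {X X' Y Y' : FinN.{u}} (f : X ⟶ X') (g : Y ⟶ Y') : sum X Y ⟶ sum X' Y' :=
  ofFun fun x => (sumEquiv X' Y').symm (Sum.map f g (sumEquiv X Y x))

theorem hom_ext_el {X Y : FinN.{u}} (f g : X ⟶ Y) (h : ∀ x : El X, f x = g x) : f = g := funext h

theorem sum_cases {X Y : FinN.{u}} {p : El (sum X Y) → Prop}
    (hl : ∀ x, p ((sumEquiv X Y).symm (Sum.inl x))) (hr : ∀ y, p ((sumEquiv X Y).symm (Sum.inr y)))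
    (z : El (sum X Y)) : p z := by
  obtain ⟨s, rfl⟩ := (sumEquiv X Y).symm.surjective z
  cases s with
  | inl x => exact hl x
  | inr y => exact hr y

theorem comp_el {X Y Z : FinN.{u}} (f : X ⟶ Y) (g : Y ⟶ Z) (x : El X) : (f ≫ g) x = g (f x) := rfl
theorem id_el {X : FinN.{u}} (x : El X) : (𝟙 X : X ⟶ X) x = x := rfl

@[simp] theorem sumMap_inl {X X' Y Y' : FinN.{u}} (f : X ⟶ X') (g : Y ⟶ Y') (x : El X) :
    (sumMap f g) ((sumEquiv X Y).symm (Sum.inl x)) = (sumEquiv X' Y').symm (Sum.inl (f x)) := by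
  simp [sumMap, ofFun]
@[simp] theorem sumMap_inr {X X' Y Y' : FinN.{u}} (f : X ⟶ X') (g : Y ⟶ Y') (y : El Y) :
    (sumMap f g) ((sumEquiv X Y).symm (Sum.inr y)) = (sumEquiv X' Y').symm (Sum.inr (g y)) := by
  simp [sumMap, ofFun]
@[simp] theorem zero_false (x : El zero.{u}) : False := x.down.elim0

instance : MonoidalCategoryStruct FinN.{u} where
  tensorObj := sum
  tensorUnit := zero
  tensorHom := sumMap
  whiskerLeft X _ _ g := sumMap (𝟙 X) g
  whiskerRight f Y := sumMap f (𝟙 Y)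
  associator X Y Z := isoOfEquiv (sumAssoc X Y Z)
  leftUnitor X := isoOfEquiv (zeroSum X)
  rightUnitor X := isoOfEquiv (sumZero X)

theorem tensorObj_eq (X Y : FinN.{u}) : X ⊗ Y = sum X Y := rfl
theorem tensorUnit_eq : 𝟙_ FinN.{u} = zero := rfl
theorem tensorHom_eq {X X' Y Y' : FinN.{u}} (f : X ⟶ X') (g : Y ⟶ Y') : f ⊗ₘ g = sumMap f g := rfl
theorem whiskerLeft_eq {X Y Y' : FinN.{u}} (g : Y ⟶ Y') : X ◁ g = sumMap (𝟙 X) g := rfl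
theorem whiskerRight_eq {X X' Y : FinN.{u}} (f : X ⟶ X') : f ▷ Y = sumMap f (𝟙 Y) := rfl
theorem assoc_eq (X Y Z : FinN.{u}) : (α_ X Y Z) = isoOfEquiv (sumAssoc X Y Z) := rfl
theorem left_eq (X : FinN.{u}) : (λ_ X) = isoOfEquiv (zeroSum X) := rfl
theorem right_eq (X : FinN.{u}) : (ρ_ X) = isoOfEquiv (sumZero X) := rfl

@[simp] theorem assoc_ll (X Y Z : FinN.{u}) (x : El X) : (isoOfEquiv (sumAssoc X Y Z)).hom
    ((sumEquiv (sum X Y) Z).symm (Sum.inl ((sumEquiv X Y).symm (Sum.inl x)))) =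
    (sumEquiv X (sum Y Z)).symm (Sum.inl x) := by simp [isoOfEquiv, ofFun, sumAssoc]
@[simp] theorem assoc_lr (X Y Z : FinN.{u}) (y : El Y) : (isoOfEquiv (sumAssoc X Y Z)).hom
    ((sumEquiv (sum X Y) Z).symm (Sum.inl ((sumEquiv X Y).symm (Sum.inr y)))) =
    (sumEquiv X (sum Y Z)).symm (Sum.inr ((sumEquiv Y Z).symm (Sum.inl y))) := by
  simp [isoOfEquiv, ofFun, sumAssoc]
@[simp] theorem assoc_r (X Y Z : FinN.{u}) (z : El Z) : (isoOfEquiv (sumAssoc X Y Z)).hom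
    ((sumEquiv (sum X Y) Z).symm (Sum.inr z)) =
    (sumEquiv X (sum Y Z)).symm (Sum.inr ((sumEquiv Y Z).symm (Sum.inr z))) := by
  simp [isoOfEquiv, ofFun, sumAssoc]
@[simp] theorem assoc_inv_l (X Y Z : FinN.{u}) (x : El X) : (isoOfEquiv (sumAssoc X Y Z)).inv
    ((sumEquiv X (sum Y Z)).symm (Sum.inl x)) =
    (sumEquiv (sum X Y) Z).symm (Sum.inl ((sumEquiv X Y).symm (Sum.inl x))) := by
  simp [isoOfEquiv, ofFun, sumAssoc]
@[simp] theorem assoc_inv_rl (X Y Z : FinN.{u}) (y : El Y) : (isoOfEquiv (sumAssoc X Y Z)).inv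
    ((sumEquiv X (sum Y Z)).symm (Sum.inr ((sumEquiv Y Z).symm (Sum.inl y)))) =
    (sumEquiv (sum X Y) Z).symm (Sum.inl ((sumEquiv X Y).symm (Sum.inr y))) := by
  simp [isoOfEquiv, ofFun, sumAssoc]
@[simp] theorem assoc_inv_rr (X Y Z : FinN.{u}) (z : El Z) : (isoOfEquiv (sumAssoc X Y Z)).inv
    ((sumEquiv X (sum Y Z)).symm (Sum.inr ((sumEquiv Y Z).symm (Sum.inr z)))) =
    (sumEquiv (sum X Y) Z).symm (Sum.inr z) := by
  simp [isoOfEquiv, ofFun, sumAssoc]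
@[simp] theorem left_r (X : FinN.{u}) (x : El X) : (isoOfEquiv (zeroSum X)).hom
    ((sumEquiv zero X).symm (Sum.inr x)) = x := by simp [isoOfEquiv, ofFun, zeroSum]
@[simp] theorem right_l (X : FinN.{u}) (x : El X) : (isoOfEquiv (sumZero X)).hom
    ((sumEquiv X zero).symm (Sum.inl x)) = x := by simp [isoOfEquiv, ofFun, sumZero]

def sumComm (X Y : FinN.{u}) : El (sum X Y) ≃ El (sum Y X) :=
  (sumEquiv X Y).trans <| (Equiv.sumComm _ _).trans (sumEquiv Y X).symm

@[simp] theorem comm_l (X Y : FinN.{u}) (x : El X) : (isoOfEquiv (sumComm X Y)).hom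
    ((sumEquiv X Y).symm (Sum.inl x)) = (sumEquiv Y X).symm (Sum.inr x) := by
  simp [isoOfEquiv, ofFun, sumComm]
@[simp] theorem comm_r (X Y : FinN.{u}) (y : El Y) : (isoOfEquiv (sumComm X Y)).hom
    ((sumEquiv X Y).symm (Sum.inr y)) = (sumEquiv Y X).symm (Sum.inl y) := by
  simp [isoOfEquiv, ofFun, sumComm]

@[simp] theorem comm_inv (X Y : FinN.{u}) : (isoOfEquiv (sumComm X Y)).inv =
  (isoOfEquiv (sumComm Y X)).hom := rfl

/-- Disjoint union of finite sets as a tensor product. -/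
instance : MonoidalCategory FinN.{u} where
  tensorHom_def f g := by
    refine hom_ext_el _ _ (sum_cases (fun x => ?_) (fun x => ?_)) <;>
      simp [tensorHom_eq, whiskerLeft_eq, whiskerRight_eq, comp_el, id_el, tensorObj_eq, tensorUnit_eq]
  id_tensorHom_id X Y := by
    refine hom_ext_el _ _ (sum_cases (fun x => ?_) (fun x => ?_)) <;>
      simp only [tensorHom_eq, sumMap_inl, sumMap_inr, id_el]
  tensorHom_comp_tensorHom f f' g g' := by
    refine hom_ext_el _ _ (sum_cases (fun x => ?_) (fun x => ?_)) <;>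
      simp [tensorHom_eq, comp_el, tensorObj_eq, tensorUnit_eq]
  whiskerLeft_id X Y := by
    refine hom_ext_el _ _ (sum_cases (fun x => ?_) (fun x => ?_)) <;>
      simp only [whiskerLeft_eq, sumMap_inl, sumMap_inr, id_el]
  id_whiskerRight X Y := by
    refine hom_ext_el _ _ (sum_cases (fun x => ?_) (fun x => ?_)) <;>
      simp only [whiskerRight_eq, sumMap_inl, sumMap_inr, id_el]
  associator_naturality f g h := by
    refine hom_ext_el _ _ (sum_cases (sum_cases (fun x => ?_) (fun x => ?_)) (fun x => ?_)) <;>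
      simp [tensorHom_eq, assoc_eq, comp_el, tensorObj_eq, tensorUnit_eq]
  leftUnitor_naturality f := by
    refine hom_ext_el _ _ (sum_cases (fun x => (zero_false x).elim) (fun x => ?_))
    simp [whiskerLeft_eq, left_eq, comp_el, tensorObj_eq, tensorUnit_eq]
  rightUnitor_naturality f := by
    refine hom_ext_el _ _ (sum_cases (fun x => ?_) (fun x => (zero_false x).elim))
    simp [whiskerRight_eq, right_eq, comp_el, tensorObj_eq, tensorUnit_eq]
  pentagon W X Y Z := by
    refine hom_ext_el _ _ (sum_cases (sum_cases (sum_cases (fun x => ?_) (fun x => ?_))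
      (fun x => ?_)) (fun x => ?_)) <;>
      simp [whiskerRight_eq, whiskerLeft_eq, assoc_eq, comp_el, id_el, tensorObj_eq, tensorUnit_eq]
  triangle X Y := by
    refine hom_ext_el _ _ (sum_cases (sum_cases (fun x => ?_) (fun x => (zero_false x).elim))
      (fun x => ?_)) <;>
      simp [whiskerRight_eq, whiskerLeft_eq, assoc_eq, left_eq, right_eq, comp_el, id_el, tensorObj_eq, tensorUnit_eq]

instance : SymmetricCategory FinN.{u} where
  braiding X Y := isoOfEquiv (sumComm X Y)
  braiding_naturality_right X Y Z f := by
    refine hom_ext_el _ _ (sum_cases (fun x => ?_) (fun x => ?_)) <;>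
      simp [whiskerRight_eq, whiskerLeft_eq, comp_el, id_el, tensorObj_eq, tensorUnit_eq]
  braiding_naturality_left f Z := by
    refine hom_ext_el _ _ (sum_cases (fun x => ?_) (fun x => ?_)) <;>
      simp [whiskerRight_eq, whiskerLeft_eq, comp_el, id_el, tensorObj_eq, tensorUnit_eq]
  hexagon_forward X Y Z := by
    refine hom_ext_el _ _ (sum_cases (sum_cases (fun x => ?_) (fun x => ?_)) (fun x => ?_)) <;>
      simp [whiskerRight_eq, whiskerLeft_eq, assoc_eq, comp_el, id_el, tensorObj_eq, tensorUnit_eq]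
  hexagon_reverse X Y Z := by
    refine hom_ext_el _ _ (sum_cases (fun x => ?_) (sum_cases (fun x => ?_) (fun x => ?_))) <;>
      simp [whiskerRight_eq, whiskerLeft_eq, assoc_eq, comp_el, id_el, tensorObj_eq, tensorUnit_eq]
  symmetry X Y := by
    refine hom_ext_el _ _ (sum_cases (fun x => ?_) (fun x => ?_)) <;>
      simp [comp_el, id_el, tensorObj_eq, tensorUnit_eq]

end FinN
end AlgClassifier

namespace AlgClassifier

instance : SymmetricCategory FinN.{u}ᵒᵖ where
  symmetry X Y := Quiver.Hom.unop_inj (SymmetricCategory.symmetry (unop X) (unop Y))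

/-- All small colimits exist, and the tensor product preserves them in each variable. -/
class CocontinuousTensor (A : Type w) [Category.{u} A] [MonoidalCategory A] : Prop where
  hasColimits : HasColimitsOfSize.{u, u} A
  left : ∀ X : A, PreservesColimitsOfSize.{u, u} (tensorLeft X)
  right : ∀ X : A, PreservesColimitsOfSize.{u, u} (tensorRight X)

section
variable (A : Type w) [Category.{u} A] [MonoidalCategory A] [CocontinuousTensor A]

instance : HasColimitsOfSize.{u, u} A := CocontinuousTensor.hasColimits
instance : HasColimitsOfSize.{0, u} A := hasColimitsOfSizeShrink.{0, u, u, u} A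
instance (X : A) : PreservesColimitsOfSize.{u, u} (tensorLeft X) := CocontinuousTensor.left X
instance (X : A) : PreservesColimitsOfSize.{u, u} (tensorRight X) := CocontinuousTensor.right X
instance (X : A) : PreservesColimitsOfSize.{0, u} (tensorLeft X) :=
  preservesColimitsOfSize_of_univLE.{u, u} _
instance (X : A) : PreservesColimitsOfSize.{0, u} (tensorRight X) :=
  preservesColimitsOfSize_of_univLE.{u, u} _
end

instance : CocontinuousTensor (Type u) where
  hasColimits := inferInstance
  left X := (Types.tensorProductAdjunction X).leftAdjoint_preservesColimits
  right X :=
    haveI := (Types.tensorProductAdjunction X).leftAdjoint_preservesColimits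
    preservesColimits_of_natIso (BraidedCategory.tensorLeftIsoTensorRight X)

/-- The category of presheaves on finite sets with values in `A`, with Day convolution with respect
to the disjoint union of finite sets as tensor product. -/
abbrev qa (A : Type w) [Category.{u} A] [MonoidalCategory A] : Type _ := DayFunctor FinN.{u}ᵒᵖ A

/-- The category of presheaves of sets on finite sets. -/
abbrev Qa : Type (u + 1) := qa (Type u)

section
variable (A : Type w) [Category.{u} A] [MonoidalCategory A] [CocontinuousTensor A]
instance (F G : FinN.{u}ᵒᵖ ⥤ A) :
    (tensor FinN.{u}ᵒᵖ).HasPointwiseLeftKanExtension (externalProduct F G) := inferInstance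
instance : (Functor.fromPUnit.{0} (𝟙_ FinN.{u}ᵒᵖ)).HasPointwiseLeftKanExtension
    (Functor.fromPUnit.{0} (𝟙_ A)) := inferInstance
variable {A}
instance (v : A) (d : FinN.{u}ᵒᵖ) : PreservesColimitsOfShape
    (CostructuredArrow (tensor FinN.{u}ᵒᵖ) d) (tensorLeft v) :=
  PreservesColimitsOfSize.preservesColimitsOfShape
instance (v : A) (d : FinN.{u}ᵒᵖ) : PreservesColimitsOfShape
    (CostructuredArrow (tensor FinN.{u}ᵒᵖ) d) (tensorRight v) :=
  PreservesColimitsOfSize.preservesColimitsOfShape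
instance (v : A) (d : FinN.{u}ᵒᵖ) : PreservesColimitsOfShape
    (CostructuredArrow (Functor.fromPUnit.{0} (𝟙_ FinN.{u}ᵒᵖ)) d) (tensorLeft v) :=
  PreservesColimitsOfSize.preservesColimitsOfShape
instance (v : A) (d : FinN.{u}ᵒᵖ) : PreservesColimitsOfShape
    (CostructuredArrow (Functor.fromPUnit.{0} (𝟙_ FinN.{u}ᵒᵖ)) d) (tensorRight v) :=
  PreservesColimitsOfSize.preservesColimitsOfShape
instance (v : A) (d : FinN.{u}ᵒᵖ × FinN.{u}ᵒᵖ) : PreservesColimitsOfShape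
    (CostructuredArrow ((𝟭 FinN.{u}ᵒᵖ).prod (Functor.fromPUnit.{0} (𝟙_ FinN.{u}ᵒᵖ))) d)
    (tensorRight v) :=
  PreservesColimitsOfSize.preservesColimitsOfShape
instance (v : A) (d : FinN.{u}ᵒᵖ × FinN.{u}ᵒᵖ) : PreservesColimitsOfShape
    (CostructuredArrow ((tensor FinN.{u}ᵒᵖ).prod (𝟭 FinN.{u}ᵒᵖ)) d) (tensorRight v) :=
  PreservesColimitsOfSize.preservesColimitsOfShape

variable (A)
noncomputable instance dayMonoidal : MonoidalCategory.{u} (qa A) := inferInstance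
noncomputable instance dayLawful :
    LawfulDayConvolutionMonoidalCategoryStruct FinN.{u}ᵒᵖ A (qa A) := inferInstance
end
end AlgClassifier

namespace AlgClassifier
section
variable {A : Type w} [Category.{u} A] [MonoidalCategory A] [CocontinuousTensor A]

open LawfulDayConvolutionMonoidalCategoryStruct

attribute [local instance] convolution convolution₂ convolution₂'

/-- The tautological identification of the category of presheaves with `FinNᵒᵖ ⥤ A`. -/
noncomputable def dayFF : (ι FinN.{u}ᵒᵖ A (qa A)).FullyFaithful :=
  (DayFunctor.equiv FinN.{u}ᵒᵖ A).fullyFaithfulFunctor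

set_option maxHeartbeats 1000000 in
noncomputable instance daySymmetric [SymmetricCategory A] : SymmetricCategory (qa A) where
  braiding F G := dayFF.preimageIso
    (DayConvolution.braiding ((ι FinN.{u}ᵒᵖ A (qa A)).obj F) ((ι FinN.{u}ᵒᵖ A (qa A)).obj G))
  braiding_naturality_right H F G f := by
    apply dayFF.map_injective
    simp only [Functor.map_comp, ← id_tensorHom, ← tensorHom_id, ι_map_tensorHom_hom_eq_tensorHom,
      Functor.FullyFaithful.preimageIso_hom, Functor.FullyFaithful.map_preimage, CategoryTheory.Functor.map_id]
    exact DayConvolution.braiding_naturality_right _ _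
  braiding_naturality_left f Z := by
    apply dayFF.map_injective
    simp only [Functor.map_comp, ← id_tensorHom, ← tensorHom_id, ι_map_tensorHom_hom_eq_tensorHom,
      Functor.FullyFaithful.preimageIso_hom, Functor.FullyFaithful.map_preimage, CategoryTheory.Functor.map_id]
    exact DayConvolution.braiding_naturality_left _ _
  hexagon_forward X Y Z := by
    apply dayFF.map_injective
    simp only [Functor.map_comp, ← id_tensorHom, ← tensorHom_id, ι_map_tensorHom_hom_eq_tensorHom,
      Functor.FullyFaithful.preimageIso_hom, Functor.FullyFaithful.map_preimage, CategoryTheory.Functor.map_id,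
      ι_map_associator_hom_eq_associator_hom]
    exact DayConvolution.hexagon_forward _ _ _
  hexagon_reverse X Y Z := by
    apply dayFF.map_injective
    have h (P Q R : qa A) : (ι FinN.{u}ᵒᵖ A (qa A)).map (α_ P Q R).inv =
        (DayConvolution.associator ((ι FinN.{u}ᵒᵖ A (qa A)).obj P)
          ((ι FinN.{u}ᵒᵖ A (qa A)).obj Q) ((ι FinN.{u}ᵒᵖ A (qa A)).obj R)).inv := by
      rw [← cancel_epi ((ι FinN.{u}ᵒᵖ A (qa A)).map (α_ P Q R).hom)]
      conv_rhs => rw [ι_map_associator_hom_eq_associator_hom]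
      rw [← Functor.map_comp, Iso.hom_inv_id, CategoryTheory.Functor.map_id]
      exact (Iso.hom_inv_id _).symm
    simp only [Functor.map_comp, ← id_tensorHom, ← tensorHom_id, ι_map_tensorHom_hom_eq_tensorHom,
      Functor.FullyFaithful.preimageIso_hom, Functor.FullyFaithful.map_preimage, CategoryTheory.Functor.map_id, h]
    exact DayConvolution.hexagon_reverse _ _ _
  symmetry X Y := by
    apply dayFF.map_injective
    simp only [Functor.map_comp,
      Functor.FullyFaithful.preimageIso_hom, Functor.FullyFaithful.map_preimage, CategoryTheory.Functor.map_id]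
    exact DayConvolution.symmetry _ _
end
end AlgClassifier

namespace AlgClassifier
noncomputable section
section
variable {A : Type w} [Category.{u} A] [MonoidalCategory A] [CocontinuousTensor A]

/-- The canonical maps `F(X) ⊗ G(Y) ⟶ (F ⊗ G)(X ⊔ Y)`, which define the Day convolution. -/
def pair (F G : qa A) (X Y : FinN.{u}) :
    F.functor.obj (op X) ⊗ G.functor.obj (op Y) ⟶ (F ⊗ G).functor.obj (op (X ⊗ Y)) :=
  (DayFunctor.η F G).app (op X, op Y)

/-- The canonical map `1 ⟶ 1(∅)`. -/
def unitPt : 𝟙_ A ⟶ (𝟙_ (qa A)).functor.obj (op (𝟙_ FinN.{u})) := DayFunctor.ν FinN.{u}ᵒᵖ A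

theorem pair_natural (F G : qa A) {X X' Y Y' : FinN.{u}} (f : X ⟶ X') (g : Y ⟶ Y') :
    (F.functor.map f.op ⊗ₘ G.functor.map g.op) ≫ pair F G X Y =
      pair F G X' Y' ≫ (F ⊗ G).functor.map (f ⊗ₘ g).op := by
  rw [MonoidalCategory.tensorHom_def]
  exact (DayFunctor.η F G).naturality (X := (op X', op Y')) (Y := (op X, op Y)) (f.op, g.op)

theorem pair_tensorHom {F F' G G' : qa A} (a : F ⟶ F') (b : G ⟶ G') (X Y : FinN.{u}) :
    pair F G X Y ≫ (a ⊗ₘ b).natTrans.app (op (X ⊗ Y)) =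
      (a.natTrans.app (op X) ⊗ₘ b.natTrans.app (op Y)) ≫ pair F' G' X Y :=
  LawfulDayConvolutionMonoidalCategoryStruct.convolutionExtensionUnit_comp_ι_map_tensorHom_app
    FinN.{u}ᵒᵖ A a b (op X) (op Y)

theorem pair_assoc (F G H : qa A) (X Y Z : FinN.{u}) :
    pair F G X Y ▷ H.functor.obj (op Z) ≫ pair (F ⊗ G) H (X ⊗ Y) Z ≫
      (α_ F G H).hom.natTrans.app (op ((X ⊗ Y) ⊗ Z)) =
    (α_ _ _ _).hom ≫ F.functor.obj (op X) ◁ pair G H Y Z ≫ pair F (G ⊗ H) X (Y ⊗ Z) ≫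
      (F ⊗ G ⊗ H).functor.map (α_ X Y Z).hom.op :=
  LawfulDayConvolutionMonoidalCategoryStruct.associator_hom_unit_unit
    A F G H (op X) (op Y) (op Z)

theorem pair_left (F : qa A) (X : FinN.{u}) :
    unitPt ▷ F.functor.obj (op X) ≫ pair (𝟙_ (qa A)) F (𝟙_ _) X ≫
      (λ_ F).hom.natTrans.app (op (𝟙_ _ ⊗ X)) =
    (λ_ _).hom ≫ F.functor.map (λ_ X).hom.op :=
  LawfulDayConvolutionMonoidalCategoryStruct.leftUnitor_hom_unit_app A F (op X)

theorem pair_right (F : qa A) (X : FinN.{u}) :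
    F.functor.obj (op X) ◁ unitPt ≫ pair F (𝟙_ (qa A)) X (𝟙_ _) ≫
      (ρ_ F).hom.natTrans.app (op (X ⊗ 𝟙_ _)) =
    (ρ_ _).hom ≫ F.functor.map (ρ_ X).hom.op :=
  LawfulDayConvolutionMonoidalCategoryStruct.rightUnitor_hom_unit_app A F (op X)

theorem pair_braiding {A : Type w} [Category.{u} A] [MonoidalCategory A] [SymmetricCategory A]
    [CocontinuousTensor A] (F G : qa A) (X Y : FinN.{u}) :
    pair F G X Y ≫ (β_ F G).hom.natTrans.app (op (X ⊗ Y)) =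
    (β_ _ _).hom ≫ pair G F Y X ≫ (G ⊗ F).functor.map (β_ X Y).hom.op := by
  let := LawfulDayConvolutionMonoidalCategoryStruct.convolution FinN.{u}ᵒᵖ A (qa A) F G
  let := LawfulDayConvolutionMonoidalCategoryStruct.convolution FinN.{u}ᵒᵖ A (qa A) G F
  have h : (β_ F G).hom.natTrans = (DayConvolution.braiding
      ((LawfulDayConvolutionMonoidalCategoryStruct.ι FinN.{u}ᵒᵖ A (qa A)).obj F)
      ((LawfulDayConvolutionMonoidalCategoryStruct.ι FinN.{u}ᵒᵖ A (qa A)).obj G)).hom :=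
    dayFF.map_preimage _
  rw [h]
  exact DayConvolution.unit_app_braiding_hom_app
    ((LawfulDayConvolutionMonoidalCategoryStruct.ι FinN.{u}ᵒᵖ A (qa A)).obj F)
    ((LawfulDayConvolutionMonoidalCategoryStruct.ι FinN.{u}ᵒᵖ A (qa A)).obj G) (op X) (op Y)

theorem pair_ext {F G H : qa A} {a b : F ⊗ G ⟶ H}
    (h : ∀ X Y : FinN.{u}, pair F G X Y ≫ a.natTrans.app (op (X ⊗ Y)) =
      pair F G X Y ≫ b.natTrans.app (op (X ⊗ Y))) : a = b :=
  DayFunctor.tensor_hom_ext fun X Y => h (unop X) (unop Y)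

open LawfulDayConvolutionMonoidalCategoryStruct in
theorem pair_ext₃ {F G H K : qa A} {a b : (F ⊗ G) ⊗ H ⟶ K}
    (h : ∀ X Y Z : FinN.{u},
      pair F G X Y ▷ H.functor.obj (op Z) ≫ pair (F ⊗ G) H (X ⊗ Y) Z ≫
        a.natTrans.app (op ((X ⊗ Y) ⊗ Z)) =
      pair F G X Y ▷ H.functor.obj (op Z) ≫ pair (F ⊗ G) H (X ⊗ Y) Z ≫
        b.natTrans.app (op ((X ⊗ Y) ⊗ Z))) : a = b := by
  let i1 := convolution FinN.{u}ᵒᵖ A (qa A) F G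
  let i2 := convolution FinN.{u}ᵒᵖ A (qa A) G H
  let i3 := convolution₂ FinN.{u}ᵒᵖ A (qa A) F G H
  let i4 := convolution₂' FinN.{u}ᵒᵖ A (qa A) F G H
  apply dayFF.map_injective
  apply Functor.hom_ext_of_isLeftKanExtension
    (DayConvolution.convolution (DayConvolution.convolution ((ι FinN.{u}ᵒᵖ A (qa A)).obj F)
      ((ι FinN.{u}ᵒᵖ A (qa A)).obj G)) ((ι FinN.{u}ᵒᵖ A (qa A)).obj H))
    (DayConvolution.unit _ ((ι FinN.{u}ᵒᵖ A (qa A)).obj H))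
  apply Functor.hom_ext_of_isLeftKanExtension
    (externalProduct (DayConvolution.convolution ((ι FinN.{u}ᵒᵖ A (qa A)).obj F)
      ((ι FinN.{u}ᵒᵖ A (qa A)).obj G)) ((ι FinN.{u}ᵒᵖ A (qa A)).obj H))
    (ExternalProduct.extensionUnitLeft (DayConvolution.convolution
      ((ι FinN.{u}ᵒᵖ A (qa A)).obj F)
      ((ι FinN.{u}ᵒᵖ A (qa A)).obj G)) (DayConvolution.unit ((ι FinN.{u}ᵒᵖ A (qa A)).obj F)
      ((ι FinN.{u}ᵒᵖ A (qa A)).obj G)) ((ι FinN.{u}ᵒᵖ A (qa A)).obj H))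
  refine NatTrans.ext (funext fun ⟨⟨x, y⟩, z⟩ => ?_)
  have := h (unop x) (unop y) (unop z)
  simpa using! this

theorem unit_ext {F : qa A} {a b : 𝟙_ (qa A) ⟶ F}
    (h : unitPt ≫ a.natTrans.app (op (𝟙_ _)) = unitPt ≫ b.natTrans.app (op (𝟙_ _))) : a = b :=
  DayFunctor.unit_hom_ext h

/-- Morphisms out of `F ⊗ G` from a natural family of maps `F(X) ⊗ G(Y) ⟶ H(X ⊔ Y)`. -/
def pairDesc {F G H : qa A}
    (t : ∀ X Y : FinN.{u}, F.functor.obj (op X) ⊗ G.functor.obj (op Y) ⟶ H.functor.obj (op (X ⊗ Y)))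
    (ht : ∀ {X X' Y Y' : FinN.{u}} (f : X ⟶ X') (g : Y ⟶ Y'),
      (F.functor.map f.op ⊗ₘ G.functor.map g.op) ≫ t X Y = t X' Y' ≫ H.functor.map (f ⊗ₘ g).op) :
    F ⊗ G ⟶ H :=
  DayFunctor.tensorDesc
    { app := fun p => t (unop p.1) (unop p.2)
      naturality := fun p q f => by
        have := ht f.1.unop f.2.unop
        rw [MonoidalCategory.tensorHom_def] at this
        exact this }

theorem pair_pairDesc {F G H : qa A}
    (t : ∀ X Y : FinN.{u}, F.functor.obj (op X) ⊗ G.functor.obj (op Y) ⟶ H.functor.obj (op (X ⊗ Y)))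
    (ht : ∀ {X X' Y Y' : FinN.{u}} (f : X ⟶ X') (g : Y ⟶ Y'),
      (F.functor.map f.op ⊗ₘ G.functor.map g.op) ≫ t X Y = t X' Y' ≫ H.functor.map (f ⊗ₘ g).op)
    (X Y : FinN.{u}) : pair F G X Y ≫ (pairDesc t ht).natTrans.app (op (X ⊗ Y)) = t X Y :=
  DayFunctor.η_comp_tensorDesc_app _ (op X) (op Y)

/-- Morphisms out of the unit presheaf. -/
def unitDesc {F : qa A} (t : 𝟙_ A ⟶ F.functor.obj (op (𝟙_ FinN.{u}))) : 𝟙_ (qa A) ⟶ F :=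
  DayFunctor.unitDesc t

theorem unitPt_unitDesc {F : qa A} (t : 𝟙_ A ⟶ F.functor.obj (op (𝟙_ FinN.{u}))) :
    unitPt ≫ (unitDesc t).natTrans.app (op (𝟙_ _)) = t := DayFunctor.ν_comp_unitDesc t
end
end
end AlgClassifier

namespace AlgClassifier
noncomputable section

/-- The presheaf `h_X` represented by `X`. -/
def hN : FinN.{u} ⥤ Qa.{u} where
  obj X := ⟨yoneda.obj X⟩
  map f := ⟨yoneda.map f⟩

/-- The canonical map `h_X ⊗ h_Y ⟶ h_{X ⊔ Y}`. -/
def hμ (X Y : FinN.{u}) : hN.obj X ⊗ hN.obj Y ⟶ hN.obj (X ⊗ Y) :=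
  pairDesc (fun X' Y' => ↾fun p : (X' ⟶ X) × (Y' ⟶ Y) => (p.1 ⊗ₘ p.2 : X' ⊗ Y' ⟶ X ⊗ Y))
    (fun f g => by
      ext ⟨p, q⟩
      exact (tensorHom_comp_tensorHom f g p q).symm)

theorem hμ_pair (X Y X' Y' : FinN.{u}) :
    pair (hN.obj X) (hN.obj Y) X' Y' ≫ (hμ X Y).natTrans.app (op (X' ⊗ Y')) =
    ↾fun p : (X' ⟶ X) × (Y' ⟶ Y) => (p.1 ⊗ₘ p.2 : X' ⊗ Y' ⟶ X ⊗ Y) :=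
  pair_pairDesc _ (fun f g => by ext ⟨p, q⟩; exact (tensorHom_comp_tensorHom f g p q).symm) _ _

/-- The canonical map from the unit presheaf to `h_∅`. -/
def hε : 𝟙_ Qa.{u} ⟶ hN.obj (𝟙_ FinN.{u}) :=
  unitDesc (↾fun _ => (𝟙 (𝟙_ FinN.{u})))

theorem hε_pt : unitPt ≫ hε.{u}.natTrans.app (op (𝟙_ _)) = ↾fun _ => (𝟙 (𝟙_ FinN.{u})) :=
  unitPt_unitDesc _

theorem pair_whiskerRight {A : Type w} [Category.{u} A] [MonoidalCategory A] [CocontinuousTensor A]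
    {F F' : qa A} (a : F ⟶ F') (G : qa A) (X Y : FinN.{u}) :
    pair F G X Y ≫ (a ▷ G).natTrans.app (op (X ⊗ Y)) =
      a.natTrans.app (op X) ▷ G.functor.obj (op Y) ≫ pair F' G X Y := by
  have := pair_tensorHom a (𝟙 G) X Y
  simpa using this

theorem pair_whiskerLeft {A : Type w} [Category.{u} A] [MonoidalCategory A] [CocontinuousTensor A]
    (F : qa A) {G G' : qa A} (a : G ⟶ G') (X Y : FinN.{u}) :
    pair F G X Y ≫ (F ◁ a).natTrans.app (op (X ⊗ Y)) =
      F.functor.obj (op X) ◁ a.natTrans.app (op Y) ≫ pair F G' X Y := by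
  have := pair_tensorHom (𝟙 F) a X Y
  simpa using this

theorem hN_map_app {X Y : FinN.{u}} (f : X ⟶ Y) (Z : FinN.{u}) :
    (hN.map f).natTrans.app (op Z) = ↾fun p : Z ⟶ X => p ≫ f := rfl

theorem comp_app {A : Type w} [Category.{u} A] [MonoidalCategory A]
   {F G H : qa A} (a : F ⟶ G) (b : G ⟶ H) (Z) :
   (a ≫ b).natTrans.app Z = a.natTrans.app Z ≫ b.natTrans.app Z := rfl

theorem pair_nat_app {A : Type w} [Category.{u} A] [MonoidalCategory A]
   {F G : qa A} (a : F ⟶ G) {Y Z} (f : Y ⟶ Z) :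
   F.functor.map f ≫ a.natTrans.app Z = a.natTrans.app Y ≫ G.functor.map f := a.natTrans.naturality f

theorem left_ext {A : Type w} [Category.{u} A] [MonoidalCategory A] [CocontinuousTensor A]
    {F K : qa A} {a b : 𝟙_ (qa A) ⊗ F ⟶ K}
    (h : ∀ X : FinN.{u}, unitPt ▷ F.functor.obj (op X) ≫ pair (𝟙_ (qa A)) F (𝟙_ _) X ≫
      a.natTrans.app (op (𝟙_ _ ⊗ X)) = unitPt ▷ F.functor.obj (op X) ≫
      pair (𝟙_ (qa A)) F (𝟙_ _) X ≫ b.natTrans.app (op (𝟙_ _ ⊗ X))) : a = b := by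
  rw [← cancel_epi (λ_ F).inv]
  apply DayFunctor.hom_ext
  have key (c : 𝟙_ (qa A) ⊗ F ⟶ K) (X : FinN.{u}) :
      (λ_ _).hom ≫ F.functor.map (λ_ X).hom.op ≫ ((λ_ F).inv ≫ c).natTrans.app (op (𝟙_ _ ⊗ X)) =
      unitPt ▷ F.functor.obj (op X) ≫ pair (𝟙_ (qa A)) F (𝟙_ _) X ≫
      c.natTrans.app (op (𝟙_ _ ⊗ X)) := by
    rw [← reassoc_of% (pair_left F X), ← comp_app, Iso.hom_inv_id_assoc]
  ext ⟨X⟩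
  have h1 := (key a X).trans ((h X).trans (key b X).symm)
  rw [cancel_epi, pair_nat_app, pair_nat_app, cancel_mono] at h1
  exact h1

theorem right_ext {A : Type w} [Category.{u} A] [MonoidalCategory A] [CocontinuousTensor A]
    {F K : qa A} {a b : F ⊗ 𝟙_ (qa A) ⟶ K}
    (h : ∀ X : FinN.{u}, F.functor.obj (op X) ◁ unitPt ≫ pair F (𝟙_ (qa A)) X (𝟙_ _) ≫
      a.natTrans.app (op (X ⊗ 𝟙_ _)) = F.functor.obj (op X) ◁ unitPt ≫
      pair F (𝟙_ (qa A)) X (𝟙_ _) ≫ b.natTrans.app (op (X ⊗ 𝟙_ _))) : a = b := by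
  rw [← cancel_epi (ρ_ F).inv]
  apply DayFunctor.hom_ext
  have key (c : F ⊗ 𝟙_ (qa A) ⟶ K) (X : FinN.{u}) :
      (ρ_ _).hom ≫ F.functor.map (ρ_ X).hom.op ≫ ((ρ_ F).inv ≫ c).natTrans.app (op (X ⊗ 𝟙_ _)) =
      F.functor.obj (op X) ◁ unitPt ≫ pair F (𝟙_ (qa A)) X (𝟙_ _) ≫
      c.natTrans.app (op (X ⊗ 𝟙_ _)) := by
    rw [← reassoc_of% (pair_right F X), ← comp_app, Iso.hom_inv_id_assoc]
  ext ⟨X⟩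
  have h1 := (key a X).trans ((h X).trans (key b X).symm)
  rw [cancel_epi, pair_nat_app, pair_nat_app, cancel_mono] at h1
  exact h1

theorem comp_tensor_left {X Y Z X' Y' : FinN.{u}} (p : X' ⟶ X) (q : Y' ⟶ Z) (f : X ⟶ Y) :
    (p ≫ f) ⊗ₘ q = (p ⊗ₘ q) ≫ f ▷ Z := by
  rw [← tensorHom_id, tensorHom_comp_tensorHom, Category.comp_id]

theorem comp_tensor_right {X Y Z X' Y' : FinN.{u}} (p : X' ⟶ X) (q : Y' ⟶ Y) (f : Y ⟶ Z) :
    p ⊗ₘ (q ≫ f) = (p ⊗ₘ q) ≫ X ◁ f := by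
  rw [← id_tensorHom, tensorHom_comp_tensorHom, Category.comp_id]

instance : hN.{u}.LaxMonoidal where
  ε := hε
  μ := hμ
  μ_natural_left f Z := by
    apply pair_ext
    intro X' Y'
    rw [comp_app, comp_app, ← Category.assoc, ← Category.assoc, pair_whiskerRight, hμ_pair,
      Category.assoc, hμ_pair, hN_map_app, hN_map_app]
    ext ⟨p, q⟩
    exact comp_tensor_left p q f
  μ_natural_right Z f := by
    apply pair_ext
    intro X' Y'
    rw [comp_app, comp_app, ← Category.assoc, ← Category.assoc, pair_whiskerLeft, hμ_pair,
      Category.assoc, hμ_pair, hN_map_app, hN_map_app]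
    ext ⟨p, q⟩
    exact comp_tensor_right p q f
  associativity X Y Z := by
    apply pair_ext₃
    intro X' Y' Z'
    simp only [comp_app]
    rw [reassoc_of% (pair_whiskerRight (hμ X Y) (hN.obj Z) (X' ⊗ Y') Z'),
      reassoc_of% (hμ_pair (X ⊗ Y) Z (X' ⊗ Y') Z'),
      reassoc_of% (pair_assoc (hN.obj X) (hN.obj Y) (hN.obj Z) X' Y' Z'), ← comp_app,
      pair_nat_app, comp_app, Category.assoc,
      reassoc_of% (pair_whiskerLeft (hN.obj X) (hμ Y Z) X' (Y' ⊗ Z')),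
      reassoc_of% (hμ_pair X (Y ⊗ Z) X' (Y' ⊗ Z')),
      ← comp_whiskerRight_assoc, hμ_pair, ← MonoidalCategory.whiskerLeft_comp_assoc, hμ_pair]
    ext ⟨⟨p, q⟩, r⟩
    exact associator_naturality p q r
  left_unitality X := by
    apply left_ext
    intro X'
    simp only [comp_app]
    rw [pair_left, reassoc_of% (pair_whiskerRight hε (hN.obj X) (𝟙_ _) X'),
      ← comp_whiskerRight_assoc, hε_pt, reassoc_of% (hμ_pair (𝟙_ _) X (𝟙_ _) X')]
    ext ⟨p, q⟩
    exact ((id_tensorHom (𝟙_ FinN.{u}) q =≫ _).trans (leftUnitor_naturality q)).symm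
  right_unitality X := by
    apply right_ext
    intro X'
    simp only [comp_app]
    rw [pair_right, reassoc_of% (pair_whiskerLeft (hN.obj X) hε X' (𝟙_ _)),
      ← MonoidalCategory.whiskerLeft_comp_assoc, hε_pt, reassoc_of% (hμ_pair X (𝟙_ _) X' (𝟙_ _))]
    ext ⟨p, q⟩
    exact ((tensorHom_id p (𝟙_ FinN.{u}) =≫ _).trans (rightUnitor_naturality p)).symm

instance : hN.{u}.LaxBraided where
  braided X Y := by
    apply pair_ext
    intro X' Y'
    change pair _ _ _ _ ≫ (hμ X Y ≫ hN.map _).natTrans.app _ =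
      pair _ _ _ _ ≫ ((β_ _ _).hom ≫ hμ Y X).natTrans.app _
    simp only [comp_app]
    rw [reassoc_of% (hμ_pair X Y X' Y'),
     reassoc_of% (pair_braiding (hN.obj X) (hN.obj Y) X' Y'), pair_nat_app,
     reassoc_of% (hμ_pair Y X Y' X')]
    ext ⟨p, q⟩
    exact BraidedCategory.braiding_naturality p q
end
end AlgClassifier

namespace AlgClassifier
noncomputable section
open MonObj
section
variable {A : Type w} [Category.{u} A] [MonoidalCategory A] [SymmetricCategory A]

instance one_isMonHom {M : A} [MonObj M] : IsMonHom η[M] where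
  one_hom := by simp
  mul_hom := by
    rw [one_mul_hom]; rfl

instance mul_isMonHom {M : A} [MonObj M] [IsCommMonObj M] : IsMonHom μ[M] where
  one_hom := by
    rw [MonObj.tensorObj.one_def, Category.assoc, one_mul_hom]
    simp
  mul_hom := by
    rw [MonObj.tensorObj.mul_def, Category.assoc, MonObj.mul_mul_mul_comm]

/-- A morphism of commutative algebras. -/
def algHom {M N : CommMon A} (f : M.X ⟶ N.X) [IsMonHom f] : M ⟶ N :=
  CommMon.homMk (@Mon.Hom.mk _ _ _ M.toMon N.toMon f ‹IsMonHom f›)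

/-- The morphism underlying a morphism of commutative algebras. -/
def algMap {M N : CommMon A} (f : M ⟶ N) : M.X ⟶ N.X := f.hom.hom

instance {M N : CommMon A} (f : M ⟶ N) : IsMonHom (algMap f) := f.hom.isMonHom_hom

theorem algMap_comp {M N P : CommMon A} (f : M ⟶ N) (g : N ⟶ P) :
    algMap (f ≫ g) = algMap f ≫ algMap g := rfl

theorem algMap_ext {M N : CommMon A} {f g : M ⟶ N} (h : algMap f = algMap g) : f = g :=
  CommMon.hom_ext _ _ h

/-- The tensor product of two commutative algebras, which is also their coproduct. -/
abbrev tensorAlg (M N : CommMon A) : CommMon A := ⟨M.X ⊗ N.X⟩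

/-- The coprojection `M ≅ M ⊗ 1 ⟶ M ⊗ N`. -/
def inlAlg (M N : CommMon A) : M ⟶ tensorAlg M N :=
  @algHom _ _ _ _ M (tensorAlg M N) ((ρ_ M.X).inv ≫ M.X ◁ η[N.X])
    (instIsMonHomComp (ρ_ M.X).inv (M.X ◁ η[N.X]))

/-- The coprojection `N ≅ 1 ⊗ N ⟶ M ⊗ N`. -/
def inrAlg (M N : CommMon A) : N ⟶ tensorAlg M N :=
  @algHom _ _ _ _ N (tensorAlg M N) ((λ_ N.X).inv ≫ η[M.X] ▷ N.X)
    (instIsMonHomComp (λ_ N.X).inv (η[M.X] ▷ N.X))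

/-- The algebra morphism `M ⊗ N ⟶ P`, `m ⊗ n ↦ f m * g n`. -/
def descAlg {M N P : CommMon A} (f : M ⟶ P) (g : N ⟶ P) : tensorAlg M N ⟶ P :=
  @algHom _ _ _ _ (tensorAlg M N) P ((algMap f ⊗ₘ algMap g) ≫ μ[P.X])
    (instIsMonHomComp (algMap f ⊗ₘ algMap g) μ[P.X])

theorem inl_desc {M N P : CommMon A} (f : M ⟶ P) (g : N ⟶ P) :
    inlAlg M N ≫ descAlg f g = f := by
  apply algMap_ext
  change ((ρ_ M.X).inv ≫ M.X ◁ η[N.X]) ≫ (algMap f ⊗ₘ algMap g) ≫ μ[P.X] = algMap f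
  rw [Category.assoc, ← id_tensorHom, tensorHom_comp_tensorHom_assoc, Category.id_comp,
    IsMonHom.one_hom, mul_one_hom, Iso.inv_hom_id_assoc]

theorem inr_desc {M N P : CommMon A} (f : M ⟶ P) (g : N ⟶ P) :
    inrAlg M N ≫ descAlg f g = g := by
  apply algMap_ext
  change ((λ_ N.X).inv ≫ η[M.X] ▷ N.X) ≫ (algMap f ⊗ₘ algMap g) ≫ μ[P.X] = algMap g
  rw [Category.assoc, ← tensorHom_id, tensorHom_comp_tensorHom_assoc, Category.id_comp,
    IsMonHom.one_hom, one_mul_hom, Iso.inv_hom_id_assoc]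

theorem coprod_mul (M N : A) [MonObj M] [MonObj N] :
    (((ρ_ M).inv ≫ M ◁ η[N]) ⊗ₘ ((λ_ N).inv ≫ η[M] ▷ N)) ≫ μ[M ⊗ N] = 𝟙 _ := by
  rw [MonObj.tensorObj.mul_def, ← id_tensorHom, ← tensorHom_id, ← tensorHom_comp_tensorHom,
    Category.assoc, tensorμ_natural_assoc, tensorHom_comp_tensorHom, mul_one_hom, one_mul_hom,
    Category.comp_id, Category.comp_id]
  rw [tensorμ, braiding_tensorUnit_left]
  monoidal

theorem desc_eta {M N P : A} [MonObj M] [MonObj N] [MonObj P] (h : M ⊗ N ⟶ P) [IsMonHom h] :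
    h = ((((ρ_ M).inv ≫ M ◁ η[N]) ≫ h) ⊗ₘ (((λ_ N).inv ≫ η[M] ▷ N) ≫ h)) ≫ μ[P] := by
  rw [← tensorHom_comp_tensorHom, Category.assoc, ← IsMonHom.mul_hom h, ← Category.assoc,
    coprod_mul, Category.id_comp]

theorem alg_ext {M N P : CommMon A} {f g : tensorAlg M N ⟶ P}
    (h₁ : inlAlg M N ≫ f = inlAlg M N ≫ g) (h₂ : inrAlg M N ≫ f = inrAlg M N ≫ g) : f = g := by
  have key (h : tensorAlg M N ⟶ P) : h = descAlg (inlAlg M N ≫ h) (inrAlg M N ≫ h) :=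
    algMap_ext (desc_eta (M := M.X) (N := N.X) (algMap h))
  rw [key f, key g, h₁, h₂]

/-- The tensor power `M^{⊗n}` as a commutative algebra: `M^{⊗0} = 1`,
`M^{⊗(n+1)} = M^{⊗n} ⊗ M`. -/
def pow (M : CommMon A) : ℕ → CommMon A
  | 0 => CommMon.trivial A
  | n + 1 => tensorAlg (pow M n) M

/-- The insertion of the `i`-th tensor factor, with units at all other places. -/
def powι (M : CommMon A) : (n : ℕ) → Fin n → (M ⟶ pow M n)
  | 0, i => i.elim0
  | n + 1, i => Fin.lastCases (motive := fun _ => M ⟶ tensorAlg (pow M n) M)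
      (inrAlg (pow M n) M) (fun i => powι M n i ≫ inlAlg (pow M n) M) i

/-- The algebra morphism `M^{⊗n} ⟶ P`, `m₁ ⊗ ⋯ ⊗ mₙ ↦ f₁ m₁ * ⋯ * fₙ mₙ`. -/
def powDesc {M P : CommMon A} : (n : ℕ) → (Fin n → (M ⟶ P)) → (pow M n ⟶ P)
  | 0, _ => (default : CommMon.trivial A ⟶ P)
  | n + 1, f => descAlg (powDesc n (fun i => f i.castSucc)) (f (Fin.last n))

theorem powι_desc {M P : CommMon A} (n : ℕ) (f : Fin n → (M ⟶ P)) (i : Fin n) :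
    powι M n i ≫ powDesc n f = f i := by
  induction n with
  | zero => exact i.elim0
  | succ n ih =>
    induction i using Fin.lastCases with
    | last =>
      simp only [powι, powDesc, Fin.lastCases_last]
      exact inr_desc _ _
    | cast i =>
      simp only [powι, powDesc, Fin.lastCases_castSucc]
      exact (Category.assoc (powι M n i) (inlAlg (pow M n) M) _).trans <| (powι M n i ≫= inl_desc _ _).trans (ih (fun i => f i.castSucc) i)

theorem pow_ext {M P : CommMon A} {n : ℕ} {f g : pow M n ⟶ P}
    (h : ∀ i, powι M n i ≫ f = powι M n i ≫ g) : f = g := by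
  induction n with
  | zero => exact Subsingleton.elim (α := CommMon.trivial A ⟶ P) _ _
  | succ n ih =>
    refine alg_ext (ih fun i => ?_) ?_
    · have := h i.castSucc; simp only [powι, Fin.lastCases_castSucc] at this
      exact (Category.assoc (powι M n i) (inlAlg (pow M n) M) f).symm.trans
        (this.trans (Category.assoc (powι M n i) (inlAlg (pow M n) M) g))
    · have := h (Fin.last n); simp only [powι, Fin.lastCases_last] at this; exact this

/-- The morphism `f_* : M^{⊗m} ⟶ M^{⊗n}` attached to `f : m ⟶ n`: it multiplies together the
factors in each fibre of `f`, and puts a unit where the fibre is empty. -/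
def powMap (M : CommMon A) {X Y : FinN.{u}} (f : X ⟶ Y) : pow M X.len ⟶ pow M Y.len :=
  powDesc X.len (fun i => powι M Y.len (f (ULift.up i)).down)

/-- The functor `n ↦ M^{⊗n}`. -/
def Phi (M : CommMon A) : FinN.{u} ⥤ A where
  obj X := (pow M X.len).X
  map f := (powMap M f).hom.hom
  map_id X := by
    have : powMap M (𝟙 X) = 𝟙 _ := pow_ext fun i => by
      rw [powMap, powι_desc, Category.comp_id]; rfl
    rw [this]; rfl
  map_comp f g := by
    have : powMap M (f ≫ g) = powMap M f ≫ powMap M g := pow_ext fun i => by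
      rw [powMap, powι_desc, powMap, ← Category.assoc, powι_desc, powMap, powι_desc]; rfl
    rw [this]; rfl
end
end
end AlgClassifier

namespace AlgClassifier
section
variable {A : Type w} [Category.{u} A] [MonoidalCategory A] [SymmetricCategory A]

theorem tensorμ_braid (a p b q : A) :
    tensorμ a p b q ≫ ((β_ a b).hom ⊗ₘ (β_ p q).hom) =
      (β_ (a ⊗ p) (b ⊗ q)).hom ≫ tensorμ b q a p := by
  simp only [tensorμ, Category.assoc,
    BraidedCategory.braiding_tensor_right_hom, BraidedCategory.braiding_tensor_left_hom,
    comp_whiskerRight, whisker_assoc, MonoidalCategory.whiskerLeft_comp, pentagon_assoc,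
    pentagon_inv_hom_hom_hom_inv_assoc, Iso.inv_hom_id_assoc, whiskerLeft_hom_inv_assoc]
  slice_rhs 11 12 =>
    rw [← MonoidalCategory.whiskerLeft_comp, ← comp_whiskerRight, SymmetricCategory.symmetry]
  simp only [id_whiskerRight, MonoidalCategory.whiskerLeft_id, Category.id_comp]
  rw [MonoidalCategory.tensorHom_def]
  monoidal

theorem ext_assoc {a b c p q r s t v x : A} (m₁ : p ⊗ q ⟶ s) (m₂ : s ⊗ r ⟶ t)
    (m₃ : q ⊗ r ⟶ v) (m₄ : p ⊗ v ⟶ x) (k : x ⟶ t)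
    (h : m₁ ▷ r ≫ m₂ = (α_ p q r).hom ≫ p ◁ m₃ ≫ m₄ ≫ k) :
    (tensorμ a p b q ≫ (a ⊗ b) ◁ m₁) ▷ (c ⊗ r) ≫
      (tensorμ (a ⊗ b) s c r ≫ ((a ⊗ b) ⊗ c) ◁ m₂) ≫ (α_ a b c).hom ▷ t =
    (α_ (a ⊗ p) (b ⊗ q) (c ⊗ r)).hom ≫ (a ⊗ p) ◁ (tensorμ b q c r ≫ (b ⊗ c) ◁ m₃) ≫
      (tensorμ a p (b ⊗ c) v ≫ (a ⊗ b ⊗ c) ◁ m₄) ≫ (a ⊗ b ⊗ c) ◁ k := by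
  have h' := tensor_associativity a p b q c r
  have e1 := tensorμ_natural_left (𝟙 (a ⊗ b)) m₁ c r
  have e2 := tensorμ_natural_right a p (𝟙 (b ⊗ c)) m₃
  simp only [id_tensorHom, id_whiskerRight, MonoidalCategory.whiskerLeft_id] at e1 e2
  simp only [comp_whiskerRight, MonoidalCategory.whiskerLeft_comp, Category.assoc]
  rw [reassoc_of% e1, reassoc_of% e2, ← reassoc_of% h']
  rw [← MonoidalCategory.whiskerLeft_comp_assoc, h, MonoidalCategory.tensorHom_def,
    whisker_exchange]
  simp only [MonoidalCategory.whiskerLeft_comp, Category.assoc]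

theorem ext_left {a b c p q s : A} (f : a ⟶ b) (m : p ⊗ q ⟶ s) :
    (f ▷ p) ▷ (c ⊗ q) ≫ tensorμ b p c q ≫ (b ⊗ c) ◁ m =
      (tensorμ a p c q ≫ (a ⊗ c) ◁ m) ≫ (f ▷ c) ▷ s := by
  have e1 := tensorμ_natural_left f (𝟙 p) c q
  simp only [tensorHom_id, id_whiskerRight] at e1
  rw [reassoc_of% e1, Category.assoc, whisker_exchange]

theorem ext_right {a b c p q s : A} (f : a ⟶ b) (m : p ⊗ q ⟶ s) :
    (c ⊗ p) ◁ (f ▷ q) ≫ tensorμ c p b q ≫ (c ⊗ b) ◁ m =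
      (tensorμ c p a q ≫ (c ⊗ a) ◁ m) ≫ (c ◁ f) ▷ s := by
  have e1 := tensorμ_natural_right c p f (𝟙 q)
  simp only [tensorHom_id, MonoidalCategory.whiskerLeft_id] at e1
  rw [reassoc_of% e1, Category.assoc, whisker_exchange]

theorem ext_unit_left {a p q s : A} (e : 𝟙_ A ⟶ p) (m : p ⊗ q ⟶ s) (k : q ⟶ s)
    (h : e ▷ q ≫ m = (λ_ q).hom ≫ k) :
    (λ_ (a ⊗ q)).hom ≫ a ◁ k = (e ≫ (λ_ p).inv) ▷ (a ⊗ q) ≫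
      (tensorμ (𝟙_ A) p a q ≫ (𝟙_ A ⊗ a) ◁ m) ≫ (λ_ a).hom ▷ s := by
  have e1 := tensorμ_natural_left (𝟙 (𝟙_ A)) e a q
  simp only [id_tensorHom, id_whiskerRight] at e1
  rw [leftUnitor_inv_naturality, comp_whiskerRight, Category.assoc, Category.assoc,
    reassoc_of% e1, ← MonoidalCategory.whiskerLeft_comp_assoc, h, whisker_exchange,
    tensor_left_unitality, MonoidalCategory.tensorHom_def]
  simp only [MonoidalCategory.whiskerLeft_comp, Category.assoc, ← whisker_exchange,
    ← whisker_exchange_assoc]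

theorem ext_unit_right {a p q s : A} (e : 𝟙_ A ⟶ q) (m : p ⊗ q ⟶ s) (k : p ⟶ s)
    (h : p ◁ e ≫ m = (ρ_ p).hom ≫ k) :
    (ρ_ (a ⊗ p)).hom ≫ a ◁ k = (a ⊗ p) ◁ (e ≫ (λ_ q).inv) ≫
      (tensorμ a p (𝟙_ A) q ≫ (a ⊗ 𝟙_ A) ◁ m) ≫ (ρ_ a).hom ▷ s := by
  have e1 := tensorμ_natural_right a p (𝟙 (𝟙_ A)) e
  simp only [id_tensorHom, MonoidalCategory.whiskerLeft_id] at e1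
  rw [leftUnitor_inv_naturality, MonoidalCategory.whiskerLeft_comp, Category.assoc,
    Category.assoc, reassoc_of% e1, ← MonoidalCategory.whiskerLeft_comp_assoc, h, whisker_exchange,
    tensor_right_unitality, MonoidalCategory.tensorHom_def]
  simp only [MonoidalCategory.whiskerLeft_comp, Category.assoc, ← whisker_exchange,
    ← whisker_exchange_assoc]

theorem ext_braid {a b p q s t : A} (m : p ⊗ q ⟶ s) (m' : q ⊗ p ⟶ t) (k : t ⟶ s)
    (h : m = (β_ p q).hom ≫ m' ≫ k) :
    (tensorμ a p b q ≫ (a ⊗ b) ◁ m) ≫ (β_ a b).hom ▷ s =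
      (β_ (a ⊗ p) (b ⊗ q)).hom ≫ (tensorμ b q a p ≫ (b ⊗ a) ◁ m') ≫ (b ⊗ a) ◁ k := by
  rw [h, Category.assoc, Category.assoc, ← reassoc_of% (tensorμ_braid a p b q),
    MonoidalCategory.tensorHom_def]
  simp only [MonoidalCategory.whiskerLeft_comp, Category.assoc, ← whisker_exchange,
    ← whisker_exchange_assoc]
end
end AlgClassifier

namespace AlgClassifier
noncomputable section
open MonObj

/-- The one-element standard set. -/
def FinN.one : FinN.{u} := FintypeCat.Skeleton.mk 1

instance (X : FinN.{u}) : Unique (X ⟶ FinN.one.{u}) where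
  default := FinN.ofFun fun _ => ⟨(0 : Fin 1)⟩
  uniq f := FinN.hom_ext_el _ _ fun _ => ULift.ext _ _ (Fin.ext (by
    have h (a b : Fin 1) : a.val = b.val := by omega
    exact h _ _))

/-- The one-element set as a commutative algebra for disjoint union: the multiplication is the
map `2 ⟶ 1`, the unit is the map `0 ⟶ 1`. -/
instance : MonObj FinN.one.{u} where
  one := default
  mul := default
  one_mul := Subsingleton.elim _ _
  mul_one := Subsingleton.elim _ _
  mul_assoc := Subsingleton.elim _ _

instance : IsCommMonObj FinN.one.{u} where
  mul_comm := Subsingleton.elim _ _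

/-- The universal algebra: `h_1`, with the multiplication `h_1 ⊗ h_1 ≅ h_2 ⟶ h_1` and the unit
`1 ≅ h_0 ⟶ h_1` induced by the maps `2 ⟶ 1` and `0 ⟶ 1`. -/
def Xa : CommMon Qa.{u} := hN.mapCommMon.obj ⟨FinN.one⟩

section
variable (A : Type w) [Category.{u} A] [MonoidalCategory A] [SymmetricCategory A]
  [CocontinuousTensor A]

/-- The constant presheaf with value the unit object; as there is only one map `X ⟶ 1`, it is the
presheaf `h_1` with coefficients in `A`. -/
def constOne : qa A := ⟨(Functor.const _).obj (𝟙_ A)⟩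

def constMul : constOne A ⊗ constOne A ⟶ constOne A :=
  pairDesc (fun _ _ => (λ_ (𝟙_ A)).hom) (fun _ _ => by simp [constOne])

def constUnit : 𝟙_ (qa A) ⟶ constOne A := unitDesc (𝟙 (𝟙_ A))

variable {A}

theorem constMul_pair (X Y : FinN.{u}) :
    pair (constOne A) (constOne A) X Y ≫ (constMul A).natTrans.app (op (X ⊗ Y)) =
      (λ_ (𝟙_ A)).hom := pair_pairDesc _ (fun _ _ => by simp [constOne]) _ _

theorem constUnit_pt : unitPt ≫ (constUnit A).natTrans.app (op (𝟙_ _)) = 𝟙 (𝟙_ A) :=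
  unitPt_unitDesc _

theorem constOne_map {X Y : FinN.{u}ᵒᵖ} (f : X ⟶ Y) : (constOne A).functor.map f = 𝟙 (𝟙_ A) := rfl

instance : MonObj (constOne A) where
  one := constUnit A
  mul := constMul A
  one_mul := by
    apply left_ext
    intro X
    rw [comp_app, reassoc_of% (pair_whiskerRight (constUnit A) (constOne A) (𝟙_ _) X),
      ← comp_whiskerRight_assoc, constUnit_pt, pair_left, constOne_map, constMul_pair]
    change 𝟙 (𝟙_ A) ▷ (𝟙_ A) ≫ (λ_ (𝟙_ A)).hom = (λ_ (𝟙_ A)).hom ≫ 𝟙 _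
    simp
  mul_one := by
    apply right_ext
    intro X
    rw [comp_app, reassoc_of% (pair_whiskerLeft (constOne A) (constUnit A) X (𝟙_ _)),
      ← MonoidalCategory.whiskerLeft_comp_assoc, constUnit_pt, pair_right, constOne_map,
      constMul_pair]
    change (𝟙_ A) ◁ 𝟙 (𝟙_ A) ≫ (λ_ (𝟙_ A)).hom = (ρ_ (𝟙_ A)).hom ≫ 𝟙 _
    simp [unitors_equal]
  mul_assoc := by
    apply pair_ext₃
    intro X Y Z
    simp only [comp_app]
    rw [reassoc_of% (pair_whiskerRight (constMul A) (constOne A) (X ⊗ Y) Z),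
      ← comp_whiskerRight_assoc, constMul_pair, constMul_pair,
      reassoc_of% (pair_assoc (constOne A) (constOne A) (constOne A) X Y Z), ← comp_app,
      pair_nat_app, comp_app, Category.assoc,
      reassoc_of% (pair_whiskerLeft (constOne A) (constMul A) X (Y ⊗ Z)),
      ← MonoidalCategory.whiskerLeft_comp_assoc, constMul_pair, constOne_map]
    erw [Category.comp_id, constMul_pair]
    change (λ_ (𝟙_ A)).hom ▷ 𝟙_ A ≫ (λ_ (𝟙_ A)).hom =
      (α_ (𝟙_ A) (𝟙_ A) (𝟙_ A)).hom ≫ 𝟙_ A ◁ (λ_ (𝟙_ A)).hom ≫ (λ_ (𝟙_ A)).hom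
    monoidal

instance : IsCommMonObj (constOne A) where
  mul_comm := by
    apply pair_ext
    intro X Y
    change pair _ _ _ _ ≫ ((β_ _ _).hom ≫ constMul A).natTrans.app _ =
      pair _ _ _ _ ≫ (constMul A).natTrans.app _
    rw [comp_app, reassoc_of% (pair_braiding (constOne A) (constOne A) X Y), pair_nat_app,
      reassoc_of% (constMul_pair Y X), constMul_pair, constOne_map]
    change (β_ (𝟙_ A) (𝟙_ A)).hom ≫ (λ_ (𝟙_ A)).hom ≫ 𝟙 _ = (λ_ (𝟙_ A)).hom
    rw [braiding_tensorUnit_left]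
    monoidal

variable (A) in
/-- The universal algebra in `qa A`. -/
def XaRel : CommMon (qa A) := ⟨constOne A⟩
end
end
end AlgClassifier

namespace AlgClassifier
noncomputable section
section
open MonObj
variable {A : Type w} [Category.{u} A] [MonoidalCategory A] [SymmetricCategory A]
  [CocontinuousTensor A]

/-- The maps `M(X) ⊗ M(Y) ⟶ M(X ⊔ Y)` given by the multiplication of an algebra `M`. -/
def algPair (M : qa A) [MonObj M] (X Y : FinN.{u}) :
    M.functor.obj (op X) ⊗ M.functor.obj (op Y) ⟶ M.functor.obj (op (X ⊗ Y)) :=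
  pair M M X Y ≫ (μ[M]).natTrans.app (op (X ⊗ Y))

/-- The map `1 ⟶ M(∅)` given by the unit of an algebra `M`. -/
def algPt (M : qa A) [MonObj M] : 𝟙_ A ⟶ M.functor.obj (op (𝟙_ FinN.{u})) :=
  unitPt ≫ (η[M]).natTrans.app (op (𝟙_ _))

theorem algPair_natural (M : qa A) [MonObj M] {X X' Y Y' : FinN.{u}} (f : X ⟶ X') (g : Y ⟶ Y') :
    (M.functor.map f.op ⊗ₘ M.functor.map g.op) ≫ algPair M X Y =
      algPair M X' Y' ≫ M.functor.map (f ⊗ₘ g).op := by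
  rw [algPair, reassoc_of% (pair_natural M M f g), pair_nat_app, algPair, Category.assoc]

theorem algPair_assoc (M : qa A) [MonObj M] (X Y Z : FinN.{u}) :
    algPair M X Y ▷ M.functor.obj (op Z) ≫ algPair M (X ⊗ Y) Z =
      (α_ _ _ _).hom ≫ M.functor.obj (op X) ◁ algPair M Y Z ≫ algPair M X (Y ⊗ Z) ≫
        M.functor.map (α_ X Y Z).hom.op := by
  have h := congrArg (fun t : (M ⊗ M) ⊗ M ⟶ M => pair M M X Y ▷ M.functor.obj (op Z) ≫
    pair (M ⊗ M) M (X ⊗ Y) Z ≫ t.natTrans.app (op ((X ⊗ Y) ⊗ Z))) (MonObj.mul_assoc M)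
  simp only [comp_app] at h
  rw [reassoc_of% (pair_whiskerRight μ[M] M (X ⊗ Y) Z),
    reassoc_of% (pair_assoc M M M X Y Z), ← comp_app, pair_nat_app, comp_app, Category.assoc,
    reassoc_of% (pair_whiskerLeft M μ[M] X (Y ⊗ Z))] at h
  simp only [algPair, comp_whiskerRight, MonoidalCategory.whiskerLeft_comp, Category.assoc]
  exact h

theorem algPair_one (M : qa A) [MonObj M] (X : FinN.{u}) :
    algPt M ▷ M.functor.obj (op X) ≫ algPair M (𝟙_ _) X =
      (λ_ _).hom ≫ M.functor.map (λ_ X).hom.op := by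
  rw [← pair_left, ← MonObj.one_mul M, comp_app, reassoc_of% (pair_whiskerRight η[M] M (𝟙_ _) X),
    algPt, comp_whiskerRight_assoc]
  rfl

theorem algPair_one_right (M : qa A) [MonObj M] (X : FinN.{u}) :
    M.functor.obj (op X) ◁ algPt M ≫ algPair M X (𝟙_ _) =
      (ρ_ _).hom ≫ M.functor.map (ρ_ X).hom.op := by
  rw [← pair_right, ← MonObj.mul_one M, comp_app, reassoc_of% (pair_whiskerLeft M η[M] X (𝟙_ _)),
    algPt, MonoidalCategory.whiskerLeft_comp_assoc]
  rfl

theorem algPair_comm (M : qa A) [MonObj M] [IsCommMonObj M] (X Y : FinN.{u}) :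
    algPair M X Y = (β_ _ _).hom ≫ algPair M Y X ≫ M.functor.map (β_ X Y).hom.op := by
  conv_lhs => rw [algPair, ← IsCommMonObj.mul_comm M, comp_app]
  rw [reassoc_of% (pair_braiding M M X Y), pair_nat_app, algPair, Category.assoc]

end

section
variable {A : Type w} [Category.{u} A] [MonoidalCategory A] [SymmetricCategory A]
  [CocontinuousTensor A]

/-- The functor `a ↦ (X ↦ a ⊗ M(X))` attached to a commutative algebra `M`. -/
def extFunctor (M : qa A) : A ⥤ qa A where
  obj a := ⟨M.functor ⋙ tensorLeft a⟩
  map f := ⟨{ app := fun X => f ▷ M.functor.obj X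
              naturality := fun _ _ _ => (whisker_exchange _ _) }⟩
  map_id a := by
    apply DayFunctor.hom_ext
    ext X
    exact id_whiskerRight _ _
  map_comp f g := by
    apply DayFunctor.hom_ext
    ext X
    exact comp_whiskerRight _ _ _

theorem extFunctor_map (M : qa A) {a b : A} (f : a ⟶ b) (X) :
    ((extFunctor M).map f).natTrans.app X = f ▷ M.functor.obj X := rfl

/-- The maps `(a ⊗ M(X)) ⊗ (b ⊗ M(Y)) ⟶ (a ⊗ b) ⊗ M(X ⊔ Y)`. -/
def extT (M : qa A) [MonObj M] (a b : A) (X Y : FinN.{u}) :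
    ((extFunctor M).obj a).functor.obj (op X) ⊗ ((extFunctor M).obj b).functor.obj (op Y) ⟶
      ((extFunctor M).obj (a ⊗ b)).functor.obj (op (X ⊗ Y)) :=
  tensorμ a (M.functor.obj (op X)) b (M.functor.obj (op Y)) ≫ (a ⊗ b) ◁ algPair M X Y

theorem extT_natural (M : qa A) [MonObj M] (a b : A) {X X' Y Y' : FinN.{u}} (f : X ⟶ X')
    (g : Y ⟶ Y') :
    (((extFunctor M).obj a).functor.map f.op ⊗ₘ ((extFunctor M).obj b).functor.map g.op) ≫
      extT M a b X Y = extT M a b X' Y' ≫ ((extFunctor M).obj (a ⊗ b)).functor.map (f ⊗ₘ g).op := by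
  change (a ◁ M.functor.map f.op ⊗ₘ b ◁ M.functor.map g.op) ≫ tensorμ _ _ _ _ ≫ _ =
    (tensorμ _ _ _ _ ≫ _) ≫ (a ⊗ b) ◁ M.functor.map (f ⊗ₘ g).op
  rw [← id_tensorHom, ← id_tensorHom, tensorμ_natural_assoc, Category.assoc,
    ← MonoidalCategory.whiskerLeft_comp, ← algPair_natural, MonoidalCategory.whiskerLeft_comp,
    id_tensorHom_id, id_tensorHom]

def extμ (M : qa A) [MonObj M] (a b : A) :
    (extFunctor M).obj a ⊗ (extFunctor M).obj b ⟶ (extFunctor M).obj (a ⊗ b) :=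
  pairDesc (extT M a b) (extT_natural M a b)

theorem pair_extμ (M : qa A) [MonObj M] (a b : A) (X Y : FinN.{u}) :
    pair ((extFunctor M).obj a) ((extFunctor M).obj b) X Y ≫
      (extμ M a b).natTrans.app (op (X ⊗ Y)) = extT M a b X Y :=
  pair_pairDesc _ (extT_natural M a b) _ _

def extε (M : qa A) [MonObj M] : 𝟙_ (qa A) ⟶ (extFunctor M).obj (𝟙_ A) :=
  unitDesc (algPt M ≫ (λ_ _).inv)

theorem extε_pt (M : qa A) [MonObj M] : unitPt ≫ (extε M).natTrans.app (op (𝟙_ _)) =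
    algPt M ≫ (λ_ _).inv := unitPt_unitDesc _

theorem extT_assoc (M : qa A) [MonObj M] (a b c : A) (X Y Z : FinN.{u}) :
    extT M a b X Y ▷ ((extFunctor M).obj c).functor.obj (op Z) ≫ extT M (a ⊗ b) c (X ⊗ Y) Z ≫
      (α_ a b c).hom ▷ M.functor.obj (op ((X ⊗ Y) ⊗ Z)) =
    (α_ _ _ _).hom ≫ ((extFunctor M).obj a).functor.obj (op X) ◁ extT M b c Y Z ≫
      extT M a (b ⊗ c) X (Y ⊗ Z) ≫ (a ⊗ b ⊗ c) ◁ M.functor.map (α_ X Y Z).hom.op := by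
  change (tensorμ _ _ _ _ ≫ _) ▷ (c ⊗ M.functor.obj (op Z)) ≫ (tensorμ _ _ _ _ ≫ _) ≫ _ =
    (α_ _ _ _).hom ≫ (a ⊗ M.functor.obj (op X)) ◁ (tensorμ _ _ _ _ ≫ _) ≫
      (tensorμ _ _ _ _ ≫ _) ≫ _
  exact ext_assoc _ _ _ _ _ (algPair_assoc M X Y Z)

theorem extT_unit_left (M : qa A) [MonObj M] (a : A) (X : FinN.{u}) :
    (λ_ (((extFunctor M).obj a).functor.obj (op X))).hom ≫
      ((extFunctor M).obj a).functor.map (λ_ X).hom.op =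
    (algPt M ≫ (λ_ _).inv) ▷ ((extFunctor M).obj a).functor.obj (op X) ≫
      extT M (𝟙_ A) a (𝟙_ _) X ≫ (λ_ a).hom ▷ M.functor.obj (op (𝟙_ _ ⊗ X)) :=
  ext_unit_left _ _ _ (algPair_one M X)

theorem extT_unit_right (M : qa A) [MonObj M] (a : A) (X : FinN.{u}) :
    (ρ_ (((extFunctor M).obj a).functor.obj (op X))).hom ≫
      ((extFunctor M).obj a).functor.map (ρ_ X).hom.op =
    ((extFunctor M).obj a).functor.obj (op X) ◁ (algPt M ≫ (λ_ _).inv) ≫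
      extT M a (𝟙_ A) X (𝟙_ _) ≫ (ρ_ a).hom ▷ M.functor.obj (op (X ⊗ 𝟙_ _)) :=
  ext_unit_right _ _ _ (algPair_one_right M X)

theorem extT_braid (M : qa A) [MonObj M] [IsCommMonObj M] (a b : A) (X Y : FinN.{u}) :
    extT M a b X Y ≫ (β_ a b).hom ▷ M.functor.obj (op (X ⊗ Y)) =
      (β_ (((extFunctor M).obj a).functor.obj (op X))
        (((extFunctor M).obj b).functor.obj (op Y))).hom ≫ extT M b a Y X ≫
        ((extFunctor M).obj (b ⊗ a)).functor.map (β_ X Y).hom.op :=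
  ext_braid _ _ _ (algPair_comm M X Y)

instance (M : qa A) [MonObj M] : (extFunctor M).LaxMonoidal where
  ε := extε M
  μ := extμ M
  μ_natural_left f c := by
    apply pair_ext
    intro X Y
    rw [comp_app, comp_app, reassoc_of% (pair_whiskerRight ((extFunctor M).map f)
      ((extFunctor M).obj c) X Y), pair_extμ, reassoc_of% (pair_extμ M _ c X Y),
      extFunctor_map, extFunctor_map]
    change (f ▷ _) ▷ (c ⊗ M.functor.obj (op Y)) ≫ tensorμ _ _ _ _ ≫ _ =
      (tensorμ _ _ _ _ ≫ _) ≫ _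
    exact ext_left _ _
  μ_natural_right c f := by
    apply pair_ext
    intro X Y
    rw [comp_app, comp_app, reassoc_of% (pair_whiskerLeft ((extFunctor M).obj c)
      ((extFunctor M).map f) X Y), pair_extμ, reassoc_of% (pair_extμ M c _ X Y),
      extFunctor_map, extFunctor_map]
    change (c ⊗ M.functor.obj (op X)) ◁ (f ▷ _) ≫ tensorμ _ _ _ _ ≫ _ =
      (tensorμ _ _ _ _ ≫ _) ≫ _
    exact ext_right _ _
  associativity a b c := by
    apply pair_ext₃
    intro X Y Z
    simp only [comp_app]
    rw [reassoc_of% (pair_whiskerRight (extμ M a b) ((extFunctor M).obj c) (X ⊗ Y) Z),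
      reassoc_of% (pair_extμ M (a ⊗ b) c (X ⊗ Y) Z), ← comp_whiskerRight_assoc, pair_extμ,
      extFunctor_map, reassoc_of% (pair_assoc ((extFunctor M).obj a)
        ((extFunctor M).obj b) ((extFunctor M).obj c) X Y Z), ← comp_app, pair_nat_app, comp_app,
      Category.assoc, reassoc_of% (pair_whiskerLeft ((extFunctor M).obj a) (extμ M b c) X (Y ⊗ Z)),
      reassoc_of% (pair_extμ M a (b ⊗ c) X (Y ⊗ Z)), ← MonoidalCategory.whiskerLeft_comp_assoc,
      pair_extμ]
    exact extT_assoc M a b c X Y Z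
  left_unitality a := by
    apply left_ext
    intro X
    simp only [comp_app]
    rw [pair_left, reassoc_of% (pair_whiskerRight (extε M) ((extFunctor M).obj a) (𝟙_ _) X),
      ← comp_whiskerRight_assoc, extε_pt, reassoc_of% (pair_extμ M (𝟙_ A) a (𝟙_ _) X),
      extFunctor_map]
    exact extT_unit_left M a X
  right_unitality a := by
    apply right_ext
    intro X
    simp only [comp_app]
    rw [pair_right, reassoc_of% (pair_whiskerLeft ((extFunctor M).obj a) (extε M) X (𝟙_ _)),
      ← MonoidalCategory.whiskerLeft_comp_assoc, extε_pt,
      reassoc_of% (pair_extμ M a (𝟙_ A) X (𝟙_ _)), extFunctor_map]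
    exact extT_unit_right M a X

instance (M : qa A) [MonObj M] [IsCommMonObj M] : (extFunctor M).LaxBraided where
  braided a b := by
    apply pair_ext
    intro X Y
    change pair _ _ _ _ ≫ (extμ M a b ≫ (extFunctor M).map _).natTrans.app _ =
      pair _ _ _ _ ≫ ((β_ _ _).hom ≫ extμ M b a).natTrans.app _
    simp only [comp_app]
    rw [reassoc_of% (pair_extμ M a b X Y), reassoc_of% (pair_braiding ((extFunctor M).obj a)
      ((extFunctor M).obj b) X Y), pair_nat_app, reassoc_of% (pair_extμ M b a Y X),
      extFunctor_map]
    exact extT_braid M a b X Y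

variable (A) in
/-- The functor `q^* : A ⥤ qa A`, `a ↦ (X ↦ a ⊗ 1(X))`, i.e. `a` at `∅` and the initial object
elsewhere: the inverse image functor of the structure morphism `qa A ⟶ A`. -/
def baseFunctor : A ⥤ qa A := extFunctor (𝟙_ (qa A))

instance : (baseFunctor A).LaxBraided := inferInstanceAs (extFunctor (𝟙_ (qa A))).LaxBraided
end
end
end AlgClassifier

namespace AlgClassifier

/-- The conditions on a symmetric monoidal category `A`, with morphisms forming sets in the
universe `u`, to be a vectoid. -/
class IsVectoid (A : Type w) [Category.{u} A] [MonoidalCategory A] : Prop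
    extends CocontinuousTensor A where
  hasFiniteLimits : HasFiniteLimits A
  /-- Every pullback of an epimorphism is the cokernel of its kernel pair. -/
  epi_universally_effective : ∀ {P X Y Z : A} (fst : P ⟶ X) (snd : P ⟶ Y) (f : X ⟶ Z) (g : Y ⟶ Z),
    Epi f → IsPullback fst snd f g → ∀ {K : A} (a b : K ⟶ P) (h : IsKernelPair snd a b),
      Nonempty (IsColimit (Cofork.ofπ snd h.w))
  /-- Every equivalence relation `R` on `X` has a quotient `X/R`, and `R = X ×_{X/R} X`. -/
  equivalence_effective : ∀ {R X : A} (a b : R ⟶ X),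
    (∀ {T : A} (s t : T ⟶ R), s ≫ a = t ≫ a → s ≫ b = t ≫ b → s = t) →
    (∀ T : A, Equivalence (fun x y : T ⟶ X => ∃ r : T ⟶ R, r ≫ a = x ∧ r ≫ b = y)) →
    ∃ (Q : A) (q : X ⟶ Q) (h : IsKernelPair q a b), Nonempty (IsColimit (Cofork.ofπ q h.w))
  /-- There is a small family of generators. -/
  generators : ∃ (ι : Type u) (G : ι → A), (ObjectProperty.ofObj G).IsSeparating
  /-- Every presheaf transforming small colimits into limits is representable. -/
  complete : ∀ F : Aᵒᵖ ⥤ Type u, PreservesLimitsOfSize.{u, u} F → F.IsRepresentable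

noncomputable section

section
variable (A : Type w) [Category.{u} A] [MonoidalCategory A] [SymmetricCategory A]
  (B : Type w') [Category.{u} B] [MonoidalCategory B] [SymmetricCategory B]

/-- A morphism of vectoids `A ⟶ B`: a symmetric monoidal functor `f^* : B ⥤ A` together with a
right adjoint `f_* : A ⥤ B`. -/
structure VectoidMorphism where
  inv : B ⥤ A
  [braided : inv.Braided]
  dir : A ⥤ B
  adj : inv ⊣ dir

attribute [instance] VectoidMorphism.braided

variable {A B}

/-- The inverse image functor with its lax braided structure. -/
def VectoidMorphism.lax (f : VectoidMorphism A B) : LaxBraidedFunctor B A :=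
  LaxBraidedFunctor.of f.inv

/-- The morphisms between two morphisms of vectoids are the monoidal natural transformations
between the inverse image functors. -/
instance : Category (VectoidMorphism A B) :=
  inferInstanceAs (Category (InducedCategory _ VectoidMorphism.lax))

variable (A) in
/-- The functor `f ↦ f^* M` from vectoid morphisms `A ⟶ B` to commutative algebras in `A`. -/
def pullAlg (M : CommMon B) : VectoidMorphism A B ⥤ CommMon A :=
  inducedFunctor VectoidMorphism.lax ⋙ Functor.mapCommMonFunctor B A ⋙ (evaluation _ _).obj M

/-- The natural transformation underlying a morphism of vectoid morphisms. -/
def VectoidMorphism.trans {f g : VectoidMorphism A B} (θ : f ⟶ g) : f.inv ⟶ g.inv :=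
  θ.hom.hom.hom

end

section
variable {A : Type w} [Category.{u} A] [MonoidalCategory A] [SymmetricCategory A]
  {B : Type w'} [Category.{u} B] [MonoidalCategory B] [SymmetricCategory B]
  {C : Type w''} [Category.{u} C] [MonoidalCategory C] [SymmetricCategory C]

/-- The morphisms `B ⟶ C` of vectoids over `A`, where `p` and `q` are the inverse image functors
of the structure morphisms `B ⟶ A` and `C ⟶ A`. -/
structure OverHom (p : A ⥤ B) [p.LaxBraided] (q : A ⥤ C) [q.LaxBraided] where
  toHom : VectoidMorphism B C
  iso : q ⋙ toHom.inv ≅ p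
  [monoidal : NatTrans.IsMonoidal iso.hom]

attribute [instance] OverHom.monoidal

variable {p : A ⥤ B} [p.LaxBraided] {q : A ⥤ C} [q.LaxBraided]

/-- The morphisms between two morphisms of vectoids over `A`. -/
structure OverHom.Hom (f g : OverHom p q) where
  toHom : f.toHom ⟶ g.toHom
  w : Functor.whiskerLeft q (VectoidMorphism.trans toHom) ≫ g.iso.hom = f.iso.hom

theorem OverHom.Hom.ext' {f g : OverHom p q} {a b : OverHom.Hom f g} (h : a.toHom = b.toHom) :
    a = b := by
  cases a; cases b; cases h; rfl

instance : Category (OverHom p q) where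
  Hom := OverHom.Hom
  id f := ⟨𝟙 _, by
    change Functor.whiskerLeft q (𝟙 f.toHom.inv) ≫ _ = _
    simp⟩
  comp {f g h} a b := ⟨a.toHom ≫ b.toHom, by
    change Functor.whiskerLeft q (VectoidMorphism.trans a.toHom ≫ VectoidMorphism.trans b.toHom) ≫
      _ = _
    rw [Functor.whiskerLeft_comp, Category.assoc, b.w, a.w]⟩
  id_comp _ := OverHom.Hom.ext' (Category.id_comp _)
  comp_id _ := OverHom.Hom.ext' (Category.comp_id _)
  assoc _ _ _ := OverHom.Hom.ext' (Category.assoc _ _ _)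

variable (p q) in
/-- The functor forgetting the structure over `A`. -/
def OverHom.forget : OverHom p q ⥤ VectoidMorphism B C where
  obj f := f.toHom
  map a := a.toHom

variable (p q) in
/-- The functor `f ↦ f^* M` from vectoid morphisms `B ⟶ C` over `A` to commutative algebras in
`B`. -/
def OverHom.pullAlg (M : CommMon C) : OverHom p q ⥤ CommMon B :=
  OverHom.forget p q ⋙ AlgClassifier.pullAlg B M
end
end
end AlgClassifier

namespace AlgClassifier
noncomputable section

section
variable {A : Type w} [Category.{u} A] [HasColimitsOfSize.{u, u} A]

/-- `Z`, with the maps `π i : T i ⟶ Z`, is the cokernel (coequalizer) of the two morphisms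
`⨿ j, S j ⇉ ⨿ i, T i` whose components are `l j : S j ⟶ T (a j)` and `r j : S j ⟶ T (b j)`. -/
def IsCokernel {I J : Type u} {T : I → A} {S : J → A} {a b : J → I} (l : ∀ j, S j ⟶ T (a j))
    (r : ∀ j, S j ⟶ T (b j)) {Z : A} (π : ∀ i, T i ⟶ Z) : Prop :=
  ∃ h : Sigma.desc (fun j => l j ≫ Sigma.ι T (a j)) ≫ Sigma.desc π =
      Sigma.desc (fun j => r j ≫ Sigma.ι T (b j)) ≫ Sigma.desc π,
    Nonempty (IsColimit (Cofork.ofπ (Sigma.desc π) h))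

/-- The product `S ⊗ X` of a set `S` and an object `X`: the coproduct of `S` copies of `X`. -/
def copower (S : Type u) (X : A) : A := ∐ fun _ : S => X

/-- The morphism `S ⊗ X ⟶ Z` given by a family of morphisms `X ⟶ Z`. -/
def copower.desc {S : Type u} {X Z : A} (f : S → (X ⟶ Z)) : copower S X ⟶ Z := Sigma.desc f

/-- The morphism `S ⊗ X ⟶ S' ⊗ X'`. -/
def copower.map {S S' : Type u} (g : S → S') {X X' : A} (f : X ⟶ X') :
    copower S X ⟶ copower S' X' :=
  copower.desc fun s => f ≫ Sigma.ι (fun _ : S' => X') (g s)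
end

section
variable {A : Type w} [Category.{u} A] [MonoidalCategory A] [SymmetricCategory A]
  [CocontinuousTensor A]

/-- The cocontinuous extension of `Phi M` to presheaves, i.e. its left Kan extension along
the Yoneda embedding. -/
def PhiBar (M : CommMon A) : Qa.{u} ⥤ A := hN.{u}.leftKanExtension (Phi M)

/-- The canonical map from `Phi M` to the restriction of its extension to representables. -/
def PhiBar.unit (M : CommMon A) : Phi M ⟶ hN.{u} ⋙ PhiBar M := hN.{u}.leftKanExtensionUnit (Phi M)

/-- The map `F(X) ⊗ M^{⊗X} ⟶ Φ̄_M(F)`, given on the copy of `M^{⊗X}` with index `x` by the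
morphism `h_X ⟶ F` corresponding to `x`. -/
def PhiBar.proj (M : CommMon A) (F : Qa.{u}) (X : FinN.{u}) :
    copower (F.functor.obj (op X)) ((Phi M).obj X) ⟶ (PhiBar M).obj F :=
  copower.desc fun x => (PhiBar.unit M).app X ≫ (PhiBar M).map ⟨yonedaEquiv.symm x⟩
end
end
end AlgClassifier

namespace AlgClassifier
noncomputable section

/-- The standard finite set with as many elements as `S`. -/
def std (S : Type u) [Finite S] : FinN.{u} := FintypeCat.Skeleton.mk (Nat.card S)

/-- A numbering of the elements of `S`. -/
def stdEquiv (S : Type u) [Finite S] : FinN.El (std S) ≃ S :=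
  Equiv.ulift.trans (Finite.equivFin S).symm

/-- The map of standard finite sets corresponding to a map of finite sets. -/
def stdMap {S T : Type u} [Finite S] [Finite T] (f : S → T) : std S ⟶ std T :=
  FinN.ofFun fun x => (stdEquiv T).symm (f (stdEquiv S x))

section
variable {A : Type w} [Category.{u} A] [MonoidalCategory A]

/-- The value at a finite set `S` of the extension of the presheaf `F` to all finite sets. -/
def ext (F : qa A) (S : Type u) [Finite S] : A := F.functor.obj (op (std S))

/-- The component at a finite set of a morphism of presheaves. -/
def extMap {F G : qa A} (t : F ⟶ G) (S : Type u) [Finite S] : ext F S ⟶ ext G S :=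
  t.natTrans.app (op (std S))

variable [CocontinuousTensor A]

/-- The map `F(S) ⊗ G(T) ⟶ (F ⊗ G)(W)` attached to a map `e : W → S ⊔ T`. -/
def extPair (F G : qa A) {S T W : Type u} [Finite S] [Finite T] [Finite W] (e : W → S ⊕ T) :
    ext F S ⊗ ext G T ⟶ ext (F ⊗ G) W :=
  pair F G (std S) (std T) ≫ (F ⊗ G).functor.map (Quiver.Hom.op (X := std W) (Y := std S ⊗ std T)
    (FinN.ofFun fun x => (FinN.sumEquiv (std S) (std T)).symm
      (Sum.map (stdEquiv S).symm (stdEquiv T).symm (e (stdEquiv W x)))))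

/-- The map `1 ⟶ 1(W)` for an empty set `W`. -/
def extUnit (W : Type u) [Finite W] (e : W → PEmpty.{1}) : 𝟙_ A ⟶ ext (𝟙_ (qa A)) W :=
  unitPt ≫ (𝟙_ (qa A)).functor.map (Quiver.Hom.op (X := std W) (Y := 𝟙_ FinN.{u})
    (FinN.ofFun fun x => (e (stdEquiv W x)).elim))

open Classical in
/-- A finite set `W` as the disjoint union of a subset `U` and of its complement. -/
def splitSet {W : Type u} (U : Set W) (x : W) : U ⊕ (Uᶜ : Set W) :=
  if h : x ∈ U then Sum.inl ⟨x, h⟩ else Sum.inr ⟨x, h⟩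
end

section
variable {A : Type w} [Category.{u} A] [MonoidalCategory A]

/-- The tensor product of a finite sequence of objects. -/
def tensorSeq : (n : ℕ) → (Fin n → A) → A
  | 0, _ => 𝟙_ A
  | n + 1, x => tensorSeq n (fun i => x i.castSucc) ⊗ x (Fin.last n)

/-- `⨆_{i ≤ n} S i` as the disjoint union of `⨆_{i < n} S i` and `S n`. -/
def splitLast {n : ℕ} {S : Fin (n + 1) → Type u} (x : Σ i, S i) :
    (Σ i : Fin n, S i.castSucc) ⊕ S (Fin.last n) :=
  Fin.lastCases (motive := fun i => S i → (Σ i : Fin n, S i.castSucc) ⊕ S (Fin.last n))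
    (fun s => Sum.inr s) (fun i s => Sum.inl ⟨i, s⟩) x.1 x.2

variable [SymmetricCategory A] [CocontinuousTensor A]

/-- The map `Y(S₁) ⊗ ⋯ ⊗ Y(Sₙ) ⟶ Y^{⊗n}(W)` attached to a map `e : W → S₁ ⊔ ⋯ ⊔ Sₙ`. -/
def extPow (Y : CommMon (qa A)) : (n : ℕ) → (S : Fin n → Type u) → [∀ i, Finite (S i)] →
    {W : Type u} → [Finite W] → (e : W → Σ i, S i) →
    (tensorSeq n (fun i => ext Y.X (S i)) ⟶ ext (pow Y n).X W)
  | 0, _, _, W, _, e => extUnit W (fun x => (e x).1.elim0)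
  | n + 1, S, _, _, _, e =>
    extPow Y n (fun i => S i.castSucc) id ▷ ext Y.X (S (Fin.last n)) ≫
      extPair (pow Y n).X Y.X (fun x => splitLast (e x))

/-- `Y(U₁) ⊗ ⋯ ⊗ Y(Uₙ)`, where `U_i` is the fibre of `d : V → {1, …, n}` over `i`. -/
def fibreTensor (Y : qa A) {V : Type u} [Finite V] {n : ℕ} (d : V → Fin n) : A :=
  tensorSeq n (fun i => ext Y {v : V // d v = i})

/-- The map `Y(U₁) ⊗ ⋯ ⊗ Y(Uₙ) ⟶ Y^{⊗n}(V)`. -/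
def fibreIncl (Y : CommMon (qa A)) {V : Type u} [Finite V] {n : ℕ} (d : V → Fin n) :
    fibreTensor Y.X d ⟶ ext (pow Y n).X V :=
  extPow Y n (fun i => {v : V // d v = i}) (fun v => ⟨d v, v, rfl⟩)
end
end
end AlgClassifier

namespace AlgClassifier
noncomputable section

section
variable {A : Type w} [Category.{u} A] [MonoidalCategory A] [SymmetricCategory A]
  {B : Type w'} [Category.{u} B] [MonoidalCategory B] [SymmetricCategory B]
  {C : Type w''} [Category.{u} C] [MonoidalCategory C] [SymmetricCategory C]

/-- The composite `f ∘ g : A ⟶ C` of morphisms of vectoids `g : A ⟶ B` and `f : B ⟶ C`. -/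
def VectoidMorphism.comp (f : VectoidMorphism B C) (g : VectoidMorphism A B) :
    VectoidMorphism A C where
  inv := f.inv ⋙ g.inv
  dir := g.dir ⋙ f.dir
  adj := f.adj.comp g.adj

variable {D : Type w''} [Category.{u} D] [MonoidalCategory D] [SymmetricCategory D]
variable {p : A ⥤ B} [p.LaxBraided] {q : A ⥤ C} [q.LaxBraided] {r : A ⥤ D} [r.LaxBraided]

/-- The composite `f ∘ g` of morphisms of vectoids over `A`. -/
def OverHom.comp (f : OverHom q r) (g : OverHom p q) : OverHom p r where
  toHom := f.toHom.comp g.toHom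
  iso := (Functor.associator r f.toHom.inv g.toHom.inv).symm ≪≫
    Functor.isoWhiskerRight f.iso g.toHom.inv ≪≫ g.iso
  monoidal := by
    have h₁ : NatTrans.IsMonoidal (Functor.associator r f.toHom.inv g.toHom.inv).inv := inferInstance
    have h₂ : NatTrans.IsMonoidal (Functor.whiskerRight f.iso.hom g.toHom.inv) := inferInstance
    have h₃ := g.monoidal
    have h₄ : NatTrans.IsMonoidal (Functor.whiskerRight f.iso.hom g.toHom.inv ≫ g.iso.hom) := inferInstance
    change NatTrans.IsMonoidal ((Functor.associator r f.toHom.inv g.toHom.inv).inv ≫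
      Functor.whiskerRight f.iso.hom g.toHom.inv ≫ g.iso.hom)
    exact inferInstance
end

section
variable {A : Type w} [Category.{u} A] [MonoidalCategory A] [SymmetricCategory A]
  [CocontinuousTensor A]

/-- The canonical map `a ⟶ (q^* a)(∅)`. -/
def baseIncl (a : A) : a ⟶ ((baseFunctor A).obj a).functor.obj (op (𝟙_ FinN.{u})) :=
  (ρ_ a).inv ≫ a ◁ unitPt

/-- The map `a ⊗ G(X) ⟶ (q^* a ⊗ G)(X)`. -/
def basePair (a : A) (G : qa A) (X : FinN.{u}) :
    a ⊗ G.functor.obj (op X) ⟶ ((baseFunctor A).obj a ⊗ G).functor.obj (op X) :=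
  baseIncl a ▷ G.functor.obj (op X) ≫ pair ((baseFunctor A).obj a) G (𝟙_ _) X ≫
    ((baseFunctor A).obj a ⊗ G).functor.map (λ_ X).inv.op

variable (A) in
/-- The element of `X_{a,A}^{⊗n}(n)` corresponding to the identity of `n`. -/
def genPow : (n : ℕ) →
    (𝟙_ A ⟶ (pow (XaRel A) n).X.functor.obj (op (FintypeCat.Skeleton.mk n)))
  | 0 => unitPt
  | n + 1 => (λ_ (𝟙_ A)).inv ≫ genPow n ▷ 𝟙_ A ≫
      pair (pow (XaRel A) n).X (XaRel A).X (FintypeCat.Skeleton.mk n) (FintypeCat.Skeleton.mk 1)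

/-- The generic element `a ⟶ (q^* a ⊗ X_{a,A}^{⊗n})(n)`, where `n` is the cardinality of `X`. -/
def gen (a : A) (X : FinN.{u}) :
    a ⟶ ((baseFunctor A).obj a ⊗ (pow (XaRel A) X.len).X).functor.obj (op X) :=
  (ρ_ a).inv ≫ a ◁ genPow A X.len ≫ basePair a (pow (XaRel A) X.len).X X

/-- The value of a morphism `q^* a ⊗ X_{a,A}^{⊗n} ⟶ F` at the generic element. -/
def evalGen {a : A} {X : FinN.{u}} {F : qa A}
    (ev : (baseFunctor A).obj a ⊗ (pow (XaRel A) X.len).X ⟶ F) : a ⟶ F.functor.obj (op X) :=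
  gen a X ≫ ev.natTrans.app (op X)

variable {B : Type w'} [Category.{u} B] [MonoidalCategory B] [SymmetricCategory B]
  {p : A ⥤ B} [p.LaxBraided]

/-- The morphism `p a ⊗ Y^{⊗n} ≅ f^*(q^* a) ⊗ f^*(X_{a,A})^{⊗n} ⟶ f^*(q^* a ⊗ X_{a,A}^{⊗n}) ⟶ f^* F`,
for `f` a morphism of vectoids over `A` and `Y ≅ f^*(X_{a,A})`. -/
def relProj (f : OverHom p (baseFunctor A)) {Y : CommMon B}
    (e : (OverHom.pullAlg p (baseFunctor A) (XaRel A)).obj f ≅ Y) {a : A} {n : ℕ} {F : qa A}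
    (ev : (baseFunctor A).obj a ⊗ (pow (XaRel A) n).X ⟶ F) :
    p.obj a ⊗ (pow Y n).X ⟶ f.toHom.inv.obj F :=
  (f.iso.inv.app a ⊗ₘ algMap (powDesc n fun i =>
    e.inv ≫ f.toHom.inv.mapCommMon.map (powι (XaRel A) n i))) ≫
    Functor.LaxMonoidal.μ f.toHom.inv _ _ ≫ f.toHom.inv.map ev

/-- The composite of `d : V → m` and `φ : m ⟶ n`. -/
def pushIndex {V : Type u} {M N : FinN.{u}} (φ : M ⟶ N) (d : V → Fin M.len) : V → Fin N.len :=
  fun v => (φ (ULift.up (d v))).down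

/-- The morphism `a ⊗ Y(U₁) ⊗ ⋯ ⊗ Y(Uₙ) ⟶ (q^* a ⊗ Y^{⊗n})(V) ⟶ Z(V)`, where the `U_i` are the
fibres of `d : V → {1, …, n}`. -/
def compProj {a : A} {n : ℕ} {Y : CommMon (qa A)} {Z : qa A}
    (π : (baseFunctor A).obj a ⊗ (pow Y n).X ⟶ Z) {V : Type u} [Finite V] (d : V → Fin n) :
    a ⊗ fibreTensor Y.X d ⟶ ext Z V :=
  a ◁ fibreIncl Y d ≫ basePair a (pow Y n).X (std V) ≫ extMap π V
end
end
end AlgClassifier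

open AlgClassifier

/-! ### Representability and adjoint functors in vectoids; cokernels of families of morphisms. -/

namespace AlgClassifier

section
variable {A : Type w} [Category.{u} A]

/-! The theorem is a Yoneda lemma with coefficients. In `q_a A` the presheaf `q^* a ⊗ X^{⊗n}`, with
`X` the constant presheaf `1`, is freely generated by its generic element: morphisms from it to `F`
are the same as morphisms `a ⟶ F(n)` (`isFree_gen`). Indeed the unit of Day convolution is free on
`∅`, the constant presheaf is free on the one-element set because every set has exactly one map to
it, and a product of free generators is free on the disjoint union (`IsFree.tensor`). The last point
needs right adjoints for the tensor product of `A`, which come from the representability axiom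
(`isLeftAdjoint_of_vectoid`).

Hence every presheaf `F` is the coend of the objects `q^* F(n) ⊗ X^{⊗n}` along the evaluation
morphisms (`ev_existsUnique`). If `f` is a morphism over `A` and `Y` is `f^* X`, then `f^*`
preserves colimits, tensor products and the structure over `A`, so `f^* F` is the coend of `p^* F(n)
⊗ Y^{⊗n}`. This is the cokernel formula. It also shows that 2-morphisms are determined by their
value on `X` (`faithful_pullAlg`) and that every algebra morphism is such a value (`full_pullAlg`).

Conversely an arbitrary `Y` defines a functor by this coend (`exists_presentation`). Its right
adjoint sends `W` to the presheaf `n ↦ Hom(p^*(-) ⊗ Y^{⊗n}, W)`. As `Y^{⊗n}` is the `n`-fold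
coproduct of `Y` among commutative algebras, `n ↦ Y^{⊗n}` turns disjoint unions into tensor
products, and the universal property of Day convolution makes the functor strong symmetric monoidal
(`Presentation.isIso_lμ`). It takes `X` to `Y`, which gives `essSurj_pullAlg`. The structure
`Presentation` axiomatizes such coends, so that the same arguments serve the identity functor,
inverse image functors, the constructed functors and the Kan extension `PhiBar`.

The absolute statement is the case of sets: a monoidal functor out of sets with a right adjoint
sends `S` to a sum of `S` copies of the unit, hence is unique up to a unique monoidal isomorphism,
and being over sets is no additional datum.

For the vectoid axioms, exactness in presheaves is checked pointwise, and representability follows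
from the special adjoint functor theorem (`isRepresentable_of_preservesLimits`). For the composition
product, the formula for `g^*` is evaluated at `V`. A map `V → S ⊔ T` factors uniquely through a
splitting `V → U ⊔ Uᶜ`, so a Day convolution is a sum over subsets, and `Y^{⊗n}(V)` is a sum over
maps `d : V → n` (`isSum_fibreEl`); the morphism `φ_*` takes the summand of `d` to that of `φ ∘ d`
(`factors_powDesc`). -/

theorem isRegularEpiCategory_of_kernelPair [HasFiniteLimits A]
    (h : ∀ {X Y : A} (f : X ⟶ Y) [Epi f] {K : A} (a b : K ⟶ X) (h : IsKernelPair f a b),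
      Nonempty (IsColimit (Cofork.ofπ f h.w))) : IsRegularEpiCategory A where
  regularEpiOfEpi f _ :=
    ⟨⟨{ W := pullback f f, left := pullback.fst f f, right := pullback.snd f f
        w := pullback.condition
        isColimit := (h f _ _ (IsPullback.of_hasPullback f f)).some }⟩⟩

/-- A quotient is recovered as the coequalizer of its kernel pair, so sending a quotient of an
object to its kernel pair embeds the quotients into the small set of subobjects of the square of the
object. -/
theorem wellPowered_op_of_kernelPair [HasFiniteLimits A] [WellPowered.{u} A]
    (h : ∀ {X Y : A} (f : X ⟶ Y) [Epi f] {K : A} (a b : K ⟶ X) (h : IsKernelPair f a b),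
      Nonempty (IsColimit (Cofork.ofπ f h.w))) : WellPowered.{u} Aᵒᵖ where
  subobject_small X := by
    let k (s : Subobject X) : Subobject (X.unop ⨯ X.unop) :=
      haveI : Mono (prod.lift (pullback.fst s.arrow.unop s.arrow.unop)
          (pullback.snd s.arrow.unop s.arrow.unop)) := ⟨fun a b hab => by
        apply pullback.hom_ext
        · simpa only [Category.assoc, prod.lift_fst] using hab =≫ prod.fst
        · simpa only [Category.assoc, prod.lift_snd] using hab =≫ prod.snd⟩
      Subobject.mk (prod.lift (pullback.fst s.arrow.unop s.arrow.unop)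
        (pullback.snd s.arrow.unop s.arrow.unop))
    -- The order is reversed: a larger kernel pair means a smaller quotient, that is, a smaller
    -- subobject in the opposite category.
    have key (s t : Subobject X) (hst : k s ≤ k t) : t ≤ s := by
      obtain ⟨i, hi⟩ : ∃ i, i ≫ _ = _ :=
        ⟨Subobject.ofMkLEMk _ _ hst, Subobject.ofMkLEMk_comp hst⟩
      have h₁ := hi =≫ prod.fst
      have h₂ := hi =≫ prod.snd
      simp only [Category.assoc, prod.lift_fst, prod.lift_snd] at h₁ h₂
      obtain ⟨c⟩ := h s.arrow.unop _ _ (IsPullback.of_hasPullback s.arrow.unop s.arrow.unop)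
      have w : pullback.fst s.arrow.unop s.arrow.unop ≫ t.arrow.unop =
          pullback.snd s.arrow.unop s.arrow.unop ≫ t.arrow.unop := by
        rw [← h₁, ← h₂, Category.assoc, Category.assoc, pullback.condition]
      refine Subobject.le_of_comm (Cofork.IsColimit.desc c _ w).op ?_
      apply Quiver.Hom.unop_inj
      exact Cofork.IsColimit.π_desc' c _ w
    exact small_of_injective (f := k)
      fun s t hst => le_antisymm (key t s hst.ge) (key s t hst.le)

/-- This is the special adjoint functor theorem. The representing object is the value at the
one-point set of the right adjoint of `F.rightOp`, because maps from a point to `F T` are elements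
of `F T`. It deduces the representability axiom of a vectoid from the other axioms, both for sets
and for presheaves. -/
theorem isRepresentable_of_preservesLimits [HasColimitsOfSize.{u, u} A] [HasFiniteLimits A]
    (h : ∀ {X Y : A} (f : X ⟶ Y) [Epi f] {K : A} (a b : K ⟶ X) (h : IsKernelPair f a b),
      Nonempty (IsColimit (Cofork.ofπ f h.w)))
    (hG : ∃ (ι : Type u) (G : ι → A), (ObjectProperty.ofObj G).IsSeparating)
    (F : Aᵒᵖ ⥤ Type u) [PreservesLimitsOfSize.{u, u} F] : F.IsRepresentable := by
  have := isRegularEpiCategory_of_kernelPair h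
  obtain ⟨ι, G, hG⟩ := hG
  -- Epimorphisms are regular, so the category is balanced and a separating family detects
  -- isomorphisms.
  have : WellPowered.{u} A := wellPowered_of_isDetecting hG.isDetecting
  have := wellPowered_op_of_kernelPair h
  have : PreservesColimitsOfSize.{u, u} F.rightOp := preservesColimits_rightOp F
  have := isLeftAdjoint_of_preservesColimits_of_isSeparating hG F.rightOp
  let adj := Adjunction.ofIsLeftAdjoint F.rightOp
  refine (Functor.RepresentableBy.isRepresentable
    (Y := F.rightOp.rightAdjoint.obj (op PUnit)) ⟨fun {T} => ((adj.homEquiv T (op PUnit)).symm.trans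
      ((opEquiv _ _).trans ?_)), ?_⟩)
  · exact TypeCat.homEquiv.trans (Equiv.funUnique _ _)
  · intro T T' f g
    simp only [Equiv.trans_apply, Adjunction.homEquiv_naturality_left_symm]
    rfl

/-- The representability axiom is applied to the presheaves `a ↦ Hom(F a, b)`; the representing
objects form the right adjoint. In particular the tensor product of a vectoid has right adjoints in
each variable, which is how the axiom enters most later arguments. -/
theorem isLeftAdjoint_of_vectoid [MonoidalCategory A] [IsVectoid A] {B : Type w'} [Category.{u} B]
    (F : A ⥤ B) [PreservesColimitsOfSize.{u, u} F] : F.IsLeftAdjoint := by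
  have := preservesLimitsOfSize_op.{u, u} F
  have hr (b : B) : (F.op ⋙ yoneda.obj b).IsRepresentable := IsVectoid.complete _ inferInstance
  let e (a : A) (b : B) : (F.obj a ⟶ b) ≃ (a ⟶ (F.op ⋙ yoneda.obj b).reprX) :=
    ((F.op ⋙ yoneda.obj b).representableBy.homEquiv (X := a)).symm
  exact (Adjunction.adjunctionOfEquivRight e (fun a' a b f g => by
    simp only [e]
    rw [Equiv.symm_apply_eq, Functor.RepresentableBy.homEquiv_comp]
    simp)).isLeftAdjoint
end

section
variable {A : Type w} [Category.{u} A] [HasColimitsOfSize.{u, u} A]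

/-- The universal property of a cokernel of two families of morphisms. -/
theorem isCokernel_iff {I J : Type u} {T : I → A} {S : J → A} {a b : J → I}
    {l : ∀ j, S j ⟶ T (a j)} {r : ∀ j, S j ⟶ T (b j)} {Z : A} {π : ∀ i, T i ⟶ Z} :
    IsCokernel l r π ↔ (∀ j, l j ≫ π (a j) = r j ≫ π (b j)) ∧
      ∀ (W : A) (t : ∀ i, T i ⟶ W), (∀ j, l j ≫ t (a j) = r j ≫ t (b j)) →
        ∃! g : Z ⟶ W, ∀ i, π i ≫ g = t i := by
  have hw (W : A) (t : ∀ i, T i ⟶ W) :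
      Sigma.desc (fun j => l j ≫ Sigma.ι T (a j)) ≫ Sigma.desc t =
      Sigma.desc (fun j => r j ≫ Sigma.ι T (b j)) ≫ Sigma.desc t ↔
      ∀ j, l j ≫ t (a j) = r j ≫ t (b j) := by
    constructor
    · intro h j
      simpa using Sigma.ι S j ≫= h
    · intro h
      ext j
      simpa using h j
  constructor
  · rintro ⟨h, ⟨c⟩⟩
    refine ⟨(hw Z π).1 h, fun W t ht => ⟨Cofork.IsColimit.desc c (Sigma.desc t) ((hw W t).2 ht),
      fun i => ?_, fun g hg => ?_⟩⟩
    · have := Cofork.IsColimit.π_desc' c (Sigma.desc t) ((hw W t).2 ht)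
      simpa using Sigma.ι T i ≫= this
    · apply Cofork.IsColimit.hom_ext c
      rw [Cofork.IsColimit.π_desc' c (Sigma.desc t) ((hw W t).2 ht)]
      ext i
      simpa using hg i
  · rintro ⟨h, hu⟩
    refine ⟨(hw Z π).2 h, ⟨Cofork.IsColimit.mk' _ fun s => ?_⟩⟩
    have hs : ∀ j, l j ≫ Sigma.ι T (a j) ≫ s.π = r j ≫ Sigma.ι T (b j) ≫ s.π := fun j => by
      simpa using Sigma.ι S j ≫= s.condition
    have := hu s.pt (fun i => Sigma.ι T i ≫ s.π) hs
    refine ⟨this.choose, ?_, fun {m} hm => this.choose_spec.2 m fun i => ?_⟩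
    · refine Sigma.hom_ext _ _ fun i => ?_
      simpa using this.choose_spec.1 i
    · rw [← hm]
      simp

theorem exists_isCokernel {I J : Type u} {T : I → A} {S : J → A} {a b : J → I}
    (l : ∀ j, S j ⟶ T (a j)) (r : ∀ j, S j ⟶ T (b j)) :
    ∃ (Z : A) (π : ∀ i, T i ⟶ Z), IsCokernel l r π := by
  let f := Sigma.desc (fun j => l j ≫ Sigma.ι T (a j))
  let g := Sigma.desc (fun j => r j ≫ Sigma.ι T (b j))
  have e : Sigma.desc (fun i => Sigma.ι T i ≫ coequalizer.π f g) = coequalizer.π f g := by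
    refine Sigma.hom_ext _ _ fun i => ?_
    simp
  refine ⟨coequalizer f g, fun i => Sigma.ι T i ≫ coequalizer.π f g, ?_, ⟨?_⟩⟩
  · rw [e]; exact coequalizer.condition f g
  · exact (coequalizerIsCoequalizer f g).ofIsoColimit (Cofork.ext (Iso.refl _) (by simp [e]))
end
end AlgClassifier

/-! ### Presheaves with values in a vectoid form a vectoid. -/

namespace AlgClassifier
noncomputable section
section
variable (A : Type w) [Category.{u} A] [MonoidalCategory A]

/-- Evaluation of presheaves at a standard finite set. -/
abbrev evalAt (X : FinN.{u}) : qa A ⥤ A where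
  obj F := F.functor.obj (op X)
  map a := a.natTrans.app (op X)

variable {A}

theorem evalAt_eq (X : FinN.{u}) :
    evalAt A X = (DayFunctor.equiv FinN.{u}ᵒᵖ A).functor ⋙ (evaluation _ _).obj (op X) := rfl

instance [HasColimitsOfSize.{u, u} A] : HasColimitsOfSize.{u, u} (qa A) :=
  Adjunction.has_colimits_of_equivalence (DayFunctor.equiv FinN.{u}ᵒᵖ A).functor

instance [HasFiniteLimits A] : HasFiniteLimits (qa A) :=
  ⟨fun _ => Adjunction.hasLimitsOfShape_of_equivalence (DayFunctor.equiv FinN.{u}ᵒᵖ A).functor⟩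

instance [HasColimitsOfSize.{u, u} A] (X : FinN.{u}) :
    PreservesColimitsOfSize.{u, u} (evalAt A X) := by
  rw [evalAt_eq]; infer_instance

instance [HasFiniteLimits A] (X : FinN.{u}) : PreservesFiniteLimits (evalAt A X) := by
  rw [evalAt_eq]; infer_instance

theorem qa_isColimit {J : Type w'} [Category.{w''} J] {K : J ⥤ qa A} (c : Cocone K)
    (h : ∀ X, Nonempty (IsColimit ((evalAt A X).mapCocone c))) : Nonempty (IsColimit c) :=
  ⟨isColimitOfReflects (DayFunctor.equiv FinN.{u}ᵒᵖ A).functor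
    (evaluationJointlyReflectsColimits _ fun X => (h X.unop).some)⟩

theorem qa_isPullback {P X Y Z : qa A} {fst : P ⟶ X} {snd : P ⟶ Y} {f : X ⟶ Z} {g : Y ⟶ Z}
    (h : ∀ T, IsPullback ((evalAt A T).map fst) ((evalAt A T).map snd) ((evalAt A T).map f)
      ((evalAt A T).map g)) : IsPullback fst snd f g :=
  IsPullback.of_map (DayFunctor.equiv FinN.{u}ᵒᵖ A).functor
    (DayFunctor.hom_ext (NatTrans.ext (funext fun T => (h T.unop).w)))
    (IsPullback.of_forall_isPullback_app fun T => h T.unop)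

theorem qa_cofork {X Y Z : qa A} {a b : X ⟶ Y} {q : Y ⟶ Z} (w : a ≫ q = b ≫ q)
    (h : ∀ T, Nonempty (IsColimit (Cofork.ofπ ((evalAt A T).map q)
      (by rw [← Functor.map_comp, w, Functor.map_comp] : (evalAt A T).map a ≫ (evalAt A T).map q =
        (evalAt A T).map b ≫ (evalAt A T).map q)))) :
    Nonempty (IsColimit (Cofork.ofπ q w)) :=
  qa_isColimit _ fun T => ⟨(isColimitMapCoconeCoforkEquiv _ _).symm (h T).some⟩

/-- The left adjoint of evaluation at a standard finite set. -/
def freeAt [HasColimitsOfSize.{u, u} A] (X : FinN.{u}) : A ⥤ qa A :=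
  evaluationLeftAdjoint A (op X) ⋙ (DayFunctor.equiv FinN.{u}ᵒᵖ A).inverse

def freeAtAdj [HasColimitsOfSize.{u, u} A] (X : FinN.{u}) : freeAt (A := A) X ⊣ evalAt A X :=
  (evaluationAdjunctionRight A (op X)).comp (DayFunctor.equiv FinN.{u}ᵒᵖ A).symm.toAdjunction

/-- Morphisms from the presheaf generated by `G i` at `X` to `F` are morphisms `G i ⟶ F(X)`, so
these presheaves separate pointwise, hence separate. -/
theorem qa_separating [HasColimitsOfSize.{u, u} A] {ι : Type u} {G : ι → A}
    (hG : (ObjectProperty.ofObj G).IsSeparating) :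
    (ObjectProperty.ofObj fun p : FinN.{u} × ι => (freeAt p.1).obj (G p.2)).IsSeparating := by
  intro F H f g h
  apply DayFunctor.hom_ext
  ext ⟨X⟩
  apply hG
  rintro _ ⟨i⟩ t
  have := h _ ⟨(X, i)⟩ (((freeAtAdj X).homEquiv _ _).symm t)
  exact ((freeAtAdj X).homEquiv _ _).symm.injective
    ((Adjunction.homEquiv_naturality_right_symm _ _ _).trans
      (this.trans (Adjunction.homEquiv_naturality_right_symm _ _ _).symm))
end

section
variable {A : Type w} [Category.{u} A] [MonoidalCategory A] [SymmetricCategory A]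
  [CocontinuousTensor A]

/-- A morphism out of a Day convolution is a natural family on the objects `F(X) ⊗ c(Y)`. Evaluation
at `Y` and tensoring in `A` preserve colimits, so these objects are colimits and such families can
be glued from a cocone. -/
instance (F : qa A) : PreservesColimitsOfSize.{u, u} (tensorLeft F) where
  preservesColimitsOfShape {J _} := ⟨fun {K} => ⟨fun {c} hc => ⟨by
    let hX (X Y : FinN.{u}) := isColimitOfPreserves
      (evalAt A Y ⋙ tensorLeft (F.functor.obj (op X))) hc
    -- For fixed `X` and `Y` a cocone under `F ⊗ K` induces a cocone under the values `F(X) ⊗ K(Y)`.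
    have hd (s : Cocone (K ⋙ tensorLeft F)) (X Y : FinN.{u}) :
        ∃ d : F.functor.obj (op X) ⊗ c.pt.functor.obj (op Y) ⟶ s.pt.functor.obj (op (X ⊗ Y)),
          ∀ j, F.functor.obj (op X) ◁ (c.ι.app j).natTrans.app (op Y) ≫ d =
            pair F (K.obj j) X Y ≫ (evalAt A (X ⊗ Y)).map (s.ι.app j) := by
      let s' : Cocone (K ⋙ evalAt A Y ⋙ tensorLeft (F.functor.obj (op X))) :=
        { pt := s.pt.functor.obj (op (X ⊗ Y))
          ι :=
            { app := fun j => pair F (K.obj j) X Y ≫ (evalAt A (X ⊗ Y)).map (s.ι.app j)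
              naturality := fun i j f => by
                have h := pair_whiskerLeft F (K.map f) X Y
                have h' := s.w f
                refine ((reassoc_of% h) _).symm.trans ?_
                refine (congrArg (fun t => pair F (K.obj i) X Y ≫ t)
                  ((Functor.map_comp (evalAt A (X ⊗ Y)) _ _).symm.trans
                    (congrArg _ h'))).trans (Category.comp_id _).symm } }
      exact ⟨(hX X Y).desc s', fun j => (hX X Y).fac s' j⟩
    choose d hd using hd
    -- Naturality in `X` and `Y` is tested on the legs of the colimit `F(X') ⊗ c(Y')`.
    have hn (s : Cocone (K ⋙ tensorLeft F)) {X X' Y Y' : FinN.{u}} (f : X ⟶ X') (g : Y ⟶ Y') :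
        (F.functor.map f.op ⊗ₘ c.pt.functor.map g.op) ≫ d s X Y =
          d s X' Y' ≫ s.pt.functor.map (f ⊗ₘ g).op := by
      refine (hX X' Y').hom_ext fun j => ?_
      have h₁ := pair_natural F (K.obj j) f g
      have h₂ := pair_nat_app (s.ι.app j) (f ⊗ₘ g).op
      have h₃ := pair_nat_app (c.ι.app j) g.op
      calc F.functor.obj (op X') ◁ (c.ι.app j).natTrans.app (op Y') ≫
            (F.functor.map f.op ⊗ₘ c.pt.functor.map g.op) ≫ d s X Y
        _ = (F.functor.map f.op ⊗ₘ (K.obj j).functor.map g.op) ≫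
            F.functor.obj (op X) ◁ (c.ι.app j).natTrans.app (op Y) ≫ d s X Y := by
          rw [← id_tensorHom, ← id_tensorHom, tensorHom_comp_tensorHom_assoc,
            tensorHom_comp_tensorHom_assoc, Category.id_comp, Category.comp_id]
          exact congrArg (fun t => (F.functor.map f.op ⊗ₘ t) ≫ d s X Y) h₃.symm
        _ = pair F (K.obj j) X' Y' ≫ (F ⊗ K.obj j).functor.map (f ⊗ₘ g).op ≫
            (s.ι.app j).natTrans.app (op (X ⊗ Y)) := by
          rw [hd, reassoc_of% h₁]
        _ = F.functor.obj (op X') ◁ (c.ι.app j).natTrans.app (op Y') ≫ d s X' Y' ≫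
            s.pt.functor.map (f ⊗ₘ g).op := by
          rw [reassoc_of% (hd s X' Y' j)]
          exact congrArg (fun t => pair F (K.obj j) X' Y' ≫ t) h₂
    exact
     { desc := fun s => pairDesc (d s) (hn s)
       fac := fun s j => pair_ext fun X Y => by
        have := pair_whiskerLeft F (c.ι.app j) X Y
        change pair F (K.obj j) X Y ≫ (F ◁ c.ι.app j ≫ _).natTrans.app _ = _
        rw [comp_app]
        refine ((reassoc_of% this) _).trans ?_
        rw [pair_pairDesc, hd]
       uniq := fun s m hm => pair_ext fun X Y => by
        rw [pair_pairDesc]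
        refine (hX X Y).hom_ext fun j => ?_
        have := pair_whiskerLeft F (c.ι.app j) X Y
        refine ((reassoc_of% this) _).symm.trans ((congrArg (fun t => pair F (K.obj j) X Y ≫ t)
          (congrArg (evalAt A (X ⊗ Y)).map (hm j))).trans (hd s X Y j).symm) }⟩⟩⟩

instance : CocontinuousTensor (qa A) where
  hasColimits := inferInstance
  left := inferInstance
  right F := preservesColimits_of_natIso (BraidedCategory.tensorLeftIsoTensorRight F)
end

section
variable {A : Type w} [Category.{u} A] [MonoidalCategory A] [IsVectoid A]
instance : HasFiniteLimits A := IsVectoid.hasFiniteLimits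

end

/-- Presheaves on finite sets with values in a vectoid form a vectoid. -/
instance {A : Type w} [Category.{u} A] [MonoidalCategory A] [SymmetricCategory A] [IsVectoid A] :
    IsVectoid (qa A) := by
  -- Evaluations preserve epimorphisms and pullbacks, and colimits are detected by evaluations.
  have hE : ∀ {P X Y Z : qa A} (fst : P ⟶ X) (snd : P ⟶ Y) (f : X ⟶ Z) (g : Y ⟶ Z),
      Epi f → IsPullback fst snd f g → ∀ {K : qa A} (a b : K ⟶ P) (h : IsKernelPair snd a b),
      Nonempty (IsColimit (Cofork.ofπ snd h.w)) := by
    intro P X Y Z fst snd f g hf hP K a b h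
    exact qa_cofork _ fun T => IsVectoid.epi_universally_effective _ _ _ _
      (@Functor.map_epi _ _ _ _ (evalAt A T) inferInstance _ _ f hf) (hP.map (evalAt A T)) _ _ (h.map (evalAt A T))
  have hG : ∃ (ι : Type u) (G : ι → qa A), (ObjectProperty.ofObj G).IsSeparating := by
    obtain ⟨ι, G, hG⟩ := IsVectoid.generators (A := A)
    exact ⟨_, _, qa_separating hG⟩
  refine
  { hasFiniteLimits := inferInstance
    epi_universally_effective := hE
    equivalence_effective := ?_
    generators := hG
    -- An epimorphism is its own pullback along an identity, so `hE` makes it the coequalizer of its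
    -- kernel pair.
    complete := fun F hF => isRepresentable_of_preservesLimits
      (fun f _ _ a b h => hE (𝟙 _) f f (𝟙 _) inferInstance (IsPullback.of_id_fst) a b h) hG F }
  intro R X a b hm he
  -- The values of an equivalence relation are equivalence relations: a map `U ⟶ R(T)` is a map to
  -- `R` from the presheaf generated by `U` at `T`, so `U`-valued points of `R(T)` are points of `R`
  -- with values in that presheaf.
  have hQ (T : FinN.{u}) : ∃ (Q : A) (q : (evalAt A T).obj X ⟶ Q)
      (h : IsKernelPair q ((evalAt A T).map a) ((evalAt A T).map b)),
      Nonempty (IsColimit (Cofork.ofπ q h.w)) := by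
    apply IsVectoid.equivalence_effective
    · intro U s t h₁ h₂
      apply ((freeAtAdj T).homEquiv _ _).symm.injective
      apply hm
      · exact (Adjunction.homEquiv_naturality_right_symm _ _ _).symm.trans
          ((congrArg _ h₁).trans (Adjunction.homEquiv_naturality_right_symm _ _ _))
      · exact (Adjunction.homEquiv_naturality_right_symm _ _ _).symm.trans
          ((congrArg _ h₂).trans (Adjunction.homEquiv_naturality_right_symm _ _ _))
    · intro U
      have key (x y : U ⟶ X.functor.obj (op T)) :
          (∃ r : U ⟶ R.functor.obj (op T), r ≫ (evalAt A T).map a = x ∧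
            r ≫ (evalAt A T).map b = y) ↔
          ∃ r : (freeAt T).obj U ⟶ R, r ≫ a = ((freeAtAdj T).homEquiv _ _).symm x ∧
            r ≫ b = ((freeAtAdj T).homEquiv _ _).symm y := by
        constructor
        · rintro ⟨r, rfl, rfl⟩
          exact ⟨((freeAtAdj T).homEquiv _ _).symm r,
            (Adjunction.homEquiv_naturality_right_symm _ _ _).symm,
            (Adjunction.homEquiv_naturality_right_symm _ _ _).symm⟩
        · rintro ⟨r, hx, hy⟩
          refine ⟨(freeAtAdj T).homEquiv _ _ r, ?_, ?_⟩
          · exact (Adjunction.homEquiv_naturality_right _ _ _).symm.trans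
              ((congrArg _ hx).trans (Equiv.apply_symm_apply _ _))
          · exact (Adjunction.homEquiv_naturality_right _ _ _).symm.trans
              ((congrArg _ hy).trans (Equiv.apply_symm_apply _ _))
      obtain ⟨h1, h2, h3⟩ := he ((freeAt T).obj U)
      exact ⟨fun x => (key x x).2 (h1 _), fun {x y} h => (key y x).2 (h2 ((key x y).1 h)),
        fun {x y z} h h' => (key x z).2 (h3 ((key x y).1 h) ((key y z).1 h'))⟩
  -- The coequalizer is formed pointwise. The comparison `i` from the effective quotient `Q` to its
  -- value at `T` is a split monomorphism, and kernel pairs do not change under composition with a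
  -- monomorphism.
  have hk : IsKernelPair (coequalizer.π a b) a b := qa_isPullback fun T => by
    obtain ⟨Q, q, h, ⟨c⟩⟩ := hQ T
    have hw : (evalAt A T).map a ≫ (evalAt A T).map (coequalizer.π a b) =
        (evalAt A T).map b ≫ (evalAt A T).map (coequalizer.π a b) := by
      rw [← Functor.map_comp, coequalizer.condition, Functor.map_comp]
    let c' : IsColimit (Cofork.ofπ ((evalAt A T).map (coequalizer.π a b)) hw) :=
      isColimitMapCoconeCoforkEquiv _ _ (isColimitOfPreserves (evalAt A T)
        (coequalizerIsCoequalizer a b))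
    let i : Q ⟶ (evalAt A T).obj (coequalizer a b) := Cofork.IsColimit.desc c _ hw
    let j : (evalAt A T).obj (coequalizer a b) ⟶ Q := Cofork.IsColimit.desc c' _ h.w
    have hi : q ≫ i = (evalAt A T).map (coequalizer.π a b) := Cofork.IsColimit.π_desc' c _ hw
    have hj : (evalAt A T).map (coequalizer.π a b) ≫ j = q := Cofork.IsColimit.π_desc' c' _ h.w
    have hij : i ≫ j = 𝟙 Q := Cofork.IsColimit.hom_ext c (by
      exact ((reassoc_of% hi) j).trans (hj.trans (Category.comp_id q).symm))
    have : Mono i := mono_of_mono_fac hij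
    have := h.comp_of_mono (f₂ := i)
    rwa [hi] at this
  exact ⟨coequalizer a b, coequalizer.π a b, hk, ⟨coequalizerIsCoequalizer a b⟩⟩
end
end AlgClassifier

/-! ### Sets form a vectoid. -/

namespace AlgClassifier
noncomputable section

theorem type_coequalizer {R X Q : Type u} {a b : R ⟶ X} {q : X ⟶ Q}
    (hq : Function.Surjective q) (w : a ≫ q = b ≫ q)
    (h : ∀ x y, q x = q y → ∃ r, a r = x ∧ b r = y) : Nonempty (IsColimit (Cofork.ofπ q w)) := by
  refine ⟨Cofork.IsColimit.mk' _ fun s => ⟨↾fun z => s.π (hq z).choose, ?_, fun {m} hm => ?_⟩⟩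
  · ext x
    obtain ⟨r, hr, hr'⟩ := h (hq (q x)).choose x (hq (q x)).choose_spec
    have := ConcreteCategory.congr_hom s.condition r
    simp only [ConcreteCategory.comp_apply, hr, hr'] at this
    exact this
  · ext z
    have := ConcreteCategory.congr_hom hm (hq z).choose
    change m (q _) = _ at this
    rw [(hq z).choose_spec] at this
    exact this

instance : IsVectoid (Type u) := by
  have hE : ∀ {P X Y Z : Type u} (fst : P ⟶ X) (snd : P ⟶ Y) (f : X ⟶ Z) (g : Y ⟶ Z),
      Epi f → IsPullback fst snd f g → ∀ {K : Type u} (a b : K ⟶ P) (h : IsKernelPair snd a b),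
      Nonempty (IsColimit (Cofork.ofπ snd h.w)) := by
    intro P X Y Z fst snd f g hf hP K a b h
    rw [epi_iff_surjective] at hf
    refine type_coequalizer (fun y => ?_) _ fun x y e => Types.exists_of_isPullback h x y e
    obtain ⟨x, hx⟩ := hf (g y)
    obtain ⟨r, -, hr⟩ := Types.exists_of_isPullback hP x y hx
    exact ⟨r, hr⟩
  have hG : ∃ (ι : Type u) (G : ι → Type u), (ObjectProperty.ofObj G).IsSeparating := by
    refine ⟨PUnit, fun _ => PUnit, ?_⟩
    intro X Y f g h
    ext x
    exact ConcreteCategory.congr_hom (h PUnit ⟨PUnit.unit⟩ (↾fun _ => x)) PUnit.unit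
  refine
  { hasFiniteLimits := inferInstance
    epi_universally_effective := hE
    equivalence_effective := ?_
    generators := hG
    complete := fun F hF => isRepresentable_of_preservesLimits
      (fun f _ _ a b h => hE (𝟙 _) f f (𝟙 _) inferInstance (IsPullback.of_id_fst) a b h) hG F }
  intro R X a b hm he
  let r : X → X → Prop := fun x y => ∃ t, a t = x ∧ b t = y
  -- Elements are maps from the one-point set, so `r` is the given equivalence relation at the test
  -- object `PUnit`.
  have hr (x y : X) : r x y ↔ ∃ t : PUnit.{u + 1} ⟶ R, t ≫ a = (↾fun _ => x) ∧
      t ≫ b = (↾fun _ => y) := by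
    constructor
    · rintro ⟨t, rfl, rfl⟩
      exact ⟨↾fun _ => t, rfl, rfl⟩
    · rintro ⟨t, h, h'⟩
      exact ⟨t PUnit.unit, ConcreteCategory.congr_hom h PUnit.unit,
        ConcreteCategory.congr_hom h' PUnit.unit⟩
  have hs : _root_.Equivalence r := by
    obtain ⟨h1, h2, h3⟩ := he PUnit
    exact ⟨fun x => (hr x x).2 (h1 _), fun {x y} h => (hr y x).2 (h2 ((hr x y).1 h)),
        fun {x y z} h h' => (hr x z).2 (h3 ((hr x y).1 h) ((hr y z).1 h'))⟩
  let S : Setoid X := ⟨r, hs⟩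
  have hw : a ≫ (↾(Quotient.mk S)) = b ≫ (↾(Quotient.mk S)) := by
    ext t
    exact Quotient.sound (s := S) ⟨t, rfl, rfl⟩
  have hk : IsKernelPair (↾(Quotient.mk S)) a b := by
    refine (Types.isPullback_iff _ _ _ _).2 ⟨hw, fun x y h => ?_, fun x y h => ?_⟩
    · exact ConcreteCategory.congr_hom
        (hm (T := PUnit) (↾fun _ => x) (↾fun _ => y) (by ext; exact h.1) (by ext; exact h.2))
        PUnit.unit
    · exact Quotient.exact (s := S) h
  exact ⟨_, _, hk, type_coequalizer Quotient.mk_surjective _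
    fun x y e => Types.exists_of_isPullback hk x y e⟩
end
end AlgClassifier

/-! ### Free presheaves: the Yoneda lemma with coefficients. -/

namespace AlgClassifier
noncomputable section
section
variable {A : Type w} [Category.{u} A] [MonoidalCategory A]

/-- The presheaf `H` is freely generated by the element `g` of `H(X)` with coefficients in `a`. -/
def IsFree {a : A} {X : FinN.{u}} (H : qa A) (g : a ⟶ H.functor.obj (op X)) : Prop :=
  ∀ F : qa A, Function.Bijective (fun t : H ⟶ F => g ≫ t.natTrans.app (op X))

namespace IsFree
variable {a : A} {X : FinN.{u}} {H : qa A} {g : a ⟶ H.functor.obj (op X)}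

theorem ext (hg : IsFree H g) {F : qa A} {s t : H ⟶ F}
    (h : g ≫ s.natTrans.app (op X) = g ≫ t.natTrans.app (op X)) : s = t := (hg F).1 h

theorem exists_hom (hg : IsFree H g) {F : qa A} (x : a ⟶ F.functor.obj (op X)) :
    ∃ t : H ⟶ F, g ≫ t.natTrans.app (op X) = x := (hg F).2 x

def desc (hg : IsFree H g) {F : qa A} (x : a ⟶ F.functor.obj (op X)) : H ⟶ F :=
  (hg.exists_hom x).choose

theorem fac (hg : IsFree H g) {F : qa A} (x : a ⟶ F.functor.obj (op X)) :
    g ≫ (hg.desc x).natTrans.app (op X) = x := (hg.exists_hom x).choose_spec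

/-- Morphisms `H.functor ⋙ L ⟶ K` transpose to morphisms from `H` to `K` followed by the right
adjoint of `L`, and there freeness applies. -/
theorem bijective_comp (hg : IsFree H g) {B : Type w'} [Category.{u} B] (L : A ⥤ B)
    [L.IsLeftAdjoint] (K : FinN.{u}ᵒᵖ ⥤ B) :
    Function.Bijective (fun t : H.functor ⋙ L ⟶ K => L.map g ≫ t.app (op X)) := by
  let adj := Adjunction.ofIsLeftAdjoint L
  let e : (H.functor ⋙ L ⟶ K) ≃ (H ⟶ ⟨K ⋙ L.rightAdjoint⟩) :=
    ((adj.whiskerRight FinN.{u}ᵒᵖ).homEquiv H.functor K).trans ⟨fun t => ⟨t⟩, fun t => t.natTrans,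
      fun _ => rfl, fun _ => rfl⟩
  have he (t) : adj.homEquiv _ _ (L.map g ≫ t.app (op X)) = g ≫ (e t).natTrans.app (op X) := by
    rw [Adjunction.homEquiv_naturality_left, Adjunction.homEquiv_unit]
    change _ = g ≫ ((adj.whiskerRight FinN.{u}ᵒᵖ).homEquiv H.functor K t).app (op X)
    rw [Adjunction.homEquiv_unit]
    simp
  refine (Function.Bijective.of_comp_iff' (adj.homEquiv _ _).bijective _).1 ?_
  exact (congrArg Function.Bijective (funext he)).mpr ((hg ⟨K ⋙ L.rightAdjoint⟩).comp e.bijective)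

theorem iso_comp (hg : IsFree H g) {b : A} (e : b ≅ a) : IsFree H (e.hom ≫ g) := fun F => by
  have := (e.homFromEquiv (Z := F.functor.obj (op X))).symm.bijective.comp (hg F)
  convert this using 1
  funext t
  simp

theorem comp_iso (hg : IsFree H g) {Y : FinN.{u}} (e : Y ≅ X) :
    IsFree H (g ≫ H.functor.map e.hom.op) := fun F => by
  have := ((F.functor.mapIso e.symm.op).homToEquiv (Z := a)).symm.bijective.comp (hg F)
  convert this using 1
  funext t
  simp [pair_nat_app]
end IsFree
end

section
variable {A : Type w} [Category.{u} A] [MonoidalCategory A] [CocontinuousTensor A]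

/-- The restriction of a morphism `H ⊗ K ⟶ F` to `x ⊗ K`, for an element `x` of `H(X)`. -/
def slice {a : A} {X : FinN.{u}} {H : qa A} (g : a ⟶ H.functor.obj (op X)) {K F : qa A}
    (t : H ⊗ K ⟶ F) : K.functor ⋙ tensorLeft a ⟶ (tensorLeft X).op ⋙ F.functor where
  app W := g ▷ K.functor.obj W ≫ pair H K X (unop W) ≫ t.natTrans.app (op (X ⊗ unop W))
  naturality W W' f := by
    have h₁ := pair_natural H K (𝟙 X) f.unop
    have h₂ := pair_nat_app t (𝟙 X ⊗ₘ f.unop).op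
    rw [id_tensorHom] at h₁ h₂
    simp only [op_id, CategoryTheory.Functor.map_id, id_tensorHom] at h₁
    dsimp at h₁ h₂ ⊢
    rw [whisker_exchange_assoc, reassoc_of% h₁, Category.assoc, Category.assoc, ← h₂]

theorem slice_app {a : A} {X : FinN.{u}} {H : qa A} (g : a ⟶ H.functor.obj (op X)) {K F : qa A}
    (t : H ⊗ K ⟶ F) (W : FinN.{u}) : (slice g t).app (op W) =
      g ▷ K.functor.obj (op W) ≫ pair H K X W ≫ t.natTrans.app (op (X ⊗ W)) := rfl

/-- A morphism `H ⊗ K ⟶ F` with one of the arguments fixed. -/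
def partialPair (H K : qa A) {F : qa A} (t : H ⊗ K ⟶ F) (W : FinN.{u}) :
    H.functor ⋙ tensorRight (K.functor.obj (op W)) ⟶ (tensorRight W).op ⋙ F.functor where
  app Z := pair H K (unop Z) W ≫ t.natTrans.app (op (unop Z ⊗ W))
  naturality Z Z' f := by
    have h₁ := pair_natural H K f.unop (𝟙 W)
    have h₂ := pair_nat_app t (f.unop ⊗ₘ 𝟙 W).op
    rw [tensorHom_id] at h₁ h₂
    simp only [op_id, CategoryTheory.Functor.map_id, tensorHom_id] at h₁
    dsimp at h₁ h₂ ⊢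
    rw [reassoc_of% h₁, Category.assoc, ← h₂]
end

section
variable {A : Type w} [Category.{u} A] [MonoidalCategory A] [SymmetricCategory A] [IsVectoid A]

instance (a : A) : (tensorLeft a).IsLeftAdjoint := isLeftAdjoint_of_vectoid _
instance (a : A) : (tensorRight a).IsLeftAdjoint := isLeftAdjoint_of_vectoid _

namespace IsFree
variable {a : A} {X : FinN.{u}} {H : qa A} {g : a ⟶ H.functor.obj (op X)}

/-- Fix `W`. Tensoring with `K(W)` is a left adjoint, so `bijective_comp` extends the values at the
generator to all `Z`; the uniqueness of this extension yields naturality in `W`. -/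
theorem bijective_slice (hg : IsFree H g) (K F : qa A) :
    Function.Bijective (fun t : H ⊗ K ⟶ F => slice g t) := by
  constructor
  · intro s t h
    refine pair_ext fun Z W => ?_
    have := (hg.bijective_comp (tensorRight (K.functor.obj (op W)))
      ((tensorRight W).op ⋙ F.functor)).1 (a₁ := partialPair H K s W) (a₂ := partialPair H K t W)
      (NatTrans.congr_app h (op W))
    exact NatTrans.congr_app this (op Z)
  · intro v
    have ht (W : FinN.{u}) := (hg.bijective_comp (tensorRight (K.functor.obj (op W)))
      ((tensorRight W).op ⋙ F.functor)).2 (v.app (op W))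
    choose t ht using ht
    dsimp at ht
    have hn {W W' : FinN.{u}} (f : W ⟶ W') (Z : FinN.{u}) :
        H.functor.obj (op Z) ◁ K.functor.map f.op ≫ (t W).app (op Z) =
          (t W').app (op Z) ≫ F.functor.map (Z ◁ f).op := by
      -- Both transformations are natural in `Z` with `W` and `W'` fixed, hence they agree once they
      -- agree at the generator.
      let s₁ : H.functor ⋙ tensorRight (K.functor.obj (op W')) ⟶
          (tensorRight W).op ⋙ F.functor :=
        Functor.whiskerLeft _ ((curriedTensor A).flip.map (K.functor.map f.op)) ≫ t W
      let s₂ : H.functor ⋙ tensorRight (K.functor.obj (op W')) ⟶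
          (tensorRight W).op ⋙ F.functor :=
        t W' ≫ Functor.whiskerRight (NatTrans.op ((curriedTensor FinN.{u}).flip.map f)) F.functor
      have : s₁ = s₂ := (hg.bijective_comp (tensorRight (K.functor.obj (op W')))
        ((tensorRight W).op ⋙ F.functor)).1 (by
          have := v.naturality f.op
          dsimp [s₁, s₂] at this ⊢
          rw [← whisker_exchange_assoc, ht, reassoc_of% (ht W'), this])
      exact NatTrans.congr_app this (op Z)
    have hp : ∀ {Z Z' W W' : FinN.{u}} (f : Z ⟶ Z') (f' : W ⟶ W'),
        (H.functor.map f.op ⊗ₘ K.functor.map f'.op) ≫ (t W).app (op Z) =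
          (t W').app (op Z') ≫ F.functor.map (f ⊗ₘ f').op := by
      intro Z Z' W W' f f'
      have h₁ := hn f' Z'
      have h₂ := (t W).naturality f.op
      dsimp at h₂
      rw [MonoidalCategory.tensorHom_def', Category.assoc, h₂, reassoc_of% h₁, ← Functor.map_comp,
        MonoidalCategory.tensorHom_def f f']
      rfl
    refine ⟨pairDesc (fun Z W => (t W).app (op Z)) hp, ?_⟩
    ext ⟨W⟩
    exact (congrArg _ (pair_pairDesc _ hp X W)).trans (ht W)

/-- The two generators are used one after the other: `bijective_slice` removes `H`, and the freeness
of `K`, which survives `tensorLeft a`, removes `K`. -/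
theorem tensor (hg : IsFree H g) {b : A} {Y : FinN.{u}} {K : qa A} {k : b ⟶ K.functor.obj (op Y)}
    (hk : IsFree K k) : IsFree (H ⊗ K) ((g ⊗ₘ k) ≫ pair H K X Y) := fun F => by
  have := (hk.bijective_comp (tensorLeft a) ((tensorLeft X).op ⋙ F.functor)).comp
    (hg.bijective_slice K F)
  have he (t : H ⊗ K ⟶ F) : ((g ⊗ₘ k) ≫ pair H K X Y) ≫ t.natTrans.app (op (X ⊗ Y)) =
      a ◁ k ≫ (slice g t).app (op Y) := by
    rw [slice_app, MonoidalCategory.tensorHom_def']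
    simp only [Category.assoc]
  exact (funext he : (fun t : H ⊗ K ⟶ F => ((g ⊗ₘ k) ≫ pair H K X Y) ≫
    t.natTrans.app (op (X ⊗ Y))) = fun t => a ◁ k ≫ (slice g t).app (op Y)) ▸ this
end IsFree

theorem isFree_unit : IsFree (𝟙_ (qa A)) unitPt := fun _ =>
  ⟨fun _ _ h => unit_ext h, fun x => ⟨unitDesc x, unitPt_unitDesc x⟩⟩

/-- A set has exactly one map to the one-element set, so a morphism out of the constant presheaf is
determined by its value there, and any value extends by restriction along these maps. -/
theorem isFree_constOne : IsFree (X := FinN.one) (constOne A) (𝟙 (𝟙_ A)) := fun F => by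
  constructor
  · intro s t h
    apply DayFunctor.hom_ext
    ext ⟨Z⟩
    have hs := pair_nat_app s (default : Z ⟶ FinN.one).op
    have ht := pair_nat_app t (default : Z ⟶ FinN.one).op
    rw [constOne_map] at hs ht
    replace hs := (Category.id_comp _).symm.trans hs
    replace ht := (Category.id_comp _).symm.trans ht
    rw [hs, ht]
    exact congrArg (fun t => t ≫ F.functor.map _) ((Category.id_comp _).symm.trans
      (h.trans (Category.id_comp _)))
  · intro x
    refine ⟨⟨{ app := fun Z => x ≫ F.functor.map (default : unop Z ⟶ FinN.one).op
               naturality := fun Z Z' f => ?_ }⟩, ?_⟩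
    · have : (default : unop Z' ⟶ FinN.one).op = (default : unop Z ⟶ FinN.one).op ≫ f :=
        Quiver.Hom.unop_inj (Subsingleton.elim _ _)
      refine (Category.id_comp (x ≫ F.functor.map _)).trans ?_
      rw [this, Functor.map_comp]
      exact (Category.assoc _ _ _).symm
    · refine (Category.id_comp _).trans ?_
      have : (default : FinN.one ⟶ FinN.one) = 𝟙 _ := Subsingleton.elim _ _
      dsimp
      rw [this, op_id, CategoryTheory.Functor.map_id]
      exact Category.comp_id _

/-- The presheaf `q^* a` is the unit presheaf followed by `tensorLeft a`, so the freeness of the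
unit on `∅` passes to it. -/
theorem isFree_base (a : A) : IsFree ((baseFunctor A).obj a) (baseIncl a) := by
  refine IsFree.iso_comp (X := 𝟙_ FinN.{u}) (H := (baseFunctor A).obj a) (g := a ◁ unitPt) (fun F => ?_) (ρ_ a).symm
  have := (isFree_unit (A := A)).bijective_comp (tensorLeft a) F.functor
  let e : ((baseFunctor A).obj a ⟶ F) ≃ ((𝟙_ (qa A)).functor ⋙ tensorLeft a ⟶ F.functor) :=
    ⟨fun t => t.natTrans, fun t => ⟨t⟩, fun _ => rfl, fun _ => rfl⟩
  exact this.comp e.bijective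

theorem genPow_succ (n : ℕ) : genPow A (n + 1) = (λ_ (𝟙_ A)).inv ≫ (genPow A n ⊗ₘ 𝟙 (𝟙_ A)) ≫
      pair (pow (XaRel A) n).X (XaRel A).X (FintypeCat.Skeleton.mk n)
        (FintypeCat.Skeleton.mk 1) := by
  rw [tensorHom_id]; rfl

theorem isFree_pow (n : ℕ) : IsFree (X := FintypeCat.Skeleton.mk n) (pow (XaRel A) n).X
    (genPow A n) := by
  induction n with
  | zero => exact isFree_unit
  | succ n ih =>
    rw [genPow_succ]
    exact (ih.tensor isFree_constOne).iso_comp (λ_ (𝟙_ A)).symm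

/-- The Yoneda lemma with coefficients. The generic element is the product of the generator of `q^*
a` at `∅` and of the universal element of the tensor power, transported along `∅ ⊔ X ≅ X`. -/
theorem isFree_gen (a : A) (X : FinN.{u}) :
    IsFree ((baseFunctor A).obj a ⊗ (pow (XaRel A) X.len).X) (gen a X) := by
  have := (((isFree_base a).tensor (isFree_pow (A := A) X.len)).comp_iso (λ_ X).symm).iso_comp
    (ρ_ a).symm
  convert this using 1
  rw [gen, basePair, MonoidalCategory.tensorHom_def']
  simp only [Category.assoc]
  rfl

/-- The morphisms `basePair` as a morphism of presheaves. -/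
def basePairHom (a : A) (G : qa A) : (extFunctor G).obj a ⟶ (baseFunctor A).obj a ⊗ G :=
  ⟨slice (baseIncl a) (𝟙 _) ≫
    Functor.whiskerRight (NatTrans.op (leftUnitorNatIso FinN.{u}).inv) _⟩

theorem basePairHom_app (a : A) (G : qa A) (X : FinN.{u}) :
    (basePairHom a G).natTrans.app (op X) = basePair a G X := by
  change (_ ≫ _ ≫ 𝟙 _) ≫ _ = _
  rw [Category.comp_id]
  exact Category.assoc _ _ _

/-- Tensoring with `q^* a` is pointwise tensoring with `a`: as `q^* a` is free on `∅`,
`bijective_slice` identifies morphisms out of `q^* a ⊗ G` with morphisms out of `X ↦ a ⊗ G(X)`. -/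
instance (a : A) (G : qa A) : IsIso (basePairHom a G) := by
  rw [isIso_iff_coyoneda_map_bijective]
  intro F
  let i : (tensorLeft (𝟙_ FinN.{u})).op ⋙ F.functor ≅ F.functor :=
    Functor.isoWhiskerRight (NatIso.op (leftUnitorNatIso FinN.{u}).symm) F.functor ≪≫
      Functor.leftUnitor _
  let e : (G.functor ⋙ tensorLeft a ⟶ F.functor) ≃ ((extFunctor G).obj a ⟶ F) :=
    ⟨fun t => ⟨t⟩, fun t => t.natTrans, fun _ => rfl, fun _ => rfl⟩
  have := e.bijective.comp ((i.homToEquiv).bijective.comp ((isFree_base a).bijective_slice G F))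
  convert this using 1
  funext t
  apply DayFunctor.hom_ext
  ext ⟨X⟩
  change ((_ ≫ _ ≫ 𝟙 _) ≫ _) ≫ t.natTrans.app (op X) = (_ ≫ _ ≫ _) ≫ F.functor.map (λ_ X).inv.op ≫ 𝟙 _
  rw [Category.comp_id, Category.comp_id]
  have := pair_nat_app t (λ_ X).inv.op
  refine (Category.assoc _ _ _).trans ((congrArg (fun s => (baseIncl a ▷ G.functor.obj (op X) ≫
    pair ((baseFunctor A).obj a) G (𝟙_ FinN) X) ≫ s) this).trans ?_)
  exact (Category.assoc _ _ _).trans ((congrArg (_ ≫ ·) (Category.assoc _ _ _).symm).trans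
    (Category.assoc _ _ _).symm)

instance (a : A) (G : qa A) (X : FinN.{u}) : IsIso (basePair a G X) := by
  rw [← basePairHom_app]
  exact @Functor.map_isIso _ _ _ _ _ _ (evalAt A X) (basePairHom a G) inferInstance
end
end
end AlgClassifier

/-! ### Disjoint union of finite sets as a coproduct. -/

namespace AlgClassifier

namespace FinN

/-- The inclusion of `X` into the disjoint union of `X` and `Y`. -/
def inl (X Y : FinN.{u}) : X ⟶ X ⊗ Y := ofFun fun x => (sumEquiv X Y).symm (Sum.inl x)

/-- The inclusion of `Y` into the disjoint union of `X` and `Y`. -/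
def inr (X Y : FinN.{u}) : Y ⟶ X ⊗ Y := ofFun fun y => (sumEquiv X Y).symm (Sum.inr y)

/-- The map out of a disjoint union given by a pair of maps. -/
def desc {X Y Z : FinN.{u}} (f : X ⟶ Z) (g : Y ⟶ Z) : X ⊗ Y ⟶ Z :=
  ofFun fun x => Sum.elim f g (sumEquiv X Y x)

variable {X Y Z X' Y' : FinN.{u}}

@[simp]
theorem inl_desc (f : X ⟶ Z) (g : Y ⟶ Z) : inl X Y ≫ desc f g = f := by
  refine hom_ext_el _ _ fun x => ?_
  simp [inl, desc, ofFun, comp_el]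

@[simp]
theorem inl_desc_assoc (f : X ⟶ Z) (g : Y ⟶ Z) {R : FinN.{u}}
    (h : _ ⟶ R) : inl X Y ≫ desc f g ≫ h =
      f ≫ h := by
  rw [reassoc_of% inl_desc]

@[simp]
theorem inr_desc (f : X ⟶ Z) (g : Y ⟶ Z) : inr X Y ≫ desc f g = g := by
  refine hom_ext_el _ _ fun x => ?_
  simp [inr, desc, ofFun, comp_el]

@[simp]
theorem inr_desc_assoc (f : X ⟶ Z) (g : Y ⟶ Z) {R : FinN.{u}}
    (h : _ ⟶ R) : inr X Y ≫ desc f g ≫ h =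
      g ≫ h := by
  rw [reassoc_of% inr_desc]

/-- Together with the `simp` lemmas that compute the structure maps on `inl` and `inr`, this reduces
identities between maps of iterated disjoint unions to simplification. -/
theorem sum_hom_ext {f g : X ⊗ Y ⟶ Z} (h₁ : inl X Y ≫ f = inl X Y ≫ g)
    (h₂ : inr X Y ≫ f = inr X Y ≫ g) : f = g :=
  hom_ext_el _ _ (sum_cases (fun x => congrFun h₁ x) (fun x => congrFun h₂ x))

@[simp]
theorem inl_tensorHom (f : X ⟶ X') (g : Y ⟶ Y') : inl X Y ≫ (f ⊗ₘ g) = f ≫ inl X' Y' :=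
  hom_ext_el _ _ fun x => sumMap_inl f g x

@[simp]
theorem inl_tensorHom_assoc (f : X ⟶ X') (g : Y ⟶ Y') {R : FinN.{u}}
    (h : _ ⟶ R) : inl X Y ≫ (f ⊗ₘ g) ≫ h =
      f ≫ inl X' Y' ≫ h := by
  rw [reassoc_of% inl_tensorHom]

@[simp]
theorem inr_tensorHom (f : X ⟶ X') (g : Y ⟶ Y') : inr X Y ≫ (f ⊗ₘ g) = g ≫ inr X' Y' :=
  hom_ext_el _ _ fun x => sumMap_inr f g x

@[simp]
theorem inr_tensorHom_assoc (f : X ⟶ X') (g : Y ⟶ Y') {R : FinN.{u}}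
    (h : _ ⟶ R) : inr X Y ≫ (f ⊗ₘ g) ≫ h =
      g ≫ inr X' Y' ≫ h := by
  rw [reassoc_of% inr_tensorHom]

@[simp]
theorem inl_whiskerRight (f : X ⟶ X') : inl X Y ≫ f ▷ Y = f ≫ inl X' Y :=
  hom_ext_el _ _ fun x => sumMap_inl f (𝟙 Y) x

@[simp]
theorem inl_whiskerRight_assoc (f : X ⟶ X') {R : FinN.{u}}
    (h : _ ⟶ R) : inl X Y ≫ f ▷ Y ≫ h =
      f ≫ inl X' Y ≫ h := by
  rw [reassoc_of% inl_whiskerRight]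

@[simp]
theorem inr_whiskerRight (f : X ⟶ X') : inr X Y ≫ f ▷ Y = inr X' Y :=
  hom_ext_el _ _ fun x => sumMap_inr f (𝟙 Y) x

@[simp]
theorem inr_whiskerRight_assoc (f : X ⟶ X') {R : FinN.{u}}
    (h : _ ⟶ R) : inr X Y ≫ f ▷ Y ≫ h =
      inr X' Y ≫ h := by
  rw [reassoc_of% inr_whiskerRight]

@[simp]
theorem inl_whiskerLeft (g : Y ⟶ Y') : inl X Y ≫ X ◁ g = inl X Y' :=
  hom_ext_el _ _ fun x => sumMap_inl (𝟙 X) g x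

@[simp]
theorem inl_whiskerLeft_assoc (g : Y ⟶ Y') {R : FinN.{u}}
    (h : _ ⟶ R) : inl X Y ≫ X ◁ g ≫ h =
      inl X Y' ≫ h := by
  rw [reassoc_of% inl_whiskerLeft]

@[simp]
theorem inr_whiskerLeft (g : Y ⟶ Y') : inr X Y ≫ X ◁ g = g ≫ inr X Y' :=
  hom_ext_el _ _ fun x => sumMap_inr (𝟙 X) g x

@[simp]
theorem inr_whiskerLeft_assoc (g : Y ⟶ Y') {R : FinN.{u}}
    (h : _ ⟶ R) : inr X Y ≫ X ◁ g ≫ h =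
      g ≫ inr X Y' ≫ h := by
  rw [reassoc_of% inr_whiskerLeft]

@[simp]
theorem inl_inl_assoc (X Y Z : FinN.{u}) :
    inl X Y ≫ inl (X ⊗ Y) Z ≫ (α_ X Y Z).hom = inl X (Y ⊗ Z) :=
  hom_ext_el _ _ fun x => assoc_ll X Y Z x

@[simp]
theorem inl_inl_assoc_assoc (X Y Z : FinN.{u}) {R : FinN.{u}}
    (h : _ ⟶ R) : inl X Y ≫ inl (X ⊗ Y) Z ≫ (α_ X Y Z).hom ≫ h =
      inl X (Y ⊗ Z) ≫ h := by
  rw [reassoc_of% inl_inl_assoc]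

@[simp]
theorem inr_inl_assoc (X Y Z : FinN.{u}) :
    inr X Y ≫ inl (X ⊗ Y) Z ≫ (α_ X Y Z).hom = inl Y Z ≫ inr X (Y ⊗ Z) :=
  hom_ext_el _ _ fun x => assoc_lr X Y Z x

@[simp]
theorem inr_inl_assoc_assoc (X Y Z : FinN.{u}) {R : FinN.{u}}
    (h : _ ⟶ R) : inr X Y ≫ inl (X ⊗ Y) Z ≫ (α_ X Y Z).hom ≫ h =
      inl Y Z ≫ inr X (Y ⊗ Z) ≫ h := by
  rw [reassoc_of% inr_inl_assoc]

@[simp]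
theorem inr_assoc (X Y Z : FinN.{u}) :
    inr (X ⊗ Y) Z ≫ (α_ X Y Z).hom = inr Y Z ≫ inr X (Y ⊗ Z) :=
  hom_ext_el _ _ fun x => assoc_r X Y Z x

@[simp]
theorem inr_assoc_assoc (X Y Z : FinN.{u}) {R : FinN.{u}}
    (h : _ ⟶ R) : inr (X ⊗ Y) Z ≫ (α_ X Y Z).hom ≫ h =
      inr Y Z ≫ inr X (Y ⊗ Z) ≫ h := by
  rw [reassoc_of% inr_assoc]

@[simp]
theorem inl_assoc_inv (X Y Z : FinN.{u}) :
    inl X (Y ⊗ Z) ≫ (α_ X Y Z).inv = inl X Y ≫ inl (X ⊗ Y) Z :=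
  hom_ext_el _ _ fun x => assoc_inv_l X Y Z x

@[simp]
theorem inl_assoc_inv_assoc (X Y Z : FinN.{u}) {R : FinN.{u}}
    (h : _ ⟶ R) : inl X (Y ⊗ Z) ≫ (α_ X Y Z).inv ≫ h =
      inl X Y ≫ inl (X ⊗ Y) Z ≫ h := by
  rw [reassoc_of% inl_assoc_inv]

@[simp]
theorem inl_inr_assoc_inv (X Y Z : FinN.{u}) :
    inl Y Z ≫ inr X (Y ⊗ Z) ≫ (α_ X Y Z).inv = inr X Y ≫ inl (X ⊗ Y) Z :=
  hom_ext_el _ _ fun x => assoc_inv_rl X Y Z x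

@[simp]
theorem inl_inr_assoc_inv_assoc (X Y Z : FinN.{u}) {R : FinN.{u}}
    (h : _ ⟶ R) : inl Y Z ≫ inr X (Y ⊗ Z) ≫ (α_ X Y Z).inv ≫ h =
      inr X Y ≫ inl (X ⊗ Y) Z ≫ h := by
  rw [reassoc_of% inl_inr_assoc_inv]

@[simp]
theorem inr_inr_assoc_inv (X Y Z : FinN.{u}) :
    inr Y Z ≫ inr X (Y ⊗ Z) ≫ (α_ X Y Z).inv = inr (X ⊗ Y) Z :=
  hom_ext_el _ _ fun x => assoc_inv_rr X Y Z x

@[simp]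
theorem inr_inr_assoc_inv_assoc (X Y Z : FinN.{u}) {R : FinN.{u}}
    (h : _ ⟶ R) : inr Y Z ≫ inr X (Y ⊗ Z) ≫ (α_ X Y Z).inv ≫ h =
      inr (X ⊗ Y) Z ≫ h := by
  rw [reassoc_of% inr_inr_assoc_inv]

@[simp]
theorem inr_leftUnitor (X : FinN.{u}) : inr (𝟙_ _) X ≫ (λ_ X).hom = 𝟙 X :=
  hom_ext_el _ _ fun x => left_r X x

@[simp]
theorem inr_leftUnitor_assoc (X : FinN.{u}) {R : FinN.{u}}
    (h : _ ⟶ R) : inr (𝟙_ _) X ≫ (λ_ X).hom ≫ h =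
      h := by
  rw [reassoc_of% inr_leftUnitor]

@[simp]
theorem inl_rightUnitor (X : FinN.{u}) : inl X (𝟙_ _) ≫ (ρ_ X).hom = 𝟙 X :=
  hom_ext_el _ _ fun x => right_l X x

@[simp]
theorem inl_rightUnitor_assoc (X : FinN.{u}) {R : FinN.{u}}
    (h : _ ⟶ R) : inl X (𝟙_ _) ≫ (ρ_ X).hom ≫ h =
      h := by
  rw [reassoc_of% inl_rightUnitor]

theorem leftUnitor_inv (X : FinN.{u}) : (λ_ X).inv = inr (𝟙_ _) X := by
  rw [← cancel_mono (λ_ X).hom, Iso.inv_hom_id, inr_leftUnitor]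

theorem rightUnitor_inv (X : FinN.{u}) : (ρ_ X).inv = inl X (𝟙_ _) := by
  rw [← cancel_mono (ρ_ X).hom, Iso.inv_hom_id, inl_rightUnitor]

@[simp]
theorem inl_braiding (X Y : FinN.{u}) : inl X Y ≫ (β_ X Y).hom = inr Y X :=
  hom_ext_el _ _ fun x => comm_l X Y x

@[simp]
theorem inl_braiding_assoc (X Y : FinN.{u}) {R : FinN.{u}}
    (h : _ ⟶ R) : inl X Y ≫ (β_ X Y).hom ≫ h =
      inr Y X ≫ h := by
  rw [reassoc_of% inl_braiding]

@[simp]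
theorem inr_braiding (X Y : FinN.{u}) : inr X Y ≫ (β_ X Y).hom = inl Y X :=
  hom_ext_el _ _ fun x => comm_r X Y x

@[simp]
theorem inr_braiding_assoc (X Y : FinN.{u}) {R : FinN.{u}}
    (h : _ ⟶ R) : inr X Y ≫ (β_ X Y).hom ≫ h =
      inl Y X ≫ h := by
  rw [reassoc_of% inr_braiding]

instance (X : FinN.{u}) : Unique (𝟙_ FinN.{u} ⟶ X) where
  default := ofFun fun x => (zero_false x).elim
  uniq _ := hom_ext_el _ _ fun x => (zero_false x).elim

end FinN

/-! ### Tensor products of commutative algebras as coproducts, and tensor powers. -/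

noncomputable section
open MonObj
section
variable {B : Type w} [Category.{u} B] [MonoidalCategory B] [SymmetricCategory B]

instance (M : CommMon B) : Unique ((CommMon.trivial B) ⟶ M) := CommMon.uniqueHomFromTrivial M

attribute [simp] inl_desc inr_desc

/-- The tensor product of morphisms of commutative algebras. -/
def tensorAlgHom {M M' N N' : CommMon B} (f : M ⟶ M') (g : N ⟶ N') :
    tensorAlg M N ⟶ tensorAlg M' N' :=
  algHom (M := tensorAlg M N) (N := tensorAlg M' N') (algMap f ⊗ₘ algMap g)

@[simp]
theorem inl_tensorAlgHom {M M' N N' : CommMon B} (f : M ⟶ M') (g : N ⟶ N') :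
    inlAlg M N ≫ tensorAlgHom f g = f ≫ inlAlg M' N' := by
  apply algMap_ext
  change ((ρ_ M.X).inv ≫ M.X ◁ η[N.X]) ≫ (algMap f ⊗ₘ algMap g) =
    algMap f ≫ (ρ_ M'.X).inv ≫ M'.X ◁ η[N'.X]
  rw [rightUnitor_inv_naturality_assoc, ← id_tensorHom, Category.assoc,
    tensorHom_comp_tensorHom, Category.id_comp, IsMonHom.one_hom, MonoidalCategory.tensorHom_def]

@[simp]
theorem inl_tensorAlgHom_assoc {M M' N N' : CommMon B} (f : M ⟶ M') (g : N ⟶ N') {R : CommMon B}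
    (h : _ ⟶ R) : inlAlg M N ≫ tensorAlgHom f g ≫ h =
      f ≫ inlAlg M' N' ≫ h := by
  rw [reassoc_of% inl_tensorAlgHom]

@[simp]
theorem inr_tensorAlgHom {M M' N N' : CommMon B} (f : M ⟶ M') (g : N ⟶ N') :
    inrAlg M N ≫ tensorAlgHom f g = g ≫ inrAlg M' N' := by
  apply algMap_ext
  change ((λ_ N.X).inv ≫ η[M.X] ▷ N.X) ≫ (algMap f ⊗ₘ algMap g) =
    algMap g ≫ (λ_ N'.X).inv ≫ η[M'.X] ▷ N'.X
  rw [leftUnitor_inv_naturality_assoc, ← tensorHom_id, Category.assoc,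
    tensorHom_comp_tensorHom, Category.id_comp, IsMonHom.one_hom, MonoidalCategory.tensorHom_def']

@[simp]
theorem inr_tensorAlgHom_assoc {M M' N N' : CommMon B} (f : M ⟶ M') (g : N ⟶ N') {R : CommMon B}
    (h : _ ⟶ R) : inrAlg M N ≫ tensorAlgHom f g ≫ h =
      g ≫ inrAlg M' N' ≫ h := by
  rw [reassoc_of% inr_tensorAlgHom]

/-- The structure isomorphisms of the tensor product are algebra morphisms. Identities between them
can therefore be tested on coprojections by `alg_ext`, which replaces coherence computations for
tensor powers. -/
def assocAlg (L M N : CommMon B) : tensorAlg (tensorAlg L M) N ⟶ tensorAlg L (tensorAlg M N) :=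
  algHom (M := tensorAlg (tensorAlg L M) N) (N := tensorAlg L (tensorAlg M N)) (α_ L.X M.X N.X).hom

def leftAlg (M : CommMon B) : tensorAlg (CommMon.trivial B) M ⟶ M :=
  @algHom _ _ _ _ (tensorAlg (CommMon.trivial B) M) M (λ_ M.X).hom
    (inferInstanceAs (IsMonHom (λ_ M.X).hom))

def rightAlg (M : CommMon B) : tensorAlg M (CommMon.trivial B) ⟶ M :=
  @algHom _ _ _ _ (tensorAlg M (CommMon.trivial B)) M (ρ_ M.X).hom
    (inferInstanceAs (IsMonHom (ρ_ M.X).hom))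

def braidAlg (M N : CommMon B) : tensorAlg M N ⟶ tensorAlg N M :=
  algHom (M := tensorAlg M N) (N := tensorAlg N M) (β_ M.X N.X).hom

@[simp]
theorem inl_inl_assocAlg (L M N : CommMon B) :
    inlAlg L M ≫ inlAlg (tensorAlg L M) N ≫ assocAlg L M N = inlAlg L (tensorAlg M N) := by
  apply algMap_ext
  change ((ρ_ L.X).inv ≫ L.X ◁ η[M.X]) ≫ ((ρ_ (L.X ⊗ M.X)).inv ≫ (L.X ⊗ M.X) ◁ η[N.X]) ≫
    (α_ L.X M.X N.X).hom = (ρ_ L.X).inv ≫ L.X ◁ ((λ_ _).inv ≫ (η[M.X] ⊗ₘ η[N.X]))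
  rw [MonoidalCategory.tensorHom_def]
  simp only [Category.assoc, MonoidalCategory.whiskerLeft_comp]
  monoidal

@[simp]
theorem inl_inl_assocAlg_assoc (L M N : CommMon B) {R : CommMon B}
    (h : _ ⟶ R) : inlAlg L M ≫ inlAlg (tensorAlg L M) N ≫ assocAlg L M N ≫ h =
      inlAlg L (tensorAlg M N) ≫ h := by
  rw [reassoc_of% inl_inl_assocAlg]

@[simp]
theorem inr_inl_assocAlg (L M N : CommMon B) :
    inrAlg L M ≫ inlAlg (tensorAlg L M) N ≫ assocAlg L M N =
      inlAlg M N ≫ inrAlg L (tensorAlg M N) := by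
  apply algMap_ext
  change ((λ_ M.X).inv ≫ η[L.X] ▷ M.X) ≫ ((ρ_ (L.X ⊗ M.X)).inv ≫ (L.X ⊗ M.X) ◁ η[N.X]) ≫
    (α_ L.X M.X N.X).hom = ((ρ_ M.X).inv ≫ M.X ◁ η[N.X]) ≫ (λ_ (M.X ⊗ N.X)).inv ≫
      η[L.X] ▷ (M.X ⊗ N.X)
  simp only [Category.assoc]
  rw [rightUnitor_inv_naturality_assoc, ← whisker_exchange_assoc]
  monoidal

@[simp]
theorem inr_inl_assocAlg_assoc (L M N : CommMon B) {R : CommMon B}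
    (h : _ ⟶ R) : inrAlg L M ≫ inlAlg (tensorAlg L M) N ≫ assocAlg L M N ≫ h =
      inlAlg M N ≫ inrAlg L (tensorAlg M N) ≫ h := by
  rw [reassoc_of% inr_inl_assocAlg]

@[simp]
theorem inr_assocAlg (L M N : CommMon B) :
    inrAlg (tensorAlg L M) N ≫ assocAlg L M N = inrAlg M N ≫ inrAlg L (tensorAlg M N) := by
  apply algMap_ext
  change ((λ_ N.X).inv ≫ ((λ_ _).inv ≫ (η[L.X] ⊗ₘ η[M.X])) ▷ N.X) ≫ (α_ L.X M.X N.X).hom =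
    ((λ_ N.X).inv ≫ η[M.X] ▷ N.X) ≫ (λ_ (M.X ⊗ N.X)).inv ≫ η[L.X] ▷ (M.X ⊗ N.X)
  rw [MonoidalCategory.tensorHom_def']
  simp only [Category.assoc, comp_whiskerRight]
  monoidal

@[simp]
theorem inr_assocAlg_assoc (L M N : CommMon B) {R : CommMon B}
    (h : _ ⟶ R) : inrAlg (tensorAlg L M) N ≫ assocAlg L M N ≫ h =
      inrAlg M N ≫ inrAlg L (tensorAlg M N) ≫ h := by
  rw [reassoc_of% inr_assocAlg]

@[simp]
theorem inr_leftAlg (M : CommMon B) : inrAlg (CommMon.trivial B) M ≫ leftAlg M = 𝟙 M := by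
  apply algMap_ext
  change ((λ_ M.X).inv ≫ 𝟙 (𝟙_ B) ▷ M.X) ≫ (λ_ M.X).hom = 𝟙 M.X
  simp

@[simp]
theorem inl_rightAlg (M : CommMon B) : inlAlg M (CommMon.trivial B) ≫ rightAlg M = 𝟙 M := by
  apply algMap_ext
  change ((ρ_ M.X).inv ≫ M.X ◁ 𝟙 (𝟙_ B)) ≫ (ρ_ M.X).hom = 𝟙 M.X
  simp

@[simp]
theorem inl_braidAlg (M N : CommMon B) : inlAlg M N ≫ braidAlg M N = inrAlg N M := by
  apply algMap_ext
  change ((ρ_ M.X).inv ≫ M.X ◁ η[N.X]) ≫ (β_ M.X N.X).hom = (λ_ M.X).inv ≫ η[N.X] ▷ M.X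
  rw [Category.assoc, BraidedCategory.braiding_naturality_right, braiding_tensorUnit_right]
  simp

@[simp]
theorem inl_braidAlg_assoc (M N : CommMon B) {R : CommMon B}
    (h : _ ⟶ R) : inlAlg M N ≫ braidAlg M N ≫ h =
      inrAlg N M ≫ h := by
  rw [reassoc_of% inl_braidAlg]

@[simp]
theorem inr_braidAlg (M N : CommMon B) : inrAlg M N ≫ braidAlg M N = inlAlg N M := by
  apply algMap_ext
  change ((λ_ N.X).inv ≫ η[M.X] ▷ N.X) ≫ (β_ M.X N.X).hom = (ρ_ N.X).inv ≫ N.X ◁ η[M.X]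
  rw [Category.assoc, BraidedCategory.braiding_naturality_left, braiding_tensorUnit_left]
  simp

@[simp]
theorem inr_braidAlg_assoc (M N : CommMon B) {R : CommMon B}
    (h : _ ⟶ R) : inrAlg M N ≫ braidAlg M N ≫ h =
      inlAlg N M ≫ h := by
  rw [reassoc_of% inr_braidAlg]

@[simp]
theorem powι_powMap (M : CommMon B) {X Y : FinN.{u}} (f : X ⟶ Y) (i : Fin X.len) :
    powι M X.len i ≫ powMap M f = powι M Y.len (f (ULift.up i)).down := powι_desc _ _ _

@[simp]
theorem powι_powMap_assoc (M : CommMon B) {X Y : FinN.{u}} (f : X ⟶ Y) (i : Fin X.len) {R : CommMon B}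
    (h : _ ⟶ R) : powι M X.len i ≫ powMap M f ≫ h =
      powι M Y.len (f (ULift.up i)).down ≫ h := by
  rw [reassoc_of% powι_powMap]

theorem powMap_id (M : CommMon B) (X : FinN.{u}) : powMap M (𝟙 X) = 𝟙 _ :=
  pow_ext fun i => by rw [powι_powMap, Category.comp_id]; rfl

theorem powMap_comp (M : CommMon B) {X Y Z : FinN.{u}} (f : X ⟶ Y) (g : Y ⟶ Z) :
    powMap M (f ≫ g) = powMap M f ≫ powMap M g :=
  pow_ext fun i => by simp only [powι_powMap_assoc, powι_powMap]; rfl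

/-- The multiplication `M^{⊗X} ⊗ M^{⊗Y} ⟶ M^{⊗(X ⊔ Y)}`. -/
def phiμ (M : CommMon B) (X Y : FinN.{u}) :
    tensorAlg (pow M X.len) (pow M Y.len) ⟶ pow M (X ⊗ Y).len :=
  descAlg (powMap M (FinN.inl X Y)) (powMap M (FinN.inr X Y))

@[simp]
theorem inl_phiμ (M : CommMon B) (X Y : FinN.{u}) :
    inlAlg _ _ ≫ phiμ M X Y = powMap M (FinN.inl X Y) := inl_desc _ _

@[simp]
theorem inl_phiμ_assoc (M : CommMon B) (X Y : FinN.{u}) {R : CommMon B}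
    (h : _ ⟶ R) : inlAlg _ _ ≫ phiμ M X Y ≫ h =
      powMap M (FinN.inl X Y) ≫ h := by
  rw [reassoc_of% inl_phiμ]

@[simp]
theorem inr_phiμ (M : CommMon B) (X Y : FinN.{u}) :
    inrAlg _ _ ≫ phiμ M X Y = powMap M (FinN.inr X Y) := inr_desc _ _

@[simp]
theorem inr_phiμ_assoc (M : CommMon B) (X Y : FinN.{u}) {R : CommMon B}
    (h : _ ⟶ R) : inrAlg _ _ ≫ phiμ M X Y ≫ h =
      powMap M (FinN.inr X Y) ≫ h := by
  rw [reassoc_of% inr_phiμ]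

/-- Since `M^{⊗X}` is the coproduct of copies of `M` indexed by `X`, each coherence property of
`phiμ`, here and below, becomes an identity of maps of finite sets after restriction to the
coprojections. -/
theorem phiμ_natural (M : CommMon B) {X X' Y Y' : FinN.{u}} (f : X ⟶ X') (g : Y ⟶ Y') :
    tensorAlgHom (powMap M f) (powMap M g) ≫ phiμ M X' Y' = phiμ M X Y ≫ powMap M (f ⊗ₘ g) := by
  apply alg_ext <;> simp [← powMap_comp]

theorem phiμ_assoc (M : CommMon B) (X Y Z : FinN.{u}) :
    tensorAlgHom (phiμ M X Y) (𝟙 _) ≫ phiμ M (X ⊗ Y) Z ≫ powMap M (α_ X Y Z).hom =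
      assocAlg _ _ _ ≫ tensorAlgHom (𝟙 _) (phiμ M Y Z) ≫ phiμ M X (Y ⊗ Z) := by
  apply alg_ext
  · apply alg_ext <;> simp [← powMap_comp]
  · simp [← powMap_comp]

theorem phiμ_left (M : CommMon B) (X : FinN.{u}) :
    phiμ M (𝟙_ _) X ≫ powMap M (λ_ X).hom = leftAlg (pow M X.len) := by
  apply alg_ext
  · exact Subsingleton.elim (α := CommMon.trivial B ⟶ _) _ _
  · exact (inr_phiμ_assoc M (𝟙_ _) X _).trans (by
      rw [← powMap_comp, FinN.inr_leftUnitor, powMap_id]; exact (inr_leftAlg _).symm)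

theorem phiμ_right (M : CommMon B) (X : FinN.{u}) :
    phiμ M X (𝟙_ _) ≫ powMap M (ρ_ X).hom = rightAlg (pow M X.len) := by
  apply alg_ext
  · exact (inl_phiμ_assoc M X (𝟙_ _) _).trans (by
      rw [← powMap_comp, FinN.inl_rightUnitor, powMap_id]; exact (inl_rightAlg _).symm)
  · exact Subsingleton.elim (α := CommMon.trivial B ⟶ _) _ _

theorem phiμ_braid (M : CommMon B) (X Y : FinN.{u}) :
    phiμ M X Y ≫ powMap M (β_ X Y).hom = braidAlg _ _ ≫ phiμ M Y X := by
  apply alg_ext <;> simp [← powMap_comp]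

/-- The inverse of `phiμ`. -/
def phiδ (M : CommMon B) (X Y : FinN.{u}) :
    pow M (X ⊗ Y).len ⟶ tensorAlg (pow M X.len) (pow M Y.len) :=
  powDesc _ (fun i => Sum.elim (fun x => powι M X.len x.down ≫ inlAlg _ _)
    (fun y => powι M Y.len y.down ≫ inrAlg _ _) (FinN.sumEquiv X Y ⟨i⟩))

theorem powι_phiδ_inl (M : CommMon B) (X Y : FinN.{u}) (x : FinN.El X) :
    powι M (X ⊗ Y).len (FinN.inl X Y x).down ≫ phiδ M X Y = powι M X.len x.down ≫ inlAlg _ _ := by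
  refine (powι_desc (X ⊗ Y).len _ _).trans ?_
  change Sum.elim _ _ (FinN.sumEquiv X Y (FinN.inl X Y x)) = _
  simp [FinN.inl, FinN.ofFun]

theorem powι_phiδ_inr (M : CommMon B) (X Y : FinN.{u}) (y : FinN.El Y) :
    powι M (X ⊗ Y).len (FinN.inr X Y y).down ≫ phiδ M X Y = powι M Y.len y.down ≫ inrAlg _ _ := by
  refine (powι_desc (X ⊗ Y).len _ _).trans ?_
  change Sum.elim _ _ (FinN.sumEquiv X Y (FinN.inr X Y y)) = _
  simp [FinN.inr, FinN.ofFun]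

theorem phiμ_phiδ (M : CommMon B) (X Y : FinN.{u}) : phiμ M X Y ≫ phiδ M X Y = 𝟙 _ := by
  apply alg_ext
  · rw [inl_phiμ_assoc, Category.comp_id]
    exact pow_ext fun i => by rw [powι_powMap_assoc, powι_phiδ_inl]
  · rw [inr_phiμ_assoc, Category.comp_id]
    exact pow_ext fun i => by rw [powι_powMap_assoc, powι_phiδ_inr]

theorem phiδ_phiμ (M : CommMon B) (X Y : FinN.{u}) : phiδ M X Y ≫ phiμ M X Y = 𝟙 _ := by
  refine pow_ext fun i => ?_
  obtain ⟨s, hs⟩ := (FinN.sumEquiv X Y).symm.surjective ⟨i⟩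
  rw [Category.comp_id]
  cases s with
  | inl x =>
    obtain rfl : (FinN.inl X Y x).down = i := congrArg ULift.down hs
    rw [reassoc_of% powι_phiδ_inl, inl_phiμ, powι_powMap]
  | inr x =>
    obtain rfl : (FinN.inr X Y x).down = i := congrArg ULift.down hs
    rw [reassoc_of% powι_phiδ_inr, inr_phiμ, powι_powMap]

end
end
end AlgClassifier

/-! ### Tensor powers of an algebra as a symmetric monoidal functor on finite sets. -/

namespace AlgClassifier
noncomputable section
section
variable {B : Type w} [Category.{u} B] [MonoidalCategory B] [SymmetricCategory B]

/-- The unit constraint is an identity since the zeroth power is the unit object by definition. The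
axioms are the identities underlying those already known for algebra morphisms. -/
instance (M : CommMon B) : (Phi.{u} M).LaxBraided where
  ε := 𝟙 (𝟙_ B)
  μ X Y := algMap (phiμ M X Y)
  μ_natural_left f Z := by
    have := congrArg algMap (phiμ_natural M f (𝟙 Z))
    rw [powMap_id, tensorHom_id] at this
    rw [← tensorHom_id]; exact this
  μ_natural_right Z f := by
    have := congrArg algMap (phiμ_natural M (𝟙 Z) f)
    rw [powMap_id, id_tensorHom] at this
    rw [← id_tensorHom]; exact this
  associativity X Y Z := by
    have h := congrArg algMap (phiμ_assoc M X Y Z)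
    have e₁ : algMap (phiμ M X Y) ▷ (pow M Z.len).X =
      algMap (phiμ M X Y) ⊗ₘ 𝟙 (pow M Z.len).X := (tensorHom_id _ _).symm
    have e₂ : (pow M X.len).X ◁ algMap (phiμ M Y Z) =
      𝟙 (pow M X.len).X ⊗ₘ algMap (phiμ M Y Z) := (id_tensorHom _ _).symm
    exact (congrArg (· ≫ _) e₁).trans (h.trans (congrArg (fun t => _ ≫ t ≫ _) e₂.symm))
  left_unitality X := by
    refine (congrArg algMap (phiμ_left M X)).symm.trans ?_
    change _ = 𝟙 (𝟙_ B) ▷ _ ≫ _ ≫ _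
    rw [id_whiskerRight, Category.id_comp]
    rfl
  right_unitality X := by
    refine (congrArg algMap (phiμ_right M X)).symm.trans ?_
    change _ = _ ◁ 𝟙 (𝟙_ B) ≫ _ ≫ _
    rw [MonoidalCategory.whiskerLeft_id, Category.id_comp]
    rfl
  braided X Y := congrArg algMap (phiμ_braid M X Y)

instance (M : CommMon B) : IsIso (Functor.LaxMonoidal.ε (Phi.{u} M)) :=
  inferInstanceAs (IsIso (𝟙 (𝟙_ B)))

instance (M : CommMon B) (X Y : FinN.{u}) : IsIso (Functor.LaxMonoidal.μ (Phi.{u} M) X Y) :=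
  ⟨algMap (phiδ M X Y), congrArg algMap (phiμ_phiδ M X Y), congrArg algMap (phiδ_phiμ M X Y)⟩
end
end
end AlgClassifier

/-! ### Evaluation of presheaves as a lax symmetric monoidal functor. -/

namespace AlgClassifier
noncomputable section

section
variable {C : Type w} [Category.{u} C] [MonoidalCategory C] [BraidedCategory C]
  {D : Type w'} [Category.{w''} D] [MonoidalCategory D] [BraidedCategory D]

instance : BraidedCategory (C × D) where
  braiding X Y := (β_ X.1 Y.1).prod (β_ X.2 Y.2)
  braiding_naturality_right X Y Z f := by ext <;> simp
  braiding_naturality_left f Z := by ext <;> simp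
  hexagon_forward X Y Z := by ext <;> simp
  hexagon_reverse X Y Z := by ext <;> simp

theorem prod_braiding (X Y : C × D) : (β_ X Y) = (β_ X.1 Y.1).prod (β_ X.2 Y.2) := rfl
end

section
variable {A : Type w} [Category.{u} A] [MonoidalCategory A] [SymmetricCategory A]
  [CocontinuousTensor A]

variable (A) in
/-- The evaluation of presheaves as a functor of both variables. -/
def evalFunctor : qa A × FinN.{u}ᵒᵖ ⥤ A where
  obj Z := Z.1.functor.obj Z.2
  map {Z Z'} f := f.1.natTrans.app Z.2 ≫ Z'.1.functor.map f.2
  map_id Z := by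
    change 𝟙 _ ≫ Z.1.functor.map (𝟙 _) = 𝟙 _
    rw [CategoryTheory.Functor.map_id, Category.comp_id]
  map_comp {Z Z' Z''} f g := by
    change (f.1.natTrans.app Z.2 ≫ g.1.natTrans.app Z.2) ≫ Z''.1.functor.map (f.2 ≫ g.2) = _
    rw [Functor.map_comp, Category.assoc, Category.assoc, ← reassoc_of% (pair_nat_app g.1 f.2)]

/-- Treating `(F, X) ↦ F(X)` as one functor of both variables gathers the identities for `pair` into
a single lax symmetric monoidal structure, to which general statements about the interchange apply.
-/
instance : (evalFunctor A).LaxBraided where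
  ε := unitPt
  μ Z Z' := pair Z.1 Z'.1 (unop Z.2) (unop Z'.2)
  μ_natural_left {Z Z'} f W := by
    have h := pair_natural Z'.1 W.1 f.2.unop (𝟙 (unop W.2))
    rw [op_id, CategoryTheory.Functor.map_id, tensorHom_id, tensorHom_id] at h
    change (f.1.natTrans.app Z.2 ≫ Z'.1.functor.map f.2) ▷ W.1.functor.obj W.2 ≫ _ =
      pair Z.1 W.1 (unop Z.2) (unop W.2) ≫ (f.1 ▷ W.1).natTrans.app (Z.2 ⊗ W.2) ≫
        (Z'.1 ⊗ W.1).functor.map (f.2.unop ▷ unop W.2).op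
    rw [comp_whiskerRight, Category.assoc]
    refine (congrArg _ h).trans ?_
    exact (Category.assoc _ _ _).symm.trans ((congrArg (· ≫ _)
      (pair_whiskerRight f.1 W.1 (unop Z.2) (unop W.2)).symm).trans (Category.assoc _ _ _))
  μ_natural_right {Z Z'} W f := by
    have h := pair_natural W.1 Z'.1 (𝟙 (unop W.2)) f.2.unop
    rw [op_id, CategoryTheory.Functor.map_id, id_tensorHom, id_tensorHom] at h
    change W.1.functor.obj W.2 ◁ (f.1.natTrans.app Z.2 ≫ Z'.1.functor.map f.2) ≫ _ =
      pair W.1 Z.1 (unop W.2) (unop Z.2) ≫ (W.1 ◁ f.1).natTrans.app (W.2 ⊗ Z.2) ≫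
        (W.1 ⊗ Z'.1).functor.map (unop W.2 ◁ f.2.unop).op
    rw [MonoidalCategory.whiskerLeft_comp, Category.assoc]
    refine (congrArg _ h).trans ?_
    exact (Category.assoc _ _ _).symm.trans ((congrArg (· ≫ _)
      (pair_whiskerLeft W.1 f.1 (unop W.2) (unop Z.2)).symm).trans (Category.assoc _ _ _))
  associativity Z Z' Z'' := by
    have h := pair_assoc Z.1 Z'.1 Z''.1 (unop Z.2) (unop Z'.2) (unop Z''.2)
    change pair _ _ _ _ ▷ _ ≫ pair _ _ (unop Z.2 ⊗ unop Z'.2) _ ≫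
      (α_ Z.1 Z'.1 Z''.1).hom.natTrans.app (op ((unop Z.2 ⊗ unop Z'.2) ⊗ unop Z''.2)) ≫
      (Z.1 ⊗ Z'.1 ⊗ Z''.1).functor.map (α_ (unop Z.2) (unop Z'.2) (unop Z''.2)).inv.op =
      (α_ _ _ _).hom ≫ _ ◁ pair _ _ _ _ ≫ pair _ _ _ (unop Z'.2 ⊗ unop Z''.2)
    rw [reassoc_of% h, ← Functor.map_comp, ← op_comp, Iso.inv_hom_id, op_id,
      CategoryTheory.Functor.map_id, Category.comp_id]
  left_unitality Z := by
    have h := pair_left Z.1 (unop Z.2)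
    change _ = unitPt ▷ _ ≫ pair (𝟙_ _) Z.1 (𝟙_ _) (unop Z.2) ≫
      (λ_ Z.1).hom.natTrans.app (op (𝟙_ _ ⊗ unop Z.2)) ≫ Z.1.functor.map (λ_ (unop Z.2)).inv.op
    rw [reassoc_of% h, ← Functor.map_comp, ← op_comp, Iso.inv_hom_id, op_id,
      CategoryTheory.Functor.map_id]
    exact (Category.comp_id _).symm
  right_unitality Z := by
    have h := pair_right Z.1 (unop Z.2)
    change _ = _ ◁ unitPt ≫ pair Z.1 (𝟙_ _) (unop Z.2) (𝟙_ _) ≫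
      (ρ_ Z.1).hom.natTrans.app (op (unop Z.2 ⊗ 𝟙_ _)) ≫ Z.1.functor.map (ρ_ (unop Z.2)).inv.op
    rw [reassoc_of% h, ← Functor.map_comp, ← op_comp, Iso.inv_hom_id, op_id,
      CategoryTheory.Functor.map_id]
    exact (Category.comp_id _).symm
  braided Z Z' := by
    have h := pair_braiding Z.1 Z'.1 (unop Z.2) (unop Z'.2)
    change pair _ _ _ _ ≫ (β_ Z.1 Z'.1).hom.natTrans.app (op (unop Z.2 ⊗ unop Z'.2)) ≫
      (Z'.1 ⊗ Z.1).functor.map (β_ (unop Z'.2) (unop Z.2)).hom.op = (β_ _ _).hom ≫ _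
    rw [reassoc_of% h, ← Functor.map_comp, ← op_comp, SymmetricCategory.symmetry, op_id,
      CategoryTheory.Functor.map_id, Category.comp_id]

theorem tensorμ_fst {C : Type w} [Category.{u} C] [MonoidalCategory C] [BraidedCategory C]
    {D : Type w'} [Category.{w''} D] [MonoidalCategory D] [BraidedCategory D] (P Q R S : C × D) :
    (tensorμ P Q R S).1 = tensorμ P.1 Q.1 R.1 S.1 := by
  simp [tensorμ, prod_braiding]

theorem tensorμ_snd {C : Type w} [Category.{u} C] [MonoidalCategory C] [BraidedCategory C]
    {D : Type w'} [Category.{w''} D] [MonoidalCategory D] [BraidedCategory D] (P Q R S : C × D) :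
    (tensorμ P Q R S).2 = tensorμ P.2 Q.2 R.2 S.2 := by
  simp [tensorμ, prod_braiding]

theorem tensorμ_tensorμ {C : Type w} [Category.{u} C] [MonoidalCategory C] [SymmetricCategory C]
    (X Y Z W : C) : tensorμ X Y Z W ≫ tensorμ X Z Y W = 𝟙 _ := by
  simp only [tensorμ, Category.assoc, pentagon_inv_hom_hom_hom_inv_assoc, Iso.inv_hom_id_assoc,
    Iso.hom_inv_id_assoc, whiskerLeft_hom_inv_assoc]
  have h : X ◁ (β_ Y Z).hom ▷ W ≫ X ◁ (β_ Z Y).hom ▷ W = 𝟙 _ := by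
    simp [← MonoidalCategory.whiskerLeft_comp, ← comp_whiskerRight]
  rw [reassoc_of% h]
  simp

/-- This is the general compatibility of a lax braided functor with the interchange, applied to
`evalFunctor`. The interchange of finite sets acts contravariantly, so it is moved to the other side
by `tensorμ_tensorμ`. -/
theorem pair_tensorμ (F G H K : qa A) (X Y Z W : FinN.{u}) :
    (pair F G X Y ⊗ₘ pair H K Z W) ≫ pair (F ⊗ G) (H ⊗ K) (X ⊗ Y) (Z ⊗ W) ≫
      (tensorμ F G H K).natTrans.app (op ((X ⊗ Y) ⊗ Z ⊗ W)) =
    tensorμ _ _ _ _ ≫ (pair F H X Z ⊗ₘ pair G K Y W) ≫ pair (F ⊗ H) (G ⊗ K) (X ⊗ Z) (Y ⊗ W) ≫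
      ((F ⊗ H) ⊗ (G ⊗ K)).functor.map (tensorμ X Y Z W).op := by
  have h := tensorμ_comp_μ_tensorHom_μ_comp_μ (evalFunctor A) (F, op X) (G, op Y) (H, op Z) (K, op W)
  have h₁ := tensorμ_fst (F, op X) (G, op Y) (H, op Z) (K, op W)
  have h₂ := tensorμ_snd (F, op X) (G, op Y) (H, op Z) (K, op W)
  dsimp only at h₁ h₂
  -- In the opposite category the interchange for `X, Y, Z, W` is the opposite of the one for `X, Z,
  -- Y, W`.
  rw [← BraidedCategory.op_tensorμ] at h₂
  have h₃ : (evalFunctor A).map (tensorμ (F, op X) (G, op Y) (H, op Z) (K, op W)) =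
      (tensorμ F G H K).natTrans.app (op ((X ⊗ Y) ⊗ Z ⊗ W)) ≫
        ((F ⊗ H) ⊗ (G ⊗ K)).functor.map (tensorμ X Z Y W).op := by
    rw [← h₁, ← h₂]
    rfl
  rw [h₃] at h
  change tensorμ _ _ _ _ ≫ (pair F H X Z ⊗ₘ pair G K Y W) ≫ pair (F ⊗ H) (G ⊗ K) (X ⊗ Z) (Y ⊗ W) =
    (pair F G X Y ⊗ₘ pair H K Z W) ≫ pair (F ⊗ G) (H ⊗ K) (X ⊗ Y) (Z ⊗ W) ≫ _ at h
  rw [reassoc_of% h, ← Functor.map_comp, ← op_comp, tensorμ_tensorμ, op_id,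
      CategoryTheory.Functor.map_id, Category.comp_id]
end
end
end AlgClassifier

/-! ### Products of elements, and the universal elements of tensor powers. -/

namespace AlgClassifier
noncomputable section

section
variable {A : Type w} [Category.{u} A] [MonoidalCategory A] [SymmetricCategory A]
  [CocontinuousTensor A]

/-- The product of an element of `F(X)` and of an element of `G(Y)`. -/
def elMul {F G : qa A} {X Y : FinN.{u}} {a b : A} (x : a ⟶ F.functor.obj (op X))
    (y : b ⟶ G.functor.obj (op Y)) : a ⊗ b ⟶ (F ⊗ G).functor.obj (op (X ⊗ Y)) :=
  (x ⊗ₘ y) ≫ pair F G X Y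

variable {F G H K F' G' : qa A} {X Y Z W X' Y' : FinN.{u}} {a b c d a' b' : A}
  (x : a ⟶ F.functor.obj (op X)) (y : b ⟶ G.functor.obj (op Y)) (z : c ⟶ H.functor.obj (op Z))
  (w : d ⟶ K.functor.obj (op W))

theorem comp_elMul (f : a' ⟶ a) (g : b' ⟶ b) :
    elMul (f ≫ x) (g ≫ y) = (f ⊗ₘ g) ≫ elMul x y := by
  rw [elMul, elMul, ← tensorHom_comp_tensorHom, Category.assoc]

theorem elMul_map (f : X' ⟶ X) (g : Y' ⟶ Y) :
    elMul (x ≫ F.functor.map f.op) (y ≫ G.functor.map g.op) =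
      elMul x y ≫ (F ⊗ G).functor.map (f ⊗ₘ g).op := by
  rw [elMul, elMul, ← tensorHom_comp_tensorHom, Category.assoc, pair_natural, Category.assoc]

theorem elMul_app (s : F ⟶ F') (t : G ⟶ G') :
    elMul (x ≫ s.natTrans.app (op X)) (y ≫ t.natTrans.app (op Y)) =
      elMul x y ≫ (s ⊗ₘ t).natTrans.app (op (X ⊗ Y)) := by
  rw [elMul, elMul, ← tensorHom_comp_tensorHom, Category.assoc, Category.assoc, pair_tensorHom]

theorem elMul_tensorμ :
    elMul (elMul x y) (elMul z w) ≫ (tensorμ F G H K).natTrans.app (op ((X ⊗ Y) ⊗ Z ⊗ W)) =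
      tensorμ a b c d ≫ elMul (elMul x z) (elMul y w) ≫
        ((F ⊗ H) ⊗ (G ⊗ K)).functor.map (tensorμ X Y Z W).op := by
  simp only [elMul]
  rw [← tensorHom_comp_tensorHom, Category.assoc, Category.assoc, pair_tensorμ,
    ← tensorHom_comp_tensorHom, Category.assoc, Category.assoc, ← tensorμ_natural_assoc]

theorem elMul_left :
    elMul unitPt x ≫ (λ_ F).hom.natTrans.app (op (𝟙_ _ ⊗ X)) =
      (λ_ a).hom ≫ x ≫ F.functor.map (λ_ X).hom.op := by
  rw [elMul, MonoidalCategory.tensorHom_def', Category.assoc, Category.assoc, pair_left,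
    leftUnitor_naturality_assoc]

theorem elMul_left_inv :
    elMul unitPt x ≫ (𝟙_ (qa A) ⊗ F).functor.map (λ_ X).inv.op =
      (λ_ a).hom ≫ x ≫ (λ_ F).inv.natTrans.app (op X) := by
  have h := elMul_left x
  have h₁ := congrArg (fun t => t ≫ F.functor.map (λ_ X).inv.op ≫ (λ_ F).inv.natTrans.app (op X)) h
  simp only [Category.assoc] at h₁
  rw [← reassoc_of% (pair_nat_app (λ_ F).hom (λ_ X).inv.op), ← comp_app, Iso.hom_inv_id,
    ← Functor.map_comp_assoc, ← op_comp, Iso.inv_hom_id, op_id,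
    CategoryTheory.Functor.map_id, Category.id_comp] at h₁
  exact (congrArg (_ ≫ ·) (Category.comp_id _).symm).trans h₁

theorem elMul_right :
    elMul x unitPt ≫ (ρ_ F).hom.natTrans.app (op (X ⊗ 𝟙_ _)) =
      (ρ_ a).hom ≫ x ≫ F.functor.map (ρ_ X).hom.op := by
  rw [elMul, MonoidalCategory.tensorHom_def, Category.assoc, Category.assoc, pair_right,
    rightUnitor_naturality_assoc]

theorem elMul_right_inv :
    elMul x unitPt ≫ (F ⊗ 𝟙_ (qa A)).functor.map (ρ_ X).inv.op =
      (ρ_ a).hom ≫ x ≫ (ρ_ F).inv.natTrans.app (op X) := by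
  have h := elMul_right x
  have h₁ := congrArg (fun t => t ≫ F.functor.map (ρ_ X).inv.op ≫ (ρ_ F).inv.natTrans.app (op X)) h
  simp only [Category.assoc] at h₁
  rw [← reassoc_of% (pair_nat_app (ρ_ F).hom (ρ_ X).inv.op), ← comp_app, Iso.hom_inv_id,
    ← Functor.map_comp_assoc, ← op_comp, Iso.inv_hom_id, op_id,
    CategoryTheory.Functor.map_id, Category.id_comp] at h₁
  exact (congrArg (_ ≫ ·) (Category.comp_id _).symm).trans h₁

variable (A) in
/-- The generator of the universal algebra. -/
def genOne : 𝟙_ A ⟶ (XaRel A).X.functor.obj (op FinN.one.{u}) := 𝟙 (𝟙_ A)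

theorem genOne_map {X : FinN.{u}} (f : X ⟶ FinN.one) :
    genOne A ≫ (XaRel A).X.functor.map f.op = 𝟙 (𝟙_ A) := Category.comp_id _

end
section
open MonObj
variable {A : Type w} [Category.{u} A] [MonoidalCategory A] [SymmetricCategory A]
  [CocontinuousTensor A]
variable {X : FinN.{u}} {a : A}

theorem inlAlg_el (M N : CommMon (qa A)) (x : a ⟶ M.X.functor.obj (op X)) :
    x ≫ (algMap (inlAlg M N)).natTrans.app (op X) =
      (ρ_ a).inv ≫ elMul x (algPt N.X) ≫ (M.X ⊗ N.X).functor.map (ρ_ X).inv.op := by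
  have h₁ : algMap (inlAlg M N) = (ρ_ M.X).inv ≫ M.X ◁ η[N.X] := rfl
  have h₂ := elMul_app x unitPt (𝟙 M.X) η[N.X]
  have h₃ : x ≫ (𝟙 M.X : M.X ⟶ M.X).natTrans.app (op X) = x := Category.comp_id x
  rw [id_tensorHom, h₃] at h₂
  rw [h₁, comp_app, ← cancel_epi (ρ_ a).hom, ← reassoc_of% (elMul_right_inv x), algPt, h₂,
    Iso.hom_inv_id_assoc, Category.assoc, pair_nat_app]

theorem inrAlg_el (M N : CommMon (qa A)) (x : a ⟶ N.X.functor.obj (op X)) :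
    x ≫ (algMap (inrAlg M N)).natTrans.app (op X) =
      (λ_ a).inv ≫ elMul (algPt M.X) x ≫ (M.X ⊗ N.X).functor.map (λ_ X).inv.op := by
  have h₁ : algMap (inrAlg M N) = (λ_ N.X).inv ≫ η[M.X] ▷ N.X := rfl
  have h₂ := elMul_app unitPt x η[M.X] (𝟙 N.X)
  have h₃ : x ≫ (𝟙 N.X : N.X ⟶ N.X).natTrans.app (op X) = x := Category.comp_id x
  rw [tensorHom_id, h₃] at h₂
  rw [h₁, comp_app, ← cancel_epi (λ_ a).hom, ← reassoc_of% (elMul_left_inv x), algPt, h₂,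
    Iso.hom_inv_id_assoc, Category.assoc, pair_nat_app]

theorem descAlg_el {M N P : CommMon (qa A)} (f : M ⟶ P) (g : N ⟶ P) {Y : FinN.{u}} {b : A}
    (x : a ⟶ M.X.functor.obj (op X)) (y : b ⟶ N.X.functor.obj (op Y)) :
    elMul x y ≫ (algMap (descAlg f g)).natTrans.app (op (X ⊗ Y)) =
      elMul (x ≫ (algMap f).natTrans.app (op X)) (y ≫ (algMap g).natTrans.app (op Y)) ≫
        (μ[P.X]).natTrans.app (op (X ⊗ Y)) := by
  have h₁ : algMap (descAlg f g) = (algMap f ⊗ₘ algMap g) ≫ μ[P.X] := rfl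
  rw [h₁, comp_app, elMul_app, Category.assoc]

theorem algPt_one : algPt (𝟙_ (qa A)) = unitPt := Category.comp_id _

theorem algPt_tensor (M N : CommMon (qa A)) : algPt (tensorAlg M N).X =
    (λ_ _).inv ≫ elMul (algPt M.X) (algPt N.X) ≫ (M.X ⊗ N.X).functor.map (λ_ (𝟙_ _)).inv.op := by
  have h₁ : η[(tensorAlg M N).X] = (λ_ _).inv ≫ (η[M.X] ⊗ₘ η[N.X]) := rfl
  have h₂ := elMul_left_inv (A := A) unitPt
  rw [algPt, h₁, comp_app, algPt, algPt, elMul_app, ← cancel_epi (λ_ _).hom,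
    ← reassoc_of% h₂, Iso.hom_inv_id_assoc, Category.assoc, pair_nat_app]

/-- The element `g` of `M(X)` is compatible with the maps `∅ ⟶ X` and `X ⊔ X ⟶ X`. -/
structure IsCodiag (M : CommMon (qa A)) {X : FinN.{u}} (g : 𝟙_ A ⟶ M.X.functor.obj (op X)) :
    Prop where
  pt (f : 𝟙_ FinN.{u} ⟶ X) : g ≫ M.X.functor.map f.op = algPt M.X
  mul : elMul g g ≫ (μ[M.X]).natTrans.app (op (X ⊗ X)) =
    (λ_ (𝟙_ A)).hom ≫ g ≫ M.X.functor.map (FinN.desc (𝟙 X) (𝟙 X)).op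

section
variable {M N : CommMon (qa A)} {X Y : FinN.{u}} {g : 𝟙_ A ⟶ M.X.functor.obj (op X)}
  {h : 𝟙_ A ⟶ N.X.functor.obj (op Y)}

/-- The product of elements with coefficients in the unit object. -/
def oneMul {F G : qa A} {X Y : FinN.{u}} (g : 𝟙_ A ⟶ F.functor.obj (op X))
    (h : 𝟙_ A ⟶ G.functor.obj (op Y)) : 𝟙_ A ⟶ (F ⊗ G).functor.obj (op (X ⊗ Y)) :=
  (λ_ _).inv ≫ elMul g h

theorem oneMul_map {F G : qa A} {X Y X' Y' : FinN.{u}} (g : 𝟙_ A ⟶ F.functor.obj (op X))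
    (h : 𝟙_ A ⟶ G.functor.obj (op Y)) (f : X' ⟶ X) (f' : Y' ⟶ Y) :
    oneMul g h ≫ (F ⊗ G).functor.map (f ⊗ₘ f').op =
      oneMul (g ≫ F.functor.map f.op) (h ≫ G.functor.map f'.op) := by
  rw [oneMul, oneMul, Category.assoc, elMul_map]

theorem IsCodiag.inl (hh : IsCodiag N h) : g ≫ (algMap (inlAlg M N)).natTrans.app (op X) =
    oneMul g h ≫ (M.X ⊗ N.X).functor.map (FinN.inl X Y).op := by
  have e : FinN.inl X Y = (ρ_ X).inv ≫ (𝟙 X ⊗ₘ (default : 𝟙_ FinN.{u} ⟶ Y)) := by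
    rw [Iso.eq_inv_comp]
    refine FinN.sum_hom_ext ?_ (Subsingleton.elim _ _)
    simp
  rw [inlAlg_el, ← hh.pt default, e, op_comp, Functor.map_comp, reassoc_of% (oneMul_map g h),
    op_id, CategoryTheory.Functor.map_id, Category.comp_id, oneMul, unitors_inv_equal,
    Category.assoc]

theorem IsCodiag.inr (hg : IsCodiag M g) : h ≫ (algMap (inrAlg M N)).natTrans.app (op Y) =
    oneMul g h ≫ (M.X ⊗ N.X).functor.map (FinN.inr X Y).op := by
  have e : FinN.inr X Y = (λ_ Y).inv ≫ ((default : 𝟙_ FinN.{u} ⟶ X) ⊗ₘ 𝟙 Y) := by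
    rw [Iso.eq_inv_comp]
    refine FinN.sum_hom_ext (Subsingleton.elim _ _) ?_
    simp
  rw [inrAlg_el, ← hg.pt default, e, op_comp, Functor.map_comp, reassoc_of% (oneMul_map g h),
    op_id, CategoryTheory.Functor.map_id, Category.comp_id, oneMul, Category.assoc]

theorem tensorμ_one : tensorμ (𝟙_ A) (𝟙_ A) (𝟙_ A) (𝟙_ A) = 𝟙 _ := by
  rw [tensorμ, braiding_tensorUnit_left]
  monoidal

/-- The multiplication of `M ⊗ N` rearranges `(g h)(g h)` to `(g g)(h h)`, while the codiagonal of
`X ⊔ Y` is the interchange followed by the codiagonals of `X` and `Y`. -/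
theorem IsCodiag.tensor (hg : IsCodiag M g) (hh : IsCodiag N h) :
    IsCodiag (tensorAlg M N) (X := X ⊗ Y) (oneMul g h) where
  pt f := by
    have e : f = (λ_ _).inv ≫ (default ⊗ₘ default) := Subsingleton.elim _ _
    rw [algPt_tensor, e, op_comp, Functor.map_comp, ← hg.pt default, ← hh.pt default,
      reassoc_of% (oneMul_map g h), oneMul, Category.assoc]
  mul := by
    have h₁ : μ[(tensorAlg M N).X] = tensorμ _ _ _ _ ≫ (μ[M.X] ⊗ₘ μ[N.X]) := rfl
    have e : tensorμ X Y X Y ≫ (FinN.desc (𝟙 X) (𝟙 X) ⊗ₘ FinN.desc (𝟙 Y) (𝟙 Y)) =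
        FinN.desc (𝟙 (X ⊗ Y)) (𝟙 (X ⊗ Y)) := by
      refine FinN.sum_hom_ext (FinN.sum_hom_ext ?_ ?_) (FinN.sum_hom_ext ?_ ?_) <;>
        simp [tensorμ]
    rw [h₁, oneMul, comp_elMul, comp_app, Category.assoc, reassoc_of% (elMul_tensorμ g h g h),
      tensorμ_one, Category.id_comp, pair_nat_app, ← reassoc_of% elMul_app, hg.mul, hh.mul,
      comp_elMul, elMul_map, ← e, op_comp, Functor.map_comp]
    simp [tensorHom_comp_tensorHom_assoc]
end

theorem isCodiag_unit : IsCodiag (CommMon.trivial (qa A)) (X := 𝟙_ _) unitPt where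
  pt f := by
    obtain rfl : f = 𝟙 (𝟙_ FinN.{u}) := Subsingleton.elim _ _
    rw [op_id, CategoryTheory.Functor.map_id]
    exact (Category.comp_id _).trans algPt_one.symm
  mul := by
    have e : (λ_ (𝟙_ FinN.{u})).hom = FinN.desc (𝟙 _) (𝟙 _) := 
      FinN.sum_hom_ext (Subsingleton.elim _ _) (Subsingleton.elim _ _)
    rw [← e]
    exact elMul_left unitPt

theorem isCodiag_one : IsCodiag (XaRel A) (genOne A) where
  pt f := (genOne_map _).trans constUnit_pt.symm
  mul := by
    rw [genOne_map]
    refine Eq.trans ?_ (Category.comp_id _).symm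
    rw [elMul, Category.assoc]
    refine (congrArg (_ ≫ ·) (constMul_pair _ _)).trans ?_
    rw [genOne]
    exact (congrArg (· ≫ _) (id_tensorHom_id _ _)).trans (Category.id_comp _)

theorem genPow_succ_eq (n : ℕ) : genPow A (n + 1) =
    oneMul (F := (pow (XaRel A) n).X) (X := FintypeCat.Skeleton.mk n) (genPow A n) (genOne A) :=
  congrArg (_ ≫ ·) (congrArg (· ≫ _) (tensorHom_id _ _).symm)

/-- One may think of the `n`-th power of the universal algebra as `h_n`, where the product of maps
from `S` and `T` to `n` is the induced map from `S ⊔ T`; the square of the identity is then the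
codiagonal. The proof only needs induction on the tensor factors. -/
theorem isCodiag_pow (n : ℕ) :
    IsCodiag (X := FintypeCat.Skeleton.mk n) (pow (XaRel A) n) (genPow A n) := by
  induction n with
  | zero => exact isCodiag_unit
  | succ n ih =>
    rw [genPow_succ_eq]
    exact ih.tensor isCodiag_one

/-- The `i`-th insertion corresponds to the map `1 ⟶ n` with value `i`; the last factor and the
earlier ones come from the two inclusions into `n ⊔ 1`. -/
theorem genPow_powι (n : ℕ) (i : Fin n) :
    genOne A ≫ (algMap (powι (XaRel A) n i)).natTrans.app (op FinN.one) = genPow A n ≫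
      (pow (XaRel A) n).X.functor.map (Quiver.Hom.op (X := FinN.one.{u})
        (Y := FintypeCat.Skeleton.mk n) (FinN.ofFun fun _ => ⟨i⟩)) := by
  induction n with
  | zero => exact i.elim0
  | succ n ih =>
    rw [genPow_succ_eq]
    induction i using Fin.lastCases with
    | last =>
      have h := (isCodiag_pow (A := A) n).inr (h := genOne A)
      have e : (FinN.ofFun fun _ => ⟨Fin.last n⟩ :
          FinN.one.{u} ⟶ FintypeCat.Skeleton.mk (n + 1)) =
          FinN.inr (FintypeCat.Skeleton.mk n) FinN.one :=
        FinN.hom_ext_el _ _ fun ⟨x⟩ => by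
          obtain rfl : x = (0 : Fin 1) := Subsingleton.elim (α := Fin 1) _ _
          rfl
      simp only [powι, Fin.lastCases_last]
      rw [e]
      exact h
    | cast i =>
      have h := (isCodiag_one (A := A)).inl (g := genPow A n)
      have e : (FinN.ofFun fun _ => ⟨i.castSucc⟩ :
          FinN.one.{u} ⟶ FintypeCat.Skeleton.mk (n + 1)) =
          FinN.ofFun (X := FinN.one.{u}) (Y := FintypeCat.Skeleton.mk n) (fun _ => ⟨i⟩) ≫
            FinN.inl (FintypeCat.Skeleton.mk n) FinN.one := rfl
      simp only [powι, Fin.lastCases_castSucc]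
      rw [e]
      refine Eq.trans ?_ (congrArg (_ ≫ ·) (Functor.map_comp
        ((pow (XaRel A) n).X ⊗ (XaRel A).X).functor (FinN.inl _ _).op (Quiver.Hom.op _)).symm)
      refine Eq.trans ?_ (Category.assoc _ _ _)
      refine Eq.trans ?_ (congrArg (· ≫ _) h)
      refine Eq.trans ?_ (Category.assoc _ _ _).symm
      have h' := congrArg (· ≫ (algMap (inlAlg (pow (XaRel A) n) (XaRel A))).natTrans.app
        (op FinN.one)) (ih i)
      dsimp only at h'
      rw [Category.assoc, Category.assoc, pair_nat_app] at h'
      exact h'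

/-- By hypothesis `f i` takes the generator to the restriction of `p` along the point `φ i`. The
product of these restrictions is the restriction along `φ`, because `φ` is the disjoint union of its
restrictions to `n` and `1` followed by the codiagonal. -/
theorem IsCodiag.genPow_powDesc {P : CommMon (qa A)} {Y : FinN.{u}}
    {p : 𝟙_ A ⟶ P.X.functor.obj (op Y)} (hp : IsCodiag P p) (n : ℕ)
    (f : Fin n → (XaRel A ⟶ P)) (φ : (FintypeCat.Skeleton.mk n : FinN.{u}) ⟶ Y)
    (h : ∀ i, genOne A ≫ (algMap (f i)).natTrans.app (op FinN.one) =
      p ≫ P.X.functor.map (Quiver.Hom.op (X := FinN.one.{u}) (FinN.ofFun fun _ => φ ⟨i⟩))) :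
    genPow A n ≫ (algMap (powDesc n f)).natTrans.app (op (FintypeCat.Skeleton.mk n)) =
      p ≫ P.X.functor.map φ.op := by
  induction n with
  | zero =>
    have h := hp.pt φ
    exact h.symm
  | succ n ih =>
    have h₁ := ih (fun i => f i.castSucc) (FinN.inl _ FinN.one ≫ φ) (fun i => h i.castSucc)
    have h₂ := h (Fin.last n)
    have e₂ : (FinN.ofFun fun _ => φ ⟨Fin.last n⟩ : FinN.one.{u} ⟶ Y) =
        FinN.inr (FintypeCat.Skeleton.mk n) FinN.one ≫ φ :=
      FinN.hom_ext_el _ _ fun ⟨x⟩ => by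
        obtain rfl : x = (0 : Fin 1) := Subsingleton.elim (α := Fin 1) _ _
        rfl
    have e₃ : (FinN.inl (FintypeCat.Skeleton.mk n) FinN.one ≫ φ ⊗ₘ
        FinN.inr (FintypeCat.Skeleton.mk n) FinN.one ≫ φ) ≫ FinN.desc (𝟙 Y) (𝟙 Y) = φ := by
      apply FinN.sum_hom_ext <;> simp
    rw [e₂] at h₂
    have h₃ := descAlg_el (powDesc n (fun i => f i.castSucc)) (f (Fin.last n))
      (X := FintypeCat.Skeleton.mk n) (genPow A n) (genOne A)
    rw [h₁, h₂, elMul_map, Category.assoc, pair_nat_app, reassoc_of% hp.mul,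
      ← Functor.map_comp, ← op_comp, e₃] at h₃
    rw [genPow_succ_eq, oneMul]
    refine (Category.assoc _ _ _).trans ((congrArg (_ ≫ ·) h₃).trans ?_)
    rw [Iso.inv_hom_id_assoc]
    rfl

/-- In terms of representable presheaves, both sides are `f` regarded as an element of `h_Y(X)`.
This is what makes the evaluation morphisms dinatural. -/
theorem genPow_powMap {X Y : FinN.{u}} (f : X ⟶ Y) :
    genPow A X.len ≫ (algMap (powMap (XaRel A) f)).natTrans.app (op X) =
      genPow A Y.len ≫ (pow (XaRel A) Y.len).X.functor.map f.op :=
  (isCodiag_pow Y.len).genPow_powDesc X.len _ f fun _ => genPow_powι _ _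
end
end
end AlgClassifier

/-! ### Generic elements and the evaluation morphisms. -/

namespace AlgClassifier
noncomputable section
section
variable {A : Type w} [Category.{u} A] [MonoidalCategory A] [SymmetricCategory A]

theorem tensorμ_unit (a b : A) : ((ρ_ a).inv ⊗ₘ (ρ_ b).inv) ≫ tensorμ a (𝟙_ A) b (𝟙_ A) =
    (ρ_ (a ⊗ b)).inv ≫ (a ⊗ b) ◁ (λ_ (𝟙_ A)).inv := by
  rw [← cancel_epi ((ρ_ a).hom ⊗ₘ (ρ_ b).hom), tensorHom_comp_tensorHom_assoc, Iso.hom_inv_id,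
    Iso.hom_inv_id, id_tensorHom_id, Category.id_comp, rightUnitor_monoidal]
  simp

end

section
variable {A : Type w} [Category.{u} A] [MonoidalCategory A]

/-- The device for inverting comparison morphisms between free presheaves: it is enough that they
match the generators. -/
theorem IsFree.isIso {a : A} {X : FinN.{u}} {H H' : qa A} {g : a ⟶ H.functor.obj (op X)}
    {g' : a ⟶ H'.functor.obj (op X)} (hg : IsFree H g) (hg' : IsFree H' g') (t : H ⟶ H')
    (ht : g ≫ t.natTrans.app (op X) = g') : IsIso t := by
  refine ⟨hg'.desc g, hg.ext ?_, hg'.ext ?_⟩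
  · rw [comp_app, reassoc_of% ht, hg'.fac]
    exact (Category.comp_id _).symm
  · rw [comp_app, reassoc_of% (hg'.fac g), ht]
    exact (Category.comp_id _).symm
end

section
variable {A : Type w} [Category.{u} A] [MonoidalCategory A] [SymmetricCategory A]
  [CocontinuousTensor A]

variable (A) in
/-- The universal element of `X_{a,A}^{⊗X}(X)`. -/
def genEl (X : FinN.{u}) : 𝟙_ A ⟶ (pow (XaRel A) X.len).X.functor.obj (op X) := genPow A X.len

theorem isCodiag_genEl (X : FinN.{u}) : IsCodiag (pow (XaRel A) X.len) (genEl A X) :=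
  isCodiag_pow _

theorem genEl_powMap {X Y : FinN.{u}} (f : X ⟶ Y) :
    genEl A X ≫ (algMap (powMap (XaRel A) f)).natTrans.app (op X) =
      genEl A Y ≫ (pow (XaRel A) Y.len).X.functor.map f.op :=
  genPow_powMap f

/-- The product of the restrictions along the two inclusions is the restriction along their disjoint
union followed by the codiagonal, and this composite is the identity of `X ⊔ Y`. -/
theorem genEl_phiμ (X Y : FinN.{u}) : elMul (genEl A X) (genEl A Y) ≫
    (algMap (phiμ (XaRel A) X Y)).natTrans.app (op (X ⊗ Y)) =
      (λ_ _).hom ≫ genEl A (X ⊗ Y) := by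
  have e : (FinN.inl X Y ⊗ₘ FinN.inr X Y) ≫ FinN.desc (𝟙 _) (𝟙 _) = 𝟙 (X ⊗ Y) := by
    apply FinN.sum_hom_ext <;> simp
  refine (descAlg_el _ _ (X := X) (Y := Y) _ _).trans ?_
  rw [genEl_powMap, genEl_powMap, elMul_map, Category.assoc, pair_nat_app,
    reassoc_of% (isCodiag_genEl (A := A) (X ⊗ Y)).mul, ← Functor.map_comp, ← op_comp, e, op_id,
    CategoryTheory.Functor.map_id, Category.comp_id]

theorem baseIncl_natural {a b : A} (f : a ⟶ b) :
    baseIncl a ≫ ((baseFunctor A).map f).natTrans.app (op (𝟙_ _)) = f ≫ baseIncl b := by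
  have : ((ρ_ a).inv ≫ a ◁ unitPt) ≫ f ▷ (𝟙_ (qa A)).functor.obj (op (𝟙_ _)) =
      f ≫ (ρ_ b).inv ≫ b ◁ unitPt := by
    rw [Category.assoc, rightUnitor_inv_naturality_assoc, ← whisker_exchange]
  exact this

theorem unitPt_baseε : unitPt ≫ (Functor.LaxMonoidal.ε (baseFunctor A)).natTrans.app (op (𝟙_ _)) =
    baseIncl (𝟙_ A) := by
  refine (extε_pt (𝟙_ (qa A))).trans ?_
  rw [algPt_one, baseIncl, leftUnitor_inv_naturality, unitors_inv_equal]
  rfl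

theorem elMul_unitPt_mul : elMul (A := A) unitPt unitPt ≫ (MonObj.mul (X := 𝟙_ (qa A))).natTrans.app
    (op (𝟙_ _ ⊗ 𝟙_ _)) = (λ_ _).hom ≫ unitPt ≫ (𝟙_ (qa A)).functor.map (λ_ (𝟙_ _)).hom.op :=
  elMul_left unitPt

theorem elMul_baseμ (a b : A) : elMul (baseIncl a) (baseIncl b) ≫
    (Functor.LaxMonoidal.μ (baseFunctor A) a b).natTrans.app (op (𝟙_ _ ⊗ 𝟙_ _)) =
    baseIncl (a ⊗ b) ≫ ((baseFunctor A).obj (a ⊗ b)).functor.map (λ_ (𝟙_ _)).hom.op := by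
  rw [elMul, Category.assoc]
  refine (congrArg (_ ≫ ·) (pair_extμ (𝟙_ (qa A)) a b (𝟙_ _) (𝟙_ _))).trans ?_
  have h₁ := tensorμ_natural (𝟙 a) unitPt (𝟙 b) (unitPt (A := A))
  have h₂ := elMul_unitPt_mul (A := A)
  rw [elMul, Category.assoc] at h₂
  rw [id_tensorHom, id_tensorHom] at h₁
  have : ((ρ_ a).inv ≫ a ◁ unitPt ⊗ₘ (ρ_ b).inv ≫ b ◁ unitPt) ≫ tensorμ _ _ _ _ ≫
      (a ⊗ b) ◁ algPair (𝟙_ (qa A)) (𝟙_ _) (𝟙_ _) = ((ρ_ (a ⊗ b)).inv ≫ (a ⊗ b) ◁ unitPt) ≫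
        (a ⊗ b) ◁ (𝟙_ (qa A)).functor.map (λ_ (𝟙_ _)).hom.op := by
    rw [← tensorHom_comp_tensorHom, Category.assoc, reassoc_of% h₁, id_tensorHom_id, id_tensorHom,
      reassoc_of% (tensorμ_unit a b), ← MonoidalCategory.whiskerLeft_comp,
      ← MonoidalCategory.whiskerLeft_comp, algPair, h₂, Iso.inv_hom_id_assoc,
      MonoidalCategory.whiskerLeft_comp, Category.assoc]
  exact this

theorem gen_eq (a : A) (X : FinN.{u}) : gen a X = (ρ_ a).inv ≫
    elMul (baseIncl a) (genEl A X) ≫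
      ((baseFunctor A).obj a ⊗ (pow (XaRel A) X.len).X).functor.map (λ_ X).inv.op := by
  rw [gen, basePair, elMul, MonoidalCategory.tensorHom_def']
  simp only [Category.assoc]
  rfl

theorem gen_natural {a b : A} (f : a ⟶ b) (X : FinN.{u}) :
    gen a X ≫ ((baseFunctor A).map f ▷ (pow (XaRel A) X.len).X).natTrans.app (op X) =
      f ≫ gen b X := by
  have h := elMul_app (baseIncl a) (genEl A X) (X := 𝟙_ _) (Y := X) ((baseFunctor A).map f)
    (𝟙 (pow (XaRel A) X.len).X)
  have h' : genEl A X ≫ (𝟙 (pow (XaRel A) X.len).X :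
    _ ⟶ (pow (XaRel A) X.len).X).natTrans.app (op X) = 𝟙 _ ≫ genEl A X :=
    (Category.comp_id _).trans (Category.id_comp _).symm
  rw [tensorHom_id, h', baseIncl_natural, comp_elMul, tensorHom_id] at h
  rw [gen_eq, gen_eq, Category.assoc, Category.assoc, pair_nat_app, ← reassoc_of% h,
    rightUnitor_inv_naturality_assoc]

theorem gen_powMap (a : A) {X Y : FinN.{u}} (f : X ⟶ Y) :
    gen a X ≫ ((baseFunctor A).obj a ◁ algMap (powMap (XaRel A) f)).natTrans.app (op X) =
      gen a Y ≫ ((baseFunctor A).obj a ⊗ (pow (XaRel A) Y.len).X).functor.map f.op := by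
  have h := elMul_app (baseIncl a) (genEl A X) (X := 𝟙_ _) (Y := X)
    (𝟙 ((baseFunctor A).obj a)) (algMap (powMap (XaRel A) f))
  have h' : baseIncl a ≫ (𝟙 ((baseFunctor A).obj a) : (baseFunctor A).obj a ⟶ _).natTrans.app
    (op (𝟙_ _)) = baseIncl a ≫ ((baseFunctor A).obj a).functor.map (𝟙 (𝟙_ _)).op :=
    congrArg (_ ≫ ·) (CategoryTheory.Functor.map_id _ _).symm
  rw [id_tensorHom, h', genEl_powMap, elMul_map] at h
  rw [gen_eq, gen_eq, Category.assoc, Category.assoc, pair_nat_app, ← reassoc_of% h,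
    Category.assoc, Category.assoc, ← Functor.map_comp, ← Functor.map_comp, ← op_comp, ← op_comp,
    id_tensorHom, leftUnitor_inv_naturality]

/-- Generic elements are multiplicative; this is the source of the monoidality of the evaluation
morphisms in `ev_mul`. -/
theorem gen_mul (a b : A) (X Y : FinN.{u}) : elMul (gen a X) (gen b Y) ≫
    (tensorμ _ _ _ _ ≫ (Functor.LaxMonoidal.μ (baseFunctor A) a b ⊗ₘ
      algMap (phiμ (XaRel A) X Y))).natTrans.app (op (X ⊗ Y)) = gen (a ⊗ b) (X ⊗ Y) := by
  -- Generic elements carry the reindexing `∅ ⊔ X ≅ X`; merging the two empty sets turns the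
  -- reindexings for `X` and `Y` into the one for `X ⊔ Y`.
  have e : ((λ_ X).inv ⊗ₘ (λ_ Y).inv) ≫ tensorμ (𝟙_ _) X (𝟙_ _) Y ≫ (λ_ (𝟙_ _)).hom ▷ (X ⊗ Y) =
      (λ_ (X ⊗ Y)).inv := by
    rw [FinN.leftUnitor_inv, FinN.leftUnitor_inv, FinN.leftUnitor_inv]
    apply FinN.sum_hom_ext <;> simp [tensorμ, FinN.leftUnitor_inv]
  have h := elMul_app (elMul (baseIncl a) (baseIncl b)) (elMul (genEl A X) (genEl A Y))
    (Functor.LaxMonoidal.μ (baseFunctor A) a b) (algMap (phiμ (XaRel A) X Y))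
  rw [elMul_baseμ, genEl_phiμ] at h
  have h₁ : (λ_ (𝟙_ A)).hom ≫ genEl A (X ⊗ Y) = ((λ_ (𝟙_ A)).hom ≫ genEl A (X ⊗ Y)) ≫
    (pow (XaRel A) (X ⊗ Y).len).X.functor.map (𝟙 (X ⊗ Y)).op := by
      rw [op_id, CategoryTheory.Functor.map_id, Category.comp_id]
  rw [h₁, elMul_map, ← Category.id_comp (baseIncl (a ⊗ b)), comp_elMul, id_tensorHom] at h
  rw [gen_eq, gen_eq, comp_elMul, comp_app, Category.assoc, elMul_map, Category.assoc,
    reassoc_of% pair_nat_app, reassoc_of% elMul_tensorμ]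
  rw [← Functor.map_comp_assoc, pair_nat_app, ← reassoc_of% h, ← Functor.map_comp, ← op_comp,
    tensorHom_id, ← op_comp, Category.assoc, e, reassoc_of% (tensorμ_unit a b),
    ← MonoidalCategory.whiskerLeft_comp_assoc, Iso.inv_hom_id, MonoidalCategory.whiskerLeft_id,
    Category.id_comp, gen_eq]

theorem gen_zero (a : A) : gen a (𝟙_ FinN.{u}) =
    baseIncl a ≫ (ρ_ ((baseFunctor A).obj a)).inv.natTrans.app (op (𝟙_ _)) := by
  have h := elMul_right_inv (X := 𝟙_ FinN.{u}) (baseIncl a)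
  have h' : (ρ_ a).inv ≫ elMul (baseIncl a) unitPt ≫
      ((baseFunctor A).obj a ⊗ 𝟙_ (qa A)).functor.map (λ_ (𝟙_ FinN.{u})).inv.op =
      baseIncl a ≫ (ρ_ ((baseFunctor A).obj a)).inv.natTrans.app (op (𝟙_ _)) := by
    rw [unitors_inv_equal, h, Iso.inv_hom_id_assoc]
  exact (gen_eq a (𝟙_ _)).trans h'

theorem gen_one (X : FinN.{u}) : genEl A X ≫ ((λ_ (pow (XaRel A) X.len).X).inv ≫
    Functor.LaxMonoidal.ε (baseFunctor A) ▷ (pow (XaRel A) X.len).X).natTrans.app (op X) =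
      gen (𝟙_ A) X := by
  have h := elMul_left_inv (genEl A X) (X := X)
  have h' := elMul_app unitPt (genEl A X) (X := 𝟙_ _) (Y := X)
    (Functor.LaxMonoidal.ε (baseFunctor A)) (𝟙 (pow (XaRel A) X.len).X)
  have e : genEl A X ≫ (𝟙 (pow (XaRel A) X.len).X :
    _ ⟶ (pow (XaRel A) X.len).X).natTrans.app (op X) = genEl A X := Category.comp_id _
  rw [e, unitPt_baseε, tensorHom_id] at h'
  rw [gen_eq, h', Category.assoc, ← pair_nat_app, comp_app, ← cancel_epi (ρ_ _).hom,
    Iso.hom_inv_id_assoc, ← unitors_equal, ← reassoc_of% h]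
end

section
variable {A : Type w} [Category.{u} A] [MonoidalCategory A] [SymmetricCategory A] [IsVectoid A]

instance : IsIso (Functor.LaxMonoidal.ε (baseFunctor A)) :=
  isFree_unit.isIso (isFree_base (𝟙_ A)) _ unitPt_baseε

/-- Source and target are free with coefficients in `a ⊗ b`, on `∅ ⊔ ∅` and on `∅`, and the
tensorator matches the generators. -/
instance (a b : A) : IsIso (Functor.LaxMonoidal.μ (baseFunctor A) a b) :=
  ((isFree_base a).tensor (isFree_base b)).isIso
    ((isFree_base (a ⊗ b)).comp_iso (λ_ (𝟙_ FinN.{u}))) _ (elMul_baseμ a b)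

/-- The morphism `q^* F(X) ⊗ X_{a,A}^{⊗X} ⟶ F` with value the identity at the generic element. -/
def ev (F : qa A) (X : FinN.{u}) :
    (baseFunctor A).obj (F.functor.obj (op X)) ⊗ (pow (XaRel A) X.len).X ⟶ F :=
  (isFree_gen (F.functor.obj (op X)) X).desc (𝟙 _)

theorem gen_ev (F : qa A) (X : FinN.{u}) :
    gen (F.functor.obj (op X)) X ≫ (ev F X).natTrans.app (op X) = 𝟙 _ :=
  (isFree_gen (F.functor.obj (op X)) X).fac (𝟙 _)

theorem evalGen_ev (F : qa A) (X : FinN.{u}) : evalGen (ev F X) = 𝟙 _ := gen_ev F X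

theorem gen_ext {a : A} {X : FinN.{u}} {F : qa A}
    {s t : (baseFunctor A).obj a ⊗ (pow (XaRel A) X.len).X ⟶ F}
    (h : gen a X ≫ s.natTrans.app (op X) = gen a X ≫ t.natTrans.app (op X)) : s = t :=
  (isFree_gen a X).ext h

/-- As in the other identities for `ev` below, both sides start at a free presheaf and are compared
at its generator. -/
theorem ev_natural {F G : qa A} (t : F ⟶ G) (X : FinN.{u}) :
    (baseFunctor A).map (t.natTrans.app (op X)) ▷ (pow (XaRel A) X.len).X ≫ ev G X =
      ev F X ≫ t := by
  apply gen_ext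
  rw [comp_app, comp_app, reassoc_of% (gen_natural (t.natTrans.app (op X)) X), gen_ev,
    reassoc_of% gen_ev, Category.comp_id]

theorem ev_dinatural (F : qa A) {X Y : FinN.{u}} (f : X ⟶ Y) :
    (baseFunctor A).map (F.functor.map f.op) ▷ (pow (XaRel A) X.len).X ≫ ev F X =
      (baseFunctor A).obj (F.functor.obj (op Y)) ◁ algMap (powMap (XaRel A) f) ≫ ev F Y := by
  apply gen_ext
  rw [comp_app, comp_app, reassoc_of% (gen_natural (F.functor.map f.op) X), gen_ev,
    reassoc_of% (gen_powMap (F.functor.obj (op Y)) f), pair_nat_app, reassoc_of% gen_ev,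
    Category.comp_id]

theorem ev_mul (F G : qa A) (X Y : FinN.{u}) : (ev F X ⊗ₘ ev G Y) =
    tensorμ _ _ _ _ ≫ (Functor.LaxMonoidal.μ (baseFunctor A) _ _ ⊗ₘ
      algMap (phiμ (XaRel A) X Y)) ≫ (baseFunctor A).map (pair F G X Y) ▷ _ ≫
        ev (F ⊗ G) (X ⊗ Y) := by
  apply ((isFree_gen (F.functor.obj (op X)) X).tensor (isFree_gen (G.functor.obj (op Y)) Y)).ext
  have h₁ := gen_mul (F.functor.obj (op X)) (G.functor.obj (op Y)) X Y
  have h₂ := elMul_app (gen (F.functor.obj (op X)) X) (gen (G.functor.obj (op Y)) Y)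
    (ev F X) (ev G Y)
  rw [comp_app] at h₁
  rw [gen_ev, gen_ev] at h₂
  change elMul (gen (F.functor.obj (op X)) X) (gen (G.functor.obj (op Y)) Y) ≫
      (ev F X ⊗ₘ ev G Y).natTrans.app (op (X ⊗ Y)) =
    elMul (gen (F.functor.obj (op X)) X) (gen (G.functor.obj (op Y)) Y) ≫ _
  rw [← h₂, comp_app, comp_app, comp_app]
  have h₃ := h₁ =≫ (((baseFunctor A).map (pair F G X Y) ▷
    (pow (XaRel A) (X ⊗ Y).len).X).natTrans.app (op (X ⊗ Y)) ≫
      (ev (F ⊗ G) (X ⊗ Y)).natTrans.app (op (X ⊗ Y)))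
  rw [Category.assoc, Category.assoc] at h₃
  refine Eq.trans ?_ h₃.symm
  have h₄ := gen_natural (pair F G X Y) (X ⊗ Y)
  rw [reassoc_of% h₄, gen_ev, Category.comp_id, elMul, id_tensorHom_id, Category.id_comp]

/-- Evaluation at `∅` exhibits `q^* a` as a retract of one term of its own presentation. This
recovers the structure isomorphism over `A` of an inverse image functor from its presentation. -/
theorem ev_base (a : A) : (baseFunctor A).map (baseIncl a) ≫ (ρ_ _).inv ≫
    ev ((baseFunctor A).obj a) (𝟙_ _) = 𝟙 _ := by
  apply (isFree_base a).ext
  have h : baseIncl (((baseFunctor A).obj a).functor.obj (op (𝟙_ FinN.{u}))) ≫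
      ((ρ_ ((baseFunctor A).obj (((baseFunctor A).obj a).functor.obj
        (op (𝟙_ FinN.{u}))))).inv ≫ ev ((baseFunctor A).obj a) (𝟙_ _)).natTrans.app (op (𝟙_ _)) =
        𝟙 _ := (Category.assoc _ _ _).symm.trans
          ((gen_zero _).symm =≫ _ |>.trans (gen_ev ((baseFunctor A).obj a) (𝟙_ _)))
  have h' : baseIncl a ≫ ((baseFunctor A).map (baseIncl a) ≫ (ρ_ _).inv ≫
      ev ((baseFunctor A).obj a) (𝟙_ _)).natTrans.app (op (𝟙_ _)) = baseIncl a := by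
    rw [comp_app, reassoc_of% (baseIncl_natural (baseIncl a))]
    exact (baseIncl a ≫= h).trans (Category.comp_id _)
  exact h'.trans (Category.comp_id _).symm

/-- The analogous section for a tensor power, given by its universal element; it recovers the
comparison maps of tensor powers from a presentation. -/
theorem ev_pow (X : FinN.{u}) : (λ_ (pow (XaRel A) X.len).X).inv ≫
    (Functor.LaxMonoidal.ε (baseFunctor A) ≫ (baseFunctor A).map (genEl A X)) ▷ _ ≫
      ev (pow (XaRel A) X.len).X X = 𝟙 _ := by
  apply (isFree_pow (A := A) X.len).ext
  have h := gen_one (A := A) X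
  rw [comp_app] at h
  have h' : genEl A X ≫ ((λ_ (pow (XaRel A) X.len).X).inv ≫
      (Functor.LaxMonoidal.ε (baseFunctor A) ≫ (baseFunctor A).map (genEl A X)) ▷ _ ≫
      ev (pow (XaRel A) X.len).X X).natTrans.app (op X) = genEl A X := by
    rw [comp_whiskerRight, Category.assoc, comp_app, comp_app, comp_app, reassoc_of% h,
      reassoc_of% gen_natural, gen_ev, Category.comp_id]
  exact h'.trans (Category.comp_id _).symm

theorem ev_unit : (λ_ (𝟙_ (qa A))).inv ≫ (Functor.LaxMonoidal.ε (baseFunctor A) ≫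
    (baseFunctor A).map unitPt) ▷ 𝟙_ (qa A) ≫ ev (𝟙_ (qa A)) (𝟙_ _) = 𝟙 _ :=
  ev_pow (𝟙_ FinN.{u})
end
end
end AlgClassifier

/-! ### Functors presented as coends, and their right adjoints. -/

namespace AlgClassifier
noncomputable section

section
variable {A : Type w} [Category.{u} A] [MonoidalCategory A] {B : Type w'} [Category.{u} B]
variable (E : A × FinN.{u} ⥤ B)

/-- The action of a functor of two variables on a pair of morphisms. -/
def biMap {a b : A} {X Y : FinN.{u}} (f : a ⟶ b) (g : X ⟶ Y) : E.obj (a, X) ⟶ E.obj (b, Y) :=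
  E.map (Prod.mkHom f g)

theorem biMap_comp {a b c : A} {X Y Z : FinN.{u}} (f : a ⟶ b) (f' : b ⟶ c) (g : X ⟶ Y)
    (g' : Y ⟶ Z) : biMap E f g ≫ biMap E f' g' = biMap E (f ≫ f') (g ≫ g') :=
  (E.map_comp (X := (a, X)) (Y := (b, Y)) (Z := (c, Z)) _ _).symm

theorem biMap_id (a : A) (X : FinN.{u}) : biMap E (𝟙 a) (𝟙 X) = 𝟙 _ := E.map_id (a, X)

theorem biMap_comm {a b : A} {X Y : FinN.{u}} (f : a ⟶ b) (g : X ⟶ Y) :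
    biMap E (𝟙 a) g ≫ biMap E f (𝟙 Y) = biMap E f (𝟙 X) ≫ biMap E (𝟙 b) g := by
  rw [biMap_comp, biMap_comp, Category.comp_id, Category.id_comp, Category.comp_id,
    Category.id_comp]

theorem biMap_left_comp {a b c : A} {X : FinN.{u}} (f : a ⟶ b) (f' : b ⟶ c) :
    biMap E (f ≫ f') (𝟙 X) = biMap E f (𝟙 X) ≫ biMap E f' (𝟙 X) := by
  rw [biMap_comp, Category.comp_id]

theorem biMap_right_comp {a : A} {X Y Z : FinN.{u}} (g : X ⟶ Y) (g' : Y ⟶ Z) :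
    biMap E (𝟙 a) (g ≫ g') = biMap E (𝟙 a) g ≫ biMap E (𝟙 a) g' := by
  rw [biMap_comp, Category.comp_id]

/-- A functor of two variables with the second variable fixed. -/
abbrev leftPart (X : FinN.{u}) : A ⥤ B := Prod.sectL A X ⋙ E

/-- A description of the values of a functor `Φ` on presheaves as coends: `Φ F` is the universal
recipient of a dinatural family of maps from the objects `E (F X, X)`. -/
structure Presentation (Φ : qa A ⥤ B) where
  π (F : qa A) (X : FinN.{u}) : E.obj (F.functor.obj (op X), X) ⟶ Φ.obj F
  natural {F G : qa A} (t : F ⟶ G) (X : FinN.{u}) :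
    biMap E (t.natTrans.app (op X)) (𝟙 X) ≫ π G X = π F X ≫ Φ.map t
  dinatural (F : qa A) {X Y : FinN.{u}} (f : X ⟶ Y) :
    biMap E (F.functor.map f.op) (𝟙 X) ≫ π F X = biMap E (𝟙 _) f ≫ π F Y
  universal (F : qa A) (W : B) (t : ∀ X : FinN.{u}, E.obj (F.functor.obj (op X), X) ⟶ W)
    (ht : ∀ {X Y : FinN.{u}} (f : X ⟶ Y),
      biMap E (F.functor.map f.op) (𝟙 X) ≫ t X = biMap E (𝟙 _) f ≫ t Y) :
    ∃! g : Φ.obj F ⟶ W, ∀ X, π F X ≫ g = t X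

namespace Presentation
variable {E} {Φ : qa A ⥤ B} (P : Presentation E Φ)

theorem biMap_π {F : qa A} {a : A} {X Y : FinN.{u}} (x : a ⟶ F.functor.obj (op Y)) (f : X ⟶ Y) :
    biMap E x f ≫ P.π F Y = biMap E (x ≫ F.functor.map f.op) (𝟙 X) ≫ P.π F X := by
  rw [biMap_left_comp, Category.assoc, P.dinatural, reassoc_of% biMap_comp, Category.comp_id,
    Category.id_comp]

theorem hom_ext {F : qa A} {W : B} {g h : Φ.obj F ⟶ W} (w : ∀ X, P.π F X ≫ g = P.π F X ≫ h) :
    g = h :=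
  (P.universal F W (fun X => P.π F X ≫ h) (fun f => by
    rw [← Category.assoc, P.dinatural, Category.assoc])).unique w (fun _ => rfl)

/-- The morphism out of `Φ F` given by a dinatural family. -/
def desc {F : qa A} {W : B} (t : ∀ X : FinN.{u}, E.obj (F.functor.obj (op X), X) ⟶ W)
    (ht : ∀ {X Y : FinN.{u}} (f : X ⟶ Y),
      biMap E (F.functor.map f.op) (𝟙 X) ≫ t X = biMap E (𝟙 _) f ≫ t Y) : Φ.obj F ⟶ W :=
  (P.universal F W t ht).choose

theorem fac {F : qa A} {W : B} (t : ∀ X : FinN.{u}, E.obj (F.functor.obj (op X), X) ⟶ W)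
    (ht : ∀ {X Y : FinN.{u}} (f : X ⟶ Y),
      biMap E (F.functor.map f.op) (𝟙 X) ≫ t X = biMap E (𝟙 _) f ≫ t Y) (X : FinN.{u}) :
    P.π F X ≫ P.desc t ht = t X :=
  (P.universal F W t ht).choose_spec.1 X

end Presentation

section
variable [∀ X, (leftPart E X).IsLeftAdjoint]

/-- The transpose of a morphism to the right adjoint of `E (-, X)`. -/
def transpose {a : A} {X : FinN.{u}} {W : B} :
    (E.obj (a, X) ⟶ W) ≃ (a ⟶ (leftPart E X).rightAdjoint.obj W) :=
  (Adjunction.ofIsLeftAdjoint (leftPart E X)).homEquiv a W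

theorem transpose_comp {a b : A} {X : FinN.{u}} {W : B} (f : a ⟶ b) (t : E.obj (b, X) ⟶ W) :
    transpose E (biMap E f (𝟙 X) ≫ t) = f ≫ transpose E t :=
  Adjunction.homEquiv_naturality_left _ _ _

theorem transpose_comp_symm {a b : A} {X : FinN.{u}} {W : B} (f : a ⟶ b)
    (t : b ⟶ (leftPart E X).rightAdjoint.obj W) :
    (transpose E).symm (f ≫ t) = biMap E f (𝟙 X) ≫ (transpose E).symm t := by
  rw [Equiv.symm_apply_eq, transpose_comp, Equiv.apply_symm_apply]

/-- The mate of `E (-, f)`: on transposes it acts by precomposition with `E (a, f)`. -/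
def coendRightMap (W : B) {X Y : FinN.{u}} (f : X ⟶ Y) :
    (leftPart E Y).rightAdjoint.obj W ⟶ (leftPart E X).rightAdjoint.obj W :=
  transpose E (biMap E (𝟙 _) f ≫ (transpose E).symm (𝟙 _))

theorem comp_coendRightMap {W : B} {X Y : FinN.{u}} (f : X ⟶ Y) {a : A} (t : E.obj (a, Y) ⟶ W) :
    transpose E t ≫ coendRightMap E W f = transpose E (biMap E (𝟙 a) f ≫ t) := by
  rw [coendRightMap, ← transpose_comp, ← reassoc_of% biMap_comm, ← transpose_comp_symm,
    Category.comp_id, Equiv.symm_apply_apply]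

/-- The presheaf `X ↦ Hom(E (-, X), W)`. -/
def coendRight (W : B) : qa A where
  functor :=
    { obj X := (leftPart E (unop X)).rightAdjoint.obj W
      map f := coendRightMap E W f.unop
      map_id X := by
        rw [coendRightMap, unop_id, biMap_id, Category.id_comp, Equiv.apply_symm_apply]
      map_comp f g := by
        rw [unop_comp]
        refine Eq.trans ?_ (comp_coendRightMap E g.unop _).symm
        rw [← Category.assoc, ← biMap_right_comp]
        rfl }

/-- Elements of the presheaf `coendRight E W`. -/
def coendEl {a : A} {X : FinN.{u}} {W : B} :
    (E.obj (a, X) ⟶ W) ≃ (a ⟶ (coendRight E W).functor.obj (op X)) := transpose E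

theorem coendEl_comp {a b : A} {X : FinN.{u}} {W : B} (f : a ⟶ b) (t : E.obj (b, X) ⟶ W) :
    coendEl E (biMap E f (𝟙 X) ≫ t) = f ≫ coendEl E t := transpose_comp E f t

theorem coendEl_map {W : B} {X Y : FinN.{u}} (f : X ⟶ Y) {a : A} (t : E.obj (a, Y) ⟶ W) :
    coendEl E (biMap E (𝟙 a) f ≫ t) = coendEl E t ≫ (coendRight E W).functor.map f.op :=
  (comp_coendRightMap E f t).symm

namespace Presentation
variable {E} {Φ : qa A ⥤ B} (P : Presentation E Φ)

theorem coendEl_natural {F : qa A} {W : B}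
    (t : ∀ X : FinN.{u}, E.obj (F.functor.obj (op X), X) ⟶ W) {X Y : FinN.{u}} (f : X ⟶ Y) :
    F.functor.map f.op ≫ coendEl E (t X) = coendEl E (t Y) ≫ (coendRight E W).functor.map f.op ↔
      biMap E (F.functor.map f.op) (𝟙 X) ≫ t X = biMap E (𝟙 _) f ≫ t Y := by
  rw [← coendEl_comp, ← coendEl_map, (coendEl E).apply_eq_iff_eq]

/-- Transposing each component turns a dinatural family `E (F X, X) ⟶ W` into a natural
transformation from `F` to `coendRight E W`, dinaturality becoming naturality. Hence presented
functors are left adjoints. -/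
def homEquiv (F : qa A) (W : B) : (Φ.obj F ⟶ W) ≃ (F ⟶ coendRight E W) where
  toFun g := ⟨{ app := fun X => coendEl E (P.π F (unop X) ≫ g)
                naturality := fun X Y f => (coendEl_natural (fun X => P.π F X ≫ g) f.unop).2
                  (by rw [← Category.assoc, P.dinatural, Category.assoc]) }⟩
  invFun t := P.desc (fun X => (coendEl E).symm (t.natTrans.app (op X))) (fun f => by
    rw [← coendEl_natural (t := fun X => (coendEl E).symm (t.natTrans.app (op X))),
      Equiv.apply_symm_apply, Equiv.apply_symm_apply]
    exact t.natTrans.naturality f.op)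
  left_inv g := P.hom_ext fun X => by
    rw [P.fac]
    exact (coendEl E).symm_apply_apply _
  right_inv t := by
    apply DayFunctor.hom_ext
    ext X
    change coendEl E (P.π F (unop X) ≫ P.desc _ _) = _
    rw [P.fac]
    exact (coendEl E).apply_symm_apply _

theorem homEquiv_app (F : qa A) (W : B) (g : Φ.obj F ⟶ W) (X : FinN.{u}) :
    (P.homEquiv F W g).natTrans.app (op X) = coendEl E (P.π F X ≫ g) := rfl

include P in
theorem isLeftAdjoint : Φ.IsLeftAdjoint :=
  (Adjunction.adjunctionOfEquivRight (fun F W => P.homEquiv F W) (fun F' F W t g => by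
    apply DayFunctor.hom_ext
    ext X
    change coendEl E (P.π F' (unop X) ≫ Φ.map t ≫ g) =
      t.natTrans.app X ≫ coendEl E (P.π F (unop X) ≫ g)
    rw [← coendEl_comp, ← Category.assoc, ← P.natural, Category.assoc])).isLeftAdjoint

end Presentation
end

namespace Presentation
variable {E} {Φ : qa A ⥤ B} (P : Presentation E Φ)
/-- A morphism out of the image of `Φ F` under a left adjoint functor. -/
theorem existsUnique_map {C : Type w''} [Category.{u} C] (L : B ⥤ C) [L.IsLeftAdjoint] (F : qa A)
    (W : C) (t : ∀ X : FinN.{u}, L.obj (E.obj (F.functor.obj (op X), X)) ⟶ W)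
    (ht : ∀ {X Y : FinN.{u}} (f : X ⟶ Y), L.map (biMap E (F.functor.map f.op) (𝟙 X)) ≫ t X =
      L.map (biMap E (𝟙 _) f) ≫ t Y) :
    ∃! g : L.obj (Φ.obj F) ⟶ W, ∀ X, L.map (P.π F X) ≫ g = t X := by
  let adj := Adjunction.ofIsLeftAdjoint L
  obtain ⟨g, hg, hu⟩ := P.universal F (L.rightAdjoint.obj W)
    (fun X => adj.homEquiv _ _ (t X)) (fun f => by
      rw [← Adjunction.homEquiv_naturality_left, ← Adjunction.homEquiv_naturality_left, ht])
  refine ⟨(adj.homEquiv _ _).symm g, fun X => ?_, fun h hh => ?_⟩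
  · rw [← Adjunction.homEquiv_naturality_left_symm, Equiv.symm_apply_eq, hg]
  · rw [Equiv.eq_symm_apply]
    refine hu _ fun X => ?_
    rw [← Adjunction.homEquiv_naturality_left, hh]

theorem map_hom_ext {C : Type w''} [Category.{u} C] (L : B ⥤ C) [L.IsLeftAdjoint] {F : qa A}
    {W : C} {g h : L.obj (Φ.obj F) ⟶ W} (w : ∀ X, L.map (P.π F X) ≫ g = L.map (P.π F X) ≫ h) :
    g = h :=
  (P.existsUnique_map L F W (fun X => L.map (P.π F X) ≫ h) (fun f => by
    rw [← Category.assoc, ← L.map_comp, P.dinatural, L.map_comp, Category.assoc])).unique w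
    (fun _ => rfl)

variable {E' : A × FinN.{u} ⥤ B} {Φ' : qa A ⥤ B} (P' : Presentation E' Φ')

theorem natTrans_biMap (ψ : E ⟶ E') {a b : A} {X Y : FinN.{u}} (f : a ⟶ b) (g : X ⟶ Y) :
    biMap E f g ≫ ψ.app (b, Y) = ψ.app (a, X) ≫ biMap E' f g := ψ.naturality _

theorem dinatural_natTrans (ψ : E ⟶ E') (F : qa A) {X Y : FinN.{u}} (f : X ⟶ Y) :
    biMap E (F.functor.map f.op) (𝟙 X) ≫ ψ.app (F.functor.obj (op X), X) ≫ P'.π F X =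
      biMap E (𝟙 _) f ≫ ψ.app (F.functor.obj (op Y), Y) ≫ P'.π F Y := by
  rw [← Category.assoc, natTrans_biMap, Category.assoc, P'.dinatural, ← Category.assoc,
    ← natTrans_biMap, Category.assoc]

def mapApp (ψ : E ⟶ E') (F : qa A) : Φ.obj F ⟶ Φ'.obj F :=
  P.desc (fun X => ψ.app (F.functor.obj (op X), X) ≫ P'.π F X) (P'.dinatural_natTrans ψ F)

theorem π_mapApp (ψ : E ⟶ E') (F : qa A) (X : FinN.{u}) : P.π F X ≫ P.mapApp P' ψ F =
    ψ.app (F.functor.obj (op X), X) ≫ P'.π F X := P.fac _ (P'.dinatural_natTrans ψ F) X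

/-- The morphism of presented functors given by a morphism of the presenting functors. -/
def map (ψ : E ⟶ E') : Φ ⟶ Φ' where
  app F := P.mapApp P' ψ F
  naturality F G t := P.hom_ext fun X => by
    rw [← Category.assoc, ← P.natural, Category.assoc, π_mapApp, reassoc_of% π_mapApp, ← P'.natural,
      ← Category.assoc, natTrans_biMap, Category.assoc]

theorem π_map (ψ : E ⟶ E') (F : qa A) (X : FinN.{u}) : P.π F X ≫ (P.map P' ψ).app F =
    ψ.app (F.functor.obj (op X), X) ≫ P'.π F X := P.π_mapApp P' ψ F X

theorem natTrans_ext {Ψ : qa A ⥤ B} {s t : Φ ⟶ Ψ}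
    (h : ∀ F X, P.π F X ≫ s.app F = P.π F X ≫ t.app F) : s = t := by
  ext F
  exact P.hom_ext (h F)
end Presentation
end
end
end AlgClassifier

/-! ### Symmetric monoidal structures on presented functors. -/

namespace AlgClassifier
noncomputable section

section
variable {A : Type w} [Category.{u} A] [MonoidalCategory A] [CocontinuousTensor A]
  {B : Type w'} [Category.{u} B] [MonoidalCategory B]
variable (E : A × FinN.{u} ⥤ B) [E.LaxMonoidal]

/-- The tensorator of a functor of two variables. -/
def biμ (a b : A) (X Y : FinN.{u}) : E.obj (a, X) ⊗ E.obj (b, Y) ⟶ E.obj (a ⊗ b, X ⊗ Y) :=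
  Functor.LaxMonoidal.μ E (a, X) (b, Y)

/-- The unit of a functor of two variables. -/
def biε : 𝟙_ B ⟶ E.obj (𝟙_ A, 𝟙_ FinN.{u}) := Functor.LaxMonoidal.ε E

theorem biμ_natural {a a' b b' : A} {X X' Y Y' : FinN.{u}} (f : a ⟶ a') (f' : b ⟶ b')
    (g : X ⟶ X') (g' : Y ⟶ Y') : (biMap E f g ⊗ₘ biMap E f' g') ≫ biμ E a' b' X' Y' =
      biμ E a b X Y ≫ biMap E (f ⊗ₘ f') (g ⊗ₘ g') :=
  Functor.LaxMonoidal.μ_natural E (X := (a, X)) (Y := (a', X')) (X' := (b, Y)) (Y' := (b', Y'))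
    (Prod.mkHom f g) (Prod.mkHom f' g')

theorem biμ_natural_left {a a' b : A} {X X' Y : FinN.{u}} (f : a ⟶ a') (g : X ⟶ X') :
    biMap E f g ▷ E.obj (b, Y) ≫ biμ E a' b X' Y = biμ E a b X Y ≫ biMap E (f ▷ b) (g ▷ Y) := by
  have := biμ_natural E f (𝟙 b) g (𝟙 Y)
  rwa [biMap_id, tensorHom_id, tensorHom_id, tensorHom_id] at this

theorem biμ_natural_right {a b b' : A} {X Y Y' : FinN.{u}} (f : b ⟶ b') (g : Y ⟶ Y') :
    E.obj (a, X) ◁ biMap E f g ≫ biμ E a b' X Y' = biμ E a b X Y ≫ biMap E (a ◁ f) (X ◁ g) := by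
  have := biμ_natural E (𝟙 a) f (𝟙 X) g
  rwa [biMap_id, id_tensorHom, id_tensorHom, id_tensorHom] at this

theorem biμ_assoc (a b c : A) (X Y Z : FinN.{u}) :
    biμ E a b X Y ▷ E.obj (c, Z) ≫ biμ E (a ⊗ b) c (X ⊗ Y) Z ≫
      biMap E (α_ a b c).hom (α_ X Y Z).hom =
    (α_ _ _ _).hom ≫ E.obj (a, X) ◁ biμ E b c Y Z ≫ biμ E a (b ⊗ c) X (Y ⊗ Z) :=
  Functor.LaxMonoidal.associativity E (a, X) (b, Y) (c, Z)

theorem biε_left (a : A) (X : FinN.{u}) : (λ_ (E.obj (a, X))).hom =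
    biε E ▷ E.obj (a, X) ≫ biμ E (𝟙_ A) a (𝟙_ _) X ≫ biMap E (λ_ a).hom (λ_ X).hom :=
  Functor.LaxMonoidal.left_unitality E (a, X)

theorem biε_right (a : A) (X : FinN.{u}) : (ρ_ (E.obj (a, X))).hom =
    E.obj (a, X) ◁ biε E ≫ biμ E a (𝟙_ A) X (𝟙_ _) ≫ biMap E (ρ_ a).hom (ρ_ X).hom :=
  Functor.LaxMonoidal.right_unitality E (a, X)

variable {E}

namespace Presentation
variable {Φ : qa A ⥤ B} (P : Presentation E Φ)

/-- The value of the tensorator of a presented functor on the presenting objects. -/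
def mulπ (F G : qa A) (X Y : FinN.{u}) :
    E.obj (F.functor.obj (op X), X) ⊗ E.obj (G.functor.obj (op Y), Y) ⟶ Φ.obj (F ⊗ G) :=
  biμ E _ _ X Y ≫ biMap E (pair F G X Y) (𝟙 _) ≫ P.π (F ⊗ G) (X ⊗ Y)

theorem mulπ_natural {F F' G G' : qa A} (s : F ⟶ F') (t : G ⟶ G') (X Y : FinN.{u}) :
    (biMap E (s.natTrans.app (op X)) (𝟙 X) ⊗ₘ biMap E (t.natTrans.app (op Y)) (𝟙 Y)) ≫
      P.mulπ F' G' X Y = P.mulπ F G X Y ≫ Φ.map (s ⊗ₘ t) := by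
  rw [mulπ, reassoc_of% biμ_natural, id_tensorHom_id, ← Category.assoc (biMap E _ _), biMap_comp,
    ← pair_tensorHom, Category.comp_id, biMap_left_comp, Category.assoc, P.natural, mulπ]
  simp only [Category.assoc]

theorem mulπ_dinatural (F G : qa A) {X X' Y Y' : FinN.{u}} (f : X ⟶ X') (g : Y ⟶ Y') :
    (biMap E (F.functor.map f.op) (𝟙 X) ⊗ₘ biMap E (G.functor.map g.op) (𝟙 Y)) ≫
      P.mulπ F G X Y = (biMap E (𝟙 _) f ⊗ₘ biMap E (𝟙 _) g) ≫ P.mulπ F G X' Y' := by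
  rw [mulπ, mulπ, reassoc_of% biμ_natural, reassoc_of% biμ_natural, id_tensorHom_id,
    ← Category.assoc (biMap E _ _), biMap_comp, pair_natural, Category.comp_id, biMap_left_comp,
    Category.assoc, P.dinatural, id_tensorHom_id, reassoc_of% biMap_comm]

variable [∀ b : B, (tensorLeft b).IsLeftAdjoint] [∀ b : B, (tensorRight b).IsLeftAdjoint]

/-- `tensorLeft` and `tensorRight` are left adjoints, so the universal property of a presentation
survives tensoring and can be used in one variable after the other. -/
theorem tensor_hom_ext {F G : qa A} {W : B} {g h : Φ.obj F ⊗ Φ.obj G ⟶ W}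
    (w : ∀ X Y, (P.π F X ⊗ₘ P.π G Y) ≫ g = (P.π F X ⊗ₘ P.π G Y) ≫ h) : g = h := by
  refine P.map_hom_ext (tensorRight (Φ.obj G)) fun X => ?_
  refine P.map_hom_ext (tensorLeft (E.obj (F.functor.obj (op X), X))) fun Y => ?_
  have := w X Y
  rw [MonoidalCategory.tensorHom_def'] at this
  simpa using this

theorem tensor_hom_ext₃ {F G H : qa A} {W : B} {g h : (Φ.obj F ⊗ Φ.obj G) ⊗ Φ.obj H ⟶ W}
    (w : ∀ X Y Z, ((P.π F X ⊗ₘ P.π G Y) ⊗ₘ P.π H Z) ≫ g =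
      ((P.π F X ⊗ₘ P.π G Y) ⊗ₘ P.π H Z) ≫ h) : g = h := by
  refine P.map_hom_ext (tensorRight (Φ.obj G) ⋙ tensorRight (Φ.obj H)) fun X => ?_
  refine P.map_hom_ext (tensorLeft (E.obj (F.functor.obj (op X), X)) ⋙
    tensorRight (Φ.obj H)) fun Y => ?_
  refine P.map_hom_ext (tensorLeft (E.obj (F.functor.obj (op X), X) ⊗
    E.obj (G.functor.obj (op Y), Y))) fun Z => ?_
  have := w X Y Z
  rw [MonoidalCategory.tensorHom_def' (P.π F X ⊗ₘ P.π G Y),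
    MonoidalCategory.tensorHom_def' (P.π F X)] at this
  simpa using this

theorem existsUnique_tensor (F G : qa A) (W : B)
    (t : ∀ X Y : FinN.{u},
      E.obj (F.functor.obj (op X), X) ⊗ E.obj (G.functor.obj (op Y), Y) ⟶ W)
    (ht : ∀ {X X' Y Y' : FinN.{u}} (f : X ⟶ X') (g : Y ⟶ Y'),
      (biMap E (F.functor.map f.op) (𝟙 X) ⊗ₘ biMap E (G.functor.map g.op) (𝟙 Y)) ≫ t X Y =
        (biMap E (𝟙 _) f ⊗ₘ biMap E (𝟙 _) g) ≫ t X' Y') :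
    ∃ h : Φ.obj F ⊗ Φ.obj G ⟶ W, ∀ X Y, (P.π F X ⊗ₘ P.π G Y) ≫ h = t X Y := by
  have h₁ (X : FinN.{u}) := P.existsUnique_map
    (tensorLeft (E.obj (F.functor.obj (op X), X))) G W (t X) (fun {Y Y'} g => by
      have := ht (𝟙 X) g
      simpa [biMap_id] using this)
  choose s hs _ using h₁
  -- The family has been extended in `Y` for each `X`. The dinaturality in `X` of the extensions is
  -- itself tested on the presenting maps in `Y`.
  obtain ⟨h, hh, _⟩ := P.existsUnique_map (tensorRight (Φ.obj G)) F W s (fun {X X'} f => by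
    refine P.map_hom_ext (tensorLeft (E.obj (F.functor.obj (op X'), X))) fun Y => ?_
    have := ht f (𝟙 Y)
    have h₁ := hs X Y
    have h₂ := hs X' Y
    dsimp at h₁ h₂ ⊢
    rw [whisker_exchange_assoc, whisker_exchange_assoc, h₁, h₂]
    simpa [biMap_id] using this)
  refine ⟨h, fun X Y => ?_⟩
  have h₁ := hs X Y
  have h₂ := hh X
  dsimp at h₁ h₂
  rw [MonoidalCategory.tensorHom_def', Category.assoc, h₂, h₁]

/-- The tensorator of a presented functor. -/
def lμ (F G : qa A) : Φ.obj F ⊗ Φ.obj G ⟶ Φ.obj (F ⊗ G) :=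
  (P.existsUnique_tensor F G _ (P.mulπ F G) (P.mulπ_dinatural F G)).choose

theorem π_lμ (F G : qa A) (X Y : FinN.{u}) :
    (P.π F X ⊗ₘ P.π G Y) ≫ P.lμ F G = P.mulπ F G X Y :=
  (P.existsUnique_tensor F G _ (P.mulπ F G) (P.mulπ_dinatural F G)).choose_spec X Y

/-- The unit of a presented functor. -/
def lε : 𝟙_ B ⟶ Φ.obj (𝟙_ (qa A)) := biε E ≫ biMap E unitPt (𝟙 _) ≫ P.π (𝟙_ _) (𝟙_ _)

theorem lμ_natural {F F' G G' : qa A} (s : F ⟶ F') (t : G ⟶ G') :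
    (Φ.map s ⊗ₘ Φ.map t) ≫ P.lμ F' G' = P.lμ F G ≫ Φ.map (s ⊗ₘ t) :=
  P.tensor_hom_ext fun X Y => by
    rw [tensorHom_comp_tensorHom_assoc, ← P.natural, ← P.natural,
      ← tensorHom_comp_tensorHom_assoc, π_lμ, mulπ_natural, reassoc_of% π_lμ]

theorem lμ_assoc (F G H : qa A) : P.lμ F G ▷ Φ.obj H ≫ P.lμ (F ⊗ G) H ≫ Φ.map (α_ F G H).hom =
    (α_ _ _ _).hom ≫ Φ.obj F ◁ P.lμ G H ≫ P.lμ F (G ⊗ H) :=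
  P.tensor_hom_ext₃ fun X Y Z => by
    have h₁ : ((P.π F X ⊗ₘ P.π G Y) ⊗ₘ P.π H Z) ≫ P.lμ F G ▷ Φ.obj H ≫ P.lμ (F ⊗ G) H =
        biμ E _ _ X Y ▷ _ ≫ biμ E _ _ (X ⊗ Y) Z ≫ biMap E (pair F G X Y ▷ _) (𝟙 _) ≫
          biMap E (pair (F ⊗ G) H (X ⊗ Y) Z) (𝟙 _) ≫ P.π ((F ⊗ G) ⊗ H) ((X ⊗ Y) ⊗ Z) := by
      rw [← tensorHom_id, tensorHom_comp_tensorHom_assoc, π_lμ, Category.comp_id, mulπ,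
        ← Category.id_comp (P.π H Z), ← tensorHom_comp_tensorHom_assoc,
        ← Category.id_comp (P.π H Z), ← tensorHom_comp_tensorHom_assoc, π_lμ, mulπ,
        tensorHom_id, tensorHom_id, reassoc_of% biμ_natural_left, id_whiskerRight]
    have h₂ : ((P.π F X ⊗ₘ P.π G Y) ⊗ₘ P.π H Z) ≫ (α_ _ _ _).hom ≫ Φ.obj F ◁ P.lμ G H ≫
        P.lμ F (G ⊗ H) = (α_ _ _ _).hom ≫ _ ◁ biμ E _ _ Y Z ≫ biμ E _ _ X (Y ⊗ Z) ≫
          biMap E (_ ◁ pair G H Y Z) (𝟙 _) ≫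
          biMap E (pair F (G ⊗ H) X (Y ⊗ Z)) (𝟙 _) ≫ P.π (F ⊗ G ⊗ H) (X ⊗ Y ⊗ Z) := by
      rw [associator_naturality_assoc, ← id_tensorHom, tensorHom_comp_tensorHom_assoc, π_lμ,
        Category.comp_id, mulπ,
        ← Category.id_comp (P.π F X), ← tensorHom_comp_tensorHom_assoc,
        ← Category.id_comp (P.π F X), ← tensorHom_comp_tensorHom_assoc, π_lμ, mulπ,
        id_tensorHom, id_tensorHom, reassoc_of% biμ_natural_right, MonoidalCategory.whiskerLeft_id]
    -- Both sides are now threefold products of presenting objects followed by `π`; associativity of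
    -- the tensorator of `E` and of `pair` identifies them.
    have h₃ := biμ_assoc E (F.functor.obj (op X)) (G.functor.obj (op Y)) (H.functor.obj (op Z))
      X Y Z
    rw [h₂, ← reassoc_of% h₃, reassoc_of% h₁, ← P.natural, ← reassoc_of% biMap_left_comp,
      ← reassoc_of% biMap_left_comp, ← reassoc_of% biMap_left_comp, reassoc_of% biMap_comp, Category.comp_id,
      P.biMap_π _ (α_ X Y Z).hom, Category.assoc, pair_assoc]
    simp only [Category.assoc]

theorem lε_π_lμ (F : qa A) (X : FinN.{u}) : (P.lε ⊗ₘ P.π F X) ≫ P.lμ (𝟙_ _) F =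
    biε E ▷ E.obj (F.functor.obj (op X), X) ≫ biμ E (𝟙_ A) _ (𝟙_ _) X ≫
      biMap E (unitPt ▷ _ ≫ pair (𝟙_ (qa A)) F (𝟙_ _) X) (𝟙 _) ≫ P.π _ (𝟙_ _ ⊗ X) := by
  rw [lε, ← Category.assoc, ← Category.id_comp (P.π F X), ← tensorHom_comp_tensorHom_assoc, π_lμ,
    mulπ, tensorHom_id, comp_whiskerRight_assoc, reassoc_of% biμ_natural_left, id_whiskerRight,
    reassoc_of% biMap_left_comp]

theorem π_lε_lμ (F : qa A) (X : FinN.{u}) : (P.π F X ⊗ₘ P.lε) ≫ P.lμ F (𝟙_ _) =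
    E.obj (F.functor.obj (op X), X) ◁ biε E ≫ biμ E _ (𝟙_ A) X (𝟙_ _) ≫
      biMap E (_ ◁ unitPt ≫ pair F (𝟙_ (qa A)) X (𝟙_ _)) (𝟙 _) ≫ P.π _ (X ⊗ 𝟙_ _) := by
  rw [lε, ← Category.assoc, ← Category.id_comp (P.π F X), ← tensorHom_comp_tensorHom_assoc, π_lμ,
    mulπ, id_tensorHom, MonoidalCategory.whiskerLeft_comp_assoc, reassoc_of% biμ_natural_right,
    MonoidalCategory.whiskerLeft_id, reassoc_of% biMap_left_comp]

theorem lμ_left (F : qa A) : (λ_ (Φ.obj F)).hom =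
    P.lε ▷ Φ.obj F ≫ P.lμ (𝟙_ _) F ≫ Φ.map (λ_ F).hom := by
  refine P.map_hom_ext (tensorLeft (𝟙_ B)) fun X => ?_
  have h := pair_left F X
  dsimp
  rw [leftUnitor_naturality, ← MonoidalCategory.tensorHom_def'_assoc, reassoc_of% lε_π_lμ, ← P.natural,
    ← reassoc_of% biMap_left_comp, Category.assoc, h, ← P.biMap_π, biε_left]
  simp only [Category.assoc]

theorem lμ_right (F : qa A) : (ρ_ (Φ.obj F)).hom =
    Φ.obj F ◁ P.lε ≫ P.lμ F (𝟙_ _) ≫ Φ.map (ρ_ F).hom := by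
  refine P.map_hom_ext (tensorRight (𝟙_ B)) fun X => ?_
  have h := pair_right F X
  dsimp
  rw [rightUnitor_naturality, ← MonoidalCategory.tensorHom_def_assoc, reassoc_of% π_lε_lμ, ← P.natural,
    ← reassoc_of% biMap_left_comp, Category.assoc, h, ← P.biMap_π, biε_right]
  simp only [Category.assoc]

/-- The monoidal structure of a presented functor. -/
abbrev laxMonoidal : Φ.LaxMonoidal where
  ε := P.lε
  μ := P.lμ
  μ_natural_left f G := by
    have := P.lμ_natural f (𝟙 G)
    rwa [CategoryTheory.Functor.map_id, tensorHom_id, tensorHom_id] at this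
  μ_natural_right G f := by
    have := P.lμ_natural (𝟙 G) f
    rwa [CategoryTheory.Functor.map_id, id_tensorHom, id_tensorHom] at this
  associativity := P.lμ_assoc
  left_unitality := P.lμ_left
  right_unitality := P.lμ_right

/-- Compatibility of a presentation with monoidal structures. -/
class IsMonoidal [Φ.LaxMonoidal] : Prop where
  mul (F G : qa A) (X Y : FinN.{u}) :
    (P.π F X ⊗ₘ P.π G Y) ≫ Functor.LaxMonoidal.μ Φ F G = P.mulπ F G X Y
  one : Functor.LaxMonoidal.ε Φ = P.lε

section
variable {E' : A × FinN.{u} ⥤ B} [E'.LaxMonoidal] {Φ' : qa A ⥤ B} (P' : Presentation E' Φ')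
  [Φ.LaxMonoidal] [Φ'.LaxMonoidal] [P.IsMonoidal] [P'.IsMonoidal]

/-- Tensorators of presented functors are determined on products of presenting objects, where the
claim is the monoidality of `ψ`. -/
theorem isMonoidal_map (ψ : E ⟶ E') [NatTrans.IsMonoidal ψ] :
    NatTrans.IsMonoidal (P.map P' ψ) where
  unit := by
    have h : biε E ≫ ψ.app _ = biε E' := NatTrans.IsMonoidal.unit
    rw [IsMonoidal.one (P := P), IsMonoidal.one (P := P'), lε, lε, Category.assoc,
      Category.assoc, π_map, ← Category.assoc (biMap _ _ _), natTrans_biMap, Category.assoc,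
      reassoc_of% h]
  tensor F G := P.tensor_hom_ext fun X Y => by
    have h : biμ E _ _ X Y ≫ ψ.app _ = (ψ.app (F.functor.obj (op X), X) ⊗ₘ
      ψ.app (G.functor.obj (op Y), Y)) ≫ biμ E' _ _ X Y := NatTrans.IsMonoidal.tensor _ _
    rw [tensorHom_comp_tensorHom_assoc, π_map, π_map, ← tensorHom_comp_tensorHom_assoc,
      IsMonoidal.mul (P := P'), reassoc_of% (IsMonoidal.mul (P := P)), mulπ, mulπ, Category.assoc,
      Category.assoc, π_map, ← Category.assoc (biMap _ _ _), natTrans_biMap, Category.assoc,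
      reassoc_of% h]
end
end Presentation
end

section
variable {A : Type w} [Category.{u} A] [MonoidalCategory A] [SymmetricCategory A]
  [CocontinuousTensor A] {B : Type w'} [Category.{u} B] [MonoidalCategory B] [SymmetricCategory B]
  [∀ b : B, (tensorLeft b).IsLeftAdjoint] [∀ b : B, (tensorRight b).IsLeftAdjoint]
  {E : A × FinN.{u} ⥤ B} {Φ : qa A ⥤ B}

namespace Presentation

/-- The symmetric monoidal structure of a presented functor. -/
abbrev laxBraided [E.LaxBraided] (P : Presentation E Φ) : Φ.LaxBraided where
  toLaxMonoidal := P.laxMonoidal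
  braided F G := P.tensor_hom_ext fun X Y => by
    have h₁ : biμ E (F.functor.obj (op X)) (G.functor.obj (op Y)) X Y ≫
        biMap E (β_ _ _).hom (β_ X Y).hom = (β_ _ _).hom ≫ biμ E _ _ Y X :=
      Functor.LaxBraided.braided (F := E) (F.functor.obj (op X), X) (G.functor.obj (op Y), Y)
    change _ ≫ P.lμ F G ≫ _ = _ ≫ _ ≫ P.lμ G F
    rw [reassoc_of% π_lμ, BraidedCategory.braiding_naturality_assoc, π_lμ, mulπ, mulπ,
      ← reassoc_of% h₁, Category.assoc, Category.assoc, ← P.natural, reassoc_of% biMap_comp,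
      reassoc_of% biMap_comp, Category.comp_id, Category.comp_id, P.biMap_π _ (β_ X Y).hom,
      pair_braiding, Category.assoc]

section
variable [E.LaxMonoidal] (P : Presentation E Φ) [∀ X, (leftPart E X).IsLeftAdjoint]
  [IsIso (Functor.LaxMonoidal.ε E)] [∀ P Q, IsIso (Functor.LaxMonoidal.μ E P Q)]

instance (a b : A) (X Y : FinN.{u}) : IsIso (biμ E a b X Y) :=
  inferInstanceAs (IsIso (Functor.LaxMonoidal.μ E (a, X) (b, Y)))

instance : IsIso (biε E) := inferInstanceAs (IsIso (Functor.LaxMonoidal.ε E))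

/-- By `homEquiv` a morphism out of `Φ (F ⊗ G)` is a morphism from `F ⊗ G` to `coendRight E W`, and
by the universal property of Day convolution it is given by a family indexed by pairs `(X, Y)`. -/
theorem exists_tensorDesc {F G : qa A} {W : B}
    (t : ∀ X Y : FinN.{u}, E.obj (F.functor.obj (op X) ⊗ G.functor.obj (op Y), X ⊗ Y) ⟶ W)
    (ht : ∀ {X X' Y Y' : FinN.{u}} (f : X ⟶ X') (g : Y ⟶ Y'),
      biMap E (F.functor.map f.op ⊗ₘ G.functor.map g.op) (𝟙 _) ≫ t X Y =
        biMap E (𝟙 _) (f ⊗ₘ g) ≫ t X' Y') :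
    ∃ h : Φ.obj (F ⊗ G) ⟶ W, ∀ X Y, biMap E (pair F G X Y) (𝟙 _) ≫ P.π _ (X ⊗ Y) ≫ h = t X Y := by
  let s : F ⊗ G ⟶ coendRight E W := pairDesc (fun X Y => coendEl E (t X Y)) (fun f g => by
    rw [← coendEl_comp, ← coendEl_map, ht])
  refine ⟨(P.homEquiv _ _).symm s, fun X Y => (coendEl E).injective ?_⟩
  rw [coendEl_comp, ← homEquiv_app, Equiv.apply_symm_apply]
  exact pair_pairDesc _ _ _ _

theorem tensorDesc_ext {F G : qa A} {W : B} {h h' : Φ.obj (F ⊗ G) ⟶ W}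
    (w : ∀ X Y, biMap E (pair F G X Y) (𝟙 _) ≫ P.π _ (X ⊗ Y) ≫ h =
      biMap E (pair F G X Y) (𝟙 _) ≫ P.π _ (X ⊗ Y) ≫ h') : h = h' := by
  apply (P.homEquiv _ _).injective
  refine pair_ext fun X Y => ?_
  rw [homEquiv_app, homEquiv_app, ← coendEl_comp, ← coendEl_comp, w]

theorem unitDesc_ext {W : B} {h h' : Φ.obj (𝟙_ _) ⟶ W}
    (w : biMap E unitPt (𝟙 _) ≫ P.π _ (𝟙_ _) ≫ h =
      biMap E unitPt (𝟙 _) ≫ P.π _ (𝟙_ _) ≫ h') : h = h' := by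
  apply (P.homEquiv _ _).injective
  refine unit_ext ?_
  rw [homEquiv_app, homEquiv_app, ← coendEl_comp, ← coendEl_comp, w]

theorem exists_unitDesc {W : B} (t : E.obj (𝟙_ A, 𝟙_ _) ⟶ W) :
    ∃ h : Φ.obj (𝟙_ _) ⟶ W, biMap E unitPt (𝟙 _) ≫ P.π _ (𝟙_ _) ≫ h = t := by
  refine ⟨(P.homEquiv _ _).symm (unitDesc (coendEl E t)), (coendEl E).injective ?_⟩
  rw [coendEl_comp, ← homEquiv_app, Equiv.apply_symm_apply]
  exact unitPt_unitDesc _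

/-- Source and target corepresent the same families: those on `E (F X, X) ⊗ E (G Y, Y)` and those on
`E (F X ⊗ G Y, X ⊔ Y)` match through the invertible tensorator of `E`. -/
instance isIso_lμ (F G : qa A) : IsIso (P.lμ F G) := by
  obtain ⟨h, hh⟩ := P.exists_tensorDesc (F := F) (G := G)
    (fun X Y => inv (biμ E _ _ X Y) ≫ (P.π F X ⊗ₘ P.π G Y)) (fun {X X' Y Y'} f g => by
      have h₁ := (reassoc_of% (biμ_natural E (F.functor.map f.op) (G.functor.map g.op) (𝟙 X) (𝟙 Y)))
        (inv (biμ E _ _ X Y) ≫ (P.π F X ⊗ₘ P.π G Y))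
      have h₂ := (reassoc_of% (biμ_natural E (𝟙 (F.functor.obj (op X')))
        (𝟙 (G.functor.obj (op Y'))) f g))
        (inv (biμ E _ _ X' Y') ≫ (P.π F X' ⊗ₘ P.π G Y'))
      rw [IsIso.hom_inv_id_assoc, tensorHom_comp_tensorHom] at h₁ h₂
      rw [P.dinatural, P.dinatural, h₂, id_tensorHom_id, id_tensorHom_id, cancel_epi] at h₁
      exact h₁.symm)
  refine ⟨h, P.tensor_hom_ext fun X Y => ?_, P.tensorDesc_ext fun X Y => ?_⟩
  · rw [reassoc_of% π_lμ, mulπ, Category.assoc, Category.assoc, hh, IsIso.hom_inv_id_assoc,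
      Category.comp_id]
  · rw [reassoc_of% (hh X Y), π_lμ, mulπ, IsIso.inv_hom_id_assoc, Category.comp_id]

instance isIso_lε : IsIso P.lε := by
  obtain ⟨h, hh⟩ := P.exists_unitDesc (inv (biε E))
  refine ⟨h, ?_, P.unitDesc_ext ?_⟩
  · rw [lε, Category.assoc, Category.assoc, hh, IsIso.hom_inv_id]
  · rw [reassoc_of% hh, lε, IsIso.inv_hom_id_assoc, Category.comp_id]
end
end Presentation
end
end
end AlgClassifier

/-! ### Functors of two variables of the form `(a, X) ↦ p a ⊗ Ψ X`. -/

namespace AlgClassifier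
noncomputable section

section
variable {A : Type w} [Category.{u} A] [MonoidalCategory A]
  {B : Type w'} [Category.{u} B] [MonoidalCategory B] [SymmetricCategory B]

/-- The functor `(a, X) ↦ p a ⊗ Ψ X`. -/
abbrev tensorBi (p : A ⥤ B) (Ψ : FinN.{u} ⥤ B) : A × FinN.{u} ⥤ B := p.prod Ψ ⋙ tensor B

variable (p : A ⥤ B) (Ψ : FinN.{u} ⥤ B)

theorem tensorBi_biMap {a b : A} {X Y : FinN.{u}} (f : a ⟶ b) (g : X ⟶ Y) :
    biMap (tensorBi p Ψ) f g = (p.map f ⊗ₘ Ψ.map g) := rfl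

section
variable [p.LaxMonoidal] [Ψ.LaxMonoidal]

theorem tensorBi_μ (P Q : A × FinN.{u}) : Functor.LaxMonoidal.μ (tensorBi p Ψ) P Q =
    tensorμ _ _ _ _ ≫ (Functor.LaxMonoidal.μ p P.1 Q.1 ⊗ₘ Functor.LaxMonoidal.μ Ψ P.2 Q.2) := rfl

theorem tensorBi_ε : Functor.LaxMonoidal.ε (tensorBi p Ψ) =
    (λ_ _).inv ≫ (Functor.LaxMonoidal.ε p ⊗ₘ Functor.LaxMonoidal.ε Ψ) := rfl

instance [IsIso (Functor.LaxMonoidal.ε p)] [IsIso (Functor.LaxMonoidal.ε Ψ)] :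
    IsIso (Functor.LaxMonoidal.ε (tensorBi p Ψ)) := by
  rw [tensorBi_ε]
  infer_instance

instance [∀ a b, IsIso (Functor.LaxMonoidal.μ p a b)] [∀ X Y, IsIso (Functor.LaxMonoidal.μ Ψ X Y)]
    (P Q : A × FinN.{u}) : IsIso (Functor.LaxMonoidal.μ (tensorBi p Ψ) P Q) := by
  have : IsIso (tensorμ (p.obj P.1) (Ψ.obj P.2) (p.obj Q.1) (Ψ.obj Q.2)) :=
    inferInstanceAs (IsIso (Functor.LaxMonoidal.μ (tensor B) (p.obj P.1, Ψ.obj P.2)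
      (p.obj Q.1, Ψ.obj Q.2)))
  rw [tensorBi_μ]
  infer_instance
end

instance [SymmetricCategory A] [p.LaxBraided] [Ψ.LaxBraided] : (tensorBi p Ψ).LaxBraided where
  braided P Q := by
    have h₁ := Functor.LaxBraided.braided (F := p) P.1 Q.1
    have h₂ := Functor.LaxBraided.braided (F := Ψ) P.2 Q.2
    change (tensorμ _ _ _ _ ≫ (Functor.LaxMonoidal.μ p P.1 Q.1 ⊗ₘ
      Functor.LaxMonoidal.μ Ψ P.2 Q.2)) ≫ (p.map (β_ P.1 Q.1).hom ⊗ₘ Ψ.map (β_ P.2 Q.2).hom) = _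
    rw [Category.assoc, tensorHom_comp_tensorHom, h₁, h₂, ← tensorHom_comp_tensorHom,
      reassoc_of% tensorμ_braid]
    rfl

instance [IsVectoid B] [p.IsLeftAdjoint] (X : FinN.{u}) : (leftPart (tensorBi p Ψ) X).IsLeftAdjoint :=
  Functor.isLeftAdjoint_of_iso (F := p ⋙ tensorRight (Ψ.obj X)) (NatIso.ofComponents
    (fun a => Iso.refl (p.obj a ⊗ Ψ.obj X)) (fun f => by
      change p.map f ▷ _ ≫ 𝟙 _ = 𝟙 _ ≫ (p.map f ⊗ₘ Ψ.map (𝟙 X))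
      rw [CategoryTheory.Functor.map_id, tensorHom_id, Category.comp_id, Category.id_comp]))

variable {p Ψ} in
/-- The tensor product of two natural transformations. -/
def tensorBiMap {p' : A ⥤ B} {Ψ' : FinN.{u} ⥤ B} (s : p ⟶ p') (t : Ψ ⟶ Ψ') :
    tensorBi p Ψ ⟶ tensorBi p' Ψ' where
  app P := s.app P.1 ⊗ₘ t.app P.2
  naturality P Q f := by
    change (p.map f.1 ⊗ₘ Ψ.map f.2) ≫ _ = _ ≫ (p'.map f.1 ⊗ₘ Ψ'.map f.2)
    rw [tensorHom_comp_tensorHom, tensorHom_comp_tensorHom, s.naturality, t.naturality]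

instance {p' : A ⥤ B} {Ψ' : FinN.{u} ⥤ B} [p.LaxMonoidal] [Ψ.LaxMonoidal] [p'.LaxMonoidal]
    [Ψ'.LaxMonoidal] (s : p ⟶ p') (t : Ψ ⟶ Ψ') [NatTrans.IsMonoidal s] [NatTrans.IsMonoidal t] :
    NatTrans.IsMonoidal (tensorBiMap s t) where
  unit := by
    have h₁ : Functor.LaxMonoidal.ε p ≫ s.app _ = Functor.LaxMonoidal.ε p' :=
      NatTrans.IsMonoidal.unit
    have h₂ : Functor.LaxMonoidal.ε Ψ ≫ t.app _ = Functor.LaxMonoidal.ε Ψ' :=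
      NatTrans.IsMonoidal.unit
    rw [tensorBi_ε, tensorBi_ε, Category.assoc, ← h₁, ← h₂, ← tensorHom_comp_tensorHom]
    rfl
  tensor P Q := by
    have h₁ := NatTrans.IsMonoidal.tensor (τ := s) P.1 Q.1
    have h₂ := NatTrans.IsMonoidal.tensor (τ := t) P.2 Q.2
    have h₃ := tensorμ_natural (s.app P.1) (t.app P.2) (s.app Q.1) (t.app Q.2)
    rw [tensorBi_μ, tensorBi_μ]
    change (_ ≫ _) ≫ (s.app (P.1 ⊗ Q.1) ⊗ₘ t.app (P.2 ⊗ Q.2)) =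
      ((s.app P.1 ⊗ₘ t.app P.2) ⊗ₘ (s.app Q.1 ⊗ₘ t.app Q.2)) ≫ _
    rw [reassoc_of% h₃, tensorHom_comp_tensorHom, ← h₁, ← h₂, ← tensorHom_comp_tensorHom,
      Category.assoc]

variable {C : Type w''} [Category.{u} C] [MonoidalCategory C] [SymmetricCategory C]

/-- The tensorator of `G` as a natural transformation. -/
def tensorBiμ (G : B ⥤ C) [G.LaxMonoidal] : tensorBi (p ⋙ G) (Ψ ⋙ G) ⟶ tensorBi p Ψ ⋙ G where
  app P := Functor.LaxMonoidal.μ G (p.obj P.1) (Ψ.obj P.2)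
  naturality _ _ f := Functor.LaxMonoidal.μ_natural G (p.map f.1) (Ψ.map f.2)

/-- The tensor condition compares the interchange before and after applying `G`; this is where the
braiding of `G` enters. -/
instance (G : B ⥤ C) [G.LaxBraided] [p.LaxMonoidal] [Ψ.LaxMonoidal] :
    NatTrans.IsMonoidal (tensorBiμ p Ψ G) where
  unit := by
    change ((λ_ _).inv ≫ ((Functor.LaxMonoidal.ε G ≫ G.map (Functor.LaxMonoidal.ε p)) ⊗ₘ
      (Functor.LaxMonoidal.ε G ≫ G.map (Functor.LaxMonoidal.ε Ψ)))) ≫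
        Functor.LaxMonoidal.μ G _ _ = Functor.LaxMonoidal.ε G ≫ G.map ((λ_ _).inv ≫
          (Functor.LaxMonoidal.ε p ⊗ₘ Functor.LaxMonoidal.ε Ψ))
    rw [← tensorHom_comp_tensorHom, Category.assoc, Category.assoc,
      Functor.LaxMonoidal.μ_natural, G.map_comp, ← Functor.LaxMonoidal.left_unitality_inv_assoc,
      leftUnitor_inv_naturality_assoc, MonoidalCategory.tensorHom_def']
    simp only [Category.assoc]
  tensor P Q := by
    change (tensorμ _ _ _ _ ≫ ((Functor.LaxMonoidal.μ G _ _ ≫ G.map (Functor.LaxMonoidal.μ p _ _)) ⊗ₘ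
      (Functor.LaxMonoidal.μ G _ _ ≫ G.map (Functor.LaxMonoidal.μ Ψ _ _)))) ≫
        Functor.LaxMonoidal.μ G _ _ = (Functor.LaxMonoidal.μ G _ _ ⊗ₘ Functor.LaxMonoidal.μ G _ _) ≫
          Functor.LaxMonoidal.μ G _ _ ≫ G.map (tensorμ _ _ _ _ ≫
            (Functor.LaxMonoidal.μ p _ _ ⊗ₘ Functor.LaxMonoidal.μ Ψ _ _))
    rw [← tensorHom_comp_tensorHom, Category.assoc, Category.assoc,
      Functor.LaxMonoidal.μ_natural, G.map_comp,
      tensorμ_comp_μ_tensorHom_μ_comp_μ_assoc]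
end
end
end AlgClassifier

/-! ### Comparison of tensor powers under monoidal functors, and transport of presentations. -/

namespace AlgClassifier
noncomputable section
open MonObj

section
variable {B : Type w} [Category.{u} B] [MonoidalCategory B] [SymmetricCategory B]
  {C : Type w'} [Category.{u} C] [MonoidalCategory C] [SymmetricCategory C]
  (G : B ⥤ C) [G.LaxBraided]

/-- At algebras the tensorator is the canonical algebra morphism out of the coproduct `G M ⊗ G N`.
Iterated tensorators can therefore be handled inside the category of algebras. -/
theorem algMap_tensor_map (M N : CommMon B) :
    algMap (descAlg (G.mapCommMon.map (inlAlg M N)) (G.mapCommMon.map (inrAlg M N))) =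
      Functor.LaxMonoidal.μ G M.X N.X := by
  have h := coprod_mul M.X N.X
  have h' : (G.map (algMap (inlAlg M N)) ⊗ₘ G.map (algMap (inrAlg M N))) ≫
      Functor.LaxMonoidal.μ G _ _ ≫ G.map (MonObj.mul (X := (tensorAlg M N).X)) =
      Functor.LaxMonoidal.μ G M.X N.X := by
    rw [Functor.LaxMonoidal.μ_natural_assoc, ← G.map_comp]
    refine (congrArg (fun t => _ ≫ G.map t) h).trans ?_
    rw [CategoryTheory.Functor.map_id, Category.comp_id]
  exact h'

theorem powDesc_comp {M P Q : CommMon C} (n : ℕ) (f : Fin n → (M ⟶ P)) (h : P ⟶ Q) :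
    powDesc n f ≫ h = powDesc n (fun i => f i ≫ h) :=
  pow_ext fun i => by rw [← Category.assoc, powι_desc, powι_desc]

theorem descAlg_comp {M N P Q : CommMon C} (f : M ⟶ P) (g : N ⟶ P) (h : P ⟶ Q) :
    descAlg f g ≫ h = descAlg (f ≫ h) (g ≫ h) :=
  alg_ext (by rw [← Category.assoc, inl_desc, inl_desc]) (by
    rw [← Category.assoc, inr_desc, inr_desc])

theorem tensorAlgHom_desc {M M' N N' P : CommMon C} (f : M ⟶ M') (g : N ⟶ N') (h : M' ⟶ P)
    (k : N' ⟶ P) : tensorAlgHom f g ≫ descAlg h k = descAlg (f ≫ h) (g ≫ k) :=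
  alg_ext (by rw [← Category.assoc, inl_tensorAlgHom, Category.assoc, inl_desc, inl_desc]) (by
    rw [← Category.assoc, inr_tensorAlgHom, Category.assoc, inr_desc, inr_desc])

variable {G} {X : CommMon B} {Y : CommMon C} (c : Y ⟶ G.mapCommMon.obj X)

/-- The canonical morphism `Y^{⊗n} ⟶ G (X^{⊗n})` attached to a morphism `Y ⟶ G X`. -/
def relPow (n : ℕ) : pow Y n ⟶ G.mapCommMon.obj (pow X n) :=
  powDesc n fun i => c ≫ G.mapCommMon.map (powι X n i)

theorem powι_relPow (n : ℕ) (i : Fin n) :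
    powι Y n i ≫ relPow c n = c ≫ G.mapCommMon.map (powι X n i) := powι_desc n _ i

theorem relPow_natural {S T : FinN.{u}} (f : S ⟶ T) :
    powMap Y f ≫ relPow c T.len = relPow c S.len ≫ G.mapCommMon.map (powMap X f) :=
  pow_ext fun i => by
    rw [← Category.assoc, powι_powMap, powι_relPow, ← Category.assoc, powι_relPow, Category.assoc,
      ← Functor.map_comp, powι_powMap]

theorem relPow_phiμ (S T : FinN.{u}) : phiμ Y S T ≫ relPow c (S ⊗ T).len =
    descAlg (relPow c S.len ≫ G.mapCommMon.map (powMap X (FinN.inl S T)))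
      (relPow c T.len ≫ G.mapCommMon.map (powMap X (FinN.inr S T))) := by
  rw [phiμ, descAlg_comp, relPow_natural, relPow_natural]

/-- `relPow` is defined by the universal property of powers; this identifies it with an iterated
tensorator, whence its invertibility for strong monoidal `G`. -/
theorem relPow_succ (n : ℕ) : algMap (relPow c (n + 1)) =
    (algMap (relPow c n) ⊗ₘ algMap c) ≫ Functor.LaxMonoidal.μ G (pow X n).X X.X := by
  have h : relPow c (n + 1) = tensorAlgHom (relPow c n) c ≫
      descAlg (G.mapCommMon.map (inlAlg (pow X n) X)) (G.mapCommMon.map (inrAlg (pow X n) X)) := by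
    rw [tensorAlgHom_desc]
    change descAlg (powDesc n _) _ = _
    rw [relPow, powDesc_comp]
    simp only [powι, Fin.lastCases_last, Fin.lastCases_castSucc, Category.assoc,
      ← Functor.map_comp]
    rfl
  exact (congrArg algMap h).trans (congrArg (_ ≫ ·) (algMap_tensor_map G _ _))

theorem relPow_zero : algMap (relPow c 0) = Functor.LaxMonoidal.ε G := by
  have h : algMap (relPow c 0) = Functor.LaxMonoidal.ε G ≫ G.map (𝟙 (𝟙_ B)) := by
    have h₁ : relPow c 0 = (default : CommMon.trivial C ⟶ G.mapCommMon.obj (CommMon.trivial B)) :=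
      rfl
    rw [h₁]
    rfl
  rw [h, CategoryTheory.Functor.map_id, Category.comp_id]

theorem isIso_relPow [IsIso (algMap c)] [IsIso (Functor.LaxMonoidal.ε G)]
    [∀ a b, IsIso (Functor.LaxMonoidal.μ G a b)] (n : ℕ) : IsIso (algMap (relPow c n)) := by
  induction n with
  | zero =>
    have h : IsIso (Functor.LaxMonoidal.ε G) := inferInstance
    rw [← relPow_zero c] at h
    exact h
  | succ n ih =>
    have h : IsIso ((algMap (relPow c n) ⊗ₘ algMap c) ≫
      Functor.LaxMonoidal.μ G (pow X n).X X.X) := IsIso.comp_isIso' inferInstance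
        (inferInstanceAs (IsIso (Functor.LaxMonoidal.μ G (pow X n).X X.X)))
    rw [← relPow_succ c] at h
    exact h

/-- The morphism `Y^{⊗n} ⟶ G (X^{⊗n})` as a natural transformation. -/
def relPowTrans : Phi.{u} Y ⟶ Phi X ⋙ G where
  app S := algMap (relPow c S.len)
  naturality S T f := congrArg algMap (relPow_natural c f)

instance : NatTrans.IsMonoidal (relPowTrans.{u} c) where
  unit := by
    change 𝟙 _ ≫ algMap (relPow c 0) = Functor.LaxMonoidal.ε G ≫ G.map (𝟙 (𝟙_ B))
    rw [CategoryTheory.Functor.map_id, Category.comp_id]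
    exact (Category.id_comp _).trans (relPow_zero c)
  tensor S T := by
    have h := congrArg algMap (relPow_phiμ c S T)
    have h' : descAlg (relPow c S.len ≫ G.mapCommMon.map (powMap X (FinN.inl S T)))
      (relPow c T.len ≫ G.mapCommMon.map (powMap X (FinN.inr S T))) =
      tensorAlgHom (relPow c S.len) (relPow c T.len) ≫ descAlg (G.mapCommMon.map (inlAlg _ _))
        (G.mapCommMon.map (inrAlg _ _)) ≫ G.mapCommMon.map (phiμ X S T) := by
      rw [descAlg_comp, tensorAlgHom_desc, ← Functor.map_comp, ← Functor.map_comp, inl_phiμ,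
        inr_phiμ]
    refine (h.trans (congrArg algMap h')).trans ?_
    refine (congrArg (_ ≫ ·) (congrArg (· ≫ _) (algMap_tensor_map G _ _))).trans ?_
    rfl

end

section
variable {A : Type w} [Category.{u} A] [MonoidalCategory A] {B : Type w'} [Category.{u} B]
  {C : Type w''} [Category.{u} C]

namespace Presentation

/-- Presentations of the identity are preserved by left adjoint functors. -/
def comp {E : A × FinN.{u} ⥤ qa A} (P : Presentation E (𝟭 (qa A))) (L : qa A ⥤ C)
    [L.IsLeftAdjoint] : Presentation (E ⋙ L) L where
  π F X := L.map (P.π F X)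
  natural t X := (L.map_comp _ _).symm.trans ((congrArg L.map (P.natural t X)).trans
    (L.map_comp _ _))
  dinatural F X Y f := (L.map_comp _ _).symm.trans ((congrArg L.map (P.dinatural F f)).trans
    (L.map_comp _ _))
  universal F W t ht := P.existsUnique_map L F W t ht

/-- Change of the presenting functor. -/
def ofIso {E E' : A × FinN.{u} ⥤ B} {Φ : qa A ⥤ B} (P : Presentation E Φ) (ψ : E' ⟶ E)
    [IsIso ψ] : Presentation E' Φ where
  π F X := ψ.app _ ≫ P.π F X
  natural t X := by
    rw [← Category.assoc, natTrans_biMap, Category.assoc, P.natural, Category.assoc]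
  dinatural F X Y f := P.dinatural_natTrans ψ F f
  universal F W t ht := by
    have h := P.universal F W (fun X => (inv ψ).app _ ≫ t X) (fun f => by
      rw [← Category.assoc, natTrans_biMap, Category.assoc, ht, ← Category.assoc,
        ← natTrans_biMap, Category.assoc])
    refine (existsUnique_congr fun g => forall_congr' fun X => ?_).1 h
    rw [Category.assoc, ← cancel_epi (ψ.app _)]
    simp
end Presentation
end

section
variable {A : Type w} [Category.{u} A] [MonoidalCategory A] [CocontinuousTensor A]
  {B : Type w'} [Category.{u} B] [MonoidalCategory B]
  {C : Type w''} [Category.{u} C] [MonoidalCategory C]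

namespace Presentation

instance {E : A × FinN.{u} ⥤ qa A} [E.LaxMonoidal] (P : Presentation E (𝟭 (qa A)))
    [P.IsMonoidal] (L : qa A ⥤ C) [L.IsLeftAdjoint] [L.LaxMonoidal] :
    (P.comp L).IsMonoidal where
  mul F G X Y := by
    have h := IsMonoidal.mul (P := P) F G X Y
    change (L.map _ ⊗ₘ L.map _) ≫ _ = (Functor.LaxMonoidal.μ L _ _ ≫ L.map (biμ E _ _ X Y)) ≫
      L.map (biMap E (pair F G X Y) (𝟙 _)) ≫ L.map (P.π (F ⊗ G) (X ⊗ Y))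
    rw [Functor.LaxMonoidal.μ_natural, Category.assoc, ← L.map_comp, ← L.map_comp]
    refine congrArg (fun t => _ ≫ L.map t) ((Category.comp_id _).symm.trans h)
  one := by
    have h := IsMonoidal.one (P := P)
    change _ = (Functor.LaxMonoidal.ε L ≫ L.map (biε E)) ≫
      L.map (biMap E unitPt (𝟙 _)) ≫ L.map (P.π (𝟙_ _) (𝟙_ _))
    rw [Category.assoc, ← L.map_comp, ← L.map_comp]
    refine Eq.trans ?_ (congrArg (fun t => _ ≫ L.map t) h)
    exact ((congrArg (_ ≫ ·) (CategoryTheory.Functor.map_id L _)).trans (Category.comp_id _)).symm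

instance {E E' : A × FinN.{u} ⥤ B} [E.LaxMonoidal] [E'.LaxMonoidal] {Φ : qa A ⥤ B}
    [Φ.LaxMonoidal] (P : Presentation E Φ) [P.IsMonoidal] (ψ : E' ⟶ E) [IsIso ψ]
    [NatTrans.IsMonoidal ψ] : (P.ofIso ψ).IsMonoidal where
  mul F G X Y := by
    have h : biμ E' _ _ X Y ≫ ψ.app _ = (ψ.app (F.functor.obj (op X), X) ⊗ₘ
      ψ.app (G.functor.obj (op Y), Y)) ≫ biμ E _ _ X Y := NatTrans.IsMonoidal.tensor _ _
    change (ψ.app _ ≫ _ ⊗ₘ ψ.app _ ≫ _) ≫ _ = biμ E' _ _ X Y ≫ biMap E' _ _ ≫ ψ.app _ ≫ _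
    rw [← tensorHom_comp_tensorHom, Category.assoc, IsMonoidal.mul (P := P),
      ← Category.assoc (biMap _ _ _), natTrans_biMap, Category.assoc, reassoc_of% h]
    rfl
  one := by
    have h : biε E' ≫ ψ.app _ = biε E := NatTrans.IsMonoidal.unit
    rw [IsMonoidal.one (P := P)]
    change _ = biε E' ≫ biMap E' _ _ ≫ ψ.app _ ≫ _
    rw [← Category.assoc (biMap _ _ _), natTrans_biMap, Category.assoc, reassoc_of% h]
    rfl
end Presentation
end

/-! ### Every presheaf as a coend of free presheaves. -/

section
variable {A : Type w} [Category.{u} A] [MonoidalCategory A] [SymmetricCategory A] [IsVectoid A]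

/-- The morphism `ev F X` sends the generic element to the identity, so the component at `X` of a
solution `g` has to be the value of `s X` at the generic element. Dinaturality of `s` makes these
components natural. -/
theorem ev_existsUnique (F W : qa A)
    (s : ∀ X : FinN.{u}, (baseFunctor A).obj (F.functor.obj (op X)) ⊗ (pow (XaRel A) X.len).X ⟶ W)
    (hs : ∀ {X Y : FinN.{u}} (f : X ⟶ Y),
      (baseFunctor A).map (F.functor.map f.op) ▷ (pow (XaRel A) X.len).X ≫ s X =
      (baseFunctor A).obj (F.functor.obj (op Y)) ◁ algMap (powMap (XaRel A) f) ≫ s Y) :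
    ∃! g : F ⟶ W, ∀ X, ev F X ≫ g = s X := by
  refine ⟨⟨{ app := fun X => gen _ (unop X) ≫ (s (unop X)).natTrans.app X
             naturality := fun X Y f => ?_ }⟩, fun X => ?_, fun g hg => ?_⟩
  · have h := congrArg (fun t : _ ⟶ W => gen (F.functor.obj X) (unop Y) ≫ t.natTrans.app Y)
      (hs f.unop)
    have h₁ := gen_natural (F.functor.map f) (unop Y)
    have h₂ := gen_powMap (F.functor.obj X) f.unop
    have h₃ := h₁ =≫ (s (unop Y)).natTrans.app Y
    have h₄ := h₂ =≫ (s (unop X)).natTrans.app Y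
    have h₅ := gen (F.functor.obj X) (unop X) ≫= pair_nat_app (s (unop X)) f
    rw [Category.assoc, Category.assoc] at h₃ h₄
    exact h₃.symm.trans (h.trans (h₄.trans (h₅.trans (Category.assoc _ _ _).symm)))
  · apply gen_ext
    rw [comp_app, reassoc_of% gen_ev]
  · apply DayFunctor.hom_ext
    ext X
    change _ = gen _ (unop X) ≫ (s (unop X)).natTrans.app X
    rw [← hg, comp_app]
    exact ((reassoc_of% (gen_ev _ _)) _).symm

variable (A) in
/-- The presentation of presheaves by the evaluation morphisms. -/
def evPresentation : Presentation (tensorBi (baseFunctor A) (Phi (XaRel A))) (𝟭 (qa A)) where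
  π F X := ev F X
  natural t X := by
    rw [tensorBi_biMap, CategoryTheory.Functor.map_id, tensorHom_id]
    exact ev_natural t X
  dinatural F X Y f := by
    rw [tensorBi_biMap, tensorBi_biMap, CategoryTheory.Functor.map_id, tensorHom_id,
      CategoryTheory.Functor.map_id, id_tensorHom]
    exact ev_dinatural F f
  universal F W t ht := ev_existsUnique F W t fun {X Y} f => by
    have h := ht f
    rw [tensorBi_biMap, tensorBi_biMap, CategoryTheory.Functor.map_id, tensorHom_id,
      CategoryTheory.Functor.map_id, id_tensorHom] at h
    exact h

instance : (evPresentation A).IsMonoidal where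
  mul F G X Y := by
    have h := ev_mul F G X Y
    have e : biMap (tensorBi (baseFunctor A) (Phi (XaRel A))) (pair F G X Y) (𝟙 (X ⊗ Y)) =
        (baseFunctor A).map (pair F G X Y) ▷ (Phi (XaRel A)).obj (X ⊗ Y) := by
      rw [tensorBi_biMap, CategoryTheory.Functor.map_id, tensorHom_id]
    -- The tensorator of the identity functor is an identity, which accounts for the first
    -- composite.
    exact (Category.comp_id _).trans (h.trans ((Category.assoc _ _ _).symm.trans
      (congrArg (fun t => biμ (tensorBi (baseFunctor A) (Phi (XaRel A))) (F.functor.obj (op X))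
        (G.functor.obj (op Y)) X Y ≫ t ≫ (evPresentation A).π (F ⊗ G) (X ⊗ Y)) e.symm)))
  one := by
    have h := ev_unit (A := A)
    have e : biMap (tensorBi (baseFunctor A) (Phi (XaRel A))) unitPt (𝟙 (𝟙_ _)) =
        (baseFunctor A).map unitPt ▷ (Phi (XaRel A)).obj (𝟙_ _) := by
      rw [tensorBi_biMap, CategoryTheory.Functor.map_id, tensorHom_id]
    have e' : biε (tensorBi (baseFunctor A) (Phi (XaRel A))) = (λ_ (𝟙_ (qa A))).inv ≫
        Functor.LaxMonoidal.ε (baseFunctor A) ▷ 𝟙_ (qa A) := by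
      rw [← tensorHom_id]
      rfl
    have h' : (λ_ (𝟙_ (qa A))).inv ≫ (Functor.LaxMonoidal.ε (baseFunctor A) ≫
        (baseFunctor A).map unitPt) ▷ 𝟙_ (qa A) = ((λ_ (𝟙_ (qa A))).inv ≫
        Functor.LaxMonoidal.ε (baseFunctor A) ▷ 𝟙_ (qa A)) ≫
          (baseFunctor A).map unitPt ▷ 𝟙_ (qa A) := by
      rw [comp_whiskerRight, Category.assoc]
    exact h.symm.trans ((Category.assoc _ _ _).symm.trans ((congrArg
      (· ≫ ev (𝟙_ (qa A)) (𝟙_ _)) h').trans ((Category.assoc _ _ _).trans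
        (congrArg₂ (fun s t => s ≫ t ≫ (evPresentation A).π (𝟙_ (qa A)) (𝟙_ _)) e'.symm e.symm))))
end
end
end AlgClassifier

/-! ### Inverse image functors over `A`: the cokernel formula and full faithfulness. -/

namespace AlgClassifier
noncomputable section

section
variable {B : Type w} [Category.{u} B] [MonoidalCategory B] [SymmetricCategory B]
  {C : Type w'} [Category.{u} C] [MonoidalCategory C] [SymmetricCategory C]

/-- This and the next lemma are diagram chases with opaque objects; they keep the large composites
of `pow_relTrans` and `relDesc_app` out of rewriting. -/
theorem eq_of_squares {a b c d : B} {e f : B} {r : a ⟶ b} {l : a ⟶ c} {t : c ⟶ d} {k : b ⟶ d} {x : c ⟶ e}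
    {t' : e ⟶ f} {m : d ⟶ f} {n : f ⟶ b} (h : l ≫ t = r ≫ k) (h₁ : x ≫ t' = t ≫ m)
    (h₃ : k ≫ m ≫ n = 𝟙 _) : r = l ≫ x ≫ t' ≫ n := by
  rw [reassoc_of% h₁, reassoc_of% h, h₃, Category.comp_id]

theorem eq_of_retract {a b c d e : B} {i : a ⟶ b} {r : b ⟶ c} {r' : b ⟶ e} {i' : a ⟶ c}
    {t : c ⟶ e} {s : a ⟶ d} {j : d ⟶ e} {k : e ⟶ d} {t' : a ⟶ d} (h : i ≫ r = i') (h₁ : r ≫ t = r')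
    (h₂ : i ≫ r' = s ≫ j) (h₃ : i' ≫ t = t' ≫ j) (h₄ : j ≫ k = 𝟙 _) : t' = s := by
  have : t' ≫ j ≫ k = s ≫ j ≫ k := by
    rw [← reassoc_of% h₃, ← reassoc_of% h₂, ← h₁, ← h]
    simp only [Category.assoc]
  rwa [h₄, Category.comp_id, Category.comp_id] at this

theorem rightUnitor_inv_tensorHom_μ (G : B ⥤ C) [G.LaxMonoidal] {x : C} {a : B}
    (s : x ⟶ G.obj a) : (ρ_ x).inv ≫ (s ⊗ₘ Functor.LaxMonoidal.ε G) ≫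
      Functor.LaxMonoidal.μ G a (𝟙_ B) = s ≫ G.map (ρ_ a).inv := by
  rw [MonoidalCategory.tensorHom_def, Category.assoc, ← rightUnitor_inv_naturality_assoc,
    Functor.LaxMonoidal.right_unitality_inv]

theorem leftUnitor_inv_tensorHom_μ (G : B ⥤ C) [G.LaxMonoidal] {a z : B} {x y : C} {i : 𝟙_ C ⟶ x}
    {s : x ⟶ G.obj a} {e : 𝟙_ B ⟶ a} (h : i ≫ s = Functor.LaxMonoidal.ε G ≫ G.map e)
    (r : y ⟶ G.obj z) : ((λ_ y).inv ≫ i ▷ y) ≫ (s ⊗ₘ r) ≫ Functor.LaxMonoidal.μ G a z =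
      r ≫ G.map ((λ_ z).inv ≫ e ▷ z) := by
  rw [Category.assoc, ← tensorHom_id, tensorHom_comp_tensorHom_assoc, h,
    Category.id_comp, G.map_comp, ← Functor.LaxMonoidal.left_unitality_inv_assoc,
    leftUnitor_inv_naturality_assoc, ← Functor.LaxMonoidal.μ_natural_left,
    MonoidalCategory.tensorHom_def', comp_whiskerRight]
  simp only [Category.assoc]

theorem tensorHom_μ_app {G G' : B ⥤ C} [G.LaxMonoidal] [G'.LaxMonoidal] (α : G ⟶ G')
    [NatTrans.IsMonoidal α] {a z : B} {x y : C} (s : x ⟶ G.obj a) (r : y ⟶ G.obj z) :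
    ((s ⊗ₘ r) ≫ Functor.LaxMonoidal.μ G a z) ≫ α.app (a ⊗ z) =
      (s ≫ α.app a ⊗ₘ r ≫ α.app z) ≫ Functor.LaxMonoidal.μ G' a z := by
  rw [Category.assoc, NatTrans.IsMonoidal.tensor, tensorHom_comp_tensorHom_assoc]

/-- The morphism of algebras given by a monoidal natural transformation. -/
def algTrans {G G' : B ⥤ C} [G.LaxBraided] [G'.LaxBraided] (α : G ⟶ G') [NatTrans.IsMonoidal α]
    (M : CommMon B) : G.mapCommMon.obj M ⟶ G'.mapCommMon.obj M :=
  CommMon.homMk (.mk' (α.app M.X)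
    (by
      change (Functor.LaxMonoidal.ε G ≫ G.map (MonObj.one (X := M.X))) ≫ α.app M.X =
        Functor.LaxMonoidal.ε G' ≫ G'.map (MonObj.one (X := M.X))
      rw [Category.assoc, α.naturality, ← Category.assoc, NatTrans.IsMonoidal.unit])
    (by
      change (Functor.LaxMonoidal.μ G _ _ ≫ G.map (MonObj.mul (X := M.X))) ≫ α.app M.X =
        (α.app M.X ⊗ₘ α.app M.X) ≫ Functor.LaxMonoidal.μ G' _ _ ≫ G'.map (MonObj.mul (X := M.X))
      rw [Category.assoc, α.naturality, ← Category.assoc, NatTrans.IsMonoidal.tensor,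
        Category.assoc]))

theorem relPow_algTrans {G G' : B ⥤ C} [G.LaxBraided] [G'.LaxBraided] (α : G ⟶ G')
    [NatTrans.IsMonoidal α] {X : CommMon B} {Y : CommMon C} (c : Y ⟶ G.mapCommMon.obj X) (n : ℕ) :
    algMap (relPow c n) ≫ α.app (pow X n).X = algMap (relPow (c ≫ algTrans α X) n) := by
  have nat {M N : CommMon B} (f : M ⟶ N) : G.mapCommMon.map f ≫ algTrans α N =
      algTrans α M ≫ G'.mapCommMon.map f := algMap_ext (α.naturality (algMap f))
  have h : relPow c n ≫ algTrans α (pow X n) = relPow (c ≫ algTrans α X) n := pow_ext fun i => by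
    rw [powι_relPow, ← Category.assoc, powι_relPow, Category.assoc, Category.assoc, nat]
  exact congrArg algMap h
end

section
variable {A : Type w} [Category.{u} A] [MonoidalCategory A] [SymmetricCategory A] [IsVectoid A]
  {B : Type w'} [Category.{u} B] [MonoidalCategory B] [SymmetricCategory B]
  {p : A ⥤ B} [p.LaxBraided]

instance {C : Type w''} [Category.{u} C] [MonoidalCategory C] [SymmetricCategory C]
    (f : VectoidMorphism B C) : f.inv.IsLeftAdjoint := f.adj.isLeftAdjoint

/-- The pullback of a presheaf of the form `q^* a ⊗ X^{⊗n}`. -/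
def relTrans (f : OverHom p (baseFunctor A)) {Y : CommMon B}
    (c : Y ⟶ f.toHom.inv.mapCommMon.obj (XaRel A)) :
    tensorBi p (Phi.{u} Y) ⟶ tensorBi (baseFunctor A) (Phi (XaRel A)) ⋙ f.toHom.inv :=
  tensorBiMap f.iso.inv (relPowTrans c) ≫ tensorBiμ (baseFunctor A) (Phi (XaRel A)) f.toHom.inv

theorem relTrans_app (f : OverHom p (baseFunctor A)) {Y : CommMon B}
    (c : Y ⟶ f.toHom.inv.mapCommMon.obj (XaRel A)) (a : A) (X : FinN.{u}) :
    (relTrans f c).app (a, X) = (f.iso.inv.app a ⊗ₘ algMap (relPow c X.len)) ≫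
      Functor.LaxMonoidal.μ f.toHom.inv ((baseFunctor A).obj a) (pow (XaRel A) X.len).X := rfl

instance (f : OverHom p (baseFunctor A)) {Y : CommMon B}
    (c : Y ⟶ f.toHom.inv.mapCommMon.obj (XaRel A)) : NatTrans.IsMonoidal (relTrans f c) :=
  inferInstanceAs (NatTrans.IsMonoidal (tensorBiMap f.iso.inv (relPowTrans c) ≫
    tensorBiμ (baseFunctor A) (Phi (XaRel A)) f.toHom.inv))

theorem isIso_algMap {M N : CommMon B} (e : M ≅ N) : IsIso (algMap e.hom) :=
  ⟨algMap e.inv, congrArg algMap e.hom_inv_id, congrArg algMap e.inv_hom_id⟩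

instance (f : OverHom p (baseFunctor A)) {Y : CommMon B}
    (c : Y ⟶ f.toHom.inv.mapCommMon.obj (XaRel A)) [IsIso c] : IsIso (relTrans f c) := by
  have (P : A × FinN.{u}) : IsIso ((relTrans f c).app P) := by
    have := isIso_algMap (asIso c)
    have h : IsIso (algMap (relPow c P.2.len)) :=
      haveI : IsIso (algMap c) := this
      isIso_relPow c P.2.len
    exact IsIso.comp_isIso' (inferInstanceAs (IsIso (f.iso.inv.app P.1 ⊗ₘ
      algMap (relPow c P.2.len)))) (inferInstanceAs (IsIso (Functor.LaxMonoidal.μ f.toHom.inv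
        ((baseFunctor A).obj P.1) (pow (XaRel A) P.2.len).X)))
  exact NatIso.isIso_of_isIso_app _

/-- The presentation of the inverse image functor of a morphism over `A`. -/
def relPresentation (f : OverHom p (baseFunctor A)) {Y : CommMon B}
    (c : Y ⟶ f.toHom.inv.mapCommMon.obj (XaRel A)) [IsIso c] :
    Presentation (tensorBi p (Phi Y)) f.toHom.inv :=
  ((evPresentation A).comp f.toHom.inv).ofIso (relTrans f c)

instance (f : OverHom p (baseFunctor A)) {Y : CommMon B}
    (c : Y ⟶ f.toHom.inv.mapCommMon.obj (XaRel A)) [IsIso c] : (relPresentation f c).IsMonoidal :=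
  inferInstanceAs (((evPresentation A).comp f.toHom.inv).ofIso (relTrans f c)).IsMonoidal

/-- The presenting map obtained by transport is the projection of the cokernel formula; only the
bracketing differs. -/
theorem relPresentation_π (f : OverHom p (baseFunctor A)) {Y : CommMon B}
    (e : (OverHom.pullAlg p (baseFunctor A) (XaRel A)).obj f ≅ Y) (F : qa A) (X : FinN.{u}) :
    (@relPresentation A _ _ _ _ B _ _ _ p _ f Y e.inv e.isIso_inv).π F X = relProj f e (ev F X) :=
  Category.assoc _ _ _

/-- The relations are indexed by all maps of finite sets, so that coequalizing the two arrows is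
exactly dinaturality. -/
theorem Presentation.isCokernel [HasColimitsOfSize.{u, u} B] {Ψ : FinN.{u} ⥤ B} {Φ : qa A ⥤ B}
    (P : Presentation (tensorBi p Ψ) Φ) (F : qa A) : IsCokernel
      (I := FinN.{u}) (J := Σ (m n : FinN.{u}), m ⟶ n)
      (T := fun n => p.obj (F.functor.obj (op n)) ⊗ Ψ.obj n)
      (S := fun j => p.obj (F.functor.obj (op j.2.1)) ⊗ Ψ.obj j.1)
      (a := fun j => j.1) (b := fun j => j.2.1)
      (fun j => p.map (F.functor.map j.2.2.op) ▷ Ψ.obj j.1)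
      (fun j => p.obj (F.functor.obj (op j.2.1)) ◁ Ψ.map j.2.2) (fun n => P.π F n) := by
  have e {W : B} (t : ∀ X : FinN.{u}, p.obj (F.functor.obj (op X)) ⊗ Ψ.obj X ⟶ W)
      {X Y : FinN.{u}} (f : X ⟶ Y) :
      p.map (F.functor.map f.op) ▷ Ψ.obj X ≫ t X = p.obj (F.functor.obj (op Y)) ◁ Ψ.map f ≫ t Y ↔
      biMap (tensorBi p Ψ) (F.functor.map f.op) (𝟙 X) ≫ t X =
        biMap (tensorBi p Ψ) (𝟙 _) f ≫ t Y := by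
    rw [tensorBi_biMap, tensorBi_biMap, CategoryTheory.Functor.map_id, tensorHom_id,
      CategoryTheory.Functor.map_id, id_tensorHom]
  rw [isCokernel_iff]
  refine ⟨fun j => (e (P.π F) j.2.2).2 (P.dinatural F j.2.2), fun W t ht => ?_⟩
  exact P.universal F W t fun {X Y} f => (e t f).1 (ht ⟨X, Y, f⟩)

/-! ### Morphisms -/

theorem right_relTrans (f : OverHom p (baseFunctor A)) {Y : CommMon B}
    (c : Y ⟶ f.toHom.inv.mapCommMon.obj (XaRel A)) (a : A) :
    (ρ_ (p.obj a)).inv ≫ (relTrans f c).app (a, 𝟙_ FinN.{u}) =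
      f.iso.inv.app a ≫ f.toHom.inv.map (ρ_ ((baseFunctor A).obj a)).inv := by
  have h := relTrans_app f c a (𝟙_ FinN.{u})
  have h' := relPow_zero c
  have e := rightUnitor_inv_tensorHom_μ f.toHom.inv (f.iso.inv.app a)
  refine Eq.trans ?_ e
  exact congrArg (_ ≫ ·) (congrArg (fun t => (f.iso.inv.app a ⊗ₘ t) ≫
    Functor.LaxMonoidal.μ f.toHom.inv ((baseFunctor A).obj a) (𝟙_ (qa A))) h')

theorem left_relTrans (f : OverHom p (baseFunctor A)) {Y : CommMon B}
    (c : Y ⟶ f.toHom.inv.mapCommMon.obj (XaRel A)) (X : FinN.{u}) :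
    ((λ_ (pow Y X.len).X).inv ≫ Functor.LaxMonoidal.ε p ▷ (pow Y X.len).X) ≫
      (relTrans f c).app (𝟙_ A, X) = algMap (relPow c X.len) ≫ f.toHom.inv.map
        ((λ_ (pow (XaRel A) X.len).X).inv ≫
          Functor.LaxMonoidal.ε (baseFunctor A) ▷ (pow (XaRel A) X.len).X) := by
  have h : Functor.LaxMonoidal.ε p ≫ f.iso.inv.app (𝟙_ A) =
      Functor.LaxMonoidal.ε f.toHom.inv ≫ f.toHom.inv.map
        (Functor.LaxMonoidal.ε (baseFunctor A)) :=
    NatTrans.IsMonoidal.unit (τ := f.iso.inv)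
  exact leftUnitor_inv_tensorHom_μ f.toHom.inv h (algMap (relPow c X.len))

instance {C : Type w''} [Category.{u} C] [MonoidalCategory C] [SymmetricCategory C]
    {f g : VectoidMorphism B C} (θ : f ⟶ g) : NatTrans.IsMonoidal (VectoidMorphism.trans θ) :=
  θ.hom.hom.isMonoidal

/-- A morphism of morphisms of vectoids. -/
def VectoidMorphism.homMk {C : Type w''} [Category.{u} C] [MonoidalCategory C] [SymmetricCategory C]
    {f g : VectoidMorphism B C} (α : f.inv ⟶ g.inv) [h : NatTrans.IsMonoidal α] : f ⟶ g :=
  ⟨@LaxBraidedFunctor.homMk _ _ _ _ _ _ _ _ f.lax g.lax α h⟩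

theorem relTrans_trans {f g : OverHom p (baseFunctor A)} (θ : f ⟶ g) {Y : CommMon B}
    (c : Y ⟶ f.toHom.inv.mapCommMon.obj (XaRel A)) (a : A) (X : FinN.{u}) :
    (relTrans f c).app (a, X) ≫ (VectoidMorphism.trans θ.toHom).app _ =
      (relTrans g (c ≫ (OverHom.pullAlg p (baseFunctor A) (XaRel A)).map θ)).app (a, X) := by
  have h := tensorHom_μ_app (VectoidMorphism.trans θ.toHom) (f.iso.inv.app a)
    (algMap (relPow c X.len))
  have h₁ : f.iso.inv.app a ≫ (VectoidMorphism.trans θ.toHom).app ((baseFunctor A).obj a) =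
      g.iso.inv.app a := by
    have := NatTrans.congr_app θ.w a
    rw [← cancel_mono (g.iso.hom.app a), Category.assoc]
    refine (congrArg (_ ≫ ·) this).trans ?_
    simp
  have h₂ := relPow_algTrans (VectoidMorphism.trans θ.toHom) c X.len
  refine h.trans ?_
  exact congrArg₂ (fun s t => (s ⊗ₘ t) ≫ Functor.LaxMonoidal.μ g.toHom.inv
    ((baseFunctor A).obj a) (pow (XaRel A) X.len).X) h₁ h₂

section
variable {f g : OverHom p (baseFunctor A)}

/-- On the factor `p^* F(X)` a 2-morphism is fixed by its compatibility with the structures over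
`A`, and on the tensor powers by its value on the universal algebra. -/
theorem relTrans_trans_ev (θ : f ⟶ g) {Y : CommMon B}
    (c : Y ⟶ f.toHom.inv.mapCommMon.obj (XaRel A)) (F : qa A) (X : FinN.{u}) :
    ((relTrans f c).app (F.functor.obj (op X), X) ≫ f.toHom.inv.map ((evPresentation A).π F X)) ≫
        (VectoidMorphism.trans θ.toHom).app F =
      (relTrans g (c ≫ (OverHom.pullAlg p (baseFunctor A) (XaRel A)).map θ)).app
        (F.functor.obj (op X), X) ≫ g.toHom.inv.map ((evPresentation A).π F X) := by
  have h := (VectoidMorphism.trans θ.toHom).naturality ((evPresentation A).π F X)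
  have h' : f.toHom.inv.map ((evPresentation A).π F X) ≫
      (VectoidMorphism.trans θ.toHom).app F = (VectoidMorphism.trans θ.toHom).app _ ≫
        g.toHom.inv.map ((evPresentation A).π F X) := h
  rw [Category.assoc]
  exact (congrArg (_ ≫ ·) h').trans ((Category.assoc _ _ _).symm.trans
    (congrArg (· ≫ g.toHom.inv.map ((evPresentation A).π F X))
    (relTrans_trans θ c (F.functor.obj (op X)) X)))

theorem OverHom.hom_ext {θ θ' : f ⟶ g}
    (h : VectoidMorphism.trans θ.toHom = VectoidMorphism.trans θ'.toHom) : θ = θ' := by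
  apply OverHom.Hom.ext'
  apply InducedCategory.hom_ext
  apply LaxBraidedFunctor.hom_ext
  exact h

/-- The presenting maps of `f^*` are jointly epimorphic, and `relTrans_trans_ev` computes a
2-morphism on them from its value on the universal algebra. -/
theorem faithful_pullAlg : (OverHom.pullAlg p (baseFunctor A) (XaRel A)).Faithful where
  map_injective {f g θ θ'} h := by
    have e : VectoidMorphism.trans θ.toHom = VectoidMorphism.trans θ'.toHom :=
      (relPresentation f (𝟙 _)).natTrans_ext fun F X => (relTrans_trans_ev θ (𝟙 _) F X).trans
        ((congrArg (fun t => (relTrans g (𝟙 (f.toHom.inv.mapCommMon.obj (XaRel A)) ≫ t)).app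
          (F.functor.obj (op X), X) ≫ g.toHom.inv.map ((evPresentation A).π F X)) h).trans
            (relTrans_trans_ev θ' (𝟙 _) F X).symm)
    exact OverHom.hom_ext e

/-- The transformation of inverse image functors attached to a morphism of algebras. -/
def relDesc (d : f.toHom.inv.mapCommMon.obj (XaRel A) ⟶ g.toHom.inv.mapCommMon.obj (XaRel A)) :
    f.toHom.inv ⟶ g.toHom.inv :=
  (relPresentation f (𝟙 _)).map ((evPresentation A).comp g.toHom.inv) (relTrans g d)

variable (d : f.toHom.inv.mapCommMon.obj (XaRel A) ⟶ g.toHom.inv.mapCommMon.obj (XaRel A))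

instance isMonoidal_relDesc [IsVectoid B] : NatTrans.IsMonoidal (relDesc d) :=
  Presentation.isMonoidal_map _ _ _

theorem relTrans_relDesc (F : qa A) (X : FinN.{u}) :
    ((relTrans f (𝟙 _)).app (F.functor.obj (op X), X) ≫
        f.toHom.inv.map ((evPresentation A).π F X)) ≫ (relDesc d).app F =
      (relTrans g d).app (F.functor.obj (op X), X) ≫ g.toHom.inv.map ((evPresentation A).π F X) :=
  (relPresentation f (𝟙 _)).π_map ((evPresentation A).comp g.toHom.inv) (relTrans g d) F X

/-- The structure isomorphism over `A` is expressed through presenting maps, for any choice of `c`.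
Using this for `f` and for `g` shows that `relDesc` respects the structures over `A`. -/
theorem base_relTrans {Y : CommMon B} (c : Y ⟶ f.toHom.inv.mapCommMon.obj (XaRel A)) (a : A) :
    f.iso.inv.app a = (p.map (baseIncl a) ≫ (ρ_ _).inv) ≫ (relTrans f c).app (_, 𝟙_ FinN.{u}) ≫
      f.toHom.inv.map ((evPresentation A).π ((baseFunctor A).obj a) (𝟙_ _)) := by
  have h := right_relTrans f c (((baseFunctor A).obj a).functor.obj (op (𝟙_ _)))
  have h₁ : p.map (baseIncl a) ≫ f.iso.inv.app _ = f.iso.inv.app a ≫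
    f.toHom.inv.map ((baseFunctor A).map (baseIncl a)) := f.iso.inv.naturality (baseIncl a)
  have h₂ := congrArg f.toHom.inv.map (ev_base a)
  have h₃ : f.toHom.inv.map ((baseFunctor A).map (baseIncl a)) ≫
      f.toHom.inv.map (ρ_ ((baseFunctor A).obj (((baseFunctor A).obj a).functor.obj
        (op (𝟙_ FinN.{u}))))).inv ≫
      f.toHom.inv.map ((evPresentation A).π ((baseFunctor A).obj a) (𝟙_ _)) = 𝟙 _ := by
    refine Eq.trans ?_ (h₂.trans (CategoryTheory.Functor.map_id _ _))
    rw [f.toHom.inv.map_comp]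
    exact congrArg (_ ≫ ·) (f.toHom.inv.map_comp _ _).symm
  have h₄ := congrArg (p.map (baseIncl a) ≫ ·) (congrArg (· ≫
    f.toHom.inv.map ((evPresentation A).π ((baseFunctor A).obj a) (𝟙_ _))) h)
  refine ((Category.comp_id _).symm.trans (congrArg (f.iso.inv.app a ≫ ·) h₃.symm)).trans ?_
  refine Eq.trans ?_ ((h₄.symm).trans ?_)
  · refine (Category.assoc _ _ _).symm.trans ((congrArg (· ≫ _) h₁.symm).trans ?_)
    exact (Category.assoc _ _ _).trans (congrArg (_ ≫ ·) (Category.assoc _ _ _).symm)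
  · exact (congrArg (_ ≫ ·) (Category.assoc _ _ _)).trans (Category.assoc _ _ _).symm

/-- The same for the comparison maps of tensor powers, with the section `ev_pow` in the role of
`ev_base`. -/
theorem pow_relTrans {Y : CommMon B} (c : Y ⟶ f.toHom.inv.mapCommMon.obj (XaRel A))
    (X : FinN.{u}) : algMap (relPow c X.len) = ((λ_ (pow Y X.len).X).inv ≫
      Functor.LaxMonoidal.ε p ▷ (pow Y X.len).X) ≫
        biMap (tensorBi p (Phi Y)) (genEl A X) (𝟙 X) ≫ (relTrans f c).app (_, X) ≫
          f.toHom.inv.map ((evPresentation A).π (pow (XaRel A) X.len).X X) := by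
  have h := left_relTrans f c X
  have h₁ := Presentation.natTrans_biMap (relTrans f c) (genEl A X) (𝟙 X)
  have h₂ := congrArg f.toHom.inv.map (ev_pow (A := A) X)
  have e : biMap (tensorBi (baseFunctor A) (Phi (XaRel A))) (genEl A X) (𝟙 X) =
      (baseFunctor A).map (genEl A X) ▷ (pow (XaRel A) X.len).X := by
    rw [tensorBi_biMap, CategoryTheory.Functor.map_id, tensorHom_id]
    rfl
  have h₃ : f.toHom.inv.map ((λ_ (pow (XaRel A) X.len).X).inv ≫
      Functor.LaxMonoidal.ε (baseFunctor A) ▷ (pow (XaRel A) X.len).X) ≫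
      f.toHom.inv.map (biMap (tensorBi (baseFunctor A) (Phi (XaRel A))) (genEl A X) (𝟙 X)) ≫
      f.toHom.inv.map ((evPresentation A).π (pow (XaRel A) X.len).X X) = 𝟙 _ := by
    refine Eq.trans ?_ (h₂.trans (CategoryTheory.Functor.map_id _ _))
    rw [e]
    refine (congrArg (_ ≫ ·) (f.toHom.inv.map_comp _ _).symm).trans
      ((f.toHom.inv.map_comp _ _).symm.trans (congrArg f.toHom.inv.map ?_))
    rw [comp_whiskerRight]
    exact (Category.assoc _ _ _).trans (congrArg (_ ≫ ·) (Category.assoc _ _ _).symm)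
  exact eq_of_squares h h₁ h₃

theorem base_relDesc [IsVectoid B] (a : A) :
    f.iso.inv.app a ≫ (relDesc d).app ((baseFunctor A).obj a) = g.iso.inv.app a := by
  rw [base_relTrans (𝟙 _) a, base_relTrans d a]
  exact (Category.assoc _ _ _).trans (congrArg (_ ≫ ·)
    (relTrans_relDesc d ((baseFunctor A).obj a) (𝟙_ _)))

theorem relDesc_pow [IsVectoid B] (X : FinN.{u}) :
    algMap (relPow (𝟙 (f.toHom.inv.mapCommMon.obj (XaRel A))) X.len) ≫
      (relDesc d).app (pow (XaRel A) X.len).X = algMap (relPow d X.len) := by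
  rw [pow_relTrans (𝟙 _) X, pow_relTrans d X]
  refine (Category.assoc _ _ _).trans (congrArg (_ ≫ ·) ((Category.assoc _ _ _).trans
    (congrArg (_ ≫ ·) (relTrans_relDesc d (pow (XaRel A) X.len).X X))))

/-- `relDesc_pow` gives the value on the first tensor power, of which the universal algebra is a
retract. -/
theorem relDesc_app [IsVectoid B] : (relDesc d).app (XaRel A).X = algMap d := by
  have h := relDesc_pow d FinN.one
  have h₁ := congrArg algMap (powι_relPow (𝟙 (f.toHom.inv.mapCommMon.obj (XaRel A))) 1 0)
  have h₂ := congrArg algMap (powι_relPow d 1 0)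
  have h₃ : powι (XaRel A) 1 0 ≫ powDesc 1 (fun _ => 𝟙 (XaRel A)) = 𝟙 _ := powι_desc _ _ _
  have h₄ : g.toHom.inv.map (algMap (powι (XaRel A) 1 0)) ≫
      g.toHom.inv.map (algMap (powDesc 1 (fun _ => 𝟙 (XaRel A)))) = 𝟙 _ :=
    (g.toHom.inv.map_comp _ _).symm.trans ((congrArg (fun t => g.toHom.inv.map (algMap t)) h₃).trans
      (CategoryTheory.Functor.map_id _ _))
  have h₅ := (relDesc d).naturality (algMap (powι (XaRel A) 1 0))
  exact eq_of_retract (h₁.trans (Category.id_comp _)) h h₂ h₅ h₄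

theorem full_pullAlg [IsVectoid B] : (OverHom.pullAlg p (baseFunctor A) (XaRel A)).Full where
  map_surjective {f g} d := by
    refine ⟨⟨VectoidMorphism.homMk (h := isMonoidal_relDesc d) (relDesc d), ?_⟩, ?_⟩
    · ext a
      rw [← cancel_epi (f.iso.inv.app a)]
      change f.iso.inv.app a ≫ (relDesc d).app ((baseFunctor A).obj a) ≫ g.iso.hom.app a = _
      rw [← Category.assoc]
      refine (congrArg (· ≫ g.iso.hom.app a) (base_relDesc d a)).trans ?_
      simp
    · apply algMap_ext
      exact relDesc_app d
end
end
end
end AlgClassifier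

/-! ### Construction of inverse image functors from algebras: essential surjectivity. -/

namespace AlgClassifier
noncomputable section

section
variable {A : Type w} [Category.{u} A] [MonoidalCategory A] {B : Type w'} [Category.{u} B]

namespace Presentation
variable {E : A × FinN.{u} ⥤ B} {Φ : qa A ⥤ B} (P : Presentation E Φ)

/-- The map to `Φ F` given by an element of `F(X)`. -/
def el {F : qa A} {a : A} {X : FinN.{u}} (x : a ⟶ F.functor.obj (op X)) : E.obj (a, X) ⟶ Φ.obj F :=
  biMap E x (𝟙 X) ≫ P.π F X

theorem comp_el {F : qa A} {a b : A} {X : FinN.{u}} (f : a ⟶ b) (x : b ⟶ F.functor.obj (op X)) :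
    biMap E f (𝟙 X) ≫ P.el x = P.el (f ≫ x) := by
  rw [el, el, biMap_left_comp, Category.assoc]

theorem el_map {F G : qa A} {a : A} {X : FinN.{u}} (x : a ⟶ F.functor.obj (op X)) (t : F ⟶ G) :
    P.el x ≫ Φ.map t = P.el (x ≫ t.natTrans.app (op X)) := by
  rw [el, el, Category.assoc, ← P.natural, biMap_left_comp, Category.assoc]

theorem map_el {F : qa A} {a : A} {X Y : FinN.{u}} (f : X ⟶ Y) (x : a ⟶ F.functor.obj (op Y)) :
    biMap E (𝟙 a) f ≫ P.el x = P.el (x ≫ F.functor.map f.op) := by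
  rw [el, el, reassoc_of% biMap_comm, ← P.dinatural, biMap_left_comp, Category.assoc]

/-- A presented functor takes a presheaf free on `(a, X)` to `E (a, X)`, since both objects
corepresent morphisms `a ⟶ (coendRight E W)(X)`. -/
theorem isIso_el [∀ X, (leftPart E X).IsLeftAdjoint] {F : qa A} {a : A} {X : FinN.{u}}
    {x : a ⟶ F.functor.obj (op X)} (hx : IsFree F x) : IsIso (P.el x) := by
  rw [isIso_iff_coyoneda_map_bijective]
  intro W
  have h := (coendEl E).symm.bijective.comp ((hx (coendRight E W)).comp (P.homEquiv F W).bijective)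
  convert h using 1
  funext g
  change P.el x ≫ g = (coendEl E).symm (x ≫ coendEl E (P.π F X ≫ g))
  rw [← coendEl_comp, Equiv.symm_apply_apply, el, Category.assoc]
end Presentation
end

section
variable {A : Type w} [Category.{u} A] [MonoidalCategory A] [CocontinuousTensor A]
  {B : Type w'} [Category.{u} B] [MonoidalCategory B]
  {E : A × FinN.{u} ⥤ B} [E.LaxMonoidal] {Φ : qa A ⥤ B} [Φ.LaxMonoidal]
  (P : Presentation E Φ) [P.IsMonoidal]

namespace Presentation
theorem el_mul {F G : qa A} {a b : A} {X Y : FinN.{u}} (x : a ⟶ F.functor.obj (op X))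
    (y : b ⟶ G.functor.obj (op Y)) : (P.el x ⊗ₘ P.el y) ≫ Functor.LaxMonoidal.μ Φ F G =
      biμ E a b X Y ≫ P.el (elMul x y) := by
  rw [el, el, ← tensorHom_comp_tensorHom, Category.assoc, IsMonoidal.mul, mulπ,
    reassoc_of% biμ_natural, el, elMul, id_tensorHom_id, biMap_left_comp, Category.assoc]

theorem el_unit : Functor.LaxMonoidal.ε Φ = biε E ≫ P.el unitPt := IsMonoidal.one
end Presentation
end

section
variable {A : Type w} [Category.{u} A] [MonoidalCategory A] {B : Type w'} [Category.{u} B]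
  [HasColimitsOfSize.{u, u} B] (E : A × FinN.{u} ⥤ B)

theorem exists_coend (F : qa A) : ∃ (Z : B)
    (π : ∀ X : FinN.{u}, E.obj (F.functor.obj (op X), X) ⟶ Z),
    (∀ {X Y : FinN.{u}} (f : X ⟶ Y),
      biMap E (F.functor.map f.op) (𝟙 X) ≫ π X = biMap E (𝟙 _) f ≫ π Y) ∧
    ∀ (W : B) (t : ∀ X : FinN.{u}, E.obj (F.functor.obj (op X), X) ⟶ W)
      (_ : ∀ {X Y : FinN.{u}} (f : X ⟶ Y),
        biMap E (F.functor.map f.op) (𝟙 X) ≫ t X = biMap E (𝟙 _) f ≫ t Y),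
      ∃! g : Z ⟶ W, ∀ X, π X ≫ g = t X := by
  obtain ⟨Z, π, h⟩ := exists_isCokernel
    (I := FinN.{u}) (J := Σ (m n : FinN.{u}), m ⟶ n)
    (T := fun X => E.obj (F.functor.obj (op X), X))
    (S := fun j => E.obj (F.functor.obj (op j.2.1), j.1))
    (a := fun j => j.1) (b := fun j => j.2.1)
    (fun j => biMap E (F.functor.map j.2.2.op) (𝟙 j.1))
    (fun j => biMap E (𝟙 (F.functor.obj (op j.2.1))) j.2.2)
  rw [isCokernel_iff] at h
  exact ⟨Z, π, fun {X Y} f => h.1 ⟨X, Y, f⟩, fun W t ht => h.2 W t fun j => ht j.2.2⟩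

/-- The coends exist because `B` has coproducts and coequalizers; functoriality comes from their
universal property. -/
theorem exists_presentation : ∃ Φ : qa A ⥤ B, Nonempty (Presentation E Φ) := by
  choose Z π hπ h using exists_coend E
  have hc {F G : qa A} (t : F ⟶ G) {X Y : FinN.{u}} (f : X ⟶ Y) :
      biMap E (F.functor.map f.op) (𝟙 X) ≫ biMap E (t.natTrans.app (op X)) (𝟙 X) ≫ π G X =
        biMap E (𝟙 _) f ≫ biMap E (t.natTrans.app (op Y)) (𝟙 Y) ≫ π G Y := by
    rw [reassoc_of% biMap_comm, ← hπ, ← reassoc_of% biMap_left_comp, ← reassoc_of% biMap_left_comp, pair_nat_app]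
  choose m hm hu using fun (F G : qa A) (t : F ⟶ G) => h F (Z G)
    (fun X => biMap E (t.natTrans.app (op X)) (𝟙 X) ≫ π G X) (hc t)
  have ext {F : qa A} {W : B} {g g' : Z F ⟶ W} (w : ∀ X, π F X ≫ g = π F X ≫ g') : g = g' :=
    (h F W (fun X => π F X ≫ g') (fun f => by
      rw [← Category.assoc, hπ, Category.assoc])).unique w (fun _ => rfl)
  let Φ : qa A ⥤ B :=
    { obj := Z
      map {F G} t := m F G t
      map_id F := ext fun X => by
        rw [hm, Category.comp_id]
        exact (congrArg (· ≫ π F X) (biMap_id E _ X)).trans (Category.id_comp _)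
      map_comp {F G H} s t := ext fun X => by
        rw [hm, reassoc_of% (hm F G s X), hm, comp_app, reassoc_of% biMap_left_comp] }
  exact ⟨Φ, ⟨{ π := π, natural := fun t X => (hm _ _ t X).symm, dinatural := hπ, universal := h }⟩⟩
end

section
variable {A : Type w} [Category.{u} A] [MonoidalCategory A] [SymmetricCategory A]
  [CocontinuousTensor A] {B : Type w'} [Category.{u} B] [MonoidalCategory B] [SymmetricCategory B]
  [∀ b : B, (tensorLeft b).IsLeftAdjoint] [∀ b : B, (tensorRight b).IsLeftAdjoint]
  {E : A × FinN.{u} ⥤ B} {Φ : qa A ⥤ B} [E.LaxBraided] [∀ X, (leftPart E X).IsLeftAdjoint]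
  [IsIso (Functor.LaxMonoidal.ε E)] [∀ P Q, IsIso (Functor.LaxMonoidal.μ E P Q)]

/-- The strong symmetric monoidal structure of a presented functor. -/
abbrev Presentation.braided (P : Presentation E Φ) : Φ.Braided :=
  letI := P.laxBraided
  haveI : IsIso (Functor.LaxMonoidal.ε Φ) := P.isIso_lε
  haveI (F G : qa A) : IsIso (Functor.LaxMonoidal.μ Φ F G) := P.isIso_lμ F G
  letI := Functor.Monoidal.ofLaxMonoidal Φ
  { braided := P.laxBraided.braided }

theorem Presentation.isMonoidal_braided (P : Presentation E Φ) : letI := P.braided; P.IsMonoidal :=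
  letI := P.braided
  { mul := P.π_lμ
    one := rfl }

/-- The morphism of vectoids with a given presentation. -/
def Presentation.vectoidMorphism (P : Presentation E Φ) : VectoidMorphism B (qa A) :=
  letI := P.braided
  haveI := P.isLeftAdjoint
  { inv := Φ, dir := Φ.rightAdjoint, adj := Adjunction.ofIsLeftAdjoint Φ }
end

section
variable {A : Type w} [Category.{u} A] [MonoidalCategory A] [SymmetricCategory A]
  {B : Type w'} [Category.{u} B] [MonoidalCategory B] [SymmetricCategory B]

theorem tensorμ_unit_left (a b : A) : ((λ_ a).inv ⊗ₘ (λ_ b).inv) ≫ tensorμ (𝟙_ A) a (𝟙_ A) b =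
    (λ_ (a ⊗ b)).inv ≫ (λ_ (𝟙_ A)).inv ▷ (a ⊗ b) := by
  rw [tensorμ, braiding_tensorUnit_right]
  monoidal

/-- This and the next lemma are the computations behind `baseBi_mul` and `unitBi_mul`, with opaque
objects. -/
theorem tensorμ_unit_comp {a b c s : A} (m : a ⊗ b ⟶ c) (n : 𝟙_ A ⊗ 𝟙_ A ⟶ s) (l : s ⟶ 𝟙_ A)
    (h : n ≫ l = (λ_ (𝟙_ A)).hom) : ((ρ_ a).inv ⊗ₘ (ρ_ b).inv) ≫
      (tensorμ a (𝟙_ A) b (𝟙_ A) ≫ (m ⊗ₘ n)) ≫ (𝟙 c ⊗ₘ l) = m ≫ (ρ_ c).inv := by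
  rw [Category.assoc, tensorHom_comp_tensorHom, h, Category.comp_id, reassoc_of% tensorμ_unit,
    MonoidalCategory.tensorHom_def', ← MonoidalCategory.whiskerLeft_comp_assoc, Iso.inv_hom_id,
    MonoidalCategory.whiskerLeft_id, Category.id_comp, rightUnitor_inv_naturality]

theorem tensorμ_unit_left_comp {x y z u v : A} (i : 𝟙_ A ⟶ u) (m : u ⊗ u ⟶ v) (l : v ⟶ u)
    (h : (i ⊗ₘ i) ≫ m ≫ l = (λ_ (𝟙_ A)).hom ≫ i) (n : x ⊗ y ⟶ z) :
    (((λ_ x).inv ≫ i ▷ x) ⊗ₘ ((λ_ y).inv ≫ i ▷ y)) ≫ (tensorμ u x u y ≫ (m ⊗ₘ n)) ≫ (l ⊗ₘ 𝟙 z) =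
      n ≫ (λ_ z).inv ≫ i ▷ z := by
  rw [← tensorHom_comp_tensorHom, ← tensorHom_id, ← tensorHom_id, Category.assoc, Category.assoc,
    tensorμ_natural_assoc, tensorHom_comp_tensorHom, tensorHom_comp_tensorHom, h,
    id_tensorHom_id, Category.id_comp, Category.comp_id, reassoc_of% tensorμ_unit_left,
    leftUnitor_inv_naturality_assoc, ← tensorHom_id, ← tensorHom_id, ← id_tensorHom,
    tensorHom_comp_tensorHom, tensorHom_comp_tensorHom, Iso.inv_hom_id_assoc, Category.id_comp,
    Category.id_comp, Category.comp_id]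

section
variable (Y : CommMon B) (p : A ⥤ B)

/-- The canonical map `p a ⟶ p a ⊗ Y^{⊗∅}`. -/
def baseBi (a : A) : p.obj a ⟶ (tensorBi p (Phi.{u} Y)).obj (a, 𝟙_ _) :=
  (ρ_ (p.obj a)).inv

theorem baseBi_natural {a b : A} (f : a ⟶ b) : p.map f ≫ baseBi Y p b =
    baseBi Y p a ≫ biMap (tensorBi p (Phi.{u} Y)) f (𝟙 (𝟙_ _)) := by
  have h : biMap (tensorBi p (Phi Y)) f (𝟙 (𝟙_ FinN.{u})) = p.map f ▷ 𝟙_ B := by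
    rw [tensorBi_biMap, CategoryTheory.Functor.map_id, tensorHom_id]
    rfl
  rw [h]
  exact rightUnitor_inv_naturality _

theorem baseBi_mul [p.LaxMonoidal] (a b : A) : (baseBi Y p a ⊗ₘ baseBi Y p b) ≫
    biμ (tensorBi p (Phi Y)) a b (𝟙_ FinN.{u}) (𝟙_ _) ≫
      biMap (tensorBi p (Phi Y)) (𝟙 (a ⊗ b)) (λ_ (𝟙_ FinN.{u})).hom =
    Functor.LaxMonoidal.μ p a b ≫ baseBi Y p (a ⊗ b) := by
  have h : algMap (phiμ Y (𝟙_ FinN.{u}) (𝟙_ _)) ≫ (Phi Y).map (λ_ (𝟙_ FinN.{u})).hom =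
      (λ_ (𝟙_ B)).hom := congrArg algMap (phiμ_left Y (𝟙_ FinN.{u}))
  rw [tensorBi_biMap, CategoryTheory.Functor.map_id]
  exact tensorμ_unit_comp (Functor.LaxMonoidal.μ p a b) _ _ h

end

variable (p : A ⥤ B) [p.LaxMonoidal] (Y : CommMon B)

/-- The canonical map `Y^{⊗X} ⟶ p 1 ⊗ Y^{⊗X}`. -/
def unitBi (X : FinN.{u}) : (Phi Y).obj X ⟶ (tensorBi p (Phi Y)).obj (𝟙_ A, X) :=
  (λ_ ((Phi Y).obj X)).inv ≫ Functor.LaxMonoidal.ε p ▷ ((Phi Y).obj X)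

theorem unitBi_natural {X X' : FinN.{u}} (f : X ⟶ X') : (Phi Y).map f ≫ unitBi p Y X' =
    unitBi p Y X ≫ biMap (tensorBi p (Phi Y)) (𝟙 _) f := by
  rw [tensorBi_biMap, CategoryTheory.Functor.map_id, id_tensorHom, unitBi, unitBi,
    leftUnitor_inv_naturality_assoc, Category.assoc, whisker_exchange]

theorem unitBi_mul (X X' : FinN.{u}) : (unitBi p Y X ⊗ₘ unitBi p Y X') ≫
    biμ (tensorBi p (Phi Y)) (𝟙_ A) (𝟙_ A) X X' ≫
      biMap (tensorBi p (Phi Y)) (λ_ (𝟙_ A)).hom (𝟙 (X ⊗ X')) =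
    Functor.LaxMonoidal.μ (Phi Y) X X' ≫ unitBi p Y (X ⊗ X') := by
  rw [tensorBi_biMap, CategoryTheory.Functor.map_id]
  refine tensorμ_unit_left_comp (Functor.LaxMonoidal.ε p) (Functor.LaxMonoidal.μ p _ _)
    (p.map (λ_ (𝟙_ A)).hom) ?_ (algMap (phiμ Y X X'))
  rw [MonoidalCategory.tensorHom_def', Category.assoc, ← Functor.LaxMonoidal.left_unitality,
    leftUnitor_naturality]

theorem biε_tensorBi_left : biε (tensorBi p (Phi.{u} Y)) = unitBi p Y (𝟙_ _) := by
  have h : (λ_ (𝟙_ B)).inv ≫ (Functor.LaxMonoidal.ε p ⊗ₘ 𝟙 (𝟙_ B)) =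
    (λ_ (𝟙_ B)).inv ≫ Functor.LaxMonoidal.ε p ▷ 𝟙_ B := by rw [tensorHom_id]
  exact h

theorem biε_tensorBi_right : biε (tensorBi p (Phi.{u} Y)) =
    Functor.LaxMonoidal.ε p ≫ baseBi Y p (𝟙_ A) := by
  have h : (λ_ (𝟙_ B)).inv ≫ Functor.LaxMonoidal.ε p ▷ 𝟙_ B =
    Functor.LaxMonoidal.ε p ≫ (ρ_ (p.obj (𝟙_ A))).inv := by
      rw [rightUnitor_inv_naturality, unitors_inv_equal]
  exact (biε_tensorBi_left p Y).trans h
end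

section
variable {A : Type w} [Category.{u} A] [MonoidalCategory A] [SymmetricCategory A]

theorem isIso_of_algMap {M N : CommMon A} (f : M ⟶ N) [IsIso (algMap f)] : IsIso f := by
  have h : IsMonHom f.hom.hom := f.hom.isMonHom_hom
  exact (CommMon.mkIso (M := M) (N := N) (asIso (algMap f)) h.one_hom h.mul_hom).isIso_hom
end

section
variable {A : Type w} [Category.{u} A] [MonoidalCategory A] [SymmetricCategory A] [IsVectoid A]
  {B : Type w'} [Category.{u} B] [MonoidalCategory B] [SymmetricCategory B] [IsVectoid B]
  {p : A ⥤ B} {Y : CommMon B} {Φ : qa A ⥤ B}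

namespace Presentation
variable (P : Presentation (tensorBi p (Phi Y)) Φ)

/-- The map `p a ⟶ Φ (q^* a)`. -/
def baseMap (a : A) : p.obj a ⟶ Φ.obj ((baseFunctor A).obj a) :=
  baseBi Y p a ≫ P.el (baseIncl a)

theorem baseMap_natural {a b : A} (f : a ⟶ b) : p.map f ≫ P.baseMap b =
    P.baseMap a ≫ Φ.map ((baseFunctor A).map f) := by
  rw [baseMap, baseMap, Category.assoc, P.el_map, baseIncl_natural, ← P.comp_el, ← Category.assoc,
    baseBi_natural, Category.assoc]

theorem isIso_baseMap [p.IsLeftAdjoint] (a : A) : IsIso (P.baseMap a) :=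
  haveI := P.isIso_el (isFree_base a)
  IsIso.comp_isIso' (inferInstanceAs (IsIso (ρ_ (p.obj a)).inv)) this

variable (A) in
/-- The unit as an element of the universal algebra. -/
def oneEl (X : FinN.{u}) : 𝟙_ A ⟶ (XaRel A).X.functor.obj (op X) := 𝟙 (𝟙_ A)

theorem oneEl_map {X X' : FinN.{u}} (f : X ⟶ X') :
    oneEl A X' ≫ (XaRel A).X.functor.map f.op = oneEl A X := Category.comp_id (𝟙 (𝟙_ A))

theorem oneEl_mul (X X' : FinN.{u}) : elMul (oneEl A X) (oneEl A X') ≫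
    (MonObj.mul (X := (XaRel A).X)).natTrans.app (op (X ⊗ X')) =
      (λ_ (𝟙_ A)).hom ≫ oneEl A (X ⊗ X') := by
  refine (Category.assoc _ _ _).trans ((congrArg₂ (· ≫ ·) (id_tensorHom_id (𝟙_ A) (𝟙_ A))
    (constMul_pair X X')).trans ?_)
  exact (Category.id_comp _).trans (Category.comp_id _).symm

theorem oneEl_unit : unitPt ≫ (MonObj.one (X := (XaRel A).X)).natTrans.app (op (𝟙_ FinN.{u})) =
    oneEl A (𝟙_ _) := constUnit_pt

variable [p.LaxBraided]

/-- The map `Y^{⊗X} ⟶ Φ X_{a,A}`. -/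
def algEl (X : FinN.{u}) : (Phi Y).obj X ⟶ Φ.obj (XaRel A).X :=
  unitBi p Y X ≫ P.el (oneEl A X)

theorem map_algEl {X X' : FinN.{u}} (f : X ⟶ X') : (Phi Y).map f ≫ P.algEl X' = P.algEl X := by
  rw [algEl, ← Category.assoc, unitBi_natural, Category.assoc, P.map_el, oneEl_map, algEl]

theorem isIso_algEl [p.IsLeftAdjoint] [IsIso (Functor.LaxMonoidal.ε p)] :
    IsIso (P.algEl FinN.one) :=
  haveI := P.isIso_el (isFree_constOne (A := A))
  IsIso.comp_isIso' (inferInstanceAs (IsIso ((λ_ _).inv ≫ Functor.LaxMonoidal.ε p ▷ _))) this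

variable [Φ.LaxBraided] [P.IsMonoidal]

theorem baseMap_ε : Functor.LaxMonoidal.ε p ≫ P.baseMap (𝟙_ A) =
    Functor.LaxMonoidal.ε Φ ≫ Φ.map (Functor.LaxMonoidal.ε (baseFunctor A)) := by
  rw [P.el_unit, Category.assoc, P.el_map, unitPt_baseε, biε_tensorBi_right, baseMap,
    Category.assoc]

/-- The maps `baseMap` come from the generators of the free presheaves `q^* a`, so their
multiplicativity reduces to `elMul_baseμ`. -/
theorem baseMap_μ (a b : A) : Functor.LaxMonoidal.μ p a b ≫ P.baseMap (a ⊗ b) =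
    (P.baseMap a ⊗ₘ P.baseMap b) ≫ Functor.LaxMonoidal.μ Φ _ _ ≫
      Φ.map (Functor.LaxMonoidal.μ (baseFunctor A) a b) := by
  rw [baseMap, baseMap, baseMap, ← tensorHom_comp_tensorHom, Category.assoc,
    reassoc_of% (P.el_mul (baseIncl a) (baseIncl b)), P.el_map, elMul_baseμ, ← P.map_el,
    ← reassoc_of% baseBi_mul]

theorem algEl_ε : Functor.LaxMonoidal.ε Φ ≫ Φ.map (MonObj.one (X := (XaRel A).X)) =
    P.algEl (𝟙_ _) := by
  rw [P.el_unit, Category.assoc, P.el_map, oneEl_unit, biε_tensorBi_left]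
  rfl

/-- Products of the constant elements `oneEl` are again such elements, so the product of the maps
for `X` and `X'` is the map for `X ⊔ X'`. For one-element sets this describes the multiplication of
`Φ X_{a,A}`. -/
theorem algEl_μ (X X' : FinN.{u}) : (P.algEl X ⊗ₘ P.algEl X') ≫ Functor.LaxMonoidal.μ Φ _ _ ≫
    Φ.map (MonObj.mul (X := (XaRel A).X)) =
      Functor.LaxMonoidal.μ (Phi Y) X X' ≫ P.algEl (X ⊗ X') := by
  rw [algEl, algEl, ← tensorHom_comp_tensorHom, Category.assoc,
    reassoc_of% (P.el_mul (oneEl A X) (oneEl A X')), P.el_map, oneEl_mul, ← P.comp_el,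
    algEl, ← reassoc_of% unitBi_mul]

/-- The algebra map `Y ≅ Y^{⊗1} ⟶ Φ X_{a,A}`. -/
def algIncl : pow Y 1 ⟶ Φ.mapCommMon.obj (XaRel A) :=
  CommMon.homMk (.mk' (P.algEl FinN.one)
    (by
      -- The unit of `Y^{⊗1}` is the map attached to `∅ ⟶ 1`.
      have h : algMap (powMap Y (default : 𝟙_ FinN.{u} ⟶ FinN.one)) =
          MonObj.one (X := (pow Y 1).X) := (Category.id_comp _).symm.trans
            (IsMonHom.one_hom (algMap (powMap Y (default : 𝟙_ FinN.{u} ⟶ FinN.one))))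
      refine Eq.trans ?_ P.algEl_ε.symm
      rw [← P.map_algEl (default : 𝟙_ FinN.{u} ⟶ FinN.one)]
      exact congrArg (· ≫ P.algEl FinN.one) h.symm)
    (by
      -- The multiplication of `Y^{⊗1}` is the map attached to `2 ⟶ 1`, after the identification of
      -- `Y^{⊗1} ⊗ Y^{⊗1}` with `Y^{⊗2}`.
      have h : Functor.LaxMonoidal.μ (Phi Y) FinN.one FinN.one ≫ (Phi Y).map
          (default : FinN.one ⊗ FinN.one ⟶ FinN.one.{u}) = MonObj.mul (X := (pow Y 1).X) := by
        have h₁ : phiμ Y FinN.one FinN.one ≫ powMap Y (default : _ ⟶ FinN.one.{u}) =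
            descAlg (𝟙 (pow Y 1)) (𝟙 (pow Y 1)) := by
          rw [phiμ, descAlg_comp, ← powMap_comp, ← powMap_comp]
          have e : (𝟙 FinN.one : FinN.one.{u} ⟶ _) = default := Subsingleton.elim _ _
          have e' := powMap_id Y FinN.one.{u}
          rw [e] at e'
          exact congrArg₂ descAlg e' e'
        refine (congrArg algMap h₁).trans ?_
        change (𝟙 _ ⊗ₘ 𝟙 _) ≫ _ = _
        rw [id_tensorHom_id]
        exact Category.id_comp _
      have h' := P.algEl_μ FinN.one FinN.one
      rw [← P.map_algEl (default : FinN.one ⊗ FinN.one ⟶ FinN.one.{u})] at h'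
      exact (congrArg (· ≫ P.algEl FinN.one) h.symm).trans ((Category.assoc _ _ _).trans h'.symm)))

theorem isIso_algIncl [p.IsLeftAdjoint] [IsIso (Functor.LaxMonoidal.ε p)] : IsIso P.algIncl := by
  have h : IsIso (algMap P.algIncl) := P.isIso_algEl
  exact isIso_of_algMap P.algIncl

/-- The algebra `Φ X_{a,A}` for a functor `Φ` presented by the algebra `Y`. -/
def algIso [p.IsLeftAdjoint] [IsIso (Functor.LaxMonoidal.ε p)] :
    Φ.mapCommMon.obj (XaRel A) ≅ Y :=
  haveI := P.isIso_algIncl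
  (asIso P.algIncl).symm ≪≫
    -- The first power is `1 ⊗ Y` and not `Y` itself; this is the comparison.
    { hom := powDesc 1 fun _ => 𝟙 Y
      inv := powι Y 1 0
      hom_inv_id := pow_ext fun i => by
        obtain rfl := Subsingleton.elim i 0
        rw [← Category.assoc, powι_desc, Category.id_comp, Category.comp_id]
      inv_hom_id := powι_desc _ _ _ }

theorem algIso_inv [p.IsLeftAdjoint] [IsIso (Functor.LaxMonoidal.ε p)] :
    algMap P.algIso.inv = algMap (powι Y 1 0) ≫ P.algEl FinN.one := rfl

/-- The restriction to `A` of a functor presented by an algebra. -/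
def isoBase [p.IsLeftAdjoint] : p ≅ baseFunctor A ⋙ Φ :=
  haveI := P.isIso_baseMap
  NatIso.ofComponents (fun a => asIso (P.baseMap a)) P.baseMap_natural

instance [p.IsLeftAdjoint] : NatTrans.IsMonoidal P.isoBase.hom where
  unit := P.baseMap_ε
  tensor := P.baseMap_μ
end Presentation

/-- The coend of `p F(n) ⊗ Y^{⊗n}` is presented by strong symmetric monoidal data, so it is strong
symmetric monoidal with a right adjoint. Its values on the free presheaves `q^* a` and `X_{a,A}` are
`p a` and `Y`. -/
theorem essSurj_pullAlg (p : A ⥤ B) [p.Braided] [p.IsLeftAdjoint] :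
    (OverHom.pullAlg p (baseFunctor A) (XaRel A)).EssSurj where
  mem_essImage Y := by
    obtain ⟨Φ, ⟨P⟩⟩ := exists_presentation (tensorBi p (Phi.{u} Y))
    let := P.braided
    have : P.IsMonoidal := P.isMonoidal_braided
    have h : NatTrans.IsMonoidal P.isoBase.inv := inferInstance
    exact ⟨{ toHom := P.vectoidMorphism, iso := P.isoBase.symm, monoidal := h }, ⟨P.algIso⟩⟩

theorem isEquivalence_pullAlg (p : A ⥤ B) [p.Braided] [p.IsLeftAdjoint] :
    (OverHom.pullAlg p (baseFunctor A) (XaRel A)).IsEquivalence :=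
  { faithful := faithful_pullAlg
    full := full_pullAlg
    essSurj := essSurj_pullAlg p }
end
end
end AlgClassifier

/-! ### The explicit formula for Day convolution. -/

namespace AlgClassifier
noncomputable section
section
variable {W : Type u} [Finite W]

/-- The map `W → U ⊔ Uᶜ` of standard sets. -/
def splitMap (U : Set W) : std W ⟶ std U ⊗ std (Uᶜ : Set W) :=
  FinN.ofFun fun x => (FinN.sumEquiv (std U) (std (Uᶜ : Set W))).symm
      (Sum.map (stdEquiv U).symm (stdEquiv (Uᶜ : Set W)).symm (splitSet U (stdEquiv W x)))

theorem splitMap_mem {U : Set W} {w : W} (h : w ∈ U) :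
    splitMap U ((stdEquiv W).symm w) = (FinN.sumEquiv (std U) (std (Uᶜ : Set W))).symm
      (Sum.inl ((stdEquiv U).symm ⟨w, h⟩)) := by
  simp [splitMap, FinN.ofFun, splitSet, h]

theorem splitMap_not_mem {U : Set W} {w : W} (h : w ∉ U) :
    splitMap U ((stdEquiv W).symm w) = (FinN.sumEquiv (std U) (std (Uᶜ : Set W))).symm
      (Sum.inr ((stdEquiv (Uᶜ : Set W)).symm ⟨w, h⟩)) := by
  simp [splitMap, FinN.ofFun, splitSet, h]

/-- The part of `W` which `f : W → S ⊔ T` maps to `S`. -/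
def leftPre {S T : FinN.{u}} (f : std W ⟶ S ⊗ T) : Set W :=
  {w | (FinN.sumEquiv S T (f ((stdEquiv W).symm w))).isLeft}

theorem eq_leftPre {S T : FinN.{u}} (f : std W ⟶ S ⊗ T) {U : Set W} {g : std U ⟶ S}
    {h : std (Uᶜ : Set W) ⟶ T} (e : splitMap U ≫ (g ⊗ₘ h) = f) : U = leftPre f := by
  subst e
  ext w
  by_cases hw : w ∈ U
  · simp [leftPre, FinN.comp_el, FinN.tensorHom_eq, splitMap_mem hw, hw]
  · simp [leftPre, FinN.comp_el, FinN.tensorHom_eq, splitMap_not_mem hw, hw]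

theorem splitMap_hom_ext {S T : FinN.{u}} {U : Set W} {g g' : std U ⟶ S}
    {h h' : std (Uᶜ : Set W) ⟶ T} (e : splitMap U ≫ (g ⊗ₘ h) = splitMap U ≫ (g' ⊗ₘ h')) :
    g = g' ∧ h = h' := by
  constructor
  · refine FinN.hom_ext_el _ _ fun x => ?_
    obtain ⟨⟨w, hw⟩, rfl⟩ := (stdEquiv U).symm.surjective x
    have := congrFun e ((stdEquiv W).symm w)
    simpa [FinN.comp_el, FinN.tensorHom_eq, splitMap_mem hw] using this
  · refine FinN.hom_ext_el _ _ fun x => ?_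
    obtain ⟨⟨w, hw⟩, rfl⟩ := (stdEquiv (Uᶜ : Set W)).symm.surjective x
    have := congrFun e ((stdEquiv W).symm w)
    simpa [FinN.comp_el, FinN.tensorHom_eq, splitMap_not_mem hw] using this

theorem exists_splitMap {S T : FinN.{u}} (f : std W ⟶ S ⊗ T) :
    ∃ (U : Set W) (g : std U ⟶ S) (h : std (Uᶜ : Set W) ⟶ T), splitMap U ≫ (g ⊗ₘ h) = f := by
  have hl : ∀ x : leftPre f, ∃ s, FinN.sumEquiv S T (f ((stdEquiv W).symm x)) = Sum.inl s :=
    fun x => Sum.isLeft_iff.mp x.2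
  have hr : ∀ x : ((leftPre f)ᶜ : Set W),
      ∃ s, FinN.sumEquiv S T (f ((stdEquiv W).symm x)) = Sum.inr s :=
    fun x => Sum.isRight_iff.mp (Sum.not_isLeft.mp x.2)
  choose g hg using hl
  choose h hh using hr
  refine ⟨leftPre f, FinN.ofFun fun x => g (stdEquiv _ x), FinN.ofFun fun x => h (stdEquiv _ x),
    FinN.hom_ext_el _ _ fun x => ?_⟩
  obtain ⟨w, rfl⟩ := (stdEquiv W).symm.surjective x
  by_cases hw : w ∈ leftPre f
  · rw [FinN.comp_el, splitMap_mem hw, FinN.tensorHom_eq, FinN.sumMap_inl, Equiv.symm_apply_eq,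
      hg ⟨w, hw⟩]
    simp [FinN.ofFun]
  · rw [FinN.comp_el, splitMap_not_mem hw, FinN.tensorHom_eq, FinN.sumMap_inr,
      Equiv.symm_apply_eq, hh ⟨w, hw⟩]
    simp [FinN.ofFun]

/-- The decompositions of `W` as maps `W → S ⊔ T`. -/
def splitArrow : Discrete (Set W) ⥤ CostructuredArrow (tensor FinN.{u}ᵒᵖ) (op (std W)) :=
  Discrete.functor fun U => CostructuredArrow.mk (Y := (op (std U), op (std (Uᶜ : Set W))))
    (Quiver.Hom.op (splitMap U))

theorem exists_splitHom (c : CostructuredArrow (tensor FinN.{u}ᵒᵖ) (op (std W)))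
    (U : Set W) (g : std U ⟶ unop c.left.1) (h : std (Uᶜ : Set W) ⟶ unop c.left.2)
    (e : splitMap U ≫ (g ⊗ₘ h) = c.hom.unop) :
    ∃ t : c ⟶ splitArrow.obj ⟨U⟩, t.left = (g.op, h.op) :=
  ⟨CostructuredArrow.homMk (g.op, h.op) (Quiver.Hom.unop_inj e), rfl⟩

theorem splitHom_w {c : CostructuredArrow (tensor FinN.{u}ᵒᵖ) (op (std W))} {U : Set W}
    (t : c ⟶ splitArrow.obj ⟨U⟩) :
    splitMap U ≫ (t.left.1.unop ⊗ₘ t.left.2.unop) = c.hom.unop :=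
  congrArg Quiver.Hom.unop (CostructuredArrow.w t)

/-- A map `W → S ⊔ T` factors uniquely through exactly one splitting, namely that in which `U` is
the preimage of `S`. The comma categories in question thus have exactly one object. -/
instance : (splitArrow (W := W)).Final where
  out c := by
    obtain ⟨U, g, h, e⟩ := exists_splitMap c.hom.unop
    obtain ⟨t, ht⟩ := exists_splitHom c U g h e
    have : Nonempty (StructuredArrow c splitArrow) := ⟨StructuredArrow.mk t⟩
    have hs (i j : StructuredArrow c (splitArrow (W := W))) : i = j := by
      obtain ⟨⟨⟨⟩⟩, ⟨U⟩, i⟩ := i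
      obtain ⟨⟨⟨⟩⟩, ⟨V⟩, j⟩ := j
      obtain rfl : U = V := (eq_leftPre _ (splitHom_w i)).trans (eq_leftPre _ (splitHom_w j)).symm
      obtain ⟨h₁, h₂⟩ := splitMap_hom_ext ((splitHom_w i).trans (splitHom_w j).symm)
      obtain rfl : i = j := CostructuredArrow.hom_ext _ _
        (Prod.ext (Quiver.Hom.unop_inj h₁) (Quiver.Hom.unop_inj h₂))
      rfl
    exact zigzag_isConnected fun i j => by rw [hs i j]
end

section
variable {A : Type w} [Category.{u} A] [MonoidalCategory A] [CocontinuousTensor A]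

/-- The pointwise Kan extension describes `(F ⊗ G)(W)` as a colimit over all maps `W → S ⊔ T`;
finality of the splittings cuts it down to a coproduct over subsets. -/
theorem isColimit_extPair (F G : qa A) (W : Type u) [Finite W] :
    Nonempty (IsColimit (Cofan.mk (ext (F ⊗ G) W)
      (fun U : Set W => extPair F G (splitSet U)))) := by
  have h := (Functor.Final.isColimitWhiskerEquiv (splitArrow (W := W)) _).symm
    ((LawfulDayConvolutionMonoidalCategoryStruct.isPointwiseLeftKanExtensionConvolutionExtensionUnit
      (C := FinN.{u}ᵒᵖ) (V := A) F G) (op (std W)))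
  exact ⟨Cofan.IsColimit.mk _
    (fun s => h.desc (Cocone.mk s.pt (Discrete.natTrans fun U => s.inj U.as)))
    (fun s U => h.fac (Cocone.mk s.pt (Discrete.natTrans fun U => s.inj U.as)) ⟨U⟩)
    (fun s m hm => h.uniq (Cocone.mk s.pt (Discrete.natTrans fun U => s.inj U.as)) m
      fun U => hm U.as)⟩

/-- The value of the unit at `∅` is a colimit indexed by the maps `∅ → ∅`, and the identity is
terminal in the indexing category. -/
instance : IsIso (unitPt : 𝟙_ A ⟶ _) := by
  have h := LawfulDayConvolutionMonoidalCategoryStruct.isPointwiseLeftKanExtensionUnitUnit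
    FinN.{u}ᵒᵖ A (qa A) (op (𝟙_ FinN.{u}))
  let c : CostructuredArrow (Functor.fromPUnit.{0} (𝟙_ FinN.{u}ᵒᵖ)) (op (𝟙_ FinN.{u})) :=
    CostructuredArrow.mk (Y := ⟨⟨⟩⟩) (𝟙 _)
  have hc (d : CostructuredArrow (Functor.fromPUnit.{0} (𝟙_ FinN.{u}ᵒᵖ)) (op (𝟙_ FinN.{u}))) :
      d.hom = 𝟙 _ := Quiver.Hom.unop_inj (Subsingleton.elim (α := 𝟙_ FinN.{u} ⟶ _) _ _)
  have t : IsTerminal c := IsTerminal.ofUniqueHom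
    (fun d => CostructuredArrow.homMk (𝟙 _) ((Category.id_comp _).trans (hc d).symm))
    (fun d m => CostructuredArrow.hom_ext _ _ (Subsingleton.elim _ _))
  have := h.isIso_ι_app_of_isTerminal c t
  have e : (unitPt : 𝟙_ A ⟶ _) = unitPt ≫ (𝟙_ (qa A)).functor.map (𝟙 (op (𝟙_ FinN.{u}))) := by
    rw [CategoryTheory.Functor.map_id, Category.comp_id]
  rw [e]
  exact this

/-- A nonempty set has no map to `∅`, so the value of the unit is an empty colimit. -/
theorem isInitial_unit (n : FinN.{u}) (hn : 0 < n.len) :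
    Nonempty (IsInitial ((𝟙_ (qa A)).functor.obj (op n))) := by
  have h := LawfulDayConvolutionMonoidalCategoryStruct.isPointwiseLeftKanExtensionUnitUnit
    FinN.{u}ᵒᵖ A (qa A) (op n)
  have : IsEmpty (CostructuredArrow (Functor.fromPUnit.{0} (𝟙_ FinN.{u}ᵒᵖ)) (op n)) :=
    ⟨fun c => (c.hom.unop (⟨⟨0, hn⟩⟩ : FinN.El n)).down.elim0⟩
  exact ⟨IsInitial.ofUniqueHom
    (fun Z => h.desc (Cocone.mk Z { app := fun c => isEmptyElim c, naturality := fun c => isEmptyElim c }))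
    (fun Z m => h.hom_ext fun c => isEmptyElim c)⟩
end

/-! ### The structure morphism to `A`, and composition of endomorphisms. -/

section
variable {A : Type w} [Category.{u} A] [MonoidalCategory A] [SymmetricCategory A] [IsVectoid A]

instance : PreservesColimitsOfSize.{u, u} (baseFunctor A) where
  preservesColimitsOfShape := ⟨fun {K} => ⟨fun {c} hc => qa_isColimit _ fun X =>
    ⟨isColimitOfPreserves (tensorRight ((𝟙_ (qa A)).functor.obj (op X))) hc⟩⟩⟩

instance : (baseFunctor A).IsLeftAdjoint := isLeftAdjoint_of_vectoid _

instance : (baseFunctor A).Braided :=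
  letI := Functor.Monoidal.ofLaxMonoidal (baseFunctor A)
  { braided := (inferInstance : (baseFunctor A).LaxBraided).braided }

theorem isEquivalence_pullAlg_base :
    (OverHom.pullAlg (baseFunctor A) (baseFunctor A) (XaRel A)).IsEquivalence :=
  isEquivalence_pullAlg (baseFunctor A)

/-- Passing to algebras is strictly compatible with composition of inverse image functors, so the
isomorphism has an identity as underlying morphism. -/
theorem pullAlg_comp (f g : OverHom (baseFunctor A) (baseFunctor A)) :
    ∃ i : (OverHom.pullAlg (baseFunctor A) (baseFunctor A) (XaRel A)).obj (f.comp g) ≅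
          g.toHom.inv.mapCommMon.obj
            ((OverHom.pullAlg (baseFunctor A) (baseFunctor A) (XaRel A)).obj f),
          algMap i.hom = 𝟙 (g.toHom.inv.obj (f.toHom.inv.obj (XaRel A).X)) := by
  refine ⟨(Functor.mapCommMonCompIso (F := f.toHom.inv) (G := g.toHom.inv)).app (XaRel A), ?_⟩
  rfl

theorem isCokernel_relProj {B : Type w'} [Category.{u} B] [MonoidalCategory B]
    [SymmetricCategory B] [IsVectoid B] (p : A ⥤ B) [p.LaxBraided] (Y : CommMon B)
    (f : OverHom p (baseFunctor A))
    (e : (OverHom.pullAlg p (baseFunctor A) (XaRel A)).obj f ≅ Y) (F : qa A) : IsCokernel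
      (I := FinN.{u}) (J := Σ (m n : FinN.{u}), m ⟶ n)
      (T := fun n => p.obj (F.functor.obj (op n)) ⊗ (pow Y n.len).X)
      (S := fun j => p.obj (F.functor.obj (op j.2.1)) ⊗ (pow Y j.1.len).X)
      (a := fun j => j.1) (b := fun j => j.2.1)
      (fun j => p.map (F.functor.map j.2.2.op) ▷ (pow Y j.1.len).X)
      (fun j => p.obj (F.functor.obj (op j.2.1)) ◁ algMap (powMap Y j.2.2))
      (fun n => relProj f e (ev F n)) := by
  have h := (@relPresentation A _ _ _ _ B _ _ _ p _ f Y e.inv e.isIso_inv).isCokernel F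
  have e' : (fun n => relProj f e (ev F n)) = fun n =>
    (@relPresentation A _ _ _ _ B _ _ _ p _ f Y e.inv e.isIso_inv).π F n :=
      funext fun n => (relPresentation_π f e F n).symm
  rw [e']
  exact h
end
end
end AlgClassifier

/-! ### Elements of presheaves at arbitrary finite sets. -/

namespace AlgClassifier
noncomputable section

section
variable {S T W S' T' W' P Q : Type u} [Finite S] [Finite T] [Finite W] [Finite S'] [Finite T']
  [Finite W'] [Finite P] [Finite Q]

/-- The map of standard sets corresponding to `e : W → S ⊔ T`. -/
def sumIn (e : W → S ⊕ T) : std W ⟶ std S ⊗ std T :=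
  FinN.ofFun fun x => (FinN.sumEquiv (std S) (std T)).symm
      (Sum.map (stdEquiv S).symm (stdEquiv T).symm (e (stdEquiv W x)))

theorem sumIn_inl {e : W → S ⊕ T} {w : W} {s : S} (h : e w = Sum.inl s) :
    sumIn e ((stdEquiv W).symm w) =
      (FinN.sumEquiv (std S) (std T)).symm (Sum.inl ((stdEquiv S).symm s)) := by
  simp [sumIn, FinN.ofFun, h]

theorem sumIn_inr {e : W → S ⊕ T} {w : W} {t : T} (h : e w = Sum.inr t) :
    sumIn e ((stdEquiv W).symm w) =
      (FinN.sumEquiv (std S) (std T)).symm (Sum.inr ((stdEquiv T).symm t)) := by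
  simp [sumIn, FinN.ofFun, h]

theorem stdMap_symm (f : S → T) (s : S) :
    stdMap f ((stdEquiv S).symm s) = (stdEquiv T).symm (f s) := by
  simp [stdMap, FinN.ofFun]

theorem stdMap_sumIn (f : W' → W) (e : W → S ⊕ T) : stdMap f ≫ sumIn e = sumIn (e ∘ f) := by
  refine FinN.hom_ext_el _ _ fun x => ?_
  simp [FinN.comp_el, stdMap, sumIn, FinN.ofFun]

theorem stdMap_comp (f : S → T) (g : T → W) : stdMap f ≫ stdMap g = stdMap (g ∘ f) := by
  refine FinN.hom_ext_el _ _ fun x => ?_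
  simp [FinN.comp_el, stdMap, FinN.ofFun]

theorem stdMap_id : stdMap (id : S → S) = 𝟙 (std S) := by
  refine FinN.hom_ext_el _ _ fun x => ?_
  simp [FinN.id_el, stdMap, FinN.ofFun]

theorem sumIn_map (e : W → S ⊕ T) (f : S → S') (g : T → T') :
    sumIn e ≫ (stdMap f ⊗ₘ stdMap g) = sumIn (Sum.map f g ∘ e) := by
  refine FinN.hom_ext_el _ _ fun x => ?_
  obtain ⟨w, rfl⟩ := (stdEquiv W).symm.surjective x
  rcases h : e w with s | t
  · rw [FinN.comp_el, sumIn_inl h, FinN.tensorHom_eq, FinN.sumMap_inl, stdMap_symm,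
      sumIn_inl (s := f s) (by simp [h])]
  · rw [FinN.comp_el, sumIn_inr h, FinN.tensorHom_eq, FinN.sumMap_inr, stdMap_symm,
      sumIn_inr (t := g t) (by simp [h])]

/-- The middle-four interchange of decompositions. -/
def interchange (e₁ : P → S ⊕ T) (e₂ : Q → S' ⊕ T') (e : W → P ⊕ Q) (w : W) :
    (S ⊕ S') ⊕ (T ⊕ T') :=
  Sum.elim (fun p => Sum.map Sum.inl Sum.inl (e₁ p)) (fun q => Sum.map Sum.inr Sum.inr (e₂ q)) (e w)

section
variable (X Y Z V : FinN.{u})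

theorem braiding_eq : (β_ X Y) = FinN.isoOfEquiv (FinN.sumComm X Y) := rfl

theorem tensorμ_inl_inl (x : FinN.El X) : (tensorμ X Y Z V)
    ((FinN.sumEquiv (X ⊗ Y) (Z ⊗ V)).symm (Sum.inl ((FinN.sumEquiv X Y).symm (Sum.inl x)))) =
    (FinN.sumEquiv (X ⊗ Z) (Y ⊗ V)).symm (Sum.inl ((FinN.sumEquiv X Z).symm (Sum.inl x))) := by
  simp [tensorμ, braiding_eq, FinN.comp_el, FinN.id_el, FinN.assoc_eq, FinN.whiskerLeft_eq, FinN.whiskerRight_eq, FinN.tensorObj_eq]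
theorem tensorμ_inl_inr (y : FinN.El Y) : (tensorμ X Y Z V)
    ((FinN.sumEquiv (X ⊗ Y) (Z ⊗ V)).symm (Sum.inl ((FinN.sumEquiv X Y).symm (Sum.inr y)))) =
    (FinN.sumEquiv (X ⊗ Z) (Y ⊗ V)).symm (Sum.inr ((FinN.sumEquiv Y V).symm (Sum.inl y))) := by
  simp [tensorμ, braiding_eq, FinN.comp_el, FinN.id_el, FinN.assoc_eq, FinN.whiskerLeft_eq, FinN.whiskerRight_eq, FinN.tensorObj_eq]
theorem tensorμ_inr_inl (z : FinN.El Z) : (tensorμ X Y Z V)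
    ((FinN.sumEquiv (X ⊗ Y) (Z ⊗ V)).symm (Sum.inr ((FinN.sumEquiv Z V).symm (Sum.inl z)))) =
    (FinN.sumEquiv (X ⊗ Z) (Y ⊗ V)).symm (Sum.inl ((FinN.sumEquiv X Z).symm (Sum.inr z))) := by
  simp [tensorμ, braiding_eq, FinN.comp_el, FinN.id_el, FinN.assoc_eq, FinN.whiskerLeft_eq, FinN.whiskerRight_eq, FinN.tensorObj_eq]
theorem tensorμ_inr_inr (v : FinN.El V) : (tensorμ X Y Z V)
    ((FinN.sumEquiv (X ⊗ Y) (Z ⊗ V)).symm (Sum.inr ((FinN.sumEquiv Z V).symm (Sum.inr v)))) =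
    (FinN.sumEquiv (X ⊗ Z) (Y ⊗ V)).symm (Sum.inr ((FinN.sumEquiv Y V).symm (Sum.inr v))) := by
  simp [tensorμ, braiding_eq, FinN.comp_el, FinN.id_el, FinN.assoc_eq, FinN.whiskerLeft_eq, FinN.whiskerRight_eq, FinN.tensorObj_eq]
end

/-- Both composites record in which of the four parts a point of `W` lies, so there are four cases
to check. -/
theorem sumIn_interchange (e₁ : P → S ⊕ T) (e₂ : Q → S' ⊕ T') (e : W → P ⊕ Q) :
    sumIn e ≫ (sumIn e₁ ⊗ₘ sumIn e₂) ≫ tensorμ (std S) (std T) (std S') (std T') =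
      sumIn (interchange e₁ e₂ e) ≫ (sumIn id ⊗ₘ sumIn id) := by
  refine FinN.hom_ext_el _ _ fun x => ?_
  obtain ⟨w, rfl⟩ := (stdEquiv W).symm.surjective x
  rcases h : e w with p | q
  · rw [FinN.comp_el, FinN.comp_el, FinN.comp_el, sumIn_inl h, FinN.tensorHom_eq, FinN.sumMap_inl]
    rcases h₁ : e₁ p with s | t
    · have h₂ : interchange e₁ e₂ e w = Sum.inl (Sum.inl s) := by simp [interchange, h, h₁]
      rw [sumIn_inl h₁, sumIn_inl h₂, FinN.tensorHom_eq, FinN.sumMap_inl, sumIn_inl (e := id) rfl]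
      exact tensorμ_inl_inl _ _ _ _ _
    · have h₂ : interchange e₁ e₂ e w = Sum.inr (Sum.inl t) := by simp [interchange, h, h₁]
      rw [sumIn_inr h₁, sumIn_inr h₂, FinN.tensorHom_eq, FinN.sumMap_inr, sumIn_inl (e := id) rfl]
      exact tensorμ_inl_inr _ _ _ _ _
  · rw [FinN.comp_el, FinN.comp_el, FinN.comp_el, sumIn_inr h, FinN.tensorHom_eq, FinN.sumMap_inr]
    rcases h₁ : e₂ q with s | t
    · have h₂ : interchange e₁ e₂ e w = Sum.inl (Sum.inr s) := by simp [interchange, h, h₁]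
      rw [sumIn_inl h₁, sumIn_inl h₂, FinN.tensorHom_eq, FinN.sumMap_inl, sumIn_inr (e := id) rfl]
      exact tensorμ_inr_inl _ _ _ _ _
    · have h₂ : interchange e₁ e₂ e w = Sum.inr (Sum.inr t) := by simp [interchange, h, h₁]
      rw [sumIn_inr h₁, sumIn_inr h₂, FinN.tensorHom_eq, FinN.sumMap_inr, sumIn_inr (e := id) rfl]
      exact tensorμ_inr_inr _ _ _ _ _
end

section
variable {A : Type w} [Category.{u} A] [MonoidalCategory A]

/-- The value of a presheaf at a finite set, with transparent definition. -/
abbrev val (F : qa A) (S : Type u) [Finite S] : A := F.functor.obj (op (std S))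

/-- The component at a finite set of a morphism of presheaves, with transparent definition. -/
abbrev valMap {F G : qa A} (t : F ⟶ G) (S : Type u) [Finite S] : val F S ⟶ val G S :=
  t.natTrans.app (op (std S))

/-- The restriction map of a presheaf along a map of finite sets. -/
def extRes (F : qa A) {S T : Type u} [Finite S] [Finite T] (f : S → T) : val F T ⟶ val F S :=
  F.functor.map (stdMap f).op

theorem isIso_extRes (F : qa A) {S T : Type u} [Finite S] [Finite T] {f : S → T}
    (hf : Function.Bijective f) : IsIso (extRes F f) := by
  have e : IsIso (stdMap f) := ⟨stdMap (Equiv.ofBijective f hf).symm, by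
    rw [stdMap_comp, ← stdMap_id]
    exact congrArg stdMap (funext (Equiv.ofBijective f hf).symm_apply_apply), by
    rw [stdMap_comp, ← stdMap_id]
    exact congrArg stdMap (funext (Equiv.ofBijective f hf).apply_symm_apply)⟩
  exact inferInstanceAs (IsIso (F.functor.map (stdMap f).op))

/-- The tensor product of a finite sequence of morphisms. -/
def tensorSeqMap : (n : ℕ) → {x y : Fin n → A} → (∀ i, x i ⟶ y i) →
    (tensorSeq n x ⟶ tensorSeq n y)
  | 0, _, _, _ => 𝟙 (𝟙_ A)
  | n + 1, _, _, f => tensorSeqMap n (fun i => f i.castSucc) ⊗ₘ f (Fin.last n)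

theorem isIso_tensorSeqMap (n : ℕ) {x y : Fin n → A} (f : ∀ i, x i ⟶ y i) (h : ∀ i, IsIso (f i)) :
    IsIso (tensorSeqMap n f) := by
  induction n with
  | zero => exact inferInstanceAs (IsIso (𝟙 (𝟙_ A)))
  | succ n ih =>
    have h₁ := ih (fun i => f i.castSucc) fun i => h i.castSucc
    have h₂ := h (Fin.last n)
    exact inferInstanceAs (IsIso (tensorSeqMap n (fun i => f i.castSucc) ⊗ₘ f (Fin.last n)))
end

section
variable {A : Type w} [Category.{u} A] [MonoidalCategory A] [SymmetricCategory A]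
  [CocontinuousTensor A] {F G H K F' G' : qa A} {a b c d a' b' : A}
  {S T W S' T' W' P Q : Type u} [Finite S] [Finite T] [Finite W] [Finite S'] [Finite T']
  [Finite W'] [Finite P] [Finite Q]

/-- The product of elements of `F(S)` and `G(T)`, restricted along `W → S ⊔ T`. -/
def extMul (x : a ⟶ val F S) (y : b ⟶ val G T) (e : W → S ⊕ T) : a ⊗ b ⟶ val (F ⊗ G) W :=
  elMul x y ≫ (F ⊗ G).functor.map (sumIn e).op

theorem tensorHom_extPair (x : a ⟶ val F S) (y : b ⟶ val G T) (e : W → S ⊕ T) :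
    (x ⊗ₘ y) ≫ extPair F G e = extMul x y e := (Category.assoc _ _ _).symm

theorem comp_extMul (f : a' ⟶ a) (g : b' ⟶ b) (x : a ⟶ val F S) (y : b ⟶ val G T)
    (e : W → S ⊕ T) : (f ⊗ₘ g) ≫ extMul x y e = extMul (f ≫ x) (g ≫ y) e := by
  rw [extMul, extMul, comp_elMul, Category.assoc]

theorem extMul_res (x : a ⟶ val F S) (y : b ⟶ val G T) (e : W → S ⊕ T) (f : W' → W) :
    extMul x y e ≫ extRes (F ⊗ G) f = extMul x y (e ∘ f) := by
  rw [extMul, extRes, Category.assoc, ← Functor.map_comp, ← op_comp, stdMap_sumIn, extMul]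

theorem res_extMul (x : a ⟶ val F S) (y : b ⟶ val G T) (f : S' → S) (g : T' → T)
    (e : W → S' ⊕ T') :
    extMul (x ≫ extRes F f) (y ≫ extRes G g) e = extMul x y (Sum.map f g ∘ e) := by
  rw [extMul, extRes, extRes, elMul_map, Category.assoc, ← Functor.map_comp, ← op_comp, sumIn_map,
    extMul]

theorem extMul_app (x : a ⟶ val F S) (y : b ⟶ val G T) (s : F ⟶ F') (t : G ⟶ G')
    (e : W → S ⊕ T) :
    extMul (x ≫ valMap s S) (y ≫ valMap t T) e = extMul x y e ≫ valMap (s ⊗ₘ t) W := by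
  rw [extMul, extMul, elMul_app, Category.assoc, Category.assoc,
    pair_nat_app]

/-- This is `elMul_tensorμ` restricted along decompositions; on the right stands the interchanged
decomposition into four parts. -/
theorem extMul_tensorμ (x : a ⟶ val F S) (y : b ⟶ val G T) (z : c ⟶ val H S') (w : d ⟶ val K T')
    (e₁ : P → S ⊕ T) (e₂ : Q → S' ⊕ T') (e : W → P ⊕ Q) :
    extMul (extMul x y e₁) (extMul z w e₂) e ≫ valMap (tensorμ F G H K) W =
      tensorμ a b c d ≫ extMul (extMul x z id) (extMul y w id) (interchange e₁ e₂ e) := by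
  have h : ∀ {X : FinN.{u}} (g : X ⟶ (std S ⊗ std T) ⊗ std S' ⊗ std T'),
      ((F ⊗ H) ⊗ (G ⊗ K)).functor.map (tensorμ (std S) (std T) (std S') (std T')).op ≫
      ((F ⊗ H) ⊗ (G ⊗ K)).functor.map g.op = ((F ⊗ H) ⊗ (G ⊗ K)).functor.map
        (g ≫ tensorμ (std S) (std T) (std S') (std T')).op := fun g => by
    rw [op_comp, Functor.map_comp]
  rw [extMul, extMul, extMul, elMul_map, Category.assoc, Category.assoc, pair_nat_app,
    reassoc_of% (pair_nat_app (tensorμ F G H K) (sumIn e₁ ⊗ₘ sumIn e₂).op),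
    reassoc_of% (elMul_tensorμ x y z w), ← Functor.map_comp, ← op_comp, h,
    Category.assoc, sumIn_interchange, extMul, extMul, extMul, elMul_map, Category.assoc,
    ← Functor.map_comp, ← op_comp]
end
end
end AlgClassifier

/-! ### Decompositions of a finite set, by splitting off the last part. -/

namespace AlgClassifier
noncomputable section

section
variable {n : ℕ} {S T W : Type u}

theorem splitLast_cast {S : Fin (n + 1) → Type u} (i : Fin n) (s : S i.castSucc) :
    splitLast (⟨i.castSucc, s⟩ : Σ i, S i) = Sum.inl ⟨i, s⟩ := by
  simp [splitLast]

theorem splitLast_last {S : Fin (n + 1) → Type u} (s : S (Fin.last n)) :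
    splitLast (⟨Fin.last n, s⟩ : Σ i, S i) = Sum.inr s := by
  simp [splitLast]

theorem splitLast_map {S S' : Fin (n + 1) → Type u} (s : ∀ i, S i → S' i) (x : Σ i, S i) :
    splitLast (Sigma.map id s x) =
      Sum.map (Sigma.map id fun i => s i.castSucc) (s (Fin.last n)) (splitLast x) := by
  obtain ⟨i, x⟩ := x
  induction i using Fin.lastCases with
  | last => simp [splitLast_last, Sigma.map]
  | cast i => simp [splitLast_cast, Sigma.map]

/-- An element of `V` as an element of the union of the fibres of a map. -/
def fibreMk (d : W → Fin n) (v : W) : Σ i, {v : W // d v = i} := ⟨d v, v, rfl⟩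

theorem fibreMk_eq (d : W → Fin n) {v : W} {i : Fin n} (h : d v = i) :
    fibreMk d v = ⟨i, v, h⟩ := by subst h; rfl

/-- The decomposition of `W` into `n + 1` parts given by `W → S ⊔ T` and a decomposition of `S`
into `n` parts. -/
def glue (c : S → Fin n) (e : W → S ⊕ T) (w : W) : Fin (n + 1) :=
  Sum.elim (fun s => (c s).castSucc) (fun _ => Fin.last n) (e w)

theorem glue_inl {c : S → Fin n} {e : W → S ⊕ T} {w : W} {s : S} (h : e w = Sum.inl s) :
    glue c e w = (c s).castSucc := by simp [glue, h]

theorem glue_inr {c : S → Fin n} {e : W → S ⊕ T} {w : W} {t : T} (h : e w = Sum.inr t) :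
    glue c e w = Fin.last n := by simp [glue, h]

theorem exists_glueInl {c : S → Fin n} {e : W → S ⊕ T} {i : Fin n}
    (v : {w // glue c e w = i.castSucc}) : ∃ s : {s // c s = i}, e v = Sum.inl s.1 := by
  obtain ⟨v, hv⟩ := v
  rcases h : e v with s | t
  · rw [glue_inl h] at hv
    exact ⟨⟨s, Fin.castSucc_injective _ hv⟩, rfl⟩
  · rw [glue_inr h] at hv
    exact absurd hv.symm (Fin.castSucc_lt_last i).ne

theorem exists_glueInr {c : S → Fin n} {e : W → S ⊕ T}
    (v : {w // glue c e w = Fin.last n}) : ∃ t, e v = Sum.inr t := by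
  obtain ⟨v, hv⟩ := v
  rcases h : e v with s | t
  · rw [glue_inl h] at hv
    exact absurd hv (Fin.castSucc_lt_last _).ne
  · exact ⟨t, rfl⟩

/-- The comparison of the fibres of `glue c e` with those of `c`. -/
def glueInl (c : S → Fin n) (e : W → S ⊕ T) (i : Fin n) (v : {w // glue c e w = i.castSucc}) :
    {s // c s = i} := (exists_glueInl v).choose

theorem glueInl_spec (c : S → Fin n) (e : W → S ⊕ T) (i : Fin n)
    (v : {w // glue c e w = i.castSucc}) : e v = Sum.inl (glueInl c e i v).1 :=
  (exists_glueInl v).choose_spec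

/-- The comparison of the last fibre of `glue c e` with `T`. -/
def glueInr (c : S → Fin n) (e : W → S ⊕ T) (v : {w // glue c e w = Fin.last n}) : T :=
  (exists_glueInr v).choose

theorem glueInr_spec (c : S → Fin n) (e : W → S ⊕ T) (v : {w // glue c e w = Fin.last n}) :
    e v = Sum.inr (glueInr c e v) := (exists_glueInr v).choose_spec

theorem bijective_glueInl {c : S → Fin n} {e : W → S ⊕ T} (he : Function.Bijective e) (i : Fin n) :
    Function.Bijective (glueInl c e i) := by
  refine ⟨fun v v' h => Subtype.ext (he.1 ?_), fun s => ?_⟩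
  · rw [glueInl_spec c e i v, glueInl_spec c e i v', h]
  · obtain ⟨w, hw⟩ := he.2 (Sum.inl s.1)
    refine ⟨⟨w, by rw [glue_inl hw, s.2]⟩, Subtype.ext (Sum.inl_injective (β := T) ?_)⟩
    rw [← glueInl_spec, hw]

theorem bijective_glueInr {c : S → Fin n} {e : W → S ⊕ T} (he : Function.Bijective e) :
    Function.Bijective (glueInr c e) := by
  refine ⟨fun v v' h => Subtype.ext (he.1 ?_), fun t => ?_⟩
  · rw [glueInr_spec c e v, glueInr_spec c e v', h]
  · obtain ⟨w, hw⟩ := he.2 (Sum.inr t)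
    refine ⟨⟨w, glue_inr hw⟩, Sum.inr_injective (α := S) ?_⟩
    rw [← glueInr_spec, hw]

theorem glue_splitLast (c : S → Fin n) (e : W → S ⊕ T) (w : W) :
    Sum.map (fun x : Σ i, {w // glue c e w = Fin.castSucc i} => (glueInl c e x.1 x.2).1)
      (glueInr c e) (splitLast (fibreMk (glue c e) w)) = e w := by
  rcases h : e w with s | t
  · rw [fibreMk_eq _ (glue_inl h), splitLast_cast, ← h]
    exact (glueInl_spec c e _ _).symm
  · rw [fibreMk_eq _ (glue_inr h), splitLast_last, ← h]
    exact (glueInr_spec c e _).symm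

theorem bijective_splitSet (U : Set W) : Function.Bijective (splitSet U) := by
  refine ⟨fun x y h => ?_, fun s => ?_⟩
  · by_cases hx : x ∈ U <;> by_cases hy : y ∈ U <;> simp_all [splitSet]
  · rcases s with ⟨x, hx⟩ | ⟨x, hx⟩
    · exact ⟨x, by simp [splitSet, hx]⟩
    · exact ⟨x, dif_neg hx⟩

theorem exists_glue (d : W → Fin (n + 1)) : ∃ (U : Set W) (c : U → Fin n),
    glue c (splitSet U) = d := by
  -- The last part is the complement of `U`.
  refine ⟨{w | d w ≠ Fin.last n}, fun w => (d w).castPred w.2, funext fun w => ?_⟩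
  by_cases h : d w = Fin.last n
  · have h' : w ∉ {w | d w ≠ Fin.last n} := fun h' => h' h
    rw [glue_inr (t := ⟨w, h'⟩) (dif_neg h'), h]
  · have h' : w ∈ {w | d w ≠ Fin.last n} := h
    rw [glue_inl (s := ⟨w, h'⟩) (dif_pos h')]
    exact Fin.castSucc_castPred _ _
end

section
variable {A : Type w} [Category.{u} A] [MonoidalCategory A] [SymmetricCategory A]
  [CocontinuousTensor A] {F : qa A} {S T W W' : Type u} [Finite S] [Finite T] [Finite W]
  [Finite W']

theorem extUnit_res (e : W → PEmpty) (f : W' → W) :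
    extUnit W e ≫ extRes (𝟙_ (qa A)) f = extUnit W' (e ∘ f) := by
  have h : stdMap f ≫ (show std W ⟶ 𝟙_ FinN.{u} from
      FinN.ofFun fun x => (e (stdEquiv W x)).elim) =
      FinN.ofFun fun x => (e (f (stdEquiv W' x))).elim :=
    FinN.hom_ext_el _ _ fun x => (e (f (stdEquiv W' x))).elim
  refine (Category.assoc _ _ _).trans (congrArg (unitPt ≫ ·) ?_)
  exact ((𝟙_ (qa A)).functor.map_comp _ _).symm.trans
    (congrArg (fun t => (𝟙_ (qa A)).functor.map (Quiver.Hom.op t)) h)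

instance (e : W → PEmpty) : IsIso (extUnit (A := A) W e) := by
  have h : IsEmpty W := ⟨fun w => (e w).elim⟩
  let t : std W ⟶ 𝟙_ FinN.{u} := FinN.ofFun fun x => (e (stdEquiv W x)).elim
  have : IsIso t := ⟨default, FinN.hom_ext_el _ _ fun x => (e (stdEquiv W x)).elim,
    Subsingleton.elim (α := 𝟙_ FinN.{u} ⟶ _) _ _⟩
  exact inferInstanceAs (IsIso (unitPt ≫ (𝟙_ (qa A)).functor.map t.op))

variable (Y : CommMon (qa A))

/-- The tensor product of the values of `Y` at a finite sequence of finite sets. -/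
abbrev valSeq (n : ℕ) (S : Fin n → Type u) [∀ i, Finite (S i)] : A :=
  tensorSeq n fun i => val Y.X (S i)

/-- The tensor product of restriction maps. -/
def resSeq (n : ℕ) {S S' : Fin n → Type u} [∀ i, Finite (S i)] [∀ i, Finite (S' i)]
    (s : ∀ i, S i → S' i) : valSeq Y n S' ⟶ valSeq Y n S :=
  tensorSeqMap n fun i => extRes Y.X (s i)

/-- The map `extPow` with transparent source and target. -/
def powEl (n : ℕ) (S : Fin n → Type u) [∀ i, Finite (S i)] (e : W → Σ i, S i) :
    valSeq Y n S ⟶ val (pow Y n).X W := extPow Y n S e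

/-- The map `fibreIncl` with transparent source and target. -/
def fibreEl {n : ℕ} (d : W → Fin n) : valSeq Y n (fun i => {v // d v = i}) ⟶ val (pow Y n).X W :=
  powEl Y n _ (fibreMk d)

theorem powEl_succ (n : ℕ) (S : Fin (n + 1) → Type u) [∀ i, Finite (S i)] (e : W → Σ i, S i) :
    powEl Y (n + 1) S e = extMul (powEl Y n (fun i => S i.castSucc) id)
      (𝟙 (val Y.X (S (Fin.last n)))) (fun w => splitLast (e w)) := by
  rw [← tensorHom_extPair, tensorHom_id]
  rfl

theorem powEl_res (n : ℕ) (S : Fin n → Type u) [∀ i, Finite (S i)] (e : W → Σ i, S i)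
    (f : W' → W) : powEl Y n S e ≫ extRes (pow Y n).X f = powEl Y n S (e ∘ f) := by
  cases n with
  | zero => exact extUnit_res (A := A) (fun x => (e x).1.elim0) f
  | succ n =>
    rw [powEl_succ, powEl_succ]
    exact extMul_res _ _ _ _

/-- Restriction in each factor amounts to a change of the decomposition. This compares values of `Y`
at parts that correspond to each other without being equal. -/
theorem res_powEl (n : ℕ) (S S' : Fin n → Type u) [∀ i, Finite (S i)] [∀ i, Finite (S' i)]
    (s : ∀ i, S i → S' i) (e : W → Σ i, S i) :
    resSeq Y n s ≫ powEl Y n S e = powEl Y n S' (fun w => Sigma.map id s (e w)) := by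
  induction n generalizing W with
  | zero => exact Category.id_comp _
  | succ n ih =>
    rw [powEl_succ, powEl_succ]
    refine (comp_extMul (resSeq Y n fun i => s i.castSucc) (extRes Y.X (s (Fin.last n))) _ _ _).trans
      ?_
    rw [ih, Category.comp_id, ← Category.id_comp (extRes Y.X (s (Fin.last n)))]
    have h := powEl_res Y n (fun i => S' i.castSucc) id
      (Sigma.map id fun i => s i.castSucc)
    have h' : (powEl Y n (fun i => S' i.castSucc) fun w => Sigma.map id (fun i => s i.castSucc)
      (id w)) = _ := h.symm
    rw [h']
    refine (res_extMul _ _ _ _ _).trans ?_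
    exact congrArg _ (funext fun w => (splitLast_map s (e w)).symm)

/-- The comparison of `Y(c⁻¹ 1) ⊗ ⋯ ⊗ Y(c⁻¹ n) ⊗ Y(T)` with the tensor product of the values of
`Y` at the parts of the decomposition `glue c e`. -/
def glueRes {n : ℕ} (c : S → Fin n) (e : W → S ⊕ T) :
    valSeq Y n (fun i => {v // c v = i}) ⊗ val Y.X T ⟶
      valSeq Y (n + 1) (fun i => {v // glue c e v = i}) :=
  resSeq Y n (glueInl c e) ⊗ₘ extRes Y.X (glueInr c e)

theorem isIso_glueRes {n : ℕ} {c : S → Fin n} {e : W → S ⊕ T} (he : Function.Bijective e) :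
    IsIso (glueRes Y c e) := by
  have h₁ : IsIso (resSeq Y n (glueInl c e)) := isIso_tensorSeqMap n _ fun i =>
    isIso_extRes Y.X (bijective_glueInl he i)
  have h₂ := isIso_extRes Y.X (bijective_glueInr (c := c) he)
  exact inferInstanceAs (IsIso (resSeq Y n (glueInl c e) ⊗ₘ extRes Y.X (glueInr c e)))

/-- The link for inductions: up to reindexing of the parts, a summand for `n + 1` parts is the
product of a summand of `Y^{⊗n}(S)` with `Y(T)`. -/
theorem glueRes_fibreEl {n : ℕ} (c : S → Fin n) (e : W → S ⊕ T) :
    glueRes Y c e ≫ fibreEl Y (glue c e) = extMul (fibreEl Y c) (𝟙 (val Y.X T)) e := by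
  rw [fibreEl, powEl_succ]
  refine (comp_extMul (resSeq Y n (glueInl c e)) (extRes Y.X (glueInr c e)) _ _ _).trans ?_
  rw [res_powEl, Category.comp_id, ← Category.id_comp (extRes Y.X (glueInr c e))]
  have h : (fun x : Σ i, {w // glue c e w = Fin.castSucc i} => Sigma.map id (glueInl c e) (id x)) =
      fibreMk c ∘ fun x : Σ i, {w // glue c e w = Fin.castSucc i} => (glueInl c e x.1 x.2).1 :=
    funext fun x => (fibreMk_eq c (glueInl c e x.1 x.2).2).symm
  have h' := (congrArg (powEl Y n (fun i => {s // c s = i})) h).trans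
    (powEl_res Y n _ (fibreMk c) _).symm
  rw [h']
  refine (res_extMul _ _ _ _ _).trans ?_
  exact congrArg _ (funext fun w => glue_splitLast c e w)
end
end
end AlgClassifier

/-! ### Tensor powers as sums over decompositions. -/

namespace AlgClassifier
noncomputable section

section
variable {A : Type w} [Category.{u} A] {B : Type w'} [Category.{u} B]

/-- The morphisms `f i : T i ⟶ Z` exhibit `Z` as the coproduct of the `T i`. -/
def IsSum {I : Type w''} {T : I → A} {Z : A} (f : ∀ i, T i ⟶ Z) : Prop :=
  ∀ (W : A) (t : ∀ i, T i ⟶ W), ∃! g : Z ⟶ W, ∀ i, f i ≫ g = t i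

theorem IsSum.map {I : Type w''} {T : I → A} {Z : A} {f : ∀ i, T i ⟶ Z} (h : IsSum f)
    (L : A ⥤ B) [L.IsLeftAdjoint] : IsSum fun i => L.map (f i) := fun W t => by
  let adj := Adjunction.ofIsLeftAdjoint L
  obtain ⟨g, hg, hu⟩ := h _ fun i => adj.homEquiv _ _ (t i)
  refine ⟨(adj.homEquiv _ _).symm g, fun i => ?_, fun g' hg' => ?_⟩
  · rw [← Adjunction.homEquiv_naturality_left_symm, hg, Equiv.symm_apply_apply]
  · rw [Equiv.eq_symm_apply]
    exact hu _ fun i => by rw [← hg', Adjunction.homEquiv_naturality_left]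

theorem IsSum.comp_iso {I : Type w''} {T : I → A} {Z Z' : A} {f : ∀ i, T i ⟶ Z} (h : IsSum f)
    (e : Z ⟶ Z') [IsIso e] : IsSum fun i => f i ≫ e := fun W t => by
  obtain ⟨g, hg, hu⟩ := h _ t
  refine ⟨inv e ≫ g, fun i => by simp [hg], fun g' hg' => ?_⟩
  rw [← hu (e ≫ g') fun i => by rw [← Category.assoc, hg'], IsIso.inv_hom_id_assoc]

theorem IsSum.sigma {I : Type w''} {T : I → A} {Z : A} {f : ∀ i, T i ⟶ Z} (h : IsSum f)
    {J : I → Type w''} {S : ∀ i, J i → A} {g : ∀ i j, S i j ⟶ T i} (h' : ∀ i, IsSum (g i)) :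
    IsSum fun p : Σ i, J i => g p.1 p.2 ≫ f p.1 := fun W t => by
  choose k hk hu using fun i => h' i _ fun j => t ⟨i, j⟩
  obtain ⟨l, hl, hl'⟩ := h _ k
  exact ⟨l, fun p => by rw [Category.assoc, hl, hk],
    fun l' h => hl' l' fun i => hu i _ fun j => by rw [← Category.assoc]; exact h ⟨i, j⟩⟩

theorem IsSum.of_isColimit {I : Type w''} {T : I → A} {Z : A} {f : ∀ i, T i ⟶ Z}
    (h : IsColimit (Cofan.mk Z f)) : IsSum f := fun W t =>
  ⟨Cofan.IsColimit.desc h t, fun i => Cofan.IsColimit.fac h t i, fun g hg =>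
    Cofan.IsColimit.hom_ext h _ _ fun i => (hg i).trans (Cofan.IsColimit.fac h t i).symm⟩

/-- A coproduct may be indexed by a set mapping onto the set of indices. -/
theorem IsSum.of_reindex {I J : Type w''} {T : I → A} {S : J → A} {Z : A} {f : ∀ i, T i ⟶ Z}
    (σ : J → I) (hσ : Function.Surjective σ) {g : ∀ j, S j ⟶ Z} (hg : IsSum g)
    (r : ∀ j, S j ⟶ T (σ j)) [∀ j, IsIso (r j)] (h : ∀ j, r j ≫ f (σ j) = g j) : IsSum f :=
  fun W t => by
  obtain ⟨k, hk, hu⟩ := hg _ fun j => r j ≫ t (σ j)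
  refine ⟨k, fun i => ?_, fun k' hk' => hu k' fun j => ?_⟩
  · obtain ⟨j, rfl⟩ := hσ i
    rw [← cancel_epi (r j), ← hk, ← Category.assoc, h]
  · rw [← h, Category.assoc, hk']
end

section
variable {A : Type w} [Category.{u} A] [MonoidalCategory A] [SymmetricCategory A]
  [IsVectoid A] (Y : CommMon (qa A))

theorem isSum_extMul {F G : qa A} {W : Type u} [Finite W] : IsSum fun U : Set W =>
    extMul (𝟙 (val F U)) (𝟙 (val G (Uᶜ : Set W))) (splitSet U) := by
  obtain ⟨h⟩ := isColimit_extPair F G W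
  have h' := IsSum.of_isColimit h
  have e : (fun U : Set W => extPair F G (splitSet U)) = fun U : Set W =>
      extMul (𝟙 (val F U)) (𝟙 (val G (Uᶜ : Set W))) (splitSet U) := funext fun U =>
    (Category.id_comp _).symm.trans ((congrArg (· ≫ extPair F G (splitSet U))
      (id_tensorHom_id (val F U) (val G (Uᶜ : Set W))).symm).trans (tensorHom_extPair _ _ _))
  rw [e] at h'
  exact h'

/-- Iteration of the binary formula: a decomposition into `n + 1` parts consists of a subset `U`, a
decomposition of `U` into `n` parts, and the complement as last part. -/
theorem isSum_fibreEl (n : ℕ) (W : Type u) [Finite W] :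
    IsSum fun d : W → Fin n => fibreEl Y d := by
  induction n generalizing W with
  | zero =>
    intro Z t
    by_cases h : IsEmpty W
    · let d : W → Fin 0 := fun w => h.elim w
      have h₁ : IsIso (fibreEl Y d) :=
        inferInstanceAs (IsIso (extUnit (A := A) W fun w => (d w).elim0))
      have h₂ (d' : W → Fin 0) : d' = d := funext fun w => h.elim w
      refine ⟨inv (fibreEl Y d) ≫ t d, fun d' => ?_, fun g hg => ?_⟩
      · obtain rfl := h₂ d'
        rw [IsIso.hom_inv_id_assoc]
      · rw [← hg, IsIso.inv_hom_id_assoc]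
    -- For nonempty `W` there is no decomposition into zero parts, and the value of the unit
    -- presheaf is initial.
    · rw [not_isEmpty_iff] at h
      obtain ⟨i⟩ := isInitial_unit (A := A) (std W) (Nat.card_pos (α := W))
      exact ⟨i.to Z, fun d => (d h.some).elim0, fun g _ => i.hom_ext _ _⟩
  | succ n ih =>
    have h := (isSum_extMul (F := (pow Y n).X) (G := Y.X) (W := W)).sigma fun U =>
      (ih U).map (tensorRight (val Y.X (Uᶜ : Set W)))
    have (p : Σ U : Set W, U → Fin n) := isIso_glueRes Y (c := p.2) (bijective_splitSet p.1)
    -- The sum over pairs `(U, c)` is reindexed by the decompositions `glue c`; only the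
    -- surjectivity of this assignment is needed.
    refine IsSum.of_reindex (fun p : Σ U : Set W, U → Fin n => glue p.2 (splitSet p.1))
      (fun d => ?_) h (fun p => glueRes Y p.2 (splitSet p.1)) fun p => ?_
    · obtain ⟨U, c, h⟩ := exists_glue d
      exact ⟨⟨U, c⟩, h⟩
    · refine (glueRes_fibreEl Y p.2 (splitSet p.1)).trans ?_
      change _ = fibreEl Y p.2 ▷ val Y.X (p.1ᶜ : Set W) ≫ _
      rw [← tensorHom_id, comp_extMul, Category.comp_id, Category.comp_id]

variable {Y}

/-- The element `x` of `Y^{⊗n}(W)` belongs to the summand of the decomposition `c`. -/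
def Factors {n : ℕ} {W : Type u} [Finite W] (c : W → Fin n) {b : A}
    (x : b ⟶ val (pow Y n).X W) : Prop :=
  ∃ r : b ⟶ valSeq Y n (fun i => {v // c v = i}), r ≫ fibreEl Y c = x

theorem Factors.of_isEmpty {W : Type u} [Finite W] {c : W → Fin 0} {b : A}
    (x : b ⟶ val (pow Y 0).X W) : Factors c x := by
  have h₁ : IsIso (fibreEl Y c) :=
    inferInstanceAs (IsIso (extUnit (A := A) W fun w => (c w).elim0))
  exact ⟨x ≫ inv (fibreEl Y c), by rw [Category.assoc, IsIso.inv_hom_id, Category.comp_id]⟩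

theorem Factors.comp {n : ℕ} {W : Type u} [Finite W] {c : W → Fin n} {a b : A}
    {x : b ⟶ val (pow Y n).X W} (h : Factors c x) (f : a ⟶ b) : Factors c (f ≫ x) := by
  obtain ⟨r, rfl⟩ := h
  exact ⟨f ≫ r, Category.assoc _ _ _⟩

theorem factors_fibreEl {n : ℕ} {W : Type u} [Finite W] (c : W → Fin n) :
    Factors c (fibreEl Y c) := ⟨𝟙 _, Category.id_comp _⟩

section
variable {n : ℕ} {S T W : Type u} [Finite S] [Finite T] [Finite W]

theorem Factors.glue {c : S → Fin n} {a b : A} {x : a ⟶ val (pow Y n).X S} (h : Factors c x)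
    (y : b ⟶ val Y.X T) (e : W → S ⊕ T) :
    Factors (n := n + 1) (glue c e) (extMul (F := (pow Y n).X) (G := Y.X) x y e) := by
  obtain ⟨r, rfl⟩ := h
  have h := comp_extMul r y (fibreEl Y c) (𝟙 (val Y.X T)) e
  rw [Category.comp_id] at h
  refine ⟨(r ⊗ₘ y) ≫ glueRes Y c e, ?_⟩
  exact (Category.assoc _ _ _).trans ((congrArg (_ ≫ ·) (glueRes_fibreEl Y c e)).trans h)

/-- Every element belonging to a summand of `Y^{⊗(n+1)}(W)` is a product. -/
theorem Factors.exists_eq {d : W → Fin (n + 1)} {b : A} {x : b ⟶ val (pow Y (n + 1)).X W}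
    (h : Factors d x) : ∃ (U : Set W) (c : U → Fin n) (a : A) (f : b ⟶ a ⊗ val Y.X (Uᶜ : Set W))
      (y : a ⟶ val (pow Y n).X U), Factors c y ∧ AlgClassifier.glue c (splitSet U) = d ∧
        x = f ≫ extMul (F := (pow Y n).X) (G := Y.X) y (𝟙 (val Y.X (Uᶜ : Set W))) (splitSet U) := by
  obtain ⟨U, c, rfl⟩ := exists_glue d
  obtain ⟨r, rfl⟩ := h
  have := isIso_glueRes Y (c := c) (bijective_splitSet U)
  refine ⟨U, c, _, r ≫ inv (glueRes Y c (splitSet U)), fibreEl Y c, factors_fibreEl c, rfl, ?_⟩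
  have h := congrArg ((r ≫ inv (glueRes Y c (splitSet U))) ≫ ·) (glueRes_fibreEl Y c (splitSet U))
  simp only [Category.assoc, IsIso.inv_hom_id_assoc] at h
  exact h
end

/-- The product in `Y^{⊗n}` is taken factor by factor, so the `i`-th part for the product is the
union of the two `i`-th parts. In the induction the interchange separates the last factors from the
first `n`. -/
theorem Factors.mul {n : ℕ} {S S' W : Type u} [Finite S] [Finite S'] [Finite W]
    {c : S → Fin n} {c' : S' → Fin n} {a b : A} {x : a ⟶ val (pow Y n).X S}
    {y : b ⟶ val (pow Y n).X S'} (hx : Factors c x) (hy : Factors c' y) (e : W → S ⊕ S') :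
    Factors (fun w => Sum.elim c c' (e w))
      (extMul x y e ≫ valMap (MonObj.mul (X := (pow Y n).X)) W) := by
  induction n generalizing S S' W a b with
  | zero => exact Factors.of_isEmpty _
  | succ n ih =>
    obtain ⟨U, d, a', f, x, hx', rfl, rfl⟩ := hx.exists_eq
    obtain ⟨U', d', b', f', y, hy', rfl, rfl⟩ := hy.exists_eq
    have h := ih hx' hy' (id : _ → U ⊕ U')
    have h' := h.glue (extMul (𝟙 (val Y.X (Uᶜ : Set S))) (𝟙 (val Y.X (U'ᶜ : Set S'))) id ≫
      valMap (MonObj.mul (X := Y.X)) _) (interchange (splitSet U) (splitSet U') e)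
    have h'' := (h'.comp (tensorμ _ _ _ _)).comp (f ⊗ₘ f')
    have e₁ : AlgClassifier.glue (fun w => Sum.elim d d' (id w))
        (interchange (splitSet U) (splitSet U') e) =
        fun w => Sum.elim (AlgClassifier.glue d (splitSet U)) (AlgClassifier.glue d' (splitSet U'))
          (e w) := by
      funext w
      rcases h : e w with p | q
      · rcases h₁ : splitSet U p with s | t <;> simp [AlgClassifier.glue, interchange, h, h₁]
      · rcases h₁ : splitSet U' q with s | t <;> simp [AlgClassifier.glue, interchange, h, h₁]
    rw [e₁] at h''
    refine (congrArg (Factors _) ?_).mp h''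
    have e₂ : MonObj.mul (X := (pow Y (n + 1)).X) = tensorμ (pow Y n).X Y.X (pow Y n).X Y.X ≫
      (MonObj.mul (X := (pow Y n).X) ⊗ₘ MonObj.mul (X := Y.X)) := rfl
    have e₃ := extMul_tensorμ x (𝟙 (val Y.X (Uᶜ : Set S))) y (𝟙 (val Y.X (U'ᶜ : Set S')))
      (splitSet U) (splitSet U') e
    have e₄ := congrArg (fun t => (f ⊗ₘ f') ≫ t ≫
      valMap (MonObj.mul (X := (pow Y n).X) ⊗ₘ MonObj.mul (X := Y.X)) W) e₃
    simp only [Category.assoc] at e₄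
    rw [reassoc_of% comp_extMul, ← extMul_app] at e₄
    exact e₄.symm
end
end
end AlgClassifier

/-! ### Maps of tensor powers and decompositions; the formula for the composition product. -/

namespace AlgClassifier
noncomputable section

section
variable {W : Type u} [Finite W]

theorem std_zero_ext {X : FinN.{u}} (h : IsEmpty W) (f g : std W ⟶ X) : f = g :=
  FinN.hom_ext_el _ _ fun x => h.elim (stdEquiv W x)

/-- A finite set without elements is empty. -/
def stdEmpty (e : W → PEmpty.{1}) : std W ⟶ 𝟙_ FinN.{u} :=
  FinN.ofFun fun x => (e (stdEquiv W x)).elim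

theorem sumIn_leftUnitor {W' : Type u} [Finite W'] (t : std W' ⟶ 𝟙_ FinN.{u}) :
    sumIn (Sum.inr : W → W' ⊕ W) ≫ t ▷ std W = (λ_ (std W)).inv := by
  refine FinN.hom_ext_el _ _ fun x => ?_
  obtain ⟨w, rfl⟩ := (stdEquiv W).symm.surjective x
  rw [FinN.comp_el, sumIn_inr (e := Sum.inr) rfl, FinN.leftUnitor_inv, FinN.whiskerRight_eq,
    FinN.sumMap_inr]
  rfl

theorem sumIn_rightUnitor {W' : Type u} [Finite W'] (t : std W' ⟶ 𝟙_ FinN.{u}) :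
    sumIn (Sum.inl : W → W ⊕ W') ≫ std W ◁ t = (ρ_ (std W)).inv := by
  refine FinN.hom_ext_el _ _ fun x => ?_
  obtain ⟨w, rfl⟩ := (stdEquiv W).symm.surjective x
  rw [FinN.comp_el, sumIn_inl (e := Sum.inl) rfl, FinN.rightUnitor_inv, FinN.whiskerLeft_eq,
    FinN.sumMap_inl]
  rfl
end

section
variable {A : Type w} [Category.{u} A] [MonoidalCategory A] [SymmetricCategory A]
  [IsVectoid A] {W : Type u} [Finite W]

/-- The unit of an algebra as an element at an empty set. -/
def onePt (M : CommMon (qa A)) (t : std W ⟶ 𝟙_ FinN.{u}) : 𝟙_ A ⟶ val M.X W :=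
  algPt M.X ≫ M.X.functor.map t.op

theorem inrAlg_val (M N : CommMon (qa A)) {b : A} (x : b ⟶ val N.X W) {W' : Type u} [Finite W']
    (t : std W' ⟶ 𝟙_ FinN.{u}) : x ≫ valMap (algMap (inrAlg M N)) W =
      (λ_ b).inv ≫ extMul (onePt M t) x (Sum.inr : W → W' ⊕ W) := by
  rw [inrAlg_el, extMul, onePt]
  have h := elMul_map (algPt M.X) x t (𝟙 (std W))
  have h₁ : x ≫ N.X.functor.map (𝟙 (std W)).op = x :=
    (congrArg (x ≫ ·) (CategoryTheory.Functor.map_id N.X.functor _)).trans (Category.comp_id x)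
  rw [h₁] at h
  rw [h, Category.assoc, ← Functor.map_comp, ← op_comp, tensorHom_id, sumIn_leftUnitor]

theorem inlAlg_val (M N : CommMon (qa A)) {b : A} (x : b ⟶ val M.X W) {W' : Type u} [Finite W']
    (t : std W' ⟶ 𝟙_ FinN.{u}) : x ≫ valMap (algMap (inlAlg M N)) W =
      (ρ_ b).inv ≫ extMul x (onePt N t) (Sum.inl : W → W ⊕ W') := by
  rw [inlAlg_el, extMul, onePt]
  have h := elMul_map x (algPt N.X) (𝟙 (std W)) t
  have h₁ : x ≫ M.X.functor.map (𝟙 (std W)).op = x :=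
    (congrArg (x ≫ ·) (CategoryTheory.Functor.map_id M.X.functor _)).trans (Category.comp_id x)
  rw [h₁] at h
  rw [h, Category.assoc, ← Functor.map_comp, ← op_comp, id_tensorHom, sumIn_rightUnitor]

theorem onePt_tensor (M N : CommMon (qa A)) (h : IsEmpty W) (t : std W ⟶ 𝟙_ FinN.{u}) :
    onePt (tensorAlg M N) t =
      (λ_ _).inv ≫ extMul (onePt M t) (onePt N t) (fun w : W => h.elim w) := by
  rw [onePt, algPt_tensor, extMul, onePt, onePt, elMul_map]
  simp only [Category.assoc]
  rw [← Functor.map_comp, ← Functor.map_comp, ← op_comp, ← op_comp]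
  congr 4
  exact std_zero_ext h _ _

variable {Y : CommMon (qa A)}

theorem factors_onePt (n : ℕ) (c : W → Fin n) (h : IsEmpty W) (t : std W ⟶ 𝟙_ FinN.{u}) :
    Factors c (onePt (pow Y n) t) := by
  induction n with
  | zero => exact Factors.of_isEmpty _
  | succ n ih =>
    have h₁ := ((ih (fun w => h.elim w)).glue (onePt Y t) (fun w : W => h.elim w)).comp (λ_ _).inv
    have h₂ : glue (fun w => h.elim w) (fun w : W => (h.elim w : W ⊕ W)) = c :=
      funext fun w => h.elim w
    rw [h₂] at h₁
    exact (congrArg (Factors c) (onePt_tensor (pow Y n) Y h t)).mpr h₁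

/-- The insertion in place `j` puts units elsewhere, so all of `W` is in the part `j` and the other
parts are empty. -/
theorem factors_powι (n : ℕ) (j : Fin n) {b : A} (x : b ⟶ val Y.X W) :
    Factors (fun _ => j) (x ≫ valMap (algMap (powι Y n j)) W) := by
  -- The units are written as elements at an auxiliary empty set, so that insertions become products
  -- of the form `extMul`.
  let t : std PEmpty.{u + 1} ⟶ 𝟙_ FinN.{u} := stdEmpty fun x => x.elim
  induction n with
  | zero => exact j.elim0
  | succ n ih =>
    induction j using Fin.lastCases with
    | last =>
      have h₁ := ((factors_onePt (Y := Y) n (fun w : PEmpty.{u + 1} => w.elim) inferInstance t).glue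
        x (Sum.inr : W → _)).comp (λ_ _).inv
      have h₂ : powι Y (n + 1) (Fin.last n) = inrAlg (pow Y n) Y := by
        simp only [powι, Fin.lastCases_last]
        rfl
      rw [h₂]
      exact (congrArg (Factors _) (inrAlg_val (pow Y n) Y x t)).mpr h₁
    | cast j =>
      have h₁ := ((ih j).glue (onePt Y t) (Sum.inl : W → W ⊕ PEmpty.{u + 1})).comp (ρ_ _).inv
      have h₂ : powι Y (n + 1) j.castSucc = powι Y n j ≫ inlAlg (pow Y n) Y := by
        simp only [powι, Fin.lastCases_castSucc]
        rfl
      rw [h₂]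
      refine (congrArg (Factors _) ?_).mpr h₁
      exact (Category.assoc _ _ _).symm.trans (inlAlg_val (pow Y n) Y _ t)

theorem descAlg_val {M N P : CommMon (qa A)} (f : M ⟶ P) (g : N ⟶ P) {S T : Type u} [Finite S]
    [Finite T] {a b : A} (x : a ⟶ val M.X S) (y : b ⟶ val N.X T) (e : W → S ⊕ T) :
    extMul x y e ≫ valMap (algMap (descAlg f g)) W =
      extMul (x ≫ valMap (algMap f) S) (y ≫ valMap (algMap g) T) e ≫
        valMap (MonObj.mul (X := P.X)) W := by
  rw [extMul_app, Category.assoc]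
  rfl

/-- The `i`-th factor is multiplied into place `k i`, so the summand of `d` goes to the summand of
`k ∘ d`. The induction peels off the last factor and combines `Factors.mul` with `factors_powι`. -/
theorem factors_powDesc (m n : ℕ) (k : Fin m → Fin n) (d : W → Fin m) {b : A}
    {x : b ⟶ val (pow Y m).X W} (hx : Factors d x) :
    Factors (fun w => k (d w)) (x ≫ valMap (algMap (powDesc m fun i => powι Y n (k i))) W) := by
  induction m generalizing W b with
  | zero =>
    have h : IsEmpty W := ⟨fun w => (d w).elim0⟩
    let t : std W ⟶ 𝟙_ FinN.{u} := stdEmpty fun w => h.elim w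
    have e : IsIso t := ⟨default, std_zero_ext h _ _, Subsingleton.elim (α := 𝟙_ FinN.{u} ⟶ _) _ _⟩
    have e' : IsIso ((𝟙_ (qa A)).functor.map t.op) := inferInstance
    have e'' : IsIso (unitPt ≫ (𝟙_ (qa A)).functor.map t.op) := IsIso.comp_isIso' inferInstance e'
    -- At an empty set the zeroth power has the unit object as value, so the image of any element is
    -- a multiple of the unit of `Y^{⊗n}`.
    obtain ⟨v, hv⟩ : ∃ v : val (𝟙_ (qa A)) W ⟶ 𝟙_ A,
      v ≫ unitPt ≫ (𝟙_ (qa A)).functor.map t.op = 𝟙 _ := ⟨_, (asIso (unitPt ≫ _)).inv_hom_id⟩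
    have h₁ := (factors_onePt (Y := Y) n (fun w => k (d w)) h t).comp (x ≫ v)
    refine (congrArg (Factors _) ?_).mpr h₁
    have h₂ : onePt (pow Y n) t = (unitPt ≫ (𝟙_ (qa A)).functor.map t.op) ≫
        valMap (MonObj.one (X := (pow Y n).X)) W := by
      rw [onePt, algPt, Category.assoc, Category.assoc, pair_nat_app]
    have h₃ : v ≫ onePt (pow Y n) t = valMap (MonObj.one (X := (pow Y n).X)) W := by
      rw [h₂, Category.assoc, reassoc_of% hv]
    exact (congrArg (x ≫ ·) h₃).symm.trans (Category.assoc _ _ _).symm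
  | succ m ih =>
    obtain ⟨U, c, a, f, y, hy, rfl, rfl⟩ := hx.exists_eq
    have h₁ := ((ih (fun i => k i.castSucc) c hy).mul
      (factors_powι n (k (Fin.last m)) (𝟙 (val Y.X (Uᶜ : Set W)))) (splitSet U)).comp f
    have h₂ : (fun w => Sum.elim (fun w => k (c w).castSucc)
        (fun _ : (Uᶜ : Set W) => k (Fin.last m)) (splitSet U w)) =
        fun w => k (glue c (splitSet U) w) := by
      funext w
      rcases h : splitSet U w with s | t <;> simp [glue, h]
    rw [h₂] at h₁
    refine (congrArg (Factors _) ?_).mpr h₁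
    refine (Category.assoc _ _ _).trans (congrArg (f ≫ ·) ?_)
    exact descAlg_val (powDesc m fun i => powι Y n (k i.castSucc)) (powι Y n (k (Fin.last m)))
      y (𝟙 (val Y.X (Uᶜ : Set W))) (splitSet U)

/-- `factors_powDesc` is applied to the inclusions of the summands. No presheaf other than `Y` is
involved, so the same maps serve every left factor of the composition product. -/
theorem exists_fibreMap (Y : CommMon (qa A)) (V : Type u) [Finite V] :
    ∃ ρ : ∀ (m n : FinN.{u}) (φ : m ⟶ n) (d : V → Fin m.len),
        fibreTensor Y.X d ⟶ fibreTensor Y.X (pushIndex φ d),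
      ∀ m n φ d, ρ m n φ d ≫ fibreIncl Y (pushIndex φ d) =
        fibreIncl Y d ≫ extMap (algMap (powMap Y φ)) V := by
  choose ρ h using fun (m n : FinN.{u}) (φ : m ⟶ n) (d : V → Fin m.len) =>
    factors_powDesc m.len n.len (fun i => (φ (ULift.up i)).down) d (factors_fibreEl (Y := Y) d)
  exact ⟨ρ, h⟩
end

section
variable {A : Type w} [Category.{u} A] {B : Type w'} [Category.{u} B]

theorem IsCokernel.map_universal [HasColimitsOfSize.{u, u} A] {I J : Type u} {T : I → A}
    {S : J → A} {a b : J → I}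
    {l : ∀ j, S j ⟶ T (a j)} {r : ∀ j, S j ⟶ T (b j)} {Z : A} {π : ∀ i, T i ⟶ Z}
    (h : IsCokernel l r π) (L : A ⥤ B) [L.IsLeftAdjoint] (W : B) (t : ∀ i, L.obj (T i) ⟶ W)
    (ht : ∀ j, L.map (l j) ≫ t (a j) = L.map (r j) ≫ t (b j)) :
    ∃! g : L.obj Z ⟶ W, ∀ i, L.map (π i) ≫ g = t i := by
  let adj := Adjunction.ofIsLeftAdjoint L
  obtain ⟨g, hg, hu⟩ := (isCokernel_iff.mp h).2 _ (fun i => adj.homEquiv _ _ (t i)) fun j => by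
    rw [← Adjunction.homEquiv_naturality_left, ht, Adjunction.homEquiv_naturality_left]
  refine ⟨(adj.homEquiv _ _).symm g, fun i => ?_, fun g' hg' => ?_⟩
  · rw [← Adjunction.homEquiv_naturality_left_symm, hg, Equiv.symm_apply_apply]
  · rw [Equiv.eq_symm_apply]
    exact hu _ fun i => by rw [← hg', Adjunction.homEquiv_naturality_left]
end

section
variable {A : Type w} [Category.{u} A] [MonoidalCategory A] [SymmetricCategory A]
  [IsVectoid A] {Y : CommMon (qa A)} {V : Type u} [Finite V]

theorem basePair_natural {a b : A} (f : a ⟶ b) {G H : qa A} (s : G ⟶ H) (X : FinN.{u}) :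
    (f ⊗ₘ s.natTrans.app (op X)) ≫ basePair b H X =
      basePair a G X ≫ ((baseFunctor A).map f ⊗ₘ s).natTrans.app (op X) := by
  have h (a : A) (G : qa A) : basePair a G X = elMul (baseIncl a) (𝟙 (G.functor.obj (op X))) ≫
      ((baseFunctor A).obj a ⊗ G).functor.map (λ_ X).inv.op := by
    rw [basePair, elMul, tensorHom_id, Category.assoc]
  rw [h, h, Category.assoc, pair_nat_app, ← reassoc_of% elMul_app, baseIncl_natural,
    ← reassoc_of% comp_elMul, Category.comp_id, Category.id_comp]

/-- The map `a ⊗ Y(U₁) ⊗ ⋯ ⊗ Y(Uₙ) ⟶ (q^* a ⊗ Y^{⊗n})(V)`. -/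
def baseFibre (Y : CommMon (qa A)) (a : A) {n : ℕ} (d : V → Fin n) :
    a ⊗ valSeq Y n (fun i => {v // d v = i}) ⟶ val ((baseFunctor A).obj a ⊗ (pow Y n).X) V :=
  a ◁ fibreEl Y d ≫ basePair a (pow Y n).X (std V)

/-- `tensorLeft a` preserves the sum over decompositions, and `basePair` is invertible. -/
theorem isSum_baseFibre (a : A) (n : ℕ) : IsSum fun d : V → Fin n => baseFibre Y a d :=
  ((isSum_fibreEl Y n V).map (tensorLeft a)).comp_iso (basePair a (pow Y n).X (std V))

theorem whiskerRight_baseFibre {a b : A} (f : a ⟶ b) {n : ℕ} (d : V → Fin n) :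
    f ▷ valSeq Y n (fun i => {v // d v = i}) ≫ baseFibre Y b d =
      baseFibre Y a d ≫ valMap ((baseFunctor A).map f ▷ (pow Y n).X) V := by
  have h := basePair_natural f (𝟙 (pow Y n).X) (std V)
  rw [tensorHom_id] at h
  have h' : (f ⊗ₘ (𝟙 (pow Y n).X : (pow Y n).X ⟶ _).natTrans.app (op (std V))) =
    f ▷ val (pow Y n).X V := tensorHom_id _ _
  rw [h'] at h
  rw [baseFibre, baseFibre, ← whisker_exchange_assoc, h, Category.assoc]

theorem whiskerLeft_baseFibre (a : A) {m n : ℕ} {d : V → Fin m} {d' : V → Fin n}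
    {s : (pow Y m).X ⟶ (pow Y n).X}
    {r : valSeq Y m (fun i => {v // d v = i}) ⟶ valSeq Y n (fun i => {v // d' v = i})}
    (hr : r ≫ fibreEl Y d' = fibreEl Y d ≫ valMap s V) :
    a ◁ r ≫ baseFibre Y a d' = baseFibre Y a d ≫ valMap ((baseFunctor A).obj a ◁ s) V := by
  have h := basePair_natural (𝟙 a) s (std V)
  rw [id_tensorHom, CategoryTheory.Functor.map_id, id_tensorHom] at h
  rw [baseFibre, baseFibre, ← MonoidalCategory.whiskerLeft_comp_assoc, hr,
    MonoidalCategory.whiskerLeft_comp_assoc, h, Category.assoc]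

/-- Evaluation at `V` is a left adjoint and preserves the given cokernel. Each term of the result is
a sum over decompositions of `V`, and the two arrows are determined on the summands. -/
theorem isCokernel_compProj {ρ : ∀ (m n : FinN.{u}) (φ : m ⟶ n) (d : V → Fin m.len),
      fibreTensor Y.X d ⟶ fibreTensor Y.X (pushIndex φ d)}
    (hρ : ∀ m n φ d, ρ m n φ d ≫ fibreIncl Y (pushIndex φ d) =
      fibreIncl Y d ≫ extMap (algMap (powMap Y φ)) V) (X : qa A) {Z : qa A}
    {π : ∀ n : FinN.{u}, (baseFunctor A).obj (X.functor.obj (op n)) ⊗ (pow Y n.len).X ⟶ Z}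
    (h : IsCokernel (I := FinN.{u}) (J := Σ (m n : FinN.{u}), m ⟶ n)
      (T := fun n => (baseFunctor A).obj (X.functor.obj (op n)) ⊗ (pow Y n.len).X)
      (S := fun j => (baseFunctor A).obj (X.functor.obj (op j.2.1)) ⊗ (pow Y j.1.len).X)
      (a := fun j => j.1) (b := fun j => j.2.1)
      (fun j => (baseFunctor A).map (X.functor.map j.2.2.op) ▷ (pow Y j.1.len).X)
      (fun j => (baseFunctor A).obj (X.functor.obj (op j.2.1)) ◁ algMap (powMap Y j.2.2)) π) :
    IsCokernel
      (I := Σ n : FinN.{u}, V → Fin n.len)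
      (J := Σ (m n : FinN.{u}) (_ : m ⟶ n), V → Fin m.len)
      (T := fun i => X.functor.obj (op i.1) ⊗ fibreTensor Y.X i.2)
      (S := fun j => X.functor.obj (op j.2.1) ⊗ fibreTensor Y.X j.2.2.2)
      (Z := AlgClassifier.ext Z V)
      (a := fun j => ⟨j.1, j.2.2.2⟩) (b := fun j => ⟨j.2.1, pushIndex j.2.2.1 j.2.2.2⟩)
      (fun j => X.functor.map j.2.2.1.op ▷ fibreTensor Y.X j.2.2.2)
      (fun j => X.functor.obj (op j.2.1) ◁ ρ j.1 j.2.1 j.2.2.1 j.2.2.2)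
      (fun i => compProj (π i.1) i.2) := by
  have hl {m n : FinN.{u}} (φ : m ⟶ n) (d : V → Fin m.len) {W : A} (t : _ ⟶ W) :=
    (reassoc_of% (whiskerRight_baseFibre (Y := Y) (X.functor.map φ.op) d)) t
  have hr {m n : FinN.{u}} (φ : m ⟶ n) (d : V → Fin m.len) {W : A} (t : _ ⟶ W) :=
    (reassoc_of% (whiskerLeft_baseFibre (X.functor.obj (op n)) (hρ m n φ d))) t
  have hc {n : FinN.{u}} (d : V → Fin n.len) :
    compProj (π n) d = baseFibre Y _ d ≫ valMap (π n) V := (Category.assoc _ _ _).symm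
  have : (evalAt A (std V)).IsLeftAdjoint := isLeftAdjoint_of_vectoid _
  rw [isCokernel_iff]
  constructor
  · rintro ⟨m, n, φ, d⟩
    have h₁ := congrArg (fun t => baseFibre Y (X.functor.obj (op n)) d ≫ valMap t V)
      ((isCokernel_iff.mp h).1 ⟨m, n, φ⟩)
    refine (congrArg (_ ≫ ·) (hc d)).trans (Eq.trans ?_ (congrArg (_ ≫ ·) (hc (pushIndex φ d))).symm)
    exact (hl φ d _).trans (h₁.trans (hr φ d _).symm)
  · intro W t ht
    choose k hk hu using fun n : FinN.{u} =>
      isSum_baseFibre (Y := Y) (V := V) (X.functor.obj (op n)) n.len W fun d => t ⟨n, d⟩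
    obtain ⟨g, hg, hg'⟩ := h.map_universal (evalAt A (std V)) W k (by
      rintro ⟨m, n, φ⟩
      refine (isSum_baseFibre (Y := Y) (V := V) (X.functor.obj (op n)) m.len W fun d =>
        X.functor.map φ.op ▷ _ ≫ t ⟨m, d⟩).unique (fun d => ?_) (fun d => ?_)
      · exact (hl φ d (k m)).symm.trans (congrArg (_ ≫ ·) (hk m d))
      · exact (hr φ d (k n)).symm.trans ((congrArg (_ ≫ ·) (hk n (pushIndex φ d))).trans
          (ht ⟨m, n, φ, d⟩).symm))
    refine ⟨g, fun i => ?_, fun g' h' => hg' g' fun n => hu n _ fun d => ?_⟩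
    · refine (congrArg (· ≫ g) (hc i.2)).trans ((Category.assoc _ _ _).trans ?_)
      exact (congrArg (_ ≫ ·) (hg i.1)).trans (hk i.1 i.2)
    · exact (Category.assoc _ _ _).symm.trans ((congrArg (· ≫ g') (hc d)).symm.trans (h' ⟨n, d⟩))
end
end
end AlgClassifier

/-! ### Representable presheaves of sets, and the universal property of `PhiBar`. -/

namespace AlgClassifier
noncomputable section

/-- The universal element of `h_X`. -/
def hNEl (X : FinN.{u}) : 𝟙_ (Type u) ⟶ (hN.obj X).functor.obj (op X) := ↾fun _ => (𝟙 X : X ⟶ X)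

/-- This is the Yoneda lemma. Through it the invertibility of the maps `hε` and `hμ` becomes a
matter of matching free generators. -/
theorem isFree_hN (X : FinN.{u}) : IsFree (hN.obj X) (hNEl X) := fun F => by
  constructor
  · intro s t h
    have h' : yonedaEquiv s.natTrans = yonedaEquiv t.natTrans :=
      ConcreteCategory.congr_hom h PUnit.unit
    exact DayFunctor.hom_ext (yonedaEquiv.injective h')
  · intro x
    refine ⟨⟨yonedaEquiv.symm (x PUnit.unit)⟩, ?_⟩
    ext ⟨⟩
    exact yonedaEquiv.apply_symm_apply (x PUnit.unit)

instance isIso_hε : IsIso hε.{u} := isFree_unit.isIso (isFree_hN (𝟙_ FinN.{u})) hε hε_pt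

theorem isIso_hμ (X Y : FinN.{u}) : IsIso (hμ X Y) := by
  refine ((isFree_hN X).tensor (isFree_hN Y)).isIso
    ((isFree_hN (X ⊗ Y)).iso_comp (λ_ (𝟙_ (Type u)))) (hμ X Y) ?_
  rw [Category.assoc, hμ_pair]
  ext ⟨x, y⟩
  exact id_tensorHom_id X Y

instance : hN.{u}.Full where
  map_surjective {X Y} t := by
    obtain ⟨f, hf⟩ := (yoneda (C := FinN.{u})).map_surjective t.natTrans
    exact ⟨f, DayFunctor.hom_ext hf⟩

instance : hN.{u}.Faithful where
  map_injective {X Y f g} h := (yoneda (C := FinN.{u})).map_injective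
    (congrArg DayFunctor.Hom.natTrans h)

section
variable {A : Type w} [Category.{u} A] [MonoidalCategory A] [SymmetricCategory A]
  [CocontinuousTensor A] (M : CommMon A)

def PhiBar.isPointwise :
    (Functor.LeftExtension.mk (PhiBar M) (PhiBar.unit M)).IsPointwiseLeftKanExtension :=
  @Functor.isPointwiseLeftKanExtensionOfIsLeftKanExtension _ _ _ _ _ _ hN.{u} (Phi M) _
    (PhiBar M) (PhiBar.unit M)
    (inferInstanceAs (Functor.IsLeftKanExtension _ (hN.{u}.leftKanExtensionUnit (Phi M))))

/-- The embedding `hN` is fully faithful, so a pointwise Kan extension along it restricts to the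
given functor. -/
instance : IsIso (PhiBar.unit M) := (PhiBar.isPointwise M).isIso_hom

/-- The map `Φ_M(X) ⟶ Φ̄_M(F)` given by an element of `F(X)`. -/
def PhiBar.el {F : Qa.{u}} {X : FinN.{u}} (x : F.functor.obj (op X)) :
    (Phi M).obj X ⟶ (PhiBar M).obj F :=
  (PhiBar.unit M).app X ≫ (PhiBar M).map ⟨yonedaEquiv.symm x⟩

theorem PhiBar.el_yonedaEquiv {F : Qa.{u}} {X : FinN.{u}} (t : hN.obj X ⟶ F) :
    PhiBar.el M (yonedaEquiv t.natTrans) = (PhiBar.unit M).app X ≫ (PhiBar M).map t :=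
  congrArg (fun s => (PhiBar.unit M).app X ≫ (PhiBar M).map s)
    (DayFunctor.hom_ext (yonedaEquiv.symm_apply_apply t.natTrans))

theorem PhiBar.el_map {F G : Qa.{u}} {X : FinN.{u}} (x : F.functor.obj (op X)) (t : F ⟶ G) :
    PhiBar.el M x ≫ (PhiBar M).map t = PhiBar.el M (t.natTrans.app (op X) x) := by
  rw [PhiBar.el, Category.assoc, ← Functor.map_comp]
  refine congrArg (fun s => (PhiBar.unit M).app X ≫ (PhiBar M).map s) (DayFunctor.hom_ext ?_)
  exact yonedaEquiv_symm_naturality_right X t.natTrans x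

theorem PhiBar.map_el {F : Qa.{u}} {X Y : FinN.{u}} (f : X ⟶ Y) (x : F.functor.obj (op Y)) :
    (Phi M).map f ≫ PhiBar.el M x = PhiBar.el M (F.functor.map f.op x) := by
  have h : hN.map f ≫ (⟨yonedaEquiv.symm x⟩ : hN.obj Y ⟶ F) =
      ⟨yonedaEquiv.symm (F.functor.map f.op x)⟩ :=
    DayFunctor.hom_ext (yonedaEquiv_symm_naturality_left f F.functor x)
  rw [PhiBar.el, PhiBar.el, (PhiBar.unit M).naturality_assoc, ← h, Functor.map_comp]
  rfl

/-- The pointwise Kan extension is a colimit over the morphisms `h_X ⟶ F`, that is, over the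
elements of `F`. -/
theorem PhiBar.existsUnique (F : Qa.{u}) {W : A}
    (t : ∀ X : FinN.{u}, F.functor.obj (op X) → ((Phi M).obj X ⟶ W))
    (ht : ∀ {X Y : FinN.{u}} (f : X ⟶ Y) (x : F.functor.obj (op Y)),
      (Phi M).map f ≫ t Y x = t X (F.functor.map f.op x)) :
    ∃! g : (PhiBar M).obj F ⟶ W, ∀ X x, PhiBar.el M x ≫ g = t X x := by
  have h := PhiBar.isPointwise M F
  let c : Cocone (CostructuredArrow.proj hN F ⋙ Phi M) :=
    { pt := W
      ι :=
        { app := fun Y => t Y.left (yonedaEquiv Y.hom.natTrans)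
          naturality := fun Y Z f => by
            refine (ht f.left _).trans (Eq.trans ?_ (Category.comp_id _).symm)
            refine congrArg (t Y.left) ?_
            rw [← CostructuredArrow.w f]
            exact yonedaEquiv_naturality' _ _ } }
  have key (g : (PhiBar M).obj F ⟶ W) : (∀ X x, PhiBar.el M x ≫ g = t X x) ↔
      ∀ Y, ((Functor.LeftExtension.mk (PhiBar M) (PhiBar.unit M)).coconeAt F).ι.app Y ≫ g =
        c.ι.app Y := by
    constructor
    · intro H Y
      exact (PhiBar.el_yonedaEquiv M Y.hom =≫ g).symm.trans
        (H Y.left (yonedaEquiv Y.hom.natTrans))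
    · intro H X x
      have := H (CostructuredArrow.mk (Y := X) (S := hN) (T := F) ⟨yonedaEquiv.symm x⟩)
      refine this.trans (congrArg (t X) (yonedaEquiv.apply_symm_apply x))
  exact ⟨h.desc c, (key _).mpr (h.fac c), fun g hg => h.uniq c g ((key g).mp hg)⟩

end
end
end AlgClassifier

/-! ### Monoidal functors out of sets, and sums of copies of the unit. -/

namespace AlgClassifier
noncomputable section

section
variable {A : Type w} [Category.{u} A] {I : Type w''} {T : I → A} {Z : A} {f : ∀ i, T i ⟶ Z}

theorem IsSum.hom_ext (h : IsSum f) {W : A} {g g' : Z ⟶ W} (w : ∀ i, f i ≫ g = f i ≫ g') :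
    g = g' := (h W fun i => f i ≫ g').unique w fun _ => rfl

theorem IsSum.iso_comp (h : IsSum f) {S : I → A} (e : ∀ i, S i ⟶ T i) [∀ i, IsIso (e i)] :
    IsSum fun i => e i ≫ f i := fun W t => by
  obtain ⟨g, hg, hu⟩ := h W fun i => inv (e i) ≫ t i
  exact ⟨g, fun i => by rw [Category.assoc, hg, IsIso.hom_inv_id_assoc], fun g' hg' =>
    hu g' fun i => by rw [← hg' i, Category.assoc, IsIso.inv_hom_id_assoc]⟩

/-- The morphism out of a sum with given components. -/
def IsSum.desc (h : IsSum f) {W : A} (t : ∀ i, T i ⟶ W) : Z ⟶ W := (h W t).choose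

theorem IsSum.fac (h : IsSum f) {W : A} (t : ∀ i, T i ⟶ W) (i : I) : f i ≫ h.desc t = t i :=
  (h W t).choose_spec.1 i
end

/-- An element of a set, as a map from the one-element set. -/
def point {S : Type u} (x : S) : 𝟙_ (Type u) ⟶ S := ↾fun _ => x

theorem isSum_point (S : Type u) : IsSum fun x : S => point x := fun W t =>
  ⟨↾fun x => t x PUnit.unit, fun x => by ext ⟨⟩; rfl, fun g hg => by
    ext x
    exact ConcreteCategory.congr_hom (hg x) PUnit.unit⟩

section
variable {B : Type w} [Category.{u} B] [MonoidalCategory B]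

section
variable (L : Type u ⥤ B) [L.LaxMonoidal]

/-- The map `1 ⟶ L S` given by an element of `S`. -/
def pointMap {S : Type u} (x : S) : 𝟙_ B ⟶ L.obj S :=
  Functor.LaxMonoidal.ε L ≫ L.map (point x)

theorem pointMap_map {S T : Type u} (x : S) (f : S ⟶ T) :
    pointMap L x ≫ L.map f = pointMap L (f x) := by
  rw [pointMap, Category.assoc, ← L.map_comp]
  rfl

theorem pointMap_unit : pointMap L (S := 𝟙_ (Type u)) PUnit.unit = Functor.LaxMonoidal.ε L :=
  (congrArg (_ ≫ ·) (L.map_id _)).trans (Category.comp_id _)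

theorem pointMap_μ {S T : Type u} (x : S) (y : T) :
    (pointMap L x ⊗ₘ pointMap L y) ≫ Functor.LaxMonoidal.μ L S T =
      (λ_ (𝟙_ B)).hom ≫ pointMap L (S := S ⊗ T) (x, y) := by
  have h : (Functor.LaxMonoidal.ε L ⊗ₘ Functor.LaxMonoidal.ε L) ≫
      Functor.LaxMonoidal.μ L (𝟙_ _) (𝟙_ _) =
      (λ_ (𝟙_ B)).hom ≫ Functor.LaxMonoidal.ε L ≫ L.map (λ_ (𝟙_ (Type u))).inv := by
    rw [← leftUnitor_naturality_assoc, Functor.LaxMonoidal.left_unitality, Category.assoc,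
      Category.assoc, ← L.map_comp, Iso.hom_inv_id, L.map_id, Category.comp_id,
      MonoidalCategory.tensorHom_def', Category.assoc]
  rw [pointMap, pointMap, ← tensorHom_comp_tensorHom, Category.assoc,
    Functor.LaxMonoidal.μ_natural, reassoc_of% h, ← L.map_comp]
  rfl

/-- A set is the sum of its points; `L` preserves this sum and takes the point to the unit object.
-/
theorem isSum_pointMap [L.IsLeftAdjoint] [IsIso (Functor.LaxMonoidal.ε L)] (S : Type u) :
    IsSum fun x : S => pointMap L x :=
  ((isSum_point S).map L).iso_comp fun _ => Functor.LaxMonoidal.ε L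
end

section
variable [HasColimitsOfSize.{u, u} B]

/-- The coprojection `X ⟶ S ⊗ X` with index `x`. -/
def copower.ι {S : Type u} {X : B} (x : S) : X ⟶ copower S X := Sigma.ι (fun _ : S => X) x

theorem copower.ι_map {S T : Type u} (g : S → T) {X Y : B} (f : X ⟶ Y) (x : S) :
    copower.ι x ≫ copower.map g f = f ≫ copower.ι (g x) := Sigma.ι_desc _ _

theorem copower.ι_map_id {S T : Type u} (g : S → T) {X : B} (x : S) :
    copower.ι x ≫ copower.map g (𝟙 X) = copower.ι (g x) :=
  (Sigma.ι_desc _ _).trans (Category.id_comp _)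

theorem copower.hom_ext {S : Type u} {X Z : B} {f g : copower S X ⟶ Z}
    (h : ∀ x : S, copower.ι x ≫ f = copower.ι x ≫ g) : f = g := Sigma.hom_ext _ _ h

end

section
variable [∀ b : B, (tensorLeft b).IsLeftAdjoint] [∀ b : B, (tensorRight b).IsLeftAdjoint]

theorem IsSum.tensor_hom_ext {I J : Type u} {b c : B} {X Y : B} {f : I → (b ⟶ X)} {g : J → (c ⟶ Y)}
    (hf : IsSum f) (hg : IsSum g) {W : B} {s t : X ⊗ Y ⟶ W}
    (h : ∀ i j, (f i ⊗ₘ g j) ≫ s = (f i ⊗ₘ g j) ≫ t) : s = t := by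
  refine (hf.map (tensorRight Y)).hom_ext fun i => (hg.map (tensorLeft b)).hom_ext fun j => ?_
  have := h i j
  rw [MonoidalCategory.tensorHom_def', Category.assoc, Category.assoc] at this
  exact this

theorem IsSum.tensor {I J : Type u} {b c : B} {X Y : B} {f : I → (b ⟶ X)} {g : J → (c ⟶ Y)}
    (hf : IsSum f) (hg : IsSum g) : IsSum fun p : I × J => f p.1 ⊗ₘ g p.2 := fun W t => by
  let s (i : I) : b ⊗ Y ⟶ W := (hg.map (tensorLeft b)).desc fun j => t (i, j)
  refine ⟨(hf.map (tensorRight Y)).desc s, fun ⟨i, j⟩ => ?_, fun s' hs' =>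
    hf.tensor_hom_ext hg fun i j => (hs' (i, j)).trans ?_⟩
  all_goals
    have h₁ := (hf.map (tensorRight Y)).fac s i
    have h₂ := (hg.map (tensorLeft b)).fac (fun j => t (i, j)) j
  · change (f i ⊗ₘ g j) ≫ _ = _
    rw [MonoidalCategory.tensorHom_def', Category.assoc]
    exact (congrArg (_ ≫ ·) h₁).trans h₂
  · rw [MonoidalCategory.tensorHom_def', Category.assoc]
    exact ((congrArg (_ ≫ ·) h₁).trans h₂).symm

variable [HasColimitsOfSize.{u, u} B]

variable (B) in
/-- The functor taking a set to the coproduct of as many copies of the unit object. -/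
def copowerFunctor : Type u ⥤ B where
  obj S := copower S (𝟙_ B)
  map f := copower.map f (𝟙 (𝟙_ B))
  map_id S := copower.hom_ext fun x =>
    (copower.ι_map_id id x).trans (Category.comp_id _).symm
  map_comp f g := copower.hom_ext fun x => by
    rw [copower.ι_map_id, ← Category.assoc, copower.ι_map_id, copower.ι_map_id]
    rfl

namespace copowerFunctor

/-- The coprojection with index `x`. -/
def el {S : Type u} (x : S) : 𝟙_ B ⟶ (copowerFunctor B).obj S := copower.ι x

theorem el_map {S T : Type u} (x : S) (f : S ⟶ T) :
    el x ≫ (copowerFunctor B).map f = el (B := B) (f x) :=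
  copower.ι_map_id f x

theorem isSum_el (S : Type u) : IsSum fun x : S => el (B := B) x :=
  .of_isColimit (coproductIsCoproduct fun _ : S => 𝟙_ B)

/-- The map `L S ⊗ L T ⟶ L (S × T)`. -/
def mul (S T : Type u) : (copowerFunctor B).obj S ⊗ (copowerFunctor B).obj T ⟶
    (copowerFunctor B).obj (S ⊗ T) :=
  ((isSum_el S).tensor (isSum_el T)).desc fun p => (λ_ (𝟙_ B)).hom ≫ el (S := S ⊗ T) (p.1, p.2)

theorem el_mul {S T : Type u} (x : S) (y : T) :
    (el x ⊗ₘ el y) ≫ mul S T = (λ_ (𝟙_ B)).hom ≫ el (S := S ⊗ T) (x, y) :=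
  ((isSum_el S).tensor (isSum_el T)).fac _ (x, y)

theorem hom_ext {S T : Type u} {W : B} {s t : (copowerFunctor B).obj S ⊗ (copowerFunctor B).obj T ⟶ W}
    (h : ∀ (x : S) (y : T), (el x ⊗ₘ el y) ≫ s = (el x ⊗ₘ el y) ≫ t) : s = t :=
  (isSum_el S).tensor_hom_ext (isSum_el T) h

/-- All axioms are tested on elements, because a tensor product of sums of units is a sum of units
indexed by pairs. -/
instance : (copowerFunctor B).LaxMonoidal where
  ε := el (S := 𝟙_ (Type u)) PUnit.unit
  μ := mul
  μ_natural_left f T := hom_ext fun x y => by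
    rw [← tensorHom_id, tensorHom_comp_tensorHom_assoc, el_map, Category.comp_id, el_mul,
      reassoc_of% el_mul, el_map]
    rfl
  μ_natural_right T f := hom_ext fun x y => by
    rw [← id_tensorHom, tensorHom_comp_tensorHom_assoc, el_map, Category.comp_id, el_mul,
      reassoc_of% el_mul, el_map]
    rfl
  associativity S T U := by
    refine ((isSum_el S).tensor (isSum_el T)).tensor_hom_ext (isSum_el U) fun ⟨x, y⟩ z => ?_
    dsimp only
    rw [← tensorHom_id, tensorHom_comp_tensorHom_assoc, el_mul, Category.comp_id,
      associator_naturality_assoc, ← id_tensorHom, tensorHom_comp_tensorHom_assoc, el_mul,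
      Category.comp_id]
    have h₁ : (((λ_ (𝟙_ B)).hom ≫ el (S := S ⊗ T) (x, y)) ⊗ₘ el z) = (λ_ (𝟙_ B)).hom ▷ 𝟙_ B ≫
      (el (S := S ⊗ T) (x, y) ⊗ₘ el z) := by
        rw [← tensorHom_id, tensorHom_comp_tensorHom, Category.id_comp]
    have h₂ : (el x ⊗ₘ ((λ_ (𝟙_ B)).hom ≫ el (S := T ⊗ U) (y, z))) = 𝟙_ B ◁ (λ_ (𝟙_ B)).hom ≫
      (el x ⊗ₘ el (S := T ⊗ U) (y, z)) := by
        rw [← id_tensorHom, tensorHom_comp_tensorHom, Category.id_comp]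
    rw [h₁, h₂, Category.assoc, Category.assoc, reassoc_of% el_mul, el_mul, el_map,
      triangle_assoc, unitors_equal]
    rfl
  left_unitality S := (((isSum_el S).map (tensorLeft (𝟙_ B))).hom_ext fun x => by
    have h : 𝟙_ B ◁ el x ≫ el (S := 𝟙_ (Type u)) PUnit.unit ▷ (copowerFunctor B).obj S =
      (el (S := 𝟙_ (Type u)) PUnit.unit ⊗ₘ el x) := (MonoidalCategory.tensorHom_def' _ _).symm
    refine (leftUnitor_naturality (el x)).trans ?_
    change _ = 𝟙_ B ◁ el x ≫ _
    rw [reassoc_of% h, reassoc_of% el_mul, el_map]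
    rfl)
  right_unitality S := (((isSum_el S).map (tensorRight (𝟙_ B))).hom_ext fun x => by
    have h : el x ▷ 𝟙_ B ≫ (copowerFunctor B).obj S ◁ el (S := 𝟙_ (Type u)) PUnit.unit =
      (el x ⊗ₘ el (S := 𝟙_ (Type u)) PUnit.unit) := (MonoidalCategory.tensorHom_def _ _).symm
    refine (rightUnitor_naturality (el x)).trans ?_
    change _ = el x ▷ 𝟙_ B ≫ _
    rw [reassoc_of% h, reassoc_of% el_mul, el_map, ← unitors_equal]
    rfl)

instance : IsIso (Functor.LaxMonoidal.ε (copowerFunctor B)) := by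
  let h := isSum_el (B := B) (𝟙_ (Type u))
  refine ⟨h.desc fun _ => 𝟙 _, h.fac (fun _ => 𝟙 _) PUnit.unit, h.hom_ext fun ⟨⟩ => ?_⟩
  rw [← Category.assoc, h.fac]
  exact (Category.id_comp _).trans (Category.comp_id _).symm

instance (S T : Type u) : IsIso (Functor.LaxMonoidal.μ (copowerFunctor B) S T) := by
  let h := isSum_el (B := B) (S ⊗ T)
  let g : (copowerFunctor B).obj (S ⊗ T) ⟶ (copowerFunctor B).obj S ⊗ (copowerFunctor B).obj T :=
    h.desc fun p => (λ_ (𝟙_ B)).inv ≫ (el p.1 ⊗ₘ el p.2)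
  have hg (x : S) (y : T) : el (S := S ⊗ T) (x, y) ≫ g = (λ_ (𝟙_ B)).inv ≫ (el x ⊗ₘ el y) :=
    h.fac _ (x, y)
  refine ⟨g, hom_ext fun x y => ?_, h.hom_ext fun ⟨x, y⟩ => ?_⟩
  · refine (reassoc_of% (el_mul (B := B) x y)) g |>.trans ?_
    rw [hg, Iso.hom_inv_id_assoc, Category.comp_id]
  · rw [reassoc_of% (hg x y)]
    refine (congrArg (_ ≫ ·) (el_mul x y)).trans ?_
    rw [Iso.inv_hom_id_assoc, Category.comp_id]

instance : (copowerFunctor B).Monoidal := Functor.Monoidal.ofLaxMonoidal _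

instance : (copowerFunctor B).IsLeftAdjoint :=
  (Adjunction.mkOfHomEquiv (G := coyoneda.obj (op (𝟙_ B)))
    { homEquiv := fun S W =>
        { toFun := fun g => ↾fun x : S => el x ≫ g
          invFun := fun t => (isSum_el S).desc fun x => t x
          left_inv := fun g => (isSum_el S).hom_ext fun x => (isSum_el S).fac _ x
          right_inv := fun t => by ext x; exact (isSum_el S).fac _ x }
      homEquiv_naturality_left_symm := fun {S S' W} f t => (isSum_el S).hom_ext fun x =>
        ((isSum_el S).fac _ x).trans (((reassoc_of% (el_map (B := B) x f)) _).trans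
          ((isSum_el S').fac _ (f x))).symm
      homEquiv_naturality_right := fun {S W W'} g h => by
        ext x; exact (Category.assoc _ _ _).symm }).isLeftAdjoint
end copowerFunctor
end
end

section
variable {B : Type w} [Category.{u} B] [MonoidalCategory B] [SymmetricCategory B]
  [∀ b : B, (tensorLeft b).IsLeftAdjoint] [∀ b : B, (tensorRight b).IsLeftAdjoint]
  [HasColimitsOfSize.{u, u} B]

instance : (copowerFunctor B).Braided where
  braided S T := copowerFunctor.hom_ext fun x y => by
    refine ((reassoc_of% (copowerFunctor.el_mul (B := B) x y)) _).trans ?_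
    rw [BraidedCategory.braiding_naturality_assoc]
    refine Eq.trans ?_ (congrArg (_ ≫ ·) (copowerFunctor.el_mul y x)).symm
    rw [copowerFunctor.el_map, braiding_tensorUnit_left, unitors_equal]
    simp
    rfl
end
end
end AlgClassifier

/-! ### Being over sets is no additional structure; the absolute classification. -/

namespace AlgClassifier
noncomputable section

section
variable {B : Type w} [Category.{u} B] [MonoidalCategory B]
  [∀ b : B, (tensorLeft b).IsLeftAdjoint] [∀ b : B, (tensorRight b).IsLeftAdjoint]
  {L : Type u ⥤ B} [L.LaxMonoidal] [L.IsLeftAdjoint] [IsIso (Functor.LaxMonoidal.ε L)]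
  {L' : Type u ⥤ B} [L'.LaxMonoidal]

theorem pointMap_trans (t : L ⟶ L') [NatTrans.IsMonoidal t] {S : Type u} (x : S) :
    pointMap L x ≫ t.app S = pointMap L' x := by
  rw [pointMap, Category.assoc, t.naturality, NatTrans.IsMonoidal.unit_assoc, pointMap]

/-- The source `L` sends `S` to a sum of units indexed by `S`, and a monoidal transformation is
prescribed on the units. A transformation with the prescribed values is `pointTrans`. -/
theorem monoidalTrans_ext (s t : L ⟶ L') [NatTrans.IsMonoidal s] [NatTrans.IsMonoidal t] :
    s = t := by
  ext S
  exact (isSum_pointMap L S).hom_ext fun x => (pointMap_trans s x).trans (pointMap_trans t x).symm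

variable (L L')

/-- The monoidal transformation out of a cocontinuous monoidal functor on sets. -/
def pointTrans : L ⟶ L' where
  app S := (isSum_pointMap L S).desc fun x => pointMap L' x
  naturality S T f := (isSum_pointMap L S).hom_ext fun x => by
    rw [reassoc_of% pointMap_map, IsSum.fac, ← Category.assoc, IsSum.fac, pointMap_map]

theorem pointMap_pointTrans {S : Type u} (x : S) :
    pointMap L x ≫ (pointTrans L L').app S = pointMap L' x := (isSum_pointMap L S).fac _ x

instance : NatTrans.IsMonoidal (pointTrans L L') where
  unit := by rw [← pointMap_unit, pointMap_pointTrans, pointMap_unit]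
  tensor S T := (isSum_pointMap L S).tensor_hom_ext (isSum_pointMap L T) fun x y => by
    rw [reassoc_of% pointMap_μ, pointMap_pointTrans, tensorHom_comp_tensorHom_assoc,
      pointMap_pointTrans, pointMap_pointTrans, pointMap_μ]

/-- Any two cocontinuous monoidal functors on sets are isomorphic. -/
def pointIso [L'.IsLeftAdjoint] [IsIso (Functor.LaxMonoidal.ε L')] : L ≅ L' where
  hom := pointTrans L L'
  inv := pointTrans L' L
  hom_inv_id := monoidalTrans_ext _ _
  inv_hom_id := monoidalTrans_ext _ _

instance [L'.IsLeftAdjoint] [IsIso (Functor.LaxMonoidal.ε L')] :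
    NatTrans.IsMonoidal (pointIso L L').hom := inferInstanceAs (NatTrans.IsMonoidal (pointTrans L L'))
end

section
variable (B : Type w) [Category.{u} B] [MonoidalCategory B] [SymmetricCategory B] [IsVectoid B]

instance (f : VectoidMorphism B Qa.{u}) : f.inv.IsLeftAdjoint := f.adj.isLeftAdjoint

instance (f : VectoidMorphism B Qa.{u}) : IsIso (Functor.LaxMonoidal.ε (baseFunctor (Type u) ⋙ f.inv)) :=
  inferInstanceAs (IsIso (Functor.LaxMonoidal.ε f.inv ≫
    f.inv.map (Functor.LaxMonoidal.ε (baseFunctor (Type u)))))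

variable {B} in
theorem overHom_w {p : Type u ⥤ B} [p.LaxBraided] {f g : OverHom p (baseFunctor (Type u))}
    (θ : f.toHom ⟶ g.toHom) :
    Functor.whiskerLeft (baseFunctor (Type u)) (VectoidMorphism.trans θ) ≫ g.iso.hom = f.iso.hom := by
  have h : NatTrans.IsMonoidal (Functor.whiskerLeft (baseFunctor (Type u))
    (VectoidMorphism.trans θ)) := inferInstance
  have h' : NatTrans.IsMonoidal (Functor.whiskerLeft (baseFunctor (Type u))
    (VectoidMorphism.trans θ) ≫ g.iso.hom) := inferInstance
  exact monoidalTrans_ext _ _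

/-- The structure isomorphism over sets exists by `pointIso`, and compatibility with it is automatic
by `monoidalTrans_ext`. -/
instance : (OverHom.forget (copowerFunctor B) (baseFunctor (Type u))).IsEquivalence where
  faithful := ⟨fun h => OverHom.Hom.ext' h⟩
  full := ⟨fun {f g} θ => ⟨⟨θ, overHom_w θ⟩, rfl⟩⟩
  essSurj := ⟨fun f =>
    let e := pointIso (baseFunctor (Type u) ⋙ f.inv) (copowerFunctor B)
    have h : NatTrans.IsMonoidal e.hom :=
      inferInstanceAs (NatTrans.IsMonoidal (pointIso _ (copowerFunctor B)).hom)
    ⟨{ toHom := f, iso := e, monoidal := h }, ⟨Iso.refl _⟩⟩⟩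

theorem isEquivalence_pullAlg_rel : (pullAlg B (XaRel (Type u))).IsEquivalence := by
  have h : (OverHom.forget (copowerFunctor B) (baseFunctor (Type u)) ⋙
    pullAlg B (XaRel (Type u))).IsEquivalence := isEquivalence_pullAlg (copowerFunctor B)
  exact Functor.isEquivalence_of_comp_left (OverHom.forget (copowerFunctor B) (baseFunctor (Type u))) _

/-- The map from `h_1` to the constant presheaf. -/
def oneIso : Xa.{u}.X ≅ (XaRel (Type u)).X where
  hom := ⟨{ app := fun _ => ↾fun _ => PUnit.unit, naturality := fun _ _ _ => rfl }⟩
  inv := ⟨{ app := fun X => ↾fun _ => (default : unop X ⟶ FinN.one), naturality := fun _ _ _ => rfl }⟩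
  hom_inv_id := by
    apply DayFunctor.hom_ext
    ext X x
    exact Subsingleton.elim (α := unop X ⟶ FinN.one) _ _
  inv_hom_id := rfl

/-- The constant presheaf of one-point sets is terminal, so any isomorphism of `X_a` with it
respects the algebra structures. -/
theorem hom_constOne_ext {F : Qa.{u}} (s t : F ⟶ (XaRel (Type u)).X) : s = t := by
  apply DayFunctor.hom_ext
  ext X x
  rfl

/-- The classifying algebra is the constant presheaf. -/
def XaIso : Xa.{u} ≅ XaRel (Type u) :=
  CommMon.mkIso (M := Xa) (N := XaRel (Type u)) oneIso (hom_constOne_ext _ _) (hom_constOne_ext _ _)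

theorem isEquivalence_pullAlg_Xa : (pullAlg B Xa.{u}).IsEquivalence := by
  have h := isEquivalence_pullAlg_rel B
  exact Functor.isEquivalence_of_iso (F := pullAlg B (XaRel (Type u)))
    (Functor.isoWhiskerLeft _ (Functor.isoWhiskerLeft _
      ((evaluation (CommMon Qa.{u}) (CommMon B)).mapIso XaIso.symm)))
end
end
end AlgClassifier

/-! ### The Kan extension `PhiBar` as a presented functor. -/

namespace AlgClassifier
noncomputable section

section
variable {A : Type w} [Category.{u} A] [MonoidalCategory A] [SymmetricCategory A] [IsVectoid A]
  (M : CommMon A)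

theorem Presentation.exists_braided {B : Type w'} [Category.{u} B] [MonoidalCategory B]
    [SymmetricCategory B] [IsVectoid B] {p : A ⥤ B} [p.Braided] [p.IsLeftAdjoint] {Y : CommMon B}
    {Φ : qa A ⥤ B} (P : Presentation (tensorBi p (Phi.{u} Y)) Φ) :
    ∃ (_ : Φ.Braided) (e : Φ.mapCommMon.obj (XaRel A) ≅ Y),
      algMap e.inv = algMap (powι Y 1 0) ≫ P.algEl FinN.one := by
  let := P.braided
  have : P.IsMonoidal := P.isMonoidal_braided
  exact ⟨P.braided, P.algIso, P.algIso_inv⟩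

/-- The map `M^{⊗X} ⟶ p S ⊗ M^{⊗X}` with index `x`, where `p S` is a sum of unit objects. -/
def pointBi {S : Type u} (x : S) (X : FinN.{u}) :
    (Phi M).obj X ⟶ (tensorBi (copowerFunctor A) (Phi M)).obj (S, X) :=
  (λ_ ((Phi M).obj X)).inv ≫ copowerFunctor.el x ▷ (Phi M).obj X

theorem isSum_pointBi (S : Type u) (X : FinN.{u}) : IsSum fun x : S => pointBi M x X :=
  ((copowerFunctor.isSum_el S).map (tensorRight ((Phi M).obj X))).iso_comp
    fun _ => (λ_ ((Phi M).obj X)).inv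

theorem pointBi_biMap {S T : Type u} (x : S) (g : S ⟶ T) {X Y : FinN.{u}} (f : X ⟶ Y) :
    pointBi M x X ≫ biMap (tensorBi (copowerFunctor A) (Phi M)) g f =
      (Phi M).map f ≫ pointBi M (g x) Y := by
  rw [tensorBi_biMap, pointBi, pointBi, Category.assoc, ← tensorHom_id, tensorHom_comp_tensorHom,
    copowerFunctor.el_map, Category.id_comp, leftUnitor_inv_naturality_assoc, ← tensorHom_id,
    ← id_tensorHom, tensorHom_comp_tensorHom, Category.id_comp, Category.comp_id]

namespace PhiBar

/-- The components of the presentation of `Φ̄_M`. -/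
def π (F : Qa.{u}) (X : FinN.{u}) :
    (tensorBi (copowerFunctor A) (Phi M)).obj (F.functor.obj (op X), X) ⟶ (PhiBar M).obj F :=
  (isSum_pointBi M (F.functor.obj (op X)) X).desc fun x => PhiBar.el M x

theorem pointBi_π {F : Qa.{u}} {X : FinN.{u}} (x : F.functor.obj (op X)) :
    pointBi M x X ≫ π M F X = PhiBar.el M x :=
  (isSum_pointBi M (F.functor.obj (op X)) X).fac _ x

theorem biMap_π_eq {F : Qa.{u}} {X Y : FinN.{u}} {S : Type u} (g : S ⟶ F.functor.obj (op Y))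
    (f : X ⟶ Y) (x : S) : pointBi M x X ≫ biMap _ g f ≫ π M F Y =
      (Phi M).map f ≫ PhiBar.el M (g x) := by
  rw [reassoc_of% pointBi_biMap, pointBi_π]

/-- The presentation of `Φ̄_M`. -/
def presentation : Presentation (tensorBi (copowerFunctor A) (Phi M)) (PhiBar M) where
  π := π M
  natural {F G} t X := (isSum_pointBi M _ X).hom_ext fun x => by
    rw [biMap_π_eq, (Phi M).map_id, Category.id_comp, reassoc_of% pointBi_π, el_map]
  dinatural F {X Y} f := (isSum_pointBi M _ X).hom_ext fun x => by
    rw [biMap_π_eq, biMap_π_eq, (Phi M).map_id, Category.id_comp, ← map_el]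
    rfl
  universal F W t ht := by
    have ht' {X Y : FinN.{u}} (f : X ⟶ Y) (x : F.functor.obj (op Y)) :
        (Phi M).map f ≫ pointBi M x Y ≫ t Y = pointBi M (F.functor.map f.op x) X ≫ t X := by
      have h := pointBi M x X ≫= ht f
      rw [reassoc_of% pointBi_biMap, reassoc_of% pointBi_biMap, (Phi M).map_id,
        Category.id_comp] at h
      exact h.symm
    obtain ⟨g, hg, hu⟩ := existsUnique M F (fun X x => pointBi M x X ≫ t X) ht'
    refine ⟨g, fun X => (isSum_pointBi M _ X).hom_ext fun x => ?_, fun g' hg' =>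
      hu g' fun X x => ?_⟩
    · rw [reassoc_of% pointBi_π, hg]
    · rw [← hg', reassoc_of% pointBi_π]

theorem isLeftAdjoint : (PhiBar M).IsLeftAdjoint := (presentation M).isLeftAdjoint

/-- The underlying morphism of the isomorphism of `X_a` with the constant presheaf. -/
def oneTo : hN.{u}.obj FinN.one ⟶ (XaRel (Type u)).X := XaIso.hom.hom.hom

theorem unit_map_oneTo : (PhiBar.unit M).app FinN.one ≫ (PhiBar M).map oneTo =
    PhiBar.el M (F := (XaRel (Type u)).X) (X := FinN.one) PUnit.unit :=
  congrArg (fun s => (PhiBar.unit M).app FinN.one ≫ (PhiBar M).map s) (hom_constOne_ext _ _)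

/-- The universal algebra over sets has a single element at each set, so the algebra map of the
presentation is the coprojection of that one element. -/
theorem algEl_presentation : (presentation M).algEl FinN.one =
    PhiBar.el M (F := (XaRel (Type u)).X) (X := FinN.one) PUnit.unit := by
  refine Eq.trans ?_ (pointBi_π M (F := (XaRel (Type u)).X) (X := FinN.one) PUnit.unit)
  rw [Presentation.algEl, Presentation.el, ← Category.assoc]
  refine congrArg (· ≫ π M (XaRel (Type u)).X FinN.one) ?_
  refine (pointBi_biMap M PUnit.unit (𝟙 (𝟙_ (Type u))) (𝟙 FinN.one)).trans ?_
  rw [(Phi M).map_id, Category.id_comp]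
  rfl

/-- The canonical isomorphism `M ≅ M^{⊗1}`. -/
def oneIncl : M.X ⟶ (Phi.{u} M).obj FinN.one := (λ_ M.X).inv

theorem exists_braided : ∃ (_ : (PhiBar M).Braided) (e : (PhiBar M).mapCommMon.obj Xa ≅ M),
    (λ_ M.X).inv ≫ (PhiBar.unit M).app FinN.one ≫ algMap e.hom = 𝟙 M.X := by
  obtain ⟨b, e, he⟩ := (presentation M).exists_braided
  refine ⟨b, (PhiBar M).mapCommMon.mapIso XaIso ≪≫ e, ?_⟩
  -- The inverse of `e` is known through the unit of the Kan extension; composing with `e` gives the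
  -- required normalization.
  have h : algMap e.inv = oneIncl M ≫ (PhiBar.unit M).app FinN.one ≫
      (PhiBar M).map oneTo := by
    rw [unit_map_oneTo, ← algEl_presentation, he]
    refine congrArg (· ≫ (presentation M).algEl FinN.one) ?_
    exact (congrArg (_ ≫ ·) (id_whiskerRight _ _)).trans (Category.comp_id _)
  have h' : algMap e.inv ≫ algMap e.hom = 𝟙 M.X := congrArg algMap e.inv_hom_id
  let d : (PhiBar M).obj (XaRel (Type u)).X ⟶ M.X := algMap e.hom
  have h₁ : oneIncl M ≫ (PhiBar.unit M).app FinN.one ≫ (PhiBar M).map oneTo ≫ d =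
      (oneIncl M ≫ (PhiBar.unit M).app FinN.one ≫ (PhiBar M).map oneTo) ≫ d := by
    rw [Category.assoc, Category.assoc]
  exact h₁.trans ((congrArg (· ≫ d) h.symm).trans h')

theorem ι_proj {F : Qa.{u}} {X : FinN.{u}} (x : F.functor.obj (op X)) :
    copower.ι (X := (Phi M).obj X) x ≫ PhiBar.proj M F X = PhiBar.el M x :=
  Sigma.ι_desc _ _

theorem isCokernel_proj (F : Qa.{u}) : IsCokernel
          (I := FinN.{u}) (J := Σ (m n : FinN.{u}), m ⟶ n)
          (T := fun n => copower (F.functor.obj (op n)) (pow M n.len).X)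
          (S := fun j => copower (F.functor.obj (op j.2.1)) (pow M j.1.len).X)
          (a := fun j => j.1) (b := fun j => j.2.1)
          (fun j => copower.map (fun x => F.functor.map j.2.2.op x) (𝟙 _))
          (fun j => copower.map id (algMap (powMap M j.2.2)))
          (fun n => PhiBar.proj M F n) := by
  -- Restricted to the copy with index `x`, coequalizing the two arrows is compatibility between the
  -- components at `x` and at its image under `F(φ)`.
  have key {W : A} {m n : FinN.{u}} (φ : m ⟶ n)
      (t : ∀ n : FinN.{u}, copower (F.functor.obj (op n)) ((Phi M).obj n) ⟶ W) :
      copower.map (fun x => F.functor.map φ.op x) (𝟙 ((Phi M).obj m)) ≫ t m =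
        copower.map id ((Phi M).map φ) ≫ t n ↔ ∀ x : F.functor.obj (op n),
      (Phi M).map φ ≫ copower.ι (X := (Phi M).obj n) x ≫ t n =
        copower.ι (X := (Phi M).obj m) (F.functor.map φ.op x) ≫ t m := by
    have h₁ (x : F.functor.obj (op n)) :
        copower.ι x ≫ copower.map (fun x => F.functor.map φ.op x) (𝟙 ((Phi M).obj m)) ≫ t m =
          copower.ι (X := (Phi M).obj m) (F.functor.map φ.op x) ≫ t m := by
      rw [← Category.assoc, copower.ι_map_id]
    have h₂ (x : F.functor.obj (op n)) : copower.ι x ≫ copower.map id ((Phi M).map φ) ≫ t n =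
        (Phi M).map φ ≫ copower.ι x ≫ t n := by
      rw [← Category.assoc, copower.ι_map, Category.assoc]
      rfl
    constructor
    · intro h x
      exact (h₂ x).symm.trans ((congrArg (copower.ι x ≫ ·) h).symm.trans (h₁ x))
    · intro h
      exact copower.hom_ext fun x => (h₁ x).trans ((h x).symm.trans (h₂ x).symm)
  refine isCokernel_iff.mpr ⟨?_, ?_⟩
  · rintro ⟨m, n, φ⟩
    refine (key φ (fun n => PhiBar.proj M F n)).mpr fun x => ?_
    rw [ι_proj, ι_proj, map_el]
  · intro W t ht
    obtain ⟨g, hg, hu⟩ := existsUnique M F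
      (fun X x => copower.ι (X := (Phi M).obj X) x ≫ t X)
      fun {X Y} f x => (key f t).mp (ht ⟨X, Y, f⟩) x
    refine ⟨g, fun X => copower.hom_ext fun x => ?_, fun g' hg' => hu g' fun X x => ?_⟩
    · exact ((reassoc_of% (ι_proj M x)) g).trans (hg X x)
    · exact ((ι_proj M x).symm =≫ g').trans ((Category.assoc _ _ _).trans
        (congrArg (copower.ι x ≫ ·) (hg' X)))
end PhiBar
end
end
end AlgClassifier

/-! ### Assembly of the statements. -/

theorem mainTheorem6 :
    -- `Q_a` is a vectoid, and its tensor product extends disjoint union of finite sets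
    IsVectoid Qa.{u} ∧ IsIso hε.{u} ∧ (∀ X Y : FinN.{u}, IsIso (hμ X Y)) ∧
    ∀ (A : Type w) [Category.{u} A] [MonoidalCategory A] [SymmetricCategory A] [IsVectoid A],
      -- `Q_a` is the classifier of commutative algebras, with universal algebra `X_a`
      (pullAlg A Xa.{u}).IsEquivalence ∧
      -- the functor `Φ̄_M`, and the explicit formula for it
      (∀ M : CommMon A,
        IsIso (PhiBar.unit M) ∧ (PhiBar M).IsLeftAdjoint ∧
        (∃ (_ : (PhiBar M).Braided) (e : (PhiBar M).mapCommMon.obj Xa ≅ M),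
          (λ_ M.X).inv ≫ (PhiBar.unit M).app FinN.one ≫ algMap e.hom = 𝟙 M.X) ∧
        ∀ F : Qa.{u}, IsCokernel
          (I := FinN.{u}) (J := Σ (m n : FinN.{u}), m ⟶ n)
          (T := fun n => copower (F.functor.obj (op n)) (pow M n.len).X)
          (S := fun j => copower (F.functor.obj (op j.2.1)) (pow M j.1.len).X)
          (a := fun j => j.1) (b := fun j => j.2.1)
          (fun j => copower.map (fun x => F.functor.map j.2.2.op x) (𝟙 _))
          (fun j => copower.map id (algMap (powMap M j.2.2)))
          (fun n => PhiBar.proj M F n)) ∧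
      -- the explicit formula for the tensor product of `q_a A`
      IsVectoid (qa A) ∧
      (∀ (F G : qa A) (W : Type u) [Finite W],
        Nonempty (IsColimit (Cofan.mk (ext (F ⊗ G) W)
          (fun U : Set W => extPair F G (splitSet U))))) ∧
      IsIso (unitPt : 𝟙_ A ⟶ _) ∧
      (∀ n : FinN.{u}, 0 < n.len → Nonempty (IsInitial ((𝟙_ (qa A)).functor.obj (op n)))) ∧
      -- `q_a A` is a vectoid over `A`
      IsIso (Functor.LaxMonoidal.ε (baseFunctor A)) ∧
      (∀ a b : A, IsIso (Functor.LaxMonoidal.μ (baseFunctor A) a b)) ∧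
      (baseFunctor A).IsLeftAdjoint ∧
      -- and it classifies commutative algebras in vectoids over `A`
      (∀ (B : Type w') [Category.{u} B] [MonoidalCategory B] [SymmetricCategory B] [IsVectoid B]
        (P : VectoidMorphism B A),
        (OverHom.pullAlg P.inv (baseFunctor A) (XaRel A)).IsEquivalence) ∧
      (OverHom.pullAlg (baseFunctor A) (baseFunctor A) (XaRel A)).IsEquivalence ∧
      -- the composition product of the algebras `f^* X` and `g^* X` is `g^*(f^* X)`
      (∀ f g : OverHom (baseFunctor A) (baseFunctor A),
        ∃ i : (OverHom.pullAlg (baseFunctor A) (baseFunctor A) (XaRel A)).obj (f.comp g) ≅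
          g.toHom.inv.mapCommMon.obj
            ((OverHom.pullAlg (baseFunctor A) (baseFunctor A) (XaRel A)).obj f),
          algMap i.hom = 𝟙 (g.toHom.inv.obj (f.toHom.inv.obj (XaRel A).X))) ∧
      -- the explicit formulas over `A`
      ∃ ev : ∀ (F : qa A) (n : FinN.{u}),
          (baseFunctor A).obj (F.functor.obj (op n)) ⊗ (pow (XaRel A) n.len).X ⟶ F,
        (∀ F n, evalGen (ev F n) = 𝟙 _) ∧
        -- the formula for the inverse image functor attached to an algebra `Y`
        (∀ (B : Type w') [Category.{u} B] [MonoidalCategory B] [SymmetricCategory B] [IsVectoid B]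
          (P : VectoidMorphism B A) (Y : CommMon B) (f : OverHom P.inv (baseFunctor A))
          (e : (OverHom.pullAlg P.inv (baseFunctor A) (XaRel A)).obj f ≅ Y) (F : qa A), IsCokernel
          (I := FinN.{u}) (J := Σ (m n : FinN.{u}), m ⟶ n)
          (T := fun n => P.inv.obj (F.functor.obj (op n)) ⊗ (pow Y n.len).X)
          (S := fun j => P.inv.obj (F.functor.obj (op j.2.1)) ⊗ (pow Y j.1.len).X)
          (a := fun j => j.1) (b := fun j => j.2.1)
          (fun j => P.inv.map (F.functor.map j.2.2.op) ▷ (pow Y j.1.len).X)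
          (fun j => P.inv.obj (F.functor.obj (op j.2.1)) ◁ algMap (powMap Y j.2.2))
          (fun n => relProj f e (ev F n))) ∧
        -- the formula for the composition product
        (∀ (Y : CommMon (qa A)) (V : Type u) [Finite V],
          ∃ ρ : ∀ (m n : FinN.{u}) (φ : m ⟶ n) (d : V → Fin m.len),
              fibreTensor Y.X d ⟶ fibreTensor Y.X (pushIndex φ d),
            (∀ m n φ d, ρ m n φ d ≫ fibreIncl Y (pushIndex φ d) =
              fibreIncl Y d ≫ extMap (algMap (powMap Y φ)) V) ∧
            ∀ (g : OverHom (baseFunctor A) (baseFunctor A))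
              (e : (OverHom.pullAlg (baseFunctor A) (baseFunctor A) (XaRel A)).obj g ≅ Y)
              (X : qa A), IsCokernel
              (I := Σ n : FinN.{u}, V → Fin n.len)
              (J := Σ (m n : FinN.{u}) (_ : m ⟶ n), V → Fin m.len)
              (T := fun i => X.functor.obj (op i.1) ⊗ fibreTensor Y.X i.2)
              (S := fun j => X.functor.obj (op j.2.1) ⊗ fibreTensor Y.X j.2.2.2)
              (Z := ext (g.toHom.inv.obj X) V)
              (a := fun j => ⟨j.1, j.2.2.2⟩) (b := fun j => ⟨j.2.1, pushIndex j.2.2.1 j.2.2.2⟩)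
              (fun j => X.functor.map j.2.2.1.op ▷ fibreTensor Y.X j.2.2.2)
              (fun j => X.functor.obj (op j.2.1) ◁ ρ j.1 j.2.1 j.2.2.1 j.2.2.2)
              (fun i => compProj (relProj g e (ev X i.1)) i.2)) := by
  refine ⟨inferInstance, inferInstance, isIso_hμ, fun A _ _ _ _ => ⟨isEquivalence_pullAlg_Xa A,
    fun M => ⟨inferInstance, PhiBar.isLeftAdjoint M, PhiBar.exists_braided M,
      PhiBar.isCokernel_proj M⟩, inferInstance, isColimit_extPair, inferInstance, isInitial_unit,
    inferInstance, inferInstance, inferInstance, fun B _ _ _ _ P => ?_, isEquivalence_pullAlg_base,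
    pullAlg_comp, ev, evalGen_ev, fun B _ _ _ _ P Y f e F => isCokernel_relProj P.inv Y f e F,
    fun Y V _ => ?_⟩⟩
  · have : P.inv.IsLeftAdjoint := P.adj.isLeftAdjoint
    exact isEquivalence_pullAlg P.inv
  · obtain ⟨ρ, hρ⟩ := exists_fibreMap Y V
    -- The maps `ρ` are fixed before `g` and `X`; the cokernel formula in `q_a A` is then evaluated
    -- at `V`.
    exact ⟨ρ, hρ, fun g e X => isCokernel_compProj hρ X
      (isCokernel_relProj (baseFunctor A) Y g e X)⟩
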